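/- Let $l\ge 0$ and let $\Omega\subset\mathbb C$ be a non-empty connected open set such that $\mathbb C\setminus\Omega$ has exactly $l$ bounded connected components (the holes of $\Omega$) $H_1,\dots,H_l$, each of which has non-empty interior. Fix points $z_i\in H_i$, $1\le i\le l$. For $\mathbf Q=(Q_1,\dots,Q_l)\in\mathbb R^l$ put $$\omega_{\mathbf Q}(z)=\prod_{i=1}^l|z-z_i|^{-2Q_i},\qquad z\in\Omega,$$ let $K_{\omega_{\mathbf Q},\Omega}$ be the reproducing kernel of the Bergman space $A^2(\Omega,\omega_{\mathbf Q})$ of holomorphic functions on $\Omega$ that are square integrable with respect to $\omega_{\mathbf Q}\,\mathrm dm$ ($m$ = Lebesgue measure on $\Omega$), and let $$\mathcal B_{\Omega,\mathbf Q}(z,w)=K_{\omega_{\mathbf Q},\Omega}(z,w)\,\omega_{\mathbf Q}(z)^{1/2}\,\omega_{\mathbf Q}(w)^{1/2}.$$ Let $\mathcal C_\Omega$ be the space of locally finite integer-valued positive measures on $\Omega$ with the vague topology (the coarsest topology for which $\mathcal X\mapsto\int f\,\mathrm d\mathcal X$ is continuous for every compactly supported continuous $f:\Omega\to\mathbb R$)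 and its Borel $\sigma$-algebra, and let $\mathcal P(\mathcal C_\Omega)$ be the set of probability measures on $\mathcal C_\Omega$ with the weak topology. Let $\Pi_{\mathbf Q}$ be the determinantal point process on $\Omega$ with kernel $\mathcal B_{\Omega,\mathbf Q}$ with respect to $m$, that is, the random element of $\mathcal C_\Omega$ without multiple points (almost surely every point has multiplicity at most one) such that, for all pairwise disjoint measurable $A_1,\dots,A_k\subset\Omega$, $$\mathbb E\Big[\prod_{i=1}^k\Pi_{\mathbf Q}(A_i)\Big]=\int_{A_1\times\cdots\times A_k}\det\big(\mathcal B_{\Omega,\mathbf Q}(x_i,x_j)\big)_{1\le i,j\le k}\,\mathrm dm^{\otimes k}(x_1,\dots,x_k).$$ Then the following hold. 1. For $z\in\Omega$ the number $\mathcal B_{\Omega,\mathbf Q}(z,z)$ depends on $\mathbf Q$ only through its class in $(\mathbb R/\mathbb Z)^l$, and the function $(z,\mathbf Q)\mapsto\mathcal B_{\Omega,\mathbf Q}(z,z)$ is continuous on $\Omega\times(\mathbb R/\mathbb Z)^l$. 2. For every $\mathbf Q\in\mathbb R^l$ the process $\Pi_{\mathbf Q}$ exists and its law is unique; this law depends on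 $\mathbf Q$ only through its class in $(\mathbb R/\mathbb Z)^l$; and the resulting map $(\mathbb R/\mathbb Z)^l\to\mathcal P(\mathcal C_\Omega)$, $\mathbf Q\mapsto\mathrm{law}(\Pi_{\mathbf Q})$, is injective and continuous. -/

import Mathlib

namespace BergmanProcess

open MeasureTheory Set
open scoped ENNReal ComplexOrder

theorem lintegral_ball_lower_bound (R : ℝ) (hR : 0 < R) :
    ∃ c : ℝ≥0∞, c ≠ 0 ∧ c ≠ ∞ ∧ ∀ (g : ℂ → ℂ) (w : ℂ),
      DifferentiableOn ℂ g (Metric.ball w R) →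
      c * ‖g w‖ₑ ≤ ∫⁻ z in Metric.ball w R, ‖g z‖ₑ := by
  refine ⟨∫⁻ r in Ioo 0 R, ENNReal.ofReal r, ?_, ?_, ?_⟩
  · rw [← pos_iff_ne_zero, setLIntegral_pos_iff (by fun_prop)]
    have : (Function.support fun r : ℝ => ENNReal.ofReal r) ∩ Ioo 0 R = Ioo 0 R := by
      ext r; simp
    rw [this]; simpa using hR
  · refine ne_of_lt (lt_of_le_of_lt (setLIntegral_mono' measurableSet_Ioo
      (g := fun _ => ENNReal.ofReal R) fun r hr => ENNReal.ofReal_le_ofReal hr.2.le) ?_)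
    simp [ENNReal.mul_lt_top]
  · intro g w hg
    have key : ∀ r ∈ Ioo 0 R, ‖g w‖ₑ ≤ ∫⁻ θ in Ioo (-Real.pi) Real.pi, ‖g (circleMap w r θ)‖ₑ := by
      intro r hr
      have h1 : Real.circleAverage g w r = g w := by
        apply DiffContOnCl.circleAverage
        apply DifferentiableOn.diffContOnCl
        rw [abs_of_pos hr.1, closure_ball _ hr.1.ne']
        exact hg.mono (Metric.closedBall_subset_ball hr.2)
      rw [Real.circleAverage_eq_integral_add (-Real.pi),
        intervalIntegral.integral_comp_add_right (fun θ => g (circleMap w r θ))] at h1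
      have e1 : (0 : ℝ) + -Real.pi = -Real.pi := by ring
      have e2 : 2 * Real.pi + -Real.pi = Real.pi := by ring
      rw [e1, e2, intervalIntegral.integral_of_le (by linarith [Real.pi_pos])] at h1
      rw [← h1, enorm_smul, restrict_Ioo_eq_restrict_Ioc]
      calc _ ≤ 1 * ‖∫ θ in Ioc (-Real.pi) Real.pi, g (circleMap w r θ)‖ₑ := by
            gcongr
            rw [Real.enorm_eq_ofReal (by positivity), ENNReal.ofReal_le_one]
            apply inv_le_one_of_one_le₀
            linarith [Real.pi_gt_three]
        _ ≤ _ := by rw [one_mul]; exact enorm_integral_le_lintegral_enorm _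
    have hm : Measurable ((Metric.ball w R).indicator fun z => ‖g z‖ₑ) := by
      classical
      rw [← piecewise_eq_indicator]
      exact ContinuousOn.measurable_piecewise (hg.continuousOn.enorm)
        continuousOn_const measurableSet_ball
    have hs : Measurable fun p : ℝ × ℝ => Complex.polarCoord.symm p := by
      simp only [Complex.polarCoord_symm_apply]; fun_prop
    rw [← lintegral_indicator measurableSet_ball,
      ← lintegral_add_right_eq_self _ w, ← Complex.lintegral_comp_polarCoord_symm, polarCoord_target,
      Measure.volume_eq_prod, ← Measure.prod_restrict, lintegral_prod _ (by
        apply Measurable.aemeasurable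
        apply Measurable.mul (by fun_prop)
        exact hm.comp (hs.add_const w)), ← lintegral_mul_const _ (by fun_prop)]
    refine le_trans (setLIntegral_mono' measurableSet_Ioo (g := fun r => ∫⁻ θ in Ioo (-Real.pi) Real.pi,
        ENNReal.ofReal r • (Metric.ball w R).indicator (fun z => ‖g z‖ₑ)
          (Complex.polarCoord.symm (r, θ) + w)) ?_) (lintegral_mono_set fun r hr => hr.1)
    intro r hr
    simp only [smul_eq_mul]
    rw [lintegral_const_mul' _ _ ENNReal.ofReal_ne_top]
    gcongr
    refine (key r hr).trans (le_of_eq (lintegral_congr fun θ => ?_))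
    have e : Complex.polarCoord.symm (r, θ) + w = circleMap w r θ := by
      rw [Complex.polarCoord_symm_apply, circleMap, Complex.exp_mul_I]; push_cast; ring
    rw [e, indicator_of_mem]
    rw [Metric.mem_ball, dist_eq_norm]
    simpa [circleMap, abs_of_pos hr.1] using hr.2

/-- The measure `ρ dm` on `D`, regarded as a measure on `ℂ`. -/
noncomputable def weightedMeasure (D : Set ℂ) (ρ : ℂ → ℝ) : Measure ℂ :=
  (volume.restrict D).withDensity fun z => ENNReal.ofReal (ρ z)

/-- The Bergman space `A²(D,ρ)`: functions holomorphic on `D` and square integrable with respect to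
`ρ dm` on `D`. Values outside `D` play no role. -/
def bergmanSpace (D : Set ℂ) (ρ : ℂ → ℝ) : Set (ℂ → ℂ) :=
  {f | DifferentiableOn ℂ f D ∧ MemLp f 2 (weightedMeasure D ρ)}

/-- `K` is a reproducing kernel of `A²(D,ρ)`: `K(·,w) ∈ A²(D,ρ)` and `f(w) = ⟨f, K(·,w)⟩` in
`L²(D,ρ)`, for all `w ∈ D` and `f ∈ A²(D,ρ)`. -/
def IsReproducingKernel (D : Set ℂ) (ρ : ℂ → ℝ) (K : ℂ → ℂ → ℂ) : Prop :=
  (∀ w ∈ D, (fun z => K z w) ∈ bergmanSpace D ρ) ∧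
    ∀ f ∈ bergmanSpace D ρ, ∀ w ∈ D,
      f w = ∫ z, f z * starRingEnd ℂ (K z w) ∂(weightedMeasure D ρ)

theorem ae_mem_weightedMeasure {D : Set ℂ} (hD : IsOpen D) (ρ : ℂ → ℝ) :
    ∀ᵐ z ∂(weightedMeasure D ρ), z ∈ D :=
  (withDensity_absolutelyContinuous _ _).ae_le (ae_restrict_mem hD.measurableSet)

theorem aestronglyMeasurable_weightedMeasure {D : Set ℂ} (hD : IsOpen D) (ρ : ℂ → ℝ) {f : ℂ → ℂ}
    (hf : DifferentiableOn ℂ f D) : AEStronglyMeasurable f (weightedMeasure D ρ) :=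
  (hf.continuousOn.aestronglyMeasurable hD.measurableSet).mono_ac
    (withDensity_absolutelyContinuous _ _)

theorem exists_local_bound {D : Set ℂ} (hD : IsOpen D) {ρ : ℂ → ℝ} (hc : ContinuousOn ρ D)
    (hpos : ∀ z ∈ D, 0 < ρ z) {a : ℂ} (ha : a ∈ D) :
    ∃ R > 0, ∃ C : ℝ≥0∞, C ≠ ∞ ∧ ∀ g : ℂ → ℂ, DifferentiableOn ℂ g D →
      ∀ w ∈ Metric.ball a R, ‖g w‖ₑ ≤ C * eLpNorm g 2 (weightedMeasure D ρ) := by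
  obtain ⟨r, hr, hrD⟩ := Metric.isOpen_iff.1 hD a ha
  obtain ⟨c, hc0, hct, hcb⟩ := lintegral_ball_lower_bound (r / 3) (by positivity)
  have hsub : Metric.closedBall a (2 * r / 3) ⊆ D :=
    (Metric.closedBall_subset_ball (by linarith)).trans hrD
  obtain ⟨p, hpm, hp⟩ := (isCompact_closedBall a (2 * r / 3)).exists_isMinOn
    ⟨a, Metric.mem_closedBall_self (by positivity)⟩ (hc.mono hsub)
  have hm : 0 < ρ p := hpos _ (hsub hpm)
  have hmeas : (volume.restrict (Metric.ball a (2 * r / 3)) : Measure ℂ) ≤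
      (ENNReal.ofReal (ρ p))⁻¹ • weightedMeasure D ρ := by
    refine Measure.le_iff.2 fun s hs => ?_
    rw [Measure.smul_apply, weightedMeasure, withDensity_apply _ hs, smul_eq_mul,
      ← ENNReal.mul_le_iff_le_inv (by simpa using hm) (by simp)]
    rw [Measure.restrict_restrict hs, Measure.restrict_apply hs, ← setLIntegral_const]
    refine (setLIntegral_mono_ae' (hs.inter measurableSet_ball) ?_).trans (lintegral_mono_set
      (inter_subset_inter_right s (Metric.ball_subset_closedBall.trans hsub)))
    refine Filter.Eventually.of_forall fun z hz => ENNReal.ofReal_le_ofReal ?_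
    exact hp (Metric.ball_subset_closedBall hz.2)
  have hvol : volume (Metric.ball a (2 * r / 3)) ≠ ∞ := measure_ball_lt_top.ne
  refine ⟨r / 3, by positivity, c⁻¹ * ((ENNReal.ofReal (ρ p))⁻¹ ^ (1 / (2 : ℝ≥0∞)).toReal *
    volume (Metric.ball a (2 * r / 3)) ^ (1 / 2 : ℝ)), ?_, fun g hg w hw => ?_⟩
  · refine ENNReal.mul_ne_top (by simpa using hc0) (ENNReal.mul_ne_top ?_ ?_)
    · exact ENNReal.rpow_ne_top_of_nonneg (by simp) (by simpa using hm)
    · exact ENNReal.rpow_ne_top_of_nonneg (by simp) hvol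
  have hwb : Metric.ball w (r / 3) ⊆ Metric.ball a (2 * r / 3) := by
    refine Metric.ball_subset_ball' ?_
    have := Metric.mem_ball.1 hw
    linarith
  have h1 := hcb g w (hg.mono (hwb.trans (Metric.ball_subset_closedBall.trans hsub)))
  have h2 : ∫⁻ z in Metric.ball w (r / 3), ‖g z‖ₑ ≤ eLpNorm g 1
      (volume.restrict (Metric.ball a (2 * r / 3))) := by
    rw [eLpNorm_one_eq_lintegral_enorm]
    exact lintegral_mono_set hwb
  have h3 := eLpNorm_le_eLpNorm_mul_rpow_measure_univ (p := 1) (q := 2)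
    (μ := volume.restrict (Metric.ball a (2 * r / 3))) (by norm_num)
    (((hg.mono (Metric.ball_subset_closedBall.trans hsub)).continuousOn).aestronglyMeasurable
      measurableSet_ball)
  have h4 := eLpNorm_mono_measure (p := 2) g hmeas
  rw [eLpNorm_smul_measure_of_ne_top (by simp)] at h4
  rw [mul_assoc, ← ENNReal.mul_le_iff_le_inv hc0 hct]
  refine (h1.trans (h2.trans h3)).trans ?_
  have e : (1 / (1 : ℝ≥0∞).toReal - 1 / (2 : ℝ≥0∞).toReal) = (1 / 2 : ℝ) := by norm_num
  rw [e, Measure.restrict_apply_univ]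
  refine (mul_le_mul_left h4 _).trans (le_of_eq ?_)
  rw [smul_eq_mul]; ring

theorem eqOn_of_ae_eq {D : Set ℂ} (hD : IsOpen D) {ρ : ℂ → ℝ} (hc : ContinuousOn ρ D)
    (hpos : ∀ z ∈ D, 0 < ρ z) {f g : ℂ → ℂ} (hf : DifferentiableOn ℂ f D)
    (hg : DifferentiableOn ℂ g D) (h : f =ᵐ[weightedMeasure D ρ] g) : EqOn f g D := by
  intro w hw
  obtain ⟨R, hR, C, hC, hb⟩ := exists_local_bound hD hc hpos hw
  have h1 := hb (f - g) (hf.sub hg) w (Metric.mem_ball_self hR)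
  have h2 : f - g =ᵐ[weightedMeasure D ρ] 0 := by
    filter_upwards [h] with z hz
    simp [hz]
  rw [eLpNorm_congr_ae h2] at h1
  simpa [sub_eq_zero] using h1

/-- The classes in `L²` that have a representative holomorphic on `D`. -/
noncomputable def bergmanSubmodule (D : Set ℂ) (ρ : ℂ → ℝ) :
    Submodule ℂ (Lp ℂ 2 (weightedMeasure D ρ)) where
  carrier := {F | ∃ g : ℂ → ℂ, DifferentiableOn ℂ g D ∧ F =ᵐ[weightedMeasure D ρ] g}
  zero_mem' := ⟨0, differentiableOn_const 0, Lp.coeFn_zero _ _ _⟩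
  add_mem' := by
    rintro F G ⟨f, hf, hF⟩ ⟨g, hg, hG⟩
    exact ⟨f + g, hf.add hg, (Lp.coeFn_add F G).trans (hF.add hG)⟩
  smul_mem' := by
    rintro c F ⟨f, hf, hF⟩
    exact ⟨c • f, hf.const_smul c, (Lp.coeFn_smul c F).trans (hF.const_smul c)⟩

theorem isClosed_bergmanSubmodule {D : Set ℂ} (hD : IsOpen D) {ρ : ℂ → ℝ} (hc : ContinuousOn ρ D)
    (hpos : ∀ z ∈ D, 0 < ρ z) :
    IsClosed (bergmanSubmodule D ρ : Set (Lp ℂ 2 (weightedMeasure D ρ))) := by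
  refine IsSeqClosed.isClosed fun F G hF hFG => ?_
  choose g hg hFg using hF
  have hloc : ∀ a ∈ D, ∃ R > 0, UniformCauchySeqOn g Filter.atTop (Metric.ball a R) := by
    intro a ha
    obtain ⟨R, hR, C, hC, hb⟩ := exists_local_bound hD hc hpos ha
    refine ⟨R, hR, Metric.uniformCauchySeqOn_iff.2 fun ε hε => ?_⟩
    have hCau := hFG.cauchySeq
    obtain ⟨N, hN⟩ := Metric.cauchySeq_iff.1 hCau (ε / (C.toReal + 1))
      (by positivity)
    refine ⟨N, fun m hm n hn w hw => ?_⟩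
    have h1 := hb (g m - g n) ((hg m).sub (hg n)) w hw
    have h2 : g m - g n =ᵐ[weightedMeasure D ρ] (F m - F n : Lp ℂ 2 (weightedMeasure D ρ)) := by
      filter_upwards [hFg m, hFg n, Lp.coeFn_sub (F m) (F n)] with z h1 h2 h3
      rw [h3, Pi.sub_apply, Pi.sub_apply, h1, h2]
    rw [eLpNorm_congr_ae h2] at h1
    have h3 := ENNReal.toReal_mono (ENNReal.mul_ne_top hC (Lp.eLpNorm_ne_top _)) h1
    rw [ENNReal.toReal_mul, ← Lp.norm_def, ← dist_eq_norm] at h3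
    have h4 := hN m hm n hn
    rw [lt_div_iff₀ (by positivity)] at h4
    have h5 : dist (g m w) (g n w) = ‖(g m - g n) w‖ₑ.toReal := by
      simp [dist_eq_norm]
    rw [h5]
    nlinarith [dist_nonneg (x := F m) (y := F n)]
  have hlim : ∀ z, ∃ l, z ∈ D → Filter.Tendsto (fun n => g n z) Filter.atTop (nhds l) := by
    intro z
    by_cases hz : z ∈ D
    · obtain ⟨R, hR, hU⟩ := hloc z hz
      obtain ⟨l, hl⟩ := cauchySeq_tendsto_of_complete
        (hU.cauchySeq (Metric.mem_ball_self hR))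
      exact ⟨l, fun _ => hl⟩
    · exact ⟨0, fun h => absurd h hz⟩
  choose G' hG' using hlim
  have hTLU : TendstoLocallyUniformlyOn g G' Filter.atTop D := by
    refine tendstoLocallyUniformlyOn_of_forall_exists_nhds fun a ha => ?_
    obtain ⟨R, hR, hU⟩ := hloc a ha
    obtain ⟨r, hr, hrD⟩ := Metric.isOpen_iff.1 hD a ha
    refine ⟨Metric.ball a (min r R), mem_nhdsWithin_of_mem_nhds (Metric.ball_mem_nhds a (by positivity)), ?_⟩
    refine (hU.mono (Metric.ball_subset_ball (min_le_right _ _))).tendstoUniformlyOn_of_tendsto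
      fun z hz => hG' z (hrD (Metric.ball_subset_ball (min_le_left _ _) hz))
  refine ⟨G', hTLU.differentiableOn (Filter.Eventually.of_forall hg) hD, ?_⟩
  obtain ⟨ns, hns, hae⟩ := (tendstoInMeasure_of_tendsto_Lp hFG).exists_seq_tendsto_ae
  filter_upwards [hae, ae_mem_weightedMeasure hD ρ, ae_all_iff.2 hFg] with z h1 h2 h3
  refine tendsto_nhds_unique h1 (((hG' z h2).comp hns.tendsto_atTop).congr fun n => ?_)
  simp [h3]

theorem exists_isReproducingKernel {D : Set ℂ} (hD : IsOpen D) {ρ : ℂ → ℝ} (hc : ContinuousOn ρ D)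
    (hpos : ∀ z ∈ D, 0 < ρ z) : ∃ K, IsReproducingKernel D ρ K := by
  have hcl := isClosed_bergmanSubmodule hD hc hpos
  have : CompleteSpace (bergmanSubmodule D ρ) := hcl.completeSpace_coe
  have hrep : ∀ F : bergmanSubmodule D ρ, ∃ g : ℂ → ℂ, DifferentiableOn ℂ g D ∧
      (F : Lp ℂ 2 (weightedMeasure D ρ)) =ᵐ[weightedMeasure D ρ] g := fun F => F.2
  choose r hr hFr using hrep
  have key : ∀ w ∈ D, ∃ k : bergmanSubmodule D ρ, ∀ F, inner ℂ k F = r F w := by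
    intro w hw
    obtain ⟨R, hR, C, hC, hb⟩ := exists_local_bound hD hc hpos hw
    let ev : bergmanSubmodule D ρ →ₗ[ℂ] ℂ :=
      { toFun := fun F => r F w
        map_add' := fun F G => by
          refine eqOn_of_ae_eq hD hc hpos (hr (F + G)) ((hr F).add (hr G)) ?_ hw
          filter_upwards [hFr (F + G), hFr F, hFr G,
            Lp.coeFn_add (F : Lp ℂ 2 (weightedMeasure D ρ)) G] with z h1 h2 h3 h4
          rw [← h1, Submodule.coe_add, h4, Pi.add_apply, Pi.add_apply, h2, h3]
        map_smul' := fun c F => by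
          refine eqOn_of_ae_eq hD hc hpos (hr (c • F)) ((hr F).const_smul c) ?_ hw
          filter_upwards [hFr (c • F), hFr F,
            Lp.coeFn_smul c (F : Lp ℂ 2 (weightedMeasure D ρ))] with z h1 h2 h4
          rw [← h1, Submodule.coe_smul, h4, Pi.smul_apply, h2]; rfl }
    let evc : bergmanSubmodule D ρ →L[ℂ] ℂ := ev.mkContinuous C.toReal fun F => by
      have h1 := hb (r F) (hr F) w (Metric.mem_ball_self hR)
      rw [← eLpNorm_congr_ae (hFr F)] at h1
      have h3 := ENNReal.toReal_mono (ENNReal.mul_ne_top hC (Lp.eLpNorm_ne_top _)) h1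
      rw [ENNReal.toReal_mul, ← Lp.norm_def] at h3
      simpa [ev] using h3
    exact ⟨(InnerProductSpace.toDual ℂ _).symm evc, fun F => by
      rw [InnerProductSpace.toDual_symm_apply]; rfl⟩
  choose! k hk using key
  refine ⟨fun z w => r (k w) z, fun w hw => ⟨hr _, ?_⟩, fun f hf w hw => ?_⟩
  · exact (memLp_congr_ae (hFr (k w))).1 (Lp.memLp _)
  · let F : bergmanSubmodule D ρ := ⟨hf.2.toLp f, f, hf.1, hf.2.coeFn_toLp⟩
    have h1 : EqOn f (r F) D :=
      eqOn_of_ae_eq hD hc hpos hf.1 (hr F) (hf.2.coeFn_toLp.symm.trans (hFr F))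
    rw [h1 hw, ← hk w hw F, Submodule.coe_inner, L2.inner_def]
    refine integral_congr_ae ?_
    filter_upwards [hFr (k w), hf.2.coeFn_toLp] with z h2 h3
    simp only [RCLike.inner_apply, h2]
    rw [show ((F : Lp ℂ 2 (weightedMeasure D ρ)) : ℂ → ℂ) z = f z from h3]

theorem IsReproducingKernel.eq_conj {D : Set ℂ} {ρ : ℂ → ℝ} {K K' : ℂ → ℂ → ℂ}
    (h : IsReproducingKernel D ρ K) (h' : IsReproducingKernel D ρ K') {z w : ℂ}
    (hz : z ∈ D) (hw : w ∈ D) : K' z w = starRingEnd ℂ (K w z) := by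
  rw [h.2 _ (h'.1 w hw) z hz, h'.2 _ (h.1 z hz) w hw, ← integral_conj]
  simp [mul_comm]

/-- The reproducing kernel is unique on `D × D`. -/
theorem IsReproducingKernel.unique {D : Set ℂ} {ρ : ℂ → ℝ} {K K' : ℂ → ℂ → ℂ}
    (h : IsReproducingKernel D ρ K) (h' : IsReproducingKernel D ρ K') {z w : ℂ}
    (hz : z ∈ D) (hw : w ∈ D) : K z w = K' z w :=
  (h.eq_conj h hz hw).trans (h.eq_conj h' hz hw).symm

open Classical in
/-- The Bergman kernel `K_{ρ,D}(z,w)`: the reproducing kernel of the Bergman space `A²(D,ρ)`, for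
`D` open and `ρ` continuous and positive on `D` (it exists then, and is unique on `D × D`). -/
noncomputable def bergmanKernel (D : Set ℂ) (ρ : ℂ → ℝ) : ℂ → ℂ → ℂ :=
  if h : ∃ K, IsReproducingKernel D ρ K then h.choose else 0

theorem isReproducingKernel_bergmanKernel {D : Set ℂ} (hD : IsOpen D) {ρ : ℂ → ℝ}
    (hc : ContinuousOn ρ D) (hpos : ∀ z ∈ D, 0 < ρ z) :
    IsReproducingKernel D ρ (bergmanKernel D ρ) := by
  have h := exists_isReproducingKernel hD hc hpos
  rw [bergmanKernel, dif_pos h]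
  exact h.choose_spec

/-- The weighted correlation kernel `K_{ρ,D}(z,w) ρ(z)^{1/2} ρ(w)^{1/2}`. -/
noncomputable def correlationKernel (D : Set ℂ) (ρ : ℂ → ℝ) (z w : ℂ) : ℂ :=
  bergmanKernel D ρ z w * (√(ρ z) : ℝ) * (√(ρ w) : ℝ)

/-- The log-harmonic weight `∏ i, |ζ - z i| ^ (-2 Q i)`. -/
noncomputable def logWeight {l : ℕ} (z : Fin l → ℂ) (Q : Fin l → ℝ) (ζ : ℂ) : ℝ :=
  ∏ i, ‖ζ - z i‖ ^ (-2 * Q i)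

theorem logWeight_pos {l : ℕ} {Ω : Set ℂ} {z : Fin l → ℂ} (hz : ∀ i, z i ∉ Ω) (Q : Fin l → ℝ)
    {ζ : ℂ} (hζ : ζ ∈ Ω) : 0 < logWeight z Q ζ := by
  refine Finset.prod_pos fun i _ => Real.rpow_pos_of_pos (norm_pos_iff.2 ?_) _
  exact sub_ne_zero.2 fun h => hz i (h ▸ hζ)

theorem continuousOn_logWeight {l : ℕ} {Ω : Set ℂ} {z : Fin l → ℂ} (hz : ∀ i, z i ∉ Ω)
    (Q : Fin l → ℝ) : ContinuousOn (logWeight z Q) Ω := by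
  refine continuousOn_finsetProd _ fun i _ => ContinuousOn.rpow_const (by fun_prop) ?_
  intro ζ hζ
  exact Or.inl (norm_ne_zero_iff.2 (sub_ne_zero.2 fun h => hz i (h ▸ hζ)))

/-- `B_{Ω,Q}(ζ,ξ)`, the correlation kernel of `A²(Ω, ω_Q)` with `ω_Q = ∏ i, |ζ - z i| ^ (-2 Q i)`,
for a representative `Q ∈ ℝ^l`. -/
noncomputable def bergmanB {l : ℕ} (Ω : Set ℂ) (z : Fin l → ℂ) (Q : Fin l → ℝ) (ζ ξ : ℂ) : ℂ :=
  correlationKernel Ω (logWeight z Q) ζ ξ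

/-- The holes of `Ω`: the bounded connected components of its complement. -/
def holes (Ω : Set ℂ) : Set (Set ℂ) :=
  {H | (∃ x ∈ Ωᶜ, H = connectedComponentIn Ωᶜ x) ∧ Bornology.IsBounded H}

/-- Point configurations: locally finite measures with values in `{0, 1, 2, …, ∞}`. -/
def PointConfiguration (E : Type*) [TopologicalSpace E] [MeasurableSpace E] : Type _ :=
  {X : Measure E // IsLocallyFiniteMeasure X ∧ ∀ A, MeasurableSet A → ∃ n : ℕ∞, X A = n}

/-- The vague topology: the coarsest one for which `X ↦ ∑_{x ∈ X} f x` is continuous for every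
compactly supported continuous real function `f`. -/
noncomputable instance instTopologicalSpacePointConfiguration {E : Type*} [TopologicalSpace E]
    [MeasurableSpace E] : TopologicalSpace (PointConfiguration E) :=
  ⨅ f : {f : E → ℝ // Continuous f ∧ HasCompactSupport f},
    TopologicalSpace.induced (fun X : PointConfiguration E => ∫ x, f.1 x ∂X.1) inferInstance

noncomputable instance instMeasurableSpacePointConfiguration {E : Type*} [TopologicalSpace E]
    [MeasurableSpace E] : MeasurableSpace (PointConfiguration E) := borel _

instance instBorelSpacePointConfiguration {E : Type*} [TopologicalSpace E] [MeasurableSpace E] :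
    BorelSpace (PointConfiguration E) := ⟨rfl⟩

/-- `P` is the law of a determinantal point process on `E` associated to the kernel `K` with respect
to `m`: the process has no multiple points, and for disjoint `A 1, …, A k` the expectation of
`∏ i, #(A i ∩ X)` is the integral of `det (K (x i) (x j))` over `A 1 × ⋯ × A k`, in `[0, ∞]`.
The determinants are real and non-negative, so nothing is lost in `ENNReal.ofReal`. -/
structure IsDeterminantalLaw {E : Type*} [TopologicalSpace E] [MeasurableSpace E] (m : Measure E)
    (K : E → E → ℂ) (P : ProbabilityMeasure (PointConfiguration E)) : Prop where
  simple : ∀ᵐ X ∂(P : Measure (PointConfiguration E)), ∀ x, X.1 {x} ≤ 1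
  det_nonneg : ∀ (k : ℕ) (x : Fin k → E), 0 ≤ (Matrix.of fun i j => K (x i) (x j)).det
  intensity : ∀ (k : ℕ) (A : Fin k → Set E), (∀ i, MeasurableSet (A i)) →
    Pairwise (fun i j => Disjoint (A i) (A j)) →
    ∫⁻ X, ∏ i, X.1 (A i) ∂(P : Measure (PointConfiguration E)) =
      ∫⁻ x in Set.univ.pi A, ENNReal.ofReal (Matrix.of fun i j => K (x i) (x j)).det.re
        ∂(Measure.pi fun _ => m)

/-- `P` is the law of the Bergman point process on `Ω` with weight `∏ i, |ζ - z i| ^ (-2 Q i)`: the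
determinantal process with kernel `B_{Ω,Q}` and Lebesgue measure restricted to `Ω`. -/
def IsBergmanLaw {l : ℕ} (Ω : Set ℂ) (z : Fin l → ℂ) (Q : Fin l → ℝ)
    (P : ProbabilityMeasure (PointConfiguration Ω)) : Prop :=
  IsDeterminantalLaw (Measure.comap ((↑) : Ω → ℂ) volume) (fun ζ ξ => bergmanB Ω z Q ζ ξ) P

end BergmanProcess

open BergmanProcess MeasureTheory

/-!
Why the theorem is true. Write `ρ = ω_Q` and let `K` be the Bergman kernel of `A²(Ω, ρ)`, so that
the correlation kernel is `B(z, w) = √(ρ z) K(z, w) √(ρ w)`.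

*Existence and uniqueness of the law.* `B` is the Gram matrix of vectors `v z` in the Bergman
space, and `f ↦ (z ↦ ⟪v z, f⟫)` is an isometric embedding into `L²(m)`. A finite-rank projection
kernel has an explicit process, with density `det (B (x i, x j)) / N!` on `N`-tuples
(`IsProjectionKernel.exists_isDeterminantalLaw`). Projecting on an increasing sequence of
finite-dimensional subspaces gives kernels converging to `B`. When kernels converge, the laws are
relatively compact, moments pass to the limit and no multiple points appear
(`KernelsConverge.exists_isDeterminantalLaw`); hence `exists_isDeterminantalLaw_inner`. The law is
unique (`IsDeterminantalLaw.unique`), since Hadamard's inequality bounds exponential moments and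
the characteristic functional is a limit of expressions in the numbers of points in disjoint
cells, which for small cells are at most one.

*Periodicity.* If `e` is holomorphic without zeros, then replacing `ρ` by `|e|² ρ` multiplies
`B(z, w)` by `u z * conj (u w)` with `|u| = 1` (`gaugeEquiv_correlationKernel`); this changes
neither `B(z, z)` nor the law. Taking `e = ∏ (ζ - z i) ^ n i` with integers `n i` gives the
dependence on the class of `Q` only.

*Continuity.* If weights depend continuously on a parameter and the norm of every function of the
Bergman space at `t₀` is continuous at `t₀` (`IsContinuousWeightFamily`), then Montel's theorem
and the extremal property of the kernel show that the Bergman kernels converge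
(`tendsto_bergmanKernel`), and then so do the laws. The weights `ω_Q` need not form such a family,
as integrability at infinity may fail. But on `Ω` there are holomorphic `g i` such that the
potentials `log |ζ - z i| - Re (g i ζ)` are all bounded or, if the complement of `Ω` is bounded,
all equal to `log (1 + |ζ|)` up to a bounded error (`exists_normalization`). In the first case the
weights `|exp (∑ Q i * g i)|² ω_Q` are uniformly comparable for bounded `Q`. In the second a
function of the Bergman space behaves like an integral power of `|ζ|` at infinity, so that its
square integrability persists for nearby exponents (`exists_integrability_margin`). Hence these
normalized weights form a continuous family (`exists_isContinuousWeightFamily`). They are gauge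
equivalent to `ω_Q`, and continuity in `Q ∈ ℝ^l` descends to the torus along an open quotient map.

*Injectivity.* The law determines the determinants of `B`, hence `|B(z, w)|`
(`IsDeterminantalLaw.norm_eq`). If `Q` and `Q'` have the same law, then the quotient `M` of the
two kernels `K(·, w₀)` has modulus `c ∏ |ζ - z i| ^ δ i` with `δ = Q - Q'`; so it extends to a
holomorphic function without zeros with `M' = ∑ δ i / (ζ - z i) * M` (`exists_quotient`). Here
`K(w₀, w₀) ≠ 0` because a hole has non-empty interior (`bergmanKernel_logWeight_self_ne_zero`).
Each hole is isolated from the rest of the complement (`exists_thickening_diff_subset`), so the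
monodromy of `∏ (ζ - z i) ^ δ i` around the hole of `z j`, which is `exp (2π i δ j)`, must be one
(`exp_two_pi_I_mul_eq_one`), and `δ j` is an integer.
-/

set_option linter.unusedSectionVars false

namespace BergmanProcess

open MeasureTheory Set Filter Topology
open scoped ENNReal NNReal ComplexOrder CompactlySupported Matrix

/-! ### The vague topology on the space of point configurations -/

section Vague

variable {E : Type*} [TopologicalSpace E] [LocallyCompactSpace E] [T2Space E]

/-- Urysohn functions with compact support inside a given open set. -/
theorem exists_cutoff {K U : Set E} (hK : IsCompact K) (hU : IsOpen U) (hKU : K ⊆ U) :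
    ∃ f : E → ℝ, Continuous f ∧ HasCompactSupport f ∧ tsupport f ⊆ U ∧ (∀ x ∈ K, f x = 1) ∧
      ∀ x, 0 ≤ f x ∧ f x ≤ 1 := by
  obtain ⟨L, hL, hKL, hLU⟩ := exists_compact_between hK hU hKU
  obtain ⟨f, hf1, hf0, hfc, hf⟩ := exists_continuous_one_zero_of_isCompact hK
    isOpen_interior.isClosed_compl (disjoint_compl_right_iff_subset.2 hKL)
  refine ⟨f, f.continuous, hfc, ?_, fun x hx => hf1 hx, fun x => hf x⟩
  refine (closure_minimal (fun x hx => ?_) hL.isClosed).trans hLU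
  by_contra h
  exact hx (hf0 fun h' => h (interior_subset h'))

variable [MeasurableSpace E] [BorelSpace E]

instance instIsLocallyFiniteMeasurePointConfiguration (X : PointConfiguration E) :
    IsLocallyFiniteMeasure X.1 := X.2.1

theorem PointConfiguration.exists_eq_natCast (X : PointConfiguration E) {A : Set E}
    (hA : MeasurableSet A) (h : X.1 A ≠ ∞) : ∃ n : ℕ, X.1 A = n := by
  obtain ⟨n, hn⟩ := X.2.2 A hA
  induction n using ENat.recTopCoe with
  | top => exact absurd hn (by simpa using h)
  | coe n => exact ⟨n, by simpa using hn⟩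

theorem measure_le_integral_of_eq_one {μ : Measure E} [IsFiniteMeasureOnCompacts μ] {f : E → ℝ}
    (hf : Continuous f) (hfc : HasCompactSupport f) (h0 : ∀ x, 0 ≤ f x) {K : Set E}
    (hfK : ∀ x ∈ K, f x = 1) : μ K ≤ ENNReal.ofReal (∫ x, f x ∂μ) := by
  rw [ofReal_integral_eq_lintegral_ofReal (hf.integrable_of_hasCompactSupport hfc)
    (Eventually.of_forall h0)]
  exact meas_le_lintegral₀ (by fun_prop) fun x hx => by simp [hfK x hx]

theorem integral_le_measure_of_tsupport {μ : Measure E} [IsFiniteMeasureOnCompacts μ] {f : E → ℝ}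
    (hf : Continuous f) (hfc : HasCompactSupport f) (h0 : ∀ x, 0 ≤ f x ∧ f x ≤ 1) {U : Set E}
    (hfU : tsupport f ⊆ U) : ENNReal.ofReal (∫ x, f x ∂μ) ≤ μ U := by
  rw [ofReal_integral_eq_lintegral_ofReal (hf.integrable_of_hasCompactSupport hfc)
    (Eventually.of_forall fun x => (h0 x).1)]
  refine le_trans ?_ (measure_mono hfU)
  rw [← lintegral_indicator_one (isClosed_tsupport f).measurableSet]
  refine lintegral_mono fun x => ?_
  by_cases hx : x ∈ tsupport f
  · simpa [hx] using (h0 x).2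
  · simp [image_eq_zero_of_notMem_tsupport hx]

theorem continuous_integral_pointConfiguration {f : E → ℝ} (hf : Continuous f)
    (hfc : HasCompactSupport f) : Continuous fun X : PointConfiguration E => ∫ x, f x ∂X.1 :=
  continuous_iInf_dom (i := ⟨f, hf, hfc⟩) continuous_induced_dom

theorem tendsto_pointConfiguration_iff {ι : Type*} {F : Filter ι} {x : ι → PointConfiguration E}
    {Y : PointConfiguration E} : Tendsto x F (𝓝 Y) ↔ ∀ f : E → ℝ, Continuous f →
      HasCompactSupport f → Tendsto (fun i => ∫ t, f t ∂(x i).1) F (𝓝 (∫ t, f t ∂Y.1)) := by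
  rw [nhds_iInf, tendsto_iInf]
  simp only [nhds_induced, tendsto_comap_iff, Subtype.forall, and_imp]
  rfl

theorem continuous_pointConfiguration_iff {Y : Type*} [TopologicalSpace Y]
    {x : Y → PointConfiguration E} : Continuous x ↔ ∀ f : E → ℝ, Continuous f →
      HasCompactSupport f → Continuous (fun y => ∫ t, f t ∂(x y).1) := by
  simp only [continuous_iff_continuousAt, ContinuousAt, tendsto_pointConfiguration_iff]
  exact ⟨fun h f hf hfc y => h y f hf hfc, fun h y f hf hfc => h f hf hfc y⟩

variable [SecondCountableTopology E]

theorem measure_eq_iSup_cutoff (μ : Measure E) [IsLocallyFiniteMeasure μ] {U : Set E}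
    (hU : IsOpen U) : μ U = ⨆ f : {f : E → ℝ // Continuous f ∧ HasCompactSupport f ∧
      tsupport f ⊆ U ∧ ∀ x, 0 ≤ f x ∧ f x ≤ 1}, ENNReal.ofReal (∫ x, f.1 x ∂μ) := by
  refine le_antisymm ?_ (iSup_le fun f =>
    integral_le_measure_of_tsupport f.2.1 f.2.2.1 f.2.2.2.2 f.2.2.2.1)
  rw [hU.measure_eq_iSup_isCompact]
  refine iSup₂_le fun K hKU => iSup_le fun hK => ?_
  obtain ⟨f, hf, hfc, hfU, hfK, h01⟩ := exists_cutoff hK hU hKU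
  exact (measure_le_integral_of_eq_one hf hfc (fun x => (h01 x).1) hfK).trans
    (le_iSup (fun f : {f : E → ℝ // Continuous f ∧ HasCompactSupport f ∧
      tsupport f ⊆ U ∧ ∀ x, 0 ≤ f x ∧ f x ≤ 1} => ENNReal.ofReal (∫ x, f.1 x ∂μ))
      ⟨f, hf, hfc, hfU, h01⟩)

theorem lowerSemicontinuous_measure_of_isOpen {U : Set E} (hU : IsOpen U) :
    LowerSemicontinuous fun X : PointConfiguration E => X.1 U := by
  simp_rw [measure_eq_iSup_cutoff _ hU]
  exact lowerSemicontinuous_iSup fun f =>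
    (ENNReal.continuous_ofReal.comp
      (continuous_integral_pointConfiguration f.2.1 f.2.2.1)).lowerSemicontinuous

/-- The vague Borel structure is at least as fine as the one generated by the evaluations. -/
theorem measurable_pointConfiguration_val :
    Measurable fun X : PointConfiguration E => X.1 := by
  refine Measure.measurable_of_measurable_coe _ fun A hA => ?_
  let D := CompactExhaustion.choice E
  have hD : ∀ m, Measurable fun X : PointConfiguration E => X.1.restrict (interior (D m)) := by
    intro m
    have : ∀ X : PointConfiguration E, IsFiniteMeasure (X.1.restrict (interior (D m))) := fun X =>
      ⟨by
        rw [Measure.restrict_apply_univ]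
        exact (measure_mono interior_subset).trans_lt (D.isCompact m).measure_lt_top⟩
    refine Measurable.measure_of_isPiSystem (S := {s | IsOpen s}) BorelSpace.measurable_eq
      isPiSystem_isOpen (fun s hs => ?_) ?_
    · simp_rw [Measure.restrict_apply (show IsOpen s from hs).measurableSet]
      exact (lowerSemicontinuous_measure_of_isOpen
        ((show IsOpen s from hs).inter isOpen_interior)).measurable
    · simp_rw [Measure.restrict_apply_univ]
      exact (lowerSemicontinuous_measure_of_isOpen isOpen_interior).measurable
  have h1 : ∀ X : PointConfiguration E, X.1 A = ⨆ m, X.1.restrict (interior (D m)) A := by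
    intro X
    simp_rw [Measure.restrict_apply hA]
    rw [← Monotone.measure_iUnion, ← inter_iUnion]
    · have : ⋃ m, interior (D m) = univ := by
        refine eq_univ_of_forall fun x => ?_
        obtain ⟨m, hm⟩ := D.exists_mem x
        exact mem_iUnion.2 ⟨m + 1, D.subset_interior_succ m hm⟩
      rw [this, inter_univ]
    · exact fun i j hij => inter_subset_inter_right _ (interior_mono (D.subset hij))
  simp_rw [h1]
  exact Measurable.iSup fun m => (Measure.measurable_coe hA).comp (hD m)

theorem measurable_eval {A : Set E} (hA : MeasurableSet A) :
    Measurable fun X : PointConfiguration E => X.1 A :=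
  (Measure.measurable_coe hA).comp measurable_pointConfiguration_val

/-- Countably many test functions suffice to describe the vague topology. -/
theorem exists_countable_test_functions (E : Type*) [TopologicalSpace E] [LocallyCompactSpace E]
    [T2Space E] [MeasurableSpace E] [BorelSpace E] [SecondCountableTopology E] :
    ∃ u : (ℕ × ℕ) ⊕ ℕ → E → ℝ, (∀ j, Continuous (u j) ∧ HasCompactSupport (u j)) ∧
      IsInducing fun (X : PointConfiguration E) j => ∫ x, u j x ∂X.1 := by
  let D := CompactExhaustion.choice E
  have hχ : ∀ m, ∃ f : E → ℝ, Continuous f ∧ HasCompactSupport f ∧ tsupport f ⊆ univ ∧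
      (∀ x ∈ D m, f x = 1) ∧ ∀ x, 0 ≤ f x ∧ f x ≤ 1 := fun m =>
    exists_cutoff (D.isCompact m) isOpen_univ (subset_univ _)
  choose χ hχc hχs hχu hχ1 hχ01 using hχ
  let S : ℕ → Set C(E, ℝ) := fun m => {f | ∀ x, x ∉ D m → f x = 0}
  have hS0 : ∀ m, Nonempty (S m) := fun m => ⟨⟨0, fun x _ => rfl⟩⟩
  let d : ℕ → ℕ → C(E, ℝ) := fun m k => (TopologicalSpace.denseSeq (S m) k).1
  have hd0 : ∀ m k x, x ∉ D m → d m k x = 0 := fun m k => (TopologicalSpace.denseSeq (S m) k).2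
  have hdc : ∀ m k, HasCompactSupport (d m k) := fun m k =>
    HasCompactSupport.intro (D.isCompact m) fun x hx => hd0 m k x hx
  let u : (ℕ × ℕ) ⊕ ℕ → E → ℝ := Sum.elim (fun p => d p.1 p.2) χ
  have hu : ∀ j, Continuous (u j) ∧ HasCompactSupport (u j) := by
    rintro (p | m)
    · exact ⟨(d p.1 p.2).continuous, hdc _ _⟩
    · exact ⟨hχc m, hχs m⟩
  refine ⟨u, hu, ⟨le_antisymm ?_ ?_⟩⟩
  · exact continuous_iff_le_induced.1 (continuous_pi fun j =>
      continuous_integral_pointConfiguration (hu j).1 (hu j).2)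
  -- a test function is uniformly approximated inside a compact set by members of the family,
  -- with an error controlled by one of the plateau functions `χ`
  have key : ∀ (Y : Type _) [TopologicalSpace Y] (x : Y → PointConfiguration E),
      (∀ j, Continuous fun y => ∫ t, u j t ∂(x y).1) → Continuous x := by
    intro Y _ x hx
    refine continuous_pointConfiguration_iff.2 fun f hf hfc => ?_
    obtain ⟨m, hm⟩ := D.exists_superset_of_isCompact hfc
    have hfm : ∀ t, t ∉ D m → f t = 0 := fun t ht =>
      image_eq_zero_of_notMem_tsupport fun h => ht (hm h)
    refine continuous_of_locally_uniform_approx_of_continuousAt fun y v hv => ?_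
    obtain ⟨ε, hε, hεv⟩ := Metric.mem_uniformity_dist.1 hv
    set c := ∫ t, χ m t ∂(x y).1 with hc
    have hc0 : 0 ≤ c := integral_nonneg fun t => (hχ01 m t).1
    have hηp : 0 < ε / 2 / (c + 1) := by positivity
    obtain ⟨k, hk⟩ : ∃ k, ∀ t ∈ D m, dist (f t) (d m k t) < ε / 2 / (c + 1) := by
      have h1 : IsOpen {g : S m | ∀ t ∈ D m, dist (f t) (g.1 t) < ε / 2 / (c + 1)} := by
        have h2 : IsOpen {g : C(E, ℝ) | MapsTo (fun t => dist (f t) (g t))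
            (D m) (Iio (ε / 2 / (c + 1)))} := by
          have h3 : Continuous fun g : C(E, ℝ) =>
              (⟨fun t => dist (f t) (g t), by fun_prop⟩ : C(E, ℝ)) := by
            refine ContinuousMap.continuous_of_continuous_uncurry _ ?_
            simp only [Function.uncurry_def, ContinuousMap.coe_mk]
            fun_prop
          exact (ContinuousMap.isOpen_setOfPred_mapsTo (D.isCompact m) isOpen_Iio).preimage h3
        exact h2.preimage continuous_subtype_val
      obtain ⟨k, hg⟩ := (TopologicalSpace.denseRange_denseSeq (S m)).exists_mem_open h1
        ⟨⟨⟨f, hf⟩, hfm⟩, fun t _ => by simpa using hηp⟩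
      exact ⟨k, hg⟩
    refine ⟨{y' | ∫ t, χ m t ∂(x y').1 < c + 1},
      ((isOpen_Iio.preimage (hx (Sum.inr m))).mem_nhds (show c < c + 1 by linarith)),
      fun y' => ∫ t, u (Sum.inl (m, k)) t ∂(x y').1, (hx _).continuousAt, fun y' hy' => hεv ?_⟩
    have hif : Integrable f (x y').1 := hf.integrable_of_hasCompactSupport hfc
    have hid : Integrable (d m k) (x y').1 :=
      (d m k).continuous.integrable_of_hasCompactSupport (hdc m k)
    have hiχ : Integrable (χ m) (x y').1 := (hχc m).integrable_of_hasCompactSupport (hχs m)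
    have h4 : dist (∫ t, f t ∂(x y').1) (∫ t, d m k t ∂(x y').1) ≤
        ∫ t, ε / 2 / (c + 1) * χ m t ∂(x y').1 := by
      rw [dist_eq_norm, ← integral_sub hif hid]
      refine norm_integral_le_of_norm_le (hiχ.const_mul _) (Eventually.of_forall fun t => ?_)
      by_cases ht : t ∈ D m
      · rw [hχ1 m t ht, mul_one, ← dist_eq_norm]
        exact (hk t ht).le
      · rw [hfm t ht, hd0 m k t ht, sub_zero, norm_zero]
        exact mul_nonneg hηp.le (hχ01 m t).1
    rw [integral_const_mul] at h4
    have h5 : ε / 2 / (c + 1) * ∫ t, χ m t ∂(x y').1 ≤ ε / 2 / (c + 1) * (c + 1) :=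
      mul_le_mul_of_nonneg_left (le_of_lt hy') hηp.le
    rw [div_mul_cancel₀ _ (by positivity)] at h5
    change dist (∫ t, f t ∂(x y').1) (∫ t, d m k t ∂(x y').1) < ε
    linarith
  have := @key (PointConfiguration E) (TopologicalSpace.induced
    (fun (X : PointConfiguration E) j => ∫ x, u j x ∂X.1) inferInstance) id fun j => by
      have h := @continuous_induced_dom _ _
        (fun (X : PointConfiguration E) (j : (ℕ × ℕ) ⊕ ℕ) => ∫ x, u j x ∂X.1) inferInstance
      exact @Continuous.comp _ _ _ (_) _ _ _ _ (continuous_apply j) h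
  exact continuous_id_iff_le.1 this

theorem PointConfiguration.ext_of_integral {X Y : PointConfiguration E} (h : ∀ f : E → ℝ,
    Continuous f → HasCompactSupport f → ∫ x, f x ∂X.1 = ∫ x, f x ∂Y.1) : X = Y :=
  Subtype.ext (Measure.ext_of_integral_eq_on_compactlySupported fun f =>
    h f f.continuous f.hasCompactSupport)

instance instT2SpacePointConfiguration : T2Space (PointConfiguration E) := by
  refine T2Space.of_injective_continuous
    (f := fun (X : PointConfiguration E) (f : C_c(E, ℝ)) => ∫ x, f x ∂X.1) (fun X Y h => ?_)
    (continuous_pi fun f => continuous_integral_pointConfiguration f.continuous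
      f.hasCompactSupport)
  exact PointConfiguration.ext_of_integral fun f hf hfc => congrFun h ⟨⟨f, hf⟩, hfc⟩

/-- A measure that is approximated, on every compactly supported continuous function, by point
configurations is itself integer valued. -/
theorem exists_natCast_of_approx {μ : Measure E} [IsLocallyFiniteMeasure μ]
    {F : Filter (PointConfiguration E)} [F.NeBot] (h : ∀ f : E → ℝ, Continuous f →
      HasCompactSupport f → Tendsto (fun X : PointConfiguration E => ∫ x, f x ∂X.1) F
        (𝓝 (∫ x, f x ∂μ))) {K : Set E} (hK : IsCompact K) : ∃ n : ℕ, μ K = n := by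
  set n := ⌊(μ K).toReal⌋₊ with hn
  have hKt : μ K ≠ ∞ := hK.measure_lt_top.ne
  refine ⟨n, le_antisymm ?_ ?_⟩
  swap
  · rw [← ENNReal.ofReal_toReal hKt, ← ENNReal.ofReal_natCast]
    exact ENNReal.ofReal_le_ofReal (Nat.floor_le ENNReal.toReal_nonneg)
  by_contra! hlt
  have hlt2 : μ K < n + 1 := by
    rw [← ENNReal.ofReal_toReal hKt, ← ENNReal.ofReal_natCast, ← ENNReal.ofReal_one,
      ← ENNReal.ofReal_add (by positivity) zero_le_one,
      ENNReal.ofReal_lt_ofReal_iff (by positivity)]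
    exact Nat.lt_floor_add_one _
  obtain ⟨W, hKW, hW, hμW⟩ := Set.exists_isOpen_lt_of_lt K _ hlt2
  obtain ⟨f₁, h1c, h1s, h1U, h1K, h101⟩ := exists_cutoff hK hW hKW
  obtain ⟨f₂, h2c, h2s, h2U, h2K, h201⟩ := exists_cutoff h1s hW h1U
  have hev : ∀ᶠ X : PointConfiguration E in F, (n : ℝ) + 1 ≤ ∫ x, f₂ x ∂X.1 := by
    have h3 : (n : ℝ) < ∫ x, f₁ x ∂μ := by
      have := hlt.trans_le (measure_le_integral_of_eq_one h1c h1s (fun x => (h101 x).1) h1K)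
      rw [← ENNReal.ofReal_natCast] at this
      exact (ENNReal.ofReal_lt_ofReal_iff_of_nonneg (by positivity)).1 this
    filter_upwards [(h f₁ h1c h1s).eventually (lt_mem_nhds h3)] with X hX
    have h4 : (n : ℝ≥0∞) < X.1 (tsupport f₁) := by
      refine lt_of_lt_of_le ?_ (integral_le_measure_of_tsupport h1c h1s h101 subset_rfl)
      rw [← ENNReal.ofReal_natCast]
      exact (ENNReal.ofReal_lt_ofReal_iff_of_nonneg (by positivity)).2 hX
    obtain ⟨k, hk⟩ := X.exists_eq_natCast (isClosed_tsupport f₁).measurableSet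
      (IsCompact.measure_lt_top h1s).ne
    rw [hk] at h4
    have h5 : n + 1 ≤ k := Nat.succ_le_of_lt (by exact_mod_cast h4)
    have h6 := measure_le_integral_of_eq_one (μ := X.1) h2c h2s (fun x => (h201 x).1) h2K
    rw [hk, ← ENNReal.ofReal_natCast, ENNReal.ofReal_le_ofReal_iff
      (integral_nonneg fun x => (h201 x).1)] at h6
    exact le_trans (by exact_mod_cast h5) h6
  have h7 : (n : ℝ) + 1 ≤ ∫ x, f₂ x ∂μ := ge_of_tendsto (h f₂ h2c h2s) hev
  have h8 := (integral_le_measure_of_tsupport (μ := μ) h2c h2s h201 h2U).trans_lt hμW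
  refine absurd (ENNReal.ofReal_le_ofReal h7) (not_le.2 ?_)
  rwa [ENNReal.ofReal_add (by positivity) zero_le_one, ENNReal.ofReal_natCast, ENNReal.ofReal_one]

/-- Configurations with uniformly bounded numbers of points in the members of an exhaustion
form a compact set. -/
theorem isCompact_setOf_measure_interior_le (D : CompactExhaustion E) (c : ℕ → ℝ≥0) :
    IsCompact {X : PointConfiguration E | ∀ m, X.1 (interior (D m)) ≤ c m} := by
  refine isCompact_iff_ultrafilter_le_nhds.2 fun U hU => ?_
  rw [le_principal_iff] at hU
  have hlim : ∀ f : C_c(E, ℝ), ∃ l : ℝ,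
      Tendsto (fun X : PointConfiguration E => ∫ x, f x ∂X.1) U (𝓝 l) := by
    intro f
    obtain ⟨m, hm⟩ := D.exists_superset_of_isCompact f.hasCompactSupport
    obtain ⟨B', hB'⟩ := f.continuous.bounded_above_of_compact_support f.hasCompactSupport
    set B := max B' 0
    have hB : ∀ x, ‖f x‖ ≤ B := fun x => (hB' x).trans (le_max_left _ _)
    have hbd : ∀ X : PointConfiguration E, X.1 (interior (D (m + 1))) ≤ c (m + 1) →
        ∫ x, f x ∂X.1 ∈ Icc (-(B * c (m + 1))) (B * c (m + 1)) := by
      intro X hX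
      refine abs_le.1 ?_
      rw [← Real.norm_eq_abs, ← setIntegral_eq_integral_of_forall_compl_eq_zero
        (s := interior (D (m + 1))) (fun x hx => image_eq_zero_of_notMem_tsupport
          fun h => hx (D.subset_interior_succ m (hm h)))]
      refine (norm_setIntegral_le_of_norm_le_const (hX.trans_lt ENNReal.coe_lt_top)
        fun x _ => hB x).trans ?_
      gcongr
      exact ENNReal.toReal_le_coe_of_le_coe hX
    obtain ⟨l, -, hl⟩ := isCompact_Icc.ultrafilter_le_nhds
      (U.map fun X : PointConfiguration E => ∫ x, f x ∂X.1) (le_principal_iff.2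
        (Ultrafilter.mem_map.2 (mem_of_superset hU fun X hX => hbd X (hX (m + 1)))))
    exact ⟨l, hl⟩
  choose Λ hΛ using hlim
  let L : C_c(E, ℝ) →ₚ[ℝ] ℝ := PositiveLinearMap.mk₀
    { toFun := Λ
      map_add' := fun f g => by
        refine tendsto_nhds_unique (hΛ (f + g)) (((hΛ f).add (hΛ g)).congr fun X => ?_)
        exact (integral_add (f.continuous.integrable_of_hasCompactSupport f.hasCompactSupport)
          (g.continuous.integrable_of_hasCompactSupport g.hasCompactSupport)).symm
      map_smul' := fun a f => by
        refine tendsto_nhds_unique (hΛ (a • f)) (((hΛ f).const_smul a).congr fun X => ?_)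
        exact (integral_smul a _).symm }
    fun f hf => ge_of_tendsto (hΛ f) (Eventually.of_forall fun X => integral_nonneg hf)
  set μ := RealRMK.rieszMeasure L with hμ
  have hμf : ∀ f : E → ℝ, Continuous f → HasCompactSupport f →
      Tendsto (fun X : PointConfiguration E => ∫ x, f x ∂X.1) U (𝓝 (∫ x, f x ∂μ)) := by
    intro f hf hfc
    have := RealRMK.integral_rieszMeasure L ⟨⟨f, hf⟩, hfc⟩
    simp only [← hμ] at this
    change ∫ x, f x ∂μ = Λ _ at this
    rw [this]
    exact hΛ _
  have hreg : μ.Regular := RealRMK.regular_rieszMeasure L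
  have hlf : IsLocallyFiniteMeasure μ := inferInstance
  have hK : ∀ K, IsCompact K → ∃ n : ℕ, μ K = n := fun K hK => exists_natCast_of_approx hμf hK
  have hint : ∀ A, MeasurableSet A → ∃ n : ℕ∞, μ A = n := by
    intro A hA
    have hsup := hA.measure_eq_iSup_isCompact (μ := μ)
    by_cases hb : ∃ N : ℕ, ∀ K ⊆ A, IsCompact K → μ K ≤ N
    · obtain ⟨N, hN⟩ := hb
      let T : Set ℕ := {n | ∃ K ⊆ A, IsCompact K ∧ μ K = n}
      have hT : BddAbove T := ⟨N, by
        rintro n ⟨K, hKA, hKc, hn⟩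
        have := hN K hKA hKc
        rw [hn] at this
        exact_mod_cast this⟩
      have hTn : T.Nonempty := ⟨0, ∅, empty_subset _, isCompact_empty, by simp⟩
      obtain ⟨K₀, hK₀A, hK₀, h0⟩ := Nat.sSup_mem hTn hT
      refine ⟨(sSup T : ℕ), le_antisymm ?_ ?_⟩
      · rw [hsup]
        refine iSup₂_le fun K hKA => iSup_le fun hKc => ?_
        obtain ⟨n, hn⟩ := hK K hKc
        rw [hn]
        have := le_csSup hT (show n ∈ T from ⟨K, hKA, hKc, hn⟩)
        simpa using this
      · have := measure_mono (μ := μ) hK₀A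
        rw [h0] at this
        simpa using this
    · push Not at hb
      refine ⟨⊤, ?_⟩
      rw [ENat.toENNReal_top]
      refine ENNReal.eq_top_of_forall_nnreal_le fun r => ?_
      obtain ⟨N, hN⟩ := exists_nat_ge r
      obtain ⟨K, hKA, -, h⟩ := hb N
      exact le_trans (by exact_mod_cast hN) (h.le.trans (measure_mono hKA))
  let Y : PointConfiguration E := ⟨μ, hlf, hint⟩
  refine ⟨Y, fun m => ?_, ?_⟩
  · change μ (interior (D m)) ≤ c m
    rw [measure_eq_iSup_cutoff μ isOpen_interior]
    refine iSup_le fun f => ?_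
    refine le_of_tendsto (ENNReal.tendsto_ofReal (hμf f.1 f.2.1 f.2.2.1)) ?_
    filter_upwards [hU] with X hX
    exact (integral_le_measure_of_tsupport f.2.1 f.2.2.1 f.2.2.2.2 f.2.2.2.1).trans (hX m)
  · exact tendsto_pointConfiguration_iff.2 hμf

end Vague

/-! ### Positive kernels and their determinants -/

section Determinants

variable {E : Type*}

/-- A kernel all of whose finite sections are positive semidefinite Hermitian matrices. -/
def IsPSDKernel (K : E → E → ℂ) : Prop :=
  ∀ (n : ℕ) (x : Fin n → E), (Matrix.of fun i j => K (x i) (x j)).PosSemidef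

/-- The correlation function `det (K (x i) (x j))`. -/
noncomputable def corr (K : E → E → ℂ) {n : ℕ} (x : Fin n → E) : ℝ :=
  (Matrix.of fun i j => K (x i) (x j)).det.re

theorem isPSDKernel_inner {H : Type*} [NormedAddCommGroup H] [InnerProductSpace ℂ H] (v : E → H) :
    IsPSDKernel fun x y => inner ℂ (v x) (v y) := fun _ x =>
  Matrix.posSemidef_gram ℂ fun i => v (x i)

variable {K : E → E → ℂ}

theorem IsPSDKernel.det_nonneg (hK : IsPSDKernel K) {n : ℕ} (x : Fin n → E) :
    0 ≤ (Matrix.of fun i j => K (x i) (x j)).det := (hK n x).det_nonneg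

theorem IsPSDKernel.corr_nonneg (hK : IsPSDKernel K) {n : ℕ} (x : Fin n → E) : 0 ≤ corr K x :=
  (Complex.nonneg_iff.1 (hK.det_nonneg x)).1

theorem IsPSDKernel.ofReal_corr (hK : IsPSDKernel K) {n : ℕ} (x : Fin n → E) :
    ((corr K x : ℝ) : ℂ) = (Matrix.of fun i j => K (x i) (x j)).det := by
  apply Complex.ext
  · rfl
  · exact (Complex.nonneg_iff.1 (hK.det_nonneg x)).2

theorem IsPSDKernel.conj_symm (hK : IsPSDKernel K) (x y : E) : star (K x y) = K y x := by
  have h := (hK 2 ![x, y]).isHermitian.apply 1 0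
  simpa using h

theorem IsPSDKernel.diag_nonneg (hK : IsPSDKernel K) (x : E) : 0 ≤ K x x := by
  have h := hK.det_nonneg (n := 1) ![x]
  simpa using h

/-- If a point configuration has vanishing correlation, so has any larger one. -/
theorem IsPSDKernel.det_cons_eq_zero (hK : IsPSDKernel K) {n : ℕ} (x : Fin n → E) (y : E)
    (h : (Matrix.of fun i j => K (x i) (x j)).det = 0) :
    (Matrix.of fun i j => K ((Fin.cons y x : Fin (n + 1) → E) i)
      ((Fin.cons y x : Fin (n + 1) → E) j)).det = 0 := by
  obtain ⟨u, hu0, hu⟩ := Matrix.exists_mulVec_eq_zero_iff.2 h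
  refine Matrix.exists_mulVec_eq_zero_iff.1 ⟨Fin.cons 0 u, fun h0 => hu0 ?_, ?_⟩
  · funext i
    simpa using congrFun h0 i.succ
  · refine (Matrix.PosSemidef.dotProduct_mulVec_zero_iff (hK _ _) _).1 ?_
    have hu' : ∀ i, ∑ j, K (x i) (x j) * u j = 0 := fun i => congrFun hu i
    simp only [dotProduct, Matrix.mulVec, Fin.sum_univ_succ, Pi.star_apply, Fin.cons_zero,
      Fin.cons_succ, star_zero, zero_mul, Matrix.of_apply, mul_zero, zero_add, hu']
    simp

/-- The Schur complement formula for adding one point to a configuration. -/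
theorem det_cons_eq {n : ℕ} (x : Fin n → E) (y : E)
    (h : IsUnit (Matrix.of fun i j => K (x i) (x j)).det) :
    (Matrix.of fun i j => K ((Fin.cons y x : Fin (n + 1) → E) i)
      ((Fin.cons y x : Fin (n + 1) → E) j)).det =
    (Matrix.of fun i j => K (x i) (x j)).det *
      (K y y - ∑ i, ∑ j, K y (x i) * (Matrix.of fun i j => K (x i) (x j))⁻¹ i j * K (x j) y) := by
  set A : Matrix (Fin n) (Fin n) ℂ := Matrix.of fun i j => K (x i) (x j) with hA
  have hAi : Invertible A := Matrix.invertibleOfIsUnitDet A h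
  let e : Fin (n + 1) ≃ Fin n ⊕ PUnit.{1} :=
    (finSuccEquiv n).trans (Equiv.optionEquivSumPUnit (Fin n))
  rw [← Matrix.det_submatrix_equiv_self e.symm]
  have hb : (Matrix.of fun i j => K ((Fin.cons y x : Fin (n + 1) → E) i)
      ((Fin.cons y x : Fin (n + 1) → E) j)).submatrix e.symm e.symm =
      Matrix.fromBlocks A (Matrix.of fun i _ => K (x i) y) (Matrix.of fun _ j => K y (x j))
        (Matrix.of fun _ _ => K y y) := by
    ext i j
    rcases i with i | i <;> rcases j with j | j <;> simp [e, hA]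
  rw [hb, Matrix.det_fromBlocks₁₁, Matrix.det_unique (n := PUnit)]
  congr 1
  simp only [Matrix.sub_apply, Matrix.of_apply, Matrix.mul_apply, Matrix.invOf_eq_nonsing_inv,
    Finset.sum_mul]
  rw [Finset.sum_comm]

/-- Fischer's inequality for one additional point. -/
theorem IsPSDKernel.corr_cons_le (hK : IsPSDKernel K) {n : ℕ} (x : Fin n → E) (y : E) :
    corr K (Fin.cons y x : Fin (n + 1) → E) ≤ (K y y).re * corr K x := by
  by_cases h : (Matrix.of fun i j => K (x i) (x j)).det = 0
  · rw [corr, hK.det_cons_eq_zero x y h, corr, h]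
    simp
  · have hpd : (Matrix.of fun i j => K (x i) (x j)).PosDef :=
      (hK n x).posDef_iff_det_ne_zero.2 h
    have h1 := hpd.inv.posSemidef.dotProduct_mulVec_nonneg fun j => K (x j) y
    have h2 : star (fun j => K (x j) y) ⬝ᵥ ((Matrix.of fun i j => K (x i) (x j))⁻¹ *ᵥ
        fun j => K (x j) y) = ∑ i, ∑ j, K y (x i) *
          (Matrix.of fun i j => K (x i) (x j))⁻¹ i j * K (x j) y := by
      simp only [dotProduct, Matrix.mulVec, Pi.star_apply, hK.conj_symm, Finset.mul_sum, mul_assoc]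
    rw [h2] at h1
    rw [corr, det_cons_eq x y (isUnit_iff_ne_zero.2 h), ← hK.ofReal_corr, Complex.re_ofReal_mul,
      Complex.sub_re, mul_comm]
    exact mul_le_mul_of_nonneg_right (sub_le_self _ (Complex.nonneg_iff.1 h1).1)
      (hK.corr_nonneg x)

/-- Hadamard's inequality. -/
theorem IsPSDKernel.corr_le_prod (hK : IsPSDKernel K) {n : ℕ} (x : Fin n → E) :
    corr K x ≤ ∏ i, (K (x i) (x i)).re := by
  induction n with
  | zero => simp [corr]
  | succ n ih =>
    rw [← Fin.cons_self_tail x, Fin.prod_univ_succ]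
    refine (hK.corr_cons_le _ _).trans ?_
    simp only [Fin.cons_zero, Fin.cons_succ]
    exact mul_le_mul_of_nonneg_left (ih _) (Complex.nonneg_iff.1 (hK.diag_nonneg _)).1

end Determinants

/-! ### Factorial moments of determinantal processes -/

theorem lintegral_fin_prod_eq_prod {E : Type*} [MeasurableSpace E] {n : ℕ} (μ : Fin n → Measure E)
    [∀ i, SigmaFinite (μ i)] (f : Fin n → E → ℝ≥0∞) (hf : ∀ i, Measurable (f i)) :
    ∫⁻ x, ∏ i, f i (x i) ∂(Measure.pi μ) = ∏ i, ∫⁻ x, f i x ∂(μ i) := by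
  induction n with
  | zero => simp
  | succ n ih =>
    have hm := (measurePreserving_piFinSuccAbove μ 0).symm
    rw [← hm.lintegral_comp_emb (MeasurableEquiv.measurableEmbedding _),
      lintegral_prod _ (by fun_prop)]
    simp only [Fin.prod_univ_succ, MeasurableEquiv.piFinSuccAbove_symm_apply,
      Fin.insertNthEquiv_apply, Fin.insertNth_zero', Fin.cons_zero, Fin.cons_succ]
    rw [← ih (fun i => μ i.succ) (fun i => f i.succ) (fun i => hf _)]
    simp only [Fin.zero_succAbove]
    rw [← lintegral_mul_const _ (hf 0)]
    refine lintegral_congr fun x => ?_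
    rw [lintegral_const_mul _ (by fun_prop)]

section Moments

variable {E : Type*} [TopologicalSpace E] [MeasurableSpace E] {m : Measure E} {K : E → E → ℂ}
  {P : ProbabilityMeasure (PointConfiguration E)}

/-- The expected number of points of the process in `A`. -/
noncomputable def meanCount (m : Measure E) (K : E → E → ℂ) (A : Set E) : ℝ≥0∞ :=
  ∫⁻ x in A, ENNReal.ofReal (K x x).re ∂m

theorem IsPSDKernel.lintegral_corr_le [SigmaFinite m] (hK : IsPSDKernel K)
    (hm : Measurable fun x => K x x) {n : ℕ} (A : Fin n → Set E) :
    ∫⁻ x in univ.pi A, ENNReal.ofReal (corr K x) ∂(Measure.pi fun _ => m) ≤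
      ∏ i, meanCount m K (A i) := by
  rw [Measure.restrict_pi_pi]
  simp only [meanCount]
  rw [← lintegral_fin_prod_eq_prod (fun i => m.restrict (A i))
    (fun _ x => ENNReal.ofReal (K x x).re)
    (fun _ => ENNReal.measurable_ofReal.comp (Complex.measurable_re.comp hm))]
  refine lintegral_mono fun x => ?_
  rw [← ENNReal.ofReal_prod_of_nonneg fun i _ => (Complex.nonneg_iff.1 (hK.diag_nonneg _)).1]
  exact ENNReal.ofReal_le_ofReal (hK.corr_le_prod x)

theorem IsDeterminantalLaw.lintegral_prod_fin (hP : IsDeterminantalLaw m K P) {n : ℕ}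
    (A : Fin n → Set E) (hA : ∀ i, MeasurableSet (A i))
    (hd : Pairwise fun i j => Disjoint (A i) (A j)) :
    ∫⁻ X, ∏ i, X.1 (A i) ∂(P : Measure (PointConfiguration E)) =
      ∫⁻ x in univ.pi A, ENNReal.ofReal (corr K x) ∂(Measure.pi fun _ => m) :=
  hP.intensity n A hA hd

/-- The intensity identity with the sets indexed by an arbitrary finite set. -/
theorem IsDeterminantalLaw.lintegral_prod_finset (hP : IsDeterminantalLaw m K P) {T : Type*}
    (C : T → Set E) (hC : ∀ t, MeasurableSet (C t)) (hd : Pairwise fun s t => Disjoint (C s) (C t))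
    (S : Finset T) :
    ∫⁻ X, ∏ t ∈ S, X.1 (C t) ∂(P : Measure (PointConfiguration E)) =
      ∫⁻ x in univ.pi fun i => C (S.equivFin.symm i), ENNReal.ofReal (corr K x)
        ∂(Measure.pi fun _ => m) := by
  rw [← hP.lintegral_prod_fin _ (fun i => hC _) fun i j hij => hd fun h => hij (by
    simpa using h)]
  refine lintegral_congr fun X => ?_
  rw [← Finset.prod_coe_sort, ← S.equivFin.symm.prod_comp]

theorem IsDeterminantalLaw.lintegral_prod_finset_le [SigmaFinite m] (hP : IsDeterminantalLaw m K P)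
    (hK : IsPSDKernel K) (hm : Measurable fun x => K x x) {T : Type*}
    (C : T → Set E) (hC : ∀ t, MeasurableSet (C t)) (hd : Pairwise fun s t => Disjoint (C s) (C t))
    (S : Finset T) :
    ∫⁻ X, ∏ t ∈ S, X.1 (C t) ∂(P : Measure (PointConfiguration E)) ≤
      ∏ t ∈ S, meanCount m K (C t) := by
  rw [hP.lintegral_prod_finset C hC hd]
  refine (hK.lintegral_corr_le hm _).trans (le_of_eq ?_)
  rw [← Finset.prod_coe_sort S, ← S.equivFin.symm.prod_comp]

theorem IsDeterminantalLaw.lintegral_eval [SigmaFinite m] (hP : IsDeterminantalLaw m K P)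
    {A : Set E} (hA : MeasurableSet A) :
    ∫⁻ X, X.1 A ∂(P : Measure (PointConfiguration E)) = meanCount m K A := by
  have h := hP.lintegral_prod_fin (n := 1) (fun _ => A) (fun _ => hA)
    (fun i j hij => absurd (Subsingleton.elim i j) hij)
  simp only [Finset.univ_unique, Finset.prod_singleton] at h
  rw [h, meanCount, Measure.restrict_pi_pi]
  rw [← (measurePreserving_piUnique fun _ : Fin 1 => m.restrict A).symm.lintegral_comp_emb
    (MeasurableEquiv.measurableEmbedding _)]
  simp [corr]

end Moments

/-! ### Uniqueness of determinantal processes -/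

section Cells

variable {E : Type*} [MeasurableSpace E] [MeasurableSpace.CountablyGenerated E]

/-- The partition of `E` according to membership in the first `n` sets of a countable generating
family. -/
def cell (E : Type*) [MeasurableSpace E] [MeasurableSpace.CountablyGenerated E] (n : ℕ)
    (b : Fin n → Bool) : Set E :=
  {x | ∀ i : Fin n, MeasurableSpace.mapNatBool E x i = b i}

theorem measurableSet_cell (n : ℕ) (b : Fin n → Bool) : MeasurableSet (cell E n b) := by
  have h : Measurable fun (x : E) (i : Fin n) => MeasurableSpace.mapNatBool E x i :=
    measurable_pi_lambda _ fun i =>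
      (measurable_pi_apply _).comp (MeasurableSpace.measurable_mapNatBool E)
  have h2 := h (measurableSet_singleton b)
  convert h2 using 1
  ext x
  simp [cell, funext_iff]

theorem disjoint_cell (n : ℕ) : Pairwise fun b c => Disjoint (cell E n b) (cell E n c) := by
  intro b c hbc
  refine Set.disjoint_left.2 fun x hb hc => hbc ?_
  funext i
  rw [← hb i, hc i]

theorem iUnion_cell (n : ℕ) : ⋃ b, cell E n b = univ :=
  eq_univ_of_forall fun x => mem_iUnion.2 ⟨fun i => MeasurableSpace.mapNatBool E x i, fun _ => rfl⟩

theorem sum_measure_inter_cell (μ : Measure E) {A : Set E} (hA : MeasurableSet A) (n : ℕ) :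
    ∑ b, μ (A ∩ cell E n b) = μ A := by
  rw [← measure_biUnion_finset (fun b _ c _ hbc => (disjoint_cell n hbc).mono inter_subset_right
    inter_subset_right) fun b _ => hA.inter (measurableSet_cell n b)]
  congr 1
  simp only [Finset.mem_univ, iUnion_true, ← inter_iUnion, iUnion_cell, inter_univ]

theorem sum_toReal_inter_cell (μ : Measure E) {A : Set E} (hA : MeasurableSet A) (h : μ A ≠ ∞)
    (n : ℕ) : ∑ b, (μ (A ∩ cell E n b)).toReal = (μ A).toReal := by
  rw [← sum_measure_inter_cell μ hA n, ENNReal.toReal_sum]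
  exact fun b _ => measure_ne_top_of_subset inter_subset_left h

/-- A simple configuration with finitely many points in `A` has at most one of them in each cell
of a sufficiently fine partition. -/
theorem eventually_measure_inter_cell_le_one [TopologicalSpace E]
    [LocallyCompactSpace E] [T2Space E] [BorelSpace E] [MeasurableSpace.SeparatesPoints E]
    (X : PointConfiguration E)
    (hX : ∀ x, X.1 {x} ≤ 1) {A : Set E} (hA : MeasurableSet A) (h : X.1 A ≠ ∞) :
    ∀ᶠ n in atTop, ∀ b, X.1 (A ∩ cell E n b) ≤ 1 := by
  classical
  let c : ℕ → E → Set E := fun n x => A ∩ cell E n fun i => MeasurableSpace.mapNatBool E x i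
  have hcm : ∀ n x, MeasurableSet (c n x) := fun n x => hA.inter (measurableSet_cell n _)
  have hc_anti : ∀ x, Antitone fun n => c n x := fun x i j hij y hy =>
    ⟨hy.1, fun k => hy.2 ⟨k, k.2.trans_le hij⟩⟩
  have hc_mem : ∀ n x, x ∈ A → x ∈ c n x := fun n x hx => ⟨hx, fun _ => rfl⟩
  let B : ℕ → Set E := fun n => {x | x ∈ A ∧ 2 ≤ X.1 (c n x)}
  have hBm : ∀ n, MeasurableSet (B n) := by
    intro n
    have : B n = ⋃ b ∈ {b | 2 ≤ X.1 (A ∩ cell E n b)}, A ∩ cell E n b := by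
      ext x
      simp only [B, c, mem_ofPred_eq, mem_iUnion, exists_prop]
      constructor
      · rintro ⟨hx, h2⟩
        exact ⟨_, h2, hx, fun _ => rfl⟩
      · rintro ⟨b, h2, hx, hb⟩
        have : (fun i : Fin n => MeasurableSpace.mapNatBool E x i) = b := funext hb
        exact ⟨hx, by rwa [this]⟩
    rw [this]
    exact (Set.toFinite _).measurableSet_biUnion fun b _ => hA.inter (measurableSet_cell n b)
  have hB_anti : Antitone B := fun i j hij x hx =>
    ⟨hx.1, hx.2.trans (measure_mono (hc_anti x hij))⟩
  have hB_empty : ⋂ n, B n = ∅ := by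
    refine eq_empty_of_forall_notMem fun x hx => ?_
    rw [mem_iInter] at hx
    have h1 : Tendsto (fun n => X.1 (c n x)) atTop (𝓝 (X.1 (⋂ n, c n x))) :=
      tendsto_measure_iInter_atTop (fun n => (hcm n x).nullMeasurableSet) (hc_anti x)
        ⟨0, measure_ne_top_of_subset inter_subset_left h⟩
    have h2 : 2 ≤ X.1 (⋂ n, c n x) := ge_of_tendsto h1 (Eventually.of_forall fun n => (hx n).2)
    have h3 : ⋂ n, c n x ⊆ {x} := by
      intro y hy
      rw [mem_iInter] at hy
      refine MeasurableSpace.injective_mapNatBool E (funext fun k => ?_)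
      exact (hy (k + 1)).2 ⟨k, Nat.lt_succ_self k⟩
    exact absurd (h2.trans ((measure_mono h3).trans (hX x))) (by norm_num)
  have h4 : Tendsto (fun n => X.1 (B n)) atTop (𝓝 0) := by
    have := tendsto_measure_iInter_atTop (μ := X.1) (fun n => (hBm n).nullMeasurableSet) hB_anti
      ⟨0, measure_ne_top_of_subset (fun x hx => hx.1) h⟩
    rwa [hB_empty, measure_empty] at this
  filter_upwards [h4.eventually (gt_mem_nhds (zero_lt_one' ℝ≥0∞))] with n hn b
  by_contra! hlt
  obtain ⟨k, hk⟩ := X.exists_eq_natCast (hA.inter (measurableSet_cell n b))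
    (measure_ne_top_of_subset inter_subset_left h)
  have hk2 : 2 ≤ X.1 (A ∩ cell E n b) := by
    rw [hk] at hlt ⊢
    have : 1 < k := by exact_mod_cast hlt
    exact_mod_cast this
  have h5 : A ∩ cell E n b ⊆ B n := by
    rintro x ⟨hx, hb⟩
    have : (fun i : Fin n => MeasurableSpace.mapNatBool E x i) = b := funext hb
    exact ⟨hx, by simpa only [c, this] using hk2⟩
  exact absurd ((hk2.trans (measure_mono h5)).trans_lt hn) (by norm_num)

end Cells

section Uniqueness

variable {E : Type*} [TopologicalSpace E] [LocallyCompactSpace E] [T2Space E] [MeasurableSpace E]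
  [BorelSpace E] [SecondCountableTopology E] {m : Measure E} [SigmaFinite m] {K : E → E → ℂ}
  {P P' : ProbabilityMeasure (PointConfiguration E)}

theorem IsDeterminantalLaw.ae_ne_top (hP : IsDeterminantalLaw m K P) {A : Set E}
    (hA : MeasurableSet A) (h : meanCount m K A ≠ ∞) :
    ∀ᵐ X ∂(P : Measure (PointConfiguration E)), X.1 A ≠ ∞ := by
  rw [← hP.lintegral_eval hA] at h
  filter_upwards [ae_lt_top (measurable_eval hA) h] with X hX using hX.ne

theorem IsDeterminantalLaw.lintegral_prod_one_add_le (hP : IsDeterminantalLaw m K P)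
    (hK : IsPSDKernel K) (hm : Measurable fun x => K x x) {T : Type*}
    (C : T → Set E) (hC : ∀ t, MeasurableSet (C t)) (hd : Pairwise fun s t => Disjoint (C s) (C t))
    (S : Finset T) (c : ℝ≥0∞) :
    ∫⁻ X, ∏ t ∈ S, (1 + c * X.1 (C t)) ∂(P : Measure (PointConfiguration E)) ≤
      ∏ t ∈ S, (1 + c * meanCount m K (C t)) := by
  classical
  simp only [Finset.prod_one_add]
  rw [lintegral_finsetSum _ fun S' _ => Finset.measurable_fun_prod _ fun t _ =>
    (measurable_eval (hC t)).const_mul c]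
  refine Finset.sum_le_sum fun S' _ => ?_
  simp only [Finset.prod_mul_distrib, Finset.prod_const]
  rw [lintegral_const_mul _ (Finset.measurable_fun_prod _ fun t _ => measurable_eval (hC t))]
  gcongr
  exact hP.lintegral_prod_finset_le hK hm C hC hd S'

theorem one_add_two_mul_le_three_pow (k : ℕ) : (1 : ℝ) + 2 * k ≤ 3 ^ k := by
  have := one_add_mul_le_pow (show (-2 : ℝ) ≤ 2 by norm_num) k
  norm_num at this
  linarith

/-- Exponential moments of the number of points. -/
theorem IsDeterminantalLaw.lintegral_three_pow_le (hP : IsDeterminantalLaw m K P)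
    (hK : IsPSDKernel K) (hm : Measurable fun x => K x x) {A : Set E} (hA : MeasurableSet A)
    (h : meanCount m K A ≠ ∞) :
    ∫⁻ X, ENNReal.ofReal (3 ^ (X.1 A).toReal) ∂(P : Measure (PointConfiguration E)) ≤
      ENNReal.ofReal (Real.exp (2 * (meanCount m K A).toReal)) := by
  let C : (n : ℕ) → (Fin n → Bool) → Set E := fun n b => A ∩ cell E n b
  have hC : ∀ n b, MeasurableSet (C n b) := fun n b => hA.inter (measurableSet_cell n b)
  have hd : ∀ n, Pairwise fun b c => Disjoint (C n b) (C n c) := fun n b c hbc =>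
    (disjoint_cell n hbc).mono inter_subset_right inter_subset_right
  have hbound : ∀ n, ∫⁻ X, ∏ b, (1 + 2 * X.1 (C n b)) ∂(P : Measure (PointConfiguration E)) ≤
      ENNReal.ofReal (Real.exp (2 * (meanCount m K A).toReal)) := by
    intro n
    refine (hP.lintegral_prod_one_add_le hK hm (C n) (hC n) (hd n) Finset.univ 2).trans ?_
    have hsum : (meanCount m K A).toReal = ∑ b, (meanCount m K (C n b)).toReal := by
      have := sum_toReal_inter_cell (m.withDensity fun x => ENNReal.ofReal (K x x).re) hA
        (by rwa [withDensity_apply _ hA]) n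
      rw [withDensity_apply _ hA] at this
      rw [meanCount, ← this]
      refine Finset.sum_congr rfl fun b _ => ?_
      rw [withDensity_apply _ (hC n b), meanCount]
    rw [hsum, Finset.mul_sum, Real.exp_sum, ENNReal.ofReal_prod_of_nonneg fun b _ =>
      (Real.exp_pos _).le]
    refine Finset.prod_le_prod' fun b _ => ?_
    have hb : meanCount m K (C n b) ≠ ∞ :=
      ne_top_of_le_ne_top h (lintegral_mono_set inter_subset_left)
    have : 1 + 2 * meanCount m K (C n b) =
        ENNReal.ofReal (2 * (meanCount m K (C n b)).toReal + 1) := by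
      rw [ENNReal.ofReal_add (by positivity) zero_le_one, ENNReal.ofReal_mul zero_le_two,
        ENNReal.ofReal_toReal hb, ENNReal.ofReal_one, add_comm]
      simp
    rw [this]
    exact ENNReal.ofReal_le_ofReal (Real.add_one_le_exp _)
  have hlim : ∀ᵐ X ∂(P : Measure (PointConfiguration E)),
      ENNReal.ofReal (3 ^ (X.1 A).toReal) ≤ liminf (fun n => ∏ b, (1 + 2 * X.1 (C n b))) atTop := by
    filter_upwards [hP.simple, hP.ae_ne_top hA h] with X hX hXA
    refine le_of_eq (Tendsto.liminf_eq ?_).symm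
    refine tendsto_const_nhds.congr' ?_
    filter_upwards [eventually_measure_inter_cell_le_one X hX hA hXA] with n hn
    rw [← sum_toReal_inter_cell X.1 hA hXA n, Real.rpow_sum_of_pos (by norm_num),
      ENNReal.ofReal_prod_of_nonneg fun b _ => by positivity]
    refine Finset.prod_congr rfl fun b _ => ?_
    obtain ⟨k, hk⟩ := X.exists_eq_natCast (hC n b) (measure_ne_top_of_subset inter_subset_left hXA)
    have hk1 := hn b
    change X.1 (C n b) ≤ 1 at hk1
    change ENNReal.ofReal (3 ^ (X.1 (C n b)).toReal) = _
    rw [hk] at hk1 ⊢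
    have hk2 : k ≤ 1 := by exact_mod_cast hk1
    interval_cases k <;> norm_num
  refine (lintegral_mono_ae hlim).trans ((lintegral_liminf_le fun n =>
    Finset.measurable_fun_prod _ fun b _ =>
      ((measurable_eval (hC n b)).const_mul 2).const_add 1).trans ?_)
  exact liminf_le_of_le (by isBoundedDefault) fun b hb => by
    obtain ⟨n, hn⟩ := hb.exists
    exact hn.trans (hbound n)

theorem IsDeterminantalLaw.integral_prod_toReal (hP : IsDeterminantalLaw m K P)
    (hK : IsPSDKernel K) (hm : Measurable fun x => K x x) {T : Type*}
    (C : T → Set E) (hC : ∀ t, MeasurableSet (C t)) (hd : Pairwise fun s t => Disjoint (C s) (C t))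
    (S : Finset T) (hfin : ∀ t ∈ S, meanCount m K (C t) ≠ ∞) :
    Integrable (fun X : PointConfiguration E => ∏ t ∈ S, (X.1 (C t)).toReal)
        (P : Measure (PointConfiguration E)) ∧
    ∫ X, ∏ t ∈ S, (X.1 (C t)).toReal ∂(P : Measure (PointConfiguration E)) =
      (∫⁻ x in univ.pi fun i => C (S.equivFin.symm i), ENNReal.ofReal (corr K x)
        ∂(Measure.pi fun _ => m)).toReal := by
  have hmeas : Measurable fun X : PointConfiguration E => ∏ t ∈ S, X.1 (C t) :=
    Finset.measurable_fun_prod _ fun t _ => measurable_eval (hC t)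
  have hlt : ∫⁻ X, ∏ t ∈ S, X.1 (C t) ∂(P : Measure (PointConfiguration E)) ≠ ∞ :=
    ne_top_of_le_ne_top (ENNReal.prod_ne_top hfin) (hP.lintegral_prod_finset_le hK hm C hC hd S)
  simp only [← ENNReal.toReal_prod]
  refine ⟨integrable_toReal_of_lintegral_ne_top hmeas.aemeasurable hlt, ?_⟩
  rw [integral_toReal hmeas.aemeasurable (ae_lt_top hmeas hlt), hP.lintegral_prod_finset C hC hd]

/-- The characteristic function of the numbers of points in finitely many disjoint sets is
determined by the kernel. -/
theorem IsDeterminantalLaw.integral_exp_sum_eq (hP : IsDeterminantalLaw m K P)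
    (hP' : IsDeterminantalLaw m K P') (hK : IsPSDKernel K) (hm : Measurable fun x => K x x)
    {ι : Type*} (A : ι → Set E) (hA : ∀ i, MeasurableSet (A i))
    (hd : Pairwise fun i j => Disjoint (A i) (A j)) (s : Finset ι)
    (hfin : ∀ i ∈ s, meanCount m K (A i) ≠ ∞) (a : ι → ℝ) :
    ∫ X, Complex.exp ((∑ i ∈ s, (X.1 (A i)).toReal * a i : ℝ) * Complex.I)
        ∂(P : Measure (PointConfiguration E)) =
    ∫ X, Complex.exp ((∑ i ∈ s, (X.1 (A i)).toReal * a i : ℝ) * Complex.I)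
        ∂(P' : Measure (PointConfiguration E)) := by
  let C : (n : ℕ) → ι × (Fin n → Bool) → Set E := fun n t => A t.1 ∩ cell E n t.2
  have hC : ∀ n t, MeasurableSet (C n t) := fun n t => (hA t.1).inter (measurableSet_cell n t.2)
  have hCd : ∀ n, Pairwise fun t u => Disjoint (C n t) (C n u) := by
    intro n t u htu
    by_cases h1 : t.1 = u.1
    · have h2 : t.2 ≠ u.2 := fun h2 => htu (Prod.ext h1 h2)
      exact (disjoint_cell n h2).mono inter_subset_right inter_subset_right
    · exact (hd h1).mono inter_subset_left inter_subset_left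
  let g : ι → ℂ := fun i => Complex.exp (a i * Complex.I) - 1
  have hg : ∀ i, ‖g i‖ ≤ 2 := fun i => by
    refine (norm_sub_le _ _).trans ?_
    rw [Complex.norm_exp_ofReal_mul_I]
    norm_num
  let Y : ℕ → PointConfiguration E → ℂ := fun n X =>
    ∏ t ∈ s ×ˢ Finset.univ, (1 + g t.1 * (X.1 (C n t)).toReal)
  have hCfin : ∀ n, ∀ t ∈ s ×ˢ (Finset.univ : Finset (Fin n → Bool)),
      meanCount m K (C n t) ≠ ∞ := fun n t ht =>
    ne_top_of_le_ne_top (hfin t.1 (Finset.mem_product.1 ht).1) (lintegral_mono_set inter_subset_left)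
  have hYint : ∀ n, ∫ X, Y n X ∂(P : Measure (PointConfiguration E)) =
      ∫ X, Y n X ∂(P' : Measure (PointConfiguration E)) := by
    classical
    intro n
    have key : ∀ R : ProbabilityMeasure (PointConfiguration E), IsDeterminantalLaw m K R →
        ∫ X, Y n X ∂(R : Measure (PointConfiguration E)) =
          ∑ S ∈ (s ×ˢ (Finset.univ : Finset (Fin n → Bool))).powerset, (∏ t ∈ S, g t.1) *
            ((∫⁻ x in univ.pi fun i => C n (S.equivFin.symm i), ENNReal.ofReal (corr K x)
              ∂(Measure.pi fun _ => m)).toReal : ℂ) := by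
      intro R hR
      have h1 : ∀ S ∈ (s ×ˢ (Finset.univ : Finset (Fin n → Bool))).powerset, _ := fun S hS =>
        hR.integral_prod_toReal hK hm (C n) (hC n) (hCd n) S
          fun t ht => hCfin n t (Finset.mem_powerset.1 hS ht)
      simp only [Y, Finset.prod_one_add, Finset.prod_mul_distrib]
      rw [integral_finsetSum]
      · refine Finset.sum_congr rfl fun S hS => ?_
        rw [integral_const_mul]
        congr 1
        rw [← (h1 S hS).2, ← integral_complex_ofReal]
        push_cast
        rfl
      · intro S hS
        refine Integrable.const_mul ?_ _
        have := (h1 S hS).1.ofReal (𝕜 := ℂ)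
        simpa using this
    rw [key P hP, key P' hP']
  let A' : Set E := ⋃ i ∈ s, A i
  have hA' : MeasurableSet A' := s.measurableSet_biUnion fun i _ => hA i
  have hA'fin : meanCount m K A' ≠ ∞ := by
    refine ne_top_of_le_ne_top (ENNReal.sum_ne_top.2 hfin) ?_
    have h1 := measure_biUnion_finset_le (μ := m.withDensity fun x => ENNReal.ofReal (K x x).re) s A
    rw [withDensity_apply _ hA'] at h1
    refine h1.trans (le_of_eq (Finset.sum_congr rfl fun i _ => ?_))
    rw [withDensity_apply _ (hA i), meanCount]
  have hlim : ∀ R : ProbabilityMeasure (PointConfiguration E), IsDeterminantalLaw m K R →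
      Tendsto (fun n => ∫ X, Y n X ∂(R : Measure (PointConfiguration E))) atTop
        (𝓝 (∫ X, Complex.exp ((∑ i ∈ s, (X.1 (A i)).toReal * a i : ℝ) * Complex.I)
        ∂(R : Measure (PointConfiguration E)))) := by
    intro R hR
    have hsumC : ∀ X : PointConfiguration E, X.1 A' ≠ ∞ → ∀ n (u : ι → ℝ),
        ∑ t ∈ s ×ˢ (Finset.univ : Finset (Fin n → Bool)), (X.1 (C n t)).toReal * u t.1 =
          ∑ i ∈ s, (X.1 (A i)).toReal * u i := by
      intro X hX n u
      rw [Finset.sum_product]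
      refine Finset.sum_congr rfl fun i hi => ?_
      change ∑ b, (X.1 (A i ∩ cell E n b)).toReal * u i = _
      rw [← Finset.sum_mul, sum_toReal_inter_cell X.1 (hA i)
        (measure_ne_top_of_subset (subset_biUnion_of_mem (u := A) hi) hX) n]
    have hXA' : ∀ X : PointConfiguration E, X.1 A' ≠ ∞ →
        ∑ i ∈ s, (X.1 (A i)).toReal = (X.1 A').toReal := by
      intro X hX
      rw [measure_biUnion_finset (fun i _ j _ hij => hd hij) fun i _ => hA i, ENNReal.toReal_sum]
      exact fun i hi => measure_ne_top_of_subset (subset_biUnion_of_mem (u := A) hi) hX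
    have hCtop : ∀ X : PointConfiguration E, X.1 A' ≠ ∞ → ∀ n,
        ∀ t ∈ s ×ˢ (Finset.univ : Finset (Fin n → Bool)), ∃ k : ℕ, X.1 (C n t) = k := by
      intro X hX n t ht
      exact X.exists_eq_natCast (hC n t) (measure_ne_top_of_subset (inter_subset_left.trans
        (subset_biUnion_of_mem (u := A) (Finset.mem_product.1 ht).1)) hX)
    refine tendsto_integral_of_dominated_convergence
      (fun X : PointConfiguration E => (3 : ℝ) ^ (X.1 A').toReal) (fun n => ?_) ?_ (fun n => ?_) ?_
    · refine (Finset.measurable_fun_prod _ fun t _ => ?_).aestronglyMeasurable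
      exact ((Complex.measurable_ofReal.comp (measurable_eval (hC n t)).ennreal_toReal).const_mul
        _).const_add _
    · refine ⟨((measurable_eval hA').ennreal_toReal.const_pow 3).aestronglyMeasurable, ?_⟩
      rw [hasFiniteIntegral_iff_norm]
      refine lt_of_le_of_lt (lintegral_mono fun X => ?_)
        ((hR.lintegral_three_pow_le hK hm hA' hA'fin).trans_lt ENNReal.ofReal_lt_top)
      rw [Real.norm_of_nonneg (by positivity)]
    · filter_upwards [hR.ae_ne_top hA' hA'fin] with X hX
      simp only [Y]
      rw [norm_prod]
      have h3 : (3 : ℝ) ^ (X.1 A').toReal =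
          ∏ t ∈ s ×ˢ (Finset.univ : Finset (Fin n → Bool)), (3 : ℝ) ^ (X.1 (C n t)).toReal := by
        have := hsumC X hX n fun _ => 1
        simp only [mul_one] at this
        rw [← hXA' X hX, ← this, Real.rpow_sum_of_pos (by norm_num)]
      rw [h3]
      refine Finset.prod_le_prod (fun _ _ => norm_nonneg _) fun t ht => ?_
      obtain ⟨k, hk⟩ := hCtop X hX n t ht
      rw [hk, ENNReal.toReal_natCast, Real.rpow_natCast]
      refine le_trans ((norm_add_le _ _).trans ?_) (one_add_two_mul_le_three_pow k)
      rw [norm_one, norm_mul, Complex.norm_real, Real.norm_natCast]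
      gcongr
      exact hg _
    · filter_upwards [hR.simple, hR.ae_ne_top hA' hA'fin] with X hXs hX
      refine tendsto_const_nhds.congr' ?_
      have hev : ∀ᶠ n in atTop, ∀ i ∈ s, ∀ b, X.1 (A i ∩ cell E n b) ≤ 1 :=
        (Finset.eventually_all s).2 fun i hi => eventually_measure_inter_cell_le_one X hXs (hA i)
          (measure_ne_top_of_subset (subset_biUnion_of_mem (u := A) hi) hX)
      filter_upwards [hev] with n hn
      rw [← hsumC X hX n a]
      push_cast
      rw [Finset.sum_mul, Complex.exp_sum]
      refine Finset.prod_congr rfl fun t ht => ?_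
      obtain ⟨k, hk⟩ := hCtop X hX n t ht
      have hk1 := hn t.1 (Finset.mem_product.1 ht).1 t.2
      change X.1 (C n t) ≤ 1 at hk1
      rw [hk] at hk1 ⊢
      have hk2 : k ≤ 1 := by exact_mod_cast hk1
      interval_cases k <;> simp [g]
  exact tendsto_nhds_unique ((hlim P hP).congr hYint) (hlim P' hP')

theorem IsDeterminantalLaw.integral_exp_integral_eq (hP : IsDeterminantalLaw m K P)
    (hP' : IsDeterminantalLaw m K P') (hK : IsPSDKernel K) (hm : Measurable fun x => K x x)
    (hfin : ∀ C, IsCompact C → meanCount m K C ≠ ∞) {f : E → ℝ} (hf : Continuous f)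
    (hfc : HasCompactSupport f) :
    ∫ X, Complex.exp ((∫ x, f x ∂X.1 : ℝ) * Complex.I) ∂(P : Measure (PointConfiguration E)) =
    ∫ X, Complex.exp ((∫ x, f x ∂X.1 : ℝ) * Complex.I) ∂(P' : Measure (PointConfiguration E)) := by
  classical
  let φ : ℕ → SimpleFunc E ℝ := SimpleFunc.approxOn f hf.measurable univ 0 (mem_univ _)
  have hφ0 : ∀ n x, x ∉ tsupport f → φ n x = 0 := by
    intro n x hx
    have := SimpleFunc.norm_approxOn_zero_le hf.measurable (s := univ) (mem_univ 0) x n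
    rw [image_eq_zero_of_notMem_tsupport hx, norm_zero, add_zero] at this
    exact norm_le_zero_iff.1 this
  have hsub : ∀ n, ∀ r ≠ 0, φ n ⁻¹' {r} ⊆ tsupport f := fun n r hr x hx => by
    by_contra h
    exact hr (by rw [← (show φ n x = r from hx), hφ0 n x h])
  have hlim : ∀ R : ProbabilityMeasure (PointConfiguration E), Tendsto (fun n =>
      ∫ X, Complex.exp (((φ n).integral X.1 : ℝ) * Complex.I)
        ∂(R : Measure (PointConfiguration E))) atTop
      (𝓝 (∫ X, Complex.exp ((∫ x, f x ∂X.1 : ℝ) * Complex.I)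
        ∂(R : Measure (PointConfiguration E)))) := by
    intro R
    refine tendsto_integral_of_dominated_convergence (fun _ => 1) (fun n => ?_)
      (integrable_const _) (fun n => ?_) ?_
    · simp only [SimpleFunc.integral_eq_sum_filter]
      refine Measurable.aestronglyMeasurable ?_
      refine Complex.measurable_exp.comp (Measurable.mul_const (Complex.measurable_ofReal.comp ?_) _)
      exact Finset.measurable_fun_sum _ fun r _ => (measurable_eval
        (SimpleFunc.measurableSet_preimage _ _)).ennreal_toReal.mul_const r
    · exact Eventually.of_forall fun X => (Complex.norm_exp_ofReal_mul_I _).le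
    · refine Eventually.of_forall fun X => ?_
      have h := tendsto_integral_approxOn_of_measurable (μ := X.1)
        (hf.integrable_of_hasCompactSupport hfc) hf.measurable (s := univ) (by simp)
        (mem_univ (0 : ℝ)) (integrable_zero _ _ _)
      exact ((Complex.continuous_exp.comp (by fun_prop : Continuous fun t : ℝ =>
        (t : ℂ) * Complex.I)).tendsto _).comp h
  refine tendsto_nhds_unique ((hlim P).congr fun n => ?_) (hlim P')
  simp only [SimpleFunc.integral_eq_sum_filter]
  refine hP.integral_exp_sum_eq hP' hK hm (fun r => φ n ⁻¹' {r})
    (fun r => SimpleFunc.measurableSet_preimage _ _) (fun r t hrt => ?_) _ (fun r hr => ?_)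
    fun r => r
  · exact Disjoint.preimage _ (by simpa using hrt)
  · exact ne_top_of_le_ne_top (hfin _ hfc)
      (lintegral_mono_set (hsub n r (Finset.mem_filter.1 hr).2))

/-- A law on the space of configurations is determined by its characteristic functional. -/
theorem eq_of_forall_integral_exp_eq (h : ∀ f : E → ℝ, Continuous f → HasCompactSupport f →
    ∫ X, Complex.exp ((∫ x, f x ∂X.1 : ℝ) * Complex.I) ∂(P : Measure (PointConfiguration E)) =
    ∫ X, Complex.exp ((∫ x, f x ∂X.1 : ℝ) * Complex.I) ∂(P' : Measure (PointConfiguration E))) :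
    P = P' := by
  obtain ⟨u, hu, hind⟩ := exists_countable_test_functions E
  set Φ : PointConfiguration E → ((ℕ × ℕ) ⊕ ℕ → ℝ) := fun X j => ∫ x, u j x ∂X.1 with hΦ
  have hΦm : Measurable Φ := hind.continuous.measurable
  have hfinite : ∀ I : Finset ((ℕ × ℕ) ⊕ ℕ),
      (P : Measure (PointConfiguration E)).map (fun X => I.restrict (Φ X)) =
      (P' : Measure (PointConfiguration E)).map (fun X => I.restrict (Φ X)) := by
    classical
    intro I
    have hm : Measurable fun X => I.restrict (Φ X) := (Finset.measurable_restrict I).comp hΦm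
    have := Measure.isProbabilityMeasure_map (μ := (P : Measure (PointConfiguration E)))
      hm.aemeasurable
    have := Measure.isProbabilityMeasure_map (μ := (P' : Measure (PointConfiguration E)))
      hm.aemeasurable
    refine Measure.ext_of_charFunDual (funext fun L => ?_)
    rw [charFunDual_apply, charFunDual_apply, integral_map hm.aemeasurable (by fun_prop),
      integral_map hm.aemeasurable (by fun_prop)]
    let f : E → ℝ := fun x => ∑ i : I, L (fun j => if i = j then 1 else 0) * u i x
    have hf : Continuous f := continuous_finsetSum _ fun i _ => (hu i).1.const_mul _
    have hfc : HasCompactSupport f := by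
      refine HasCompactSupport.intro (K := ⋃ i : I, tsupport (u i))
        (isCompact_iUnion fun i => (hu i).2) fun x hx => ?_
      refine Finset.sum_eq_zero fun i _ => ?_
      rw [image_eq_zero_of_notMem_tsupport fun h => hx (mem_iUnion.2 ⟨i, h⟩), mul_zero]
    have hL : ∀ X : PointConfiguration E, L (I.restrict (Φ X)) = ∫ x, f x ∂X.1 := by
      intro X
      have h1 : ∫ x, f x ∂X.1 = ∑ i : I, L (fun j => if i = j then 1 else 0) * ∫ x, u i x ∂X.1 := by
        have hi : ∀ i ∈ (Finset.univ : Finset I), Integrable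
            (fun x => L (fun j => if i = j then 1 else 0) * u i x) X.1 := fun i _ =>
          ((hu i).1.integrable_of_hasCompactSupport (hu i).2).const_mul _
        refine (integral_finsetSum _ hi).trans ?_
        simp only [integral_const_mul]
      rw [h1]
      refine ((L : (I → ℝ) →ₗ[ℝ] ℝ).pi_apply_eq_sum_univ _).trans ?_
      refine Finset.sum_congr rfl fun i _ => ?_
      rw [smul_eq_mul, mul_comm]
      rfl
    simp only [hL]
    exact h f hf hfc
  have hmap : (P : Measure (PointConfiguration E)).map Φ =
      (P' : Measure (PointConfiguration E)).map Φ :=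
    IsProjectiveLimit.unique (P := fun I =>
        (P : Measure (PointConfiguration E)).map (fun X => I.restrict (Φ X)))
      (fun I => by rw [Measure.map_map (Finset.measurable_restrict I) hΦm]; rfl)
      (fun I => by rw [Measure.map_map (Finset.measurable_restrict I) hΦm]; exact (hfinite I).symm)
  refine Subtype.ext (Measure.ext fun A hA => ?_)
  have hA' : MeasurableSet[MeasurableSpace.comap Φ (borel _)] A := by
    rw [← borel_comap, ← hind.eq_induced]
    exact hA
  obtain ⟨B, hB, rfl⟩ := hA'
  have hB' : MeasurableSet B := by rwa [BorelSpace.measurable_eq (α := (ℕ × ℕ) ⊕ ℕ → ℝ)]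
  change (P : Measure (PointConfiguration E)) _ = (P' : Measure (PointConfiguration E)) _
  rw [← Measure.map_apply hΦm hB', hmap, Measure.map_apply hΦm hB']

/-- A determinantal process is determined by its kernel. -/
theorem IsDeterminantalLaw.unique (hP : IsDeterminantalLaw m K P)
    (hP' : IsDeterminantalLaw m K P') (hK : IsPSDKernel K) (hm : Measurable fun x => K x x)
    (hfin : ∀ C, IsCompact C → meanCount m K C ≠ ∞) : P = P' :=
  eq_of_forall_integral_exp_eq fun _ hf hfc => hP.integral_exp_integral_eq hP' hK hm hfin hf hfc

end Uniqueness

/-! ### Moment measures -/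

section MomentMeasure

variable {E : Type*} [TopologicalSpace E] [LocallyCompactSpace E] [T2Space E] [MeasurableSpace E]
  [BorelSpace E] [SecondCountableTopology E]

theorem exists_seq_isCompact_of_isOpen {U : Set E} (hU : IsOpen U) :
    ∃ C : ℕ → Set E, (∀ j, IsCompact (C j)) ∧ (∀ j, C j ⊆ U) ∧ ∀ x ∈ U, ∀ᶠ j in atTop, x ∈ C j := by
  have : LocallyCompactSpace U := hU.locallyCompactSpace
  let D := CompactExhaustion.choice U
  refine ⟨fun j => Subtype.val '' D j, fun j => (D.isCompact j).image continuous_subtype_val,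
    fun j => by rintro _ ⟨y, -, rfl⟩; exact y.2, fun x hx => ?_⟩
  filter_upwards [eventually_ge_atTop (D.find ⟨x, hx⟩)] with j hj
  exact ⟨⟨x, hx⟩, D.subset hj (D.mem_find _), rfl⟩

theorem measurable_pi_pointConfiguration (k : ℕ) :
    Measurable fun X : PointConfiguration E => Measure.pi fun _ : Fin k => X.1 := by
  let D := CompactExhaustion.choice E
  have hD : ∀ n, MeasurableSet (D n) := fun n => (D.isCompact n).measurableSet
  have h1 : ∀ n, Measurable fun X : PointConfiguration E =>
      Measure.pi fun _ : Fin k => X.1.restrict (D n) := by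
    intro n
    have : ∀ X : PointConfiguration E, IsFiniteMeasure (X.1.restrict (D n)) := fun X =>
      ⟨by simpa using (D.isCompact n).measure_lt_top⟩
    refine Measurable.measure_of_isPiSystem generateFrom_pi.symm isPiSystem_pi ?_ ?_
    · rintro _ ⟨A, hA, rfl⟩
      simp only [Measure.pi_pi]
      refine Finset.measurable_fun_prod _ fun i _ => ?_
      have hAi : MeasurableSet (A i) := hA i (mem_univ i)
      simp only [Measure.restrict_apply hAi]
      exact measurable_eval (hAi.inter (hD n))
    · simp only [Measure.pi_univ, Measure.restrict_apply_univ]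
      exact Finset.measurable_fun_prod _ fun i _ => measurable_eval (hD n)
  refine Measure.measurable_of_measurable_coe _ fun B hB => ?_
  have h2 : ∀ X : PointConfiguration E, (Measure.pi fun _ : Fin k => X.1) B =
      ⨆ n, (Measure.pi fun _ : Fin k => X.1.restrict (D n)) B := by
    intro X
    have h3 : B = ⋃ n, B ∩ univ.pi fun _ : Fin k => D n := by
      rw [← inter_iUnion, eq_comm, inter_eq_left]
      intro x _
      refine mem_iUnion.2 ⟨Finset.univ.sup fun i => D.find (x i), fun i _ => ?_⟩
      exact D.subset (Finset.le_sup (f := fun i => D.find (x i)) (Finset.mem_univ i)) (D.mem_find _)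
    have h4 : Monotone fun n => B ∩ univ.pi fun _ : Fin k => D n := fun a b hab =>
      inter_subset_inter_right _ (pi_mono fun _ _ => D.subset hab)
    conv_lhs => rw [h3]
    rw [h4.measure_iUnion]
    refine iSup_congr fun n => ?_
    rw [← Measure.restrict_pi_pi, Measure.restrict_apply hB]
  simp_rw [h2]
  exact Measurable.iSup fun n => (Measure.measurable_coe hB).comp (h1 n)

/-- The `k`-th moment measure of a point process: the expectation of the `k`-fold product of the
configuration with itself. -/
noncomputable def momentMeasure (P : ProbabilityMeasure (PointConfiguration E)) (k : ℕ) :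
    Measure (Fin k → E) :=
  (P : Measure (PointConfiguration E)).bind fun X => Measure.pi fun _ => X.1

/-- The measure with density `det K(x i, x j)`. -/
noncomputable def corrMeasure (m : Measure E) (K : E → E → ℂ) (k : ℕ) : Measure (Fin k → E) :=
  (Measure.pi fun _ => m).withDensity fun x => ENNReal.ofReal (corr K x)

theorem lintegral_prod_momentMeasure (P : ProbabilityMeasure (PointConfiguration E)) {k : ℕ}
    {f : Fin k → E → ℝ≥0∞} (hf : ∀ i, Measurable (f i)) :
    ∫⁻ x, ∏ i, f i (x i) ∂(momentMeasure P k) =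
      ∫⁻ X, ∏ i, ∫⁻ x, f i x ∂X.1 ∂(P : Measure (PointConfiguration E)) := by
  have h : Measurable fun x : Fin k → E => ∏ i, f i (x i) :=
    Finset.measurable_fun_prod _ fun i _ => (hf i).comp (measurable_pi_apply i)
  refine (Measure.lintegral_bind (measurable_pi_pointConfiguration k).aemeasurable
    h.aemeasurable).trans ?_
  exact lintegral_congr fun X => lintegral_fin_prod_eq_prod (fun _ => X.1) f hf

theorem momentMeasure_pi (P : ProbabilityMeasure (PointConfiguration E)) {k : ℕ}
    {A : Fin k → Set E} (hA : ∀ i, MeasurableSet (A i)) :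
    momentMeasure P k (univ.pi A) = ∫⁻ X, ∏ i, X.1 (A i) ∂(P : Measure (PointConfiguration E)) := by
  rw [momentMeasure, Measure.bind_apply (MeasurableSet.univ_pi hA)
    (measurable_pi_pointConfiguration k).aemeasurable]
  simp only [Measure.pi_pi]

theorem corrMeasure_pi {m : Measure E} {K : E → E → ℂ} {k : ℕ}
    {A : Fin k → Set E} (hA : ∀ i, MeasurableSet (A i)) :
    corrMeasure m K k (univ.pi A) =
      ∫⁻ x in univ.pi A, ENNReal.ofReal (corr K x) ∂(Measure.pi fun _ => m) :=
  withDensity_apply _ (MeasurableSet.univ_pi hA)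

theorem measurable_corr {K : E → E → ℂ} (hK : Measurable (Function.uncurry K)) (k : ℕ) :
    Measurable fun x : Fin k → E => corr K x := by
  unfold corr
  refine Complex.measurable_re.comp ?_
  simp only [Matrix.det_apply]
  refine Finset.measurable_fun_sum _ fun σ _ => Measurable.const_smul ?_ _
  refine Finset.measurable_fun_prod _ fun i _ => ?_
  simp only [Matrix.of_apply]
  exact Measurable.comp (g := Function.uncurry K) (f := fun x : Fin k → E => (x (σ i), x i)) hK
    ((measurable_pi_apply _).prodMk (measurable_pi_apply _))

theorem lintegral_corrMeasure {m : Measure E} {K : E → E → ℂ} {k : ℕ}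
    (hK : Measurable (Function.uncurry K)) {f : (Fin k → E) → ℝ≥0∞} (hf : Measurable f) :
    ∫⁻ x, f x ∂(corrMeasure m K k) =
      ∫⁻ x, ENNReal.ofReal (corr K x) * f x ∂(Measure.pi fun _ => m) := by
  rw [corrMeasure, lintegral_withDensity_eq_lintegral_mul _
    (measurable_corr hK k).ennreal_ofReal hf]
  rfl

/-- Products of continuous cutoffs bound the measure of an open box from below, by Fatou's lemma. -/
theorem measure_pi_le_of_cutoff {k : ℕ} {μ ν : Measure (Fin k → E)} {U : Fin k → Set E}
    (hU : ∀ i, IsOpen (U i))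
    (h : ∀ f : Fin k → E → ℝ, (∀ i, Continuous (f i)) → (∀ i, HasCompactSupport (f i)) →
      (∀ i, tsupport (f i) ⊆ U i) → (∀ i x, 0 ≤ f i x ∧ f i x ≤ 1) →
      ∫⁻ x, ∏ i, ENNReal.ofReal (f i (x i)) ∂μ ≤ ∫⁻ x, ∏ i, ENNReal.ofReal (f i (x i)) ∂ν) :
    μ (univ.pi U) ≤ ν (univ.pi U) := by
  choose C hC hCU hCe using fun i => exists_seq_isCompact_of_isOpen (hU i)
  choose f hf hfc hfU hf1 hf01 using fun i j => exists_cutoff (hC i j) (hU i) (hCU i j)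
  have hbox : MeasurableSet (univ.pi U) := MeasurableSet.univ_pi fun i => (hU i).measurableSet
  have hFm : ∀ j, Measurable fun x : Fin k → E => ∏ i, ENNReal.ofReal (f i j (x i)) := fun j =>
    Finset.measurable_fun_prod _ fun i _ =>
      ((hf i j).measurable.comp (measurable_pi_apply i)).ennreal_ofReal
  calc μ (univ.pi U) = ∫⁻ x, (univ.pi U).indicator 1 x ∂μ := (lintegral_indicator_one hbox).symm
    _ ≤ ∫⁻ x, liminf (fun j => ∏ i, ENNReal.ofReal (f i j (x i))) atTop ∂μ := by
      refine lintegral_mono fun x => ?_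
      by_cases hx : x ∈ univ.pi U
      swap
      · rw [indicator_of_notMem hx]; exact zero_le
      rw [indicator_of_mem hx]
      refine le_liminf_of_le (by isBoundedDefault) ?_
      have h1 : ∀ᶠ j in atTop, ∀ i, x i ∈ C i j :=
        eventually_all.2 fun i => hCe i (x i) (hx i (mem_univ i))
      filter_upwards [h1] with j hj
      simp [hf1 _ j _ (hj _)]
    _ ≤ liminf (fun j => ∫⁻ x, ∏ i, ENNReal.ofReal (f i j (x i)) ∂μ) atTop :=
      lintegral_liminf_le hFm
    _ ≤ ν (univ.pi U) := by
      refine liminf_le_of_le (by isBoundedDefault) fun b hb => ?_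
      obtain ⟨j, hj⟩ := hb.exists
      refine hj.trans ((h (fun i => f i j) (fun i => hf i j) (fun i => hfc i j)
        (fun i => hfU i j) fun i => hf01 i j).trans ?_)
      rw [← lintegral_indicator_one hbox]
      refine lintegral_mono fun x => ?_
      by_cases hx : x ∈ univ.pi U
      · rw [indicator_of_mem hx]
        exact Finset.prod_le_one' fun i _ => by simpa using (hf01 i j (x i)).2
      · simp only [mem_univ_pi, not_forall] at hx
        obtain ⟨i, hi⟩ := hx
        rw [Finset.prod_eq_zero (Finset.mem_univ i)]
        · exact zero_le
        · rw [image_eq_zero_of_notMem_tsupport fun hh => hi (hfU i j hh), ENNReal.ofReal_zero]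

theorem restrict_pi_eq_of_isOpen {k : ℕ} {μ ν : Measure (Fin k → E)} {V : Fin k → Set E}
    (hV : ∀ i, IsOpen (V i)) (hfin : ν (univ.pi V) ≠ ∞)
    (h : ∀ U : Fin k → Set E, (∀ i, IsOpen (U i)) → (∀ i, U i ⊆ V i) →
      μ (univ.pi U) = ν (univ.pi U)) :
    μ.restrict (univ.pi V) = ν.restrict (univ.pi V) := by
  have hVV := h V hV fun _ => subset_rfl
  have : IsFiniteMeasure (μ.restrict (univ.pi V)) :=
    ⟨by rw [Measure.restrict_apply_univ, hVV]; exact hfin.lt_top⟩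
  refine ext_of_generate_finite (univ.pi '' univ.pi fun _ : Fin k => {s : Set E | IsOpen s}) ?_ ?_
    ?_ (by simpa using hVV)
  · refine (generateFrom_eq_pi (fun i => ?_) fun i => ?_).symm
    · exact (BorelSpace.measurable_eq (α := E)).symm
    · exact ⟨fun _ => univ, fun _ => isOpen_univ, iUnion_const _⟩
  · exact IsPiSystem.pi fun i => isPiSystem_isOpen
  · rintro _ ⟨U, hU, rfl⟩
    have hUm : MeasurableSet (univ.pi U) :=
      MeasurableSet.univ_pi fun i => (show IsOpen (U i) from hU i (mem_univ i)).measurableSet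
    rw [Measure.restrict_apply hUm, Measure.restrict_apply hUm, ← pi_inter_distrib]
    exact h _ (fun i => (hU i (mem_univ i)).inter (hV i)) fun i => inter_subset_right

/-- Measures that agree on boxes with disjoint small open sides agree on boxes with disjoint
measurable sides: tuples of distinct points are covered by countably many of the former. -/
theorem measure_pi_eq_of_restrict_eq {k : ℕ} {μ ν : Measure (Fin k → E)}
    (h : ∀ V : Fin k → Set E, (∀ i, IsOpen (V i)) → (∀ i, ∃ C, IsCompact C ∧ V i ⊆ C) →
      Pairwise (fun i j => Disjoint (V i) (V j)) →
      μ.restrict (univ.pi V) = ν.restrict (univ.pi V))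
    {A : Fin k → Set E} (hA : ∀ i, MeasurableSet (A i))
    (hd : Pairwise fun i j => Disjoint (A i) (A j)) : μ (univ.pi A) = ν (univ.pi A) := by
  let b := TopologicalSpace.countableBasis E
  have hb := TopologicalSpace.isBasis_countableBasis E
  have : Countable b := TopologicalSpace.countable_countableBasis E
  let I := {V : Fin k → b // (∀ i, ∃ C, IsCompact C ∧ (V i : Set E) ⊆ C) ∧
    Pairwise (fun i j => Disjoint (V i : Set E) (V j))}
  have hcov : univ.pi A ⊆ ⋃ V : I, univ.pi fun i => (V.1 i : Set E) := by
    intro x hx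
    have hinj : Function.Injective x := by
      intro i j hij
      by_contra hne
      exact Set.disjoint_left.1 (hd hne) (hx i (mem_univ i)) (hij ▸ hx j (mem_univ j))
    obtain ⟨W, hW, hWd⟩ := Set.Finite.t2_separation (finite_range x)
    have h1 : ∀ i, ∃ s ∈ b, x i ∈ s ∧ s ⊆ W (x i) ∧ ∃ C, IsCompact C ∧ s ⊆ C := by
      intro i
      obtain ⟨C, hC, hCx⟩ := exists_compact_mem_nhds (x i)
      obtain ⟨s, hs, hxs, hsub⟩ := hb.exists_subset_of_mem_open
        (show x i ∈ W (x i) ∩ interior C from ⟨(hW _).1, mem_interior_iff_mem_nhds.2 hCx⟩)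
        ((hW _).2.inter isOpen_interior)
      exact ⟨s, hs, hxs, hsub.trans inter_subset_left, C, hC,
        hsub.trans (inter_subset_right.trans interior_subset)⟩
    choose s hs hxs hsW hsC using h1
    refine mem_iUnion.2 ⟨⟨fun i => ⟨s i, hs i⟩, hsC, fun i j hij => ?_⟩, fun i _ => hxs i⟩
    exact (hWd (mem_range_self i) (mem_range_self j) (hinj.ne hij)).mono (hsW i) (hsW j)
  have h2 : μ.restrict (⋃ V : I, univ.pi fun i => (V.1 i : Set E)) =
      ν.restrict (⋃ V : I, univ.pi fun i => (V.1 i : Set E)) :=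
    Measure.restrict_iUnion_congr.2 fun V =>
      h _ (fun i => hb.isOpen (V.1 i).2) V.2.1 V.2.2
  have hbox := MeasurableSet.univ_pi hA
  have h3 := congrArg (fun ρ => ρ (univ.pi A)) h2
  simpa [Measure.restrict_apply hbox, inter_eq_left.2 hcov] using h3

variable {m : Measure E} {K : E → E → ℂ} {P : ProbabilityMeasure (PointConfiguration E)}

theorem meanCount_ne_top_of_isCompact [IsFiniteMeasureOnCompacts m] {M : ℝ} {C : Set E}
    (hC : IsCompact C) (hM : ∀ x ∈ C, (K x x).re ≤ M) : meanCount m K C ≠ ∞ := by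
  have h : meanCount m K C ≤ ENNReal.ofReal M * m C := by
    rw [meanCount, ← setLIntegral_const]
    exact setLIntegral_mono' hC.measurableSet fun x hx => ENNReal.ofReal_le_ofReal (hM x hx)
  exact ne_top_of_le_ne_top (ENNReal.mul_ne_top ENNReal.ofReal_ne_top hC.measure_ne_top) h

theorem meanCount_mono {A B : Set E} (h : A ⊆ B) : meanCount m K A ≤ meanCount m K B :=
  lintegral_mono_set h

theorem corrMeasure_pi_ne_top [SigmaFinite m] (hK : IsPSDKernel K)
    (hm : Measurable fun x => K x x) {k : ℕ} {A : Fin k → Set E} (hA : ∀ i, MeasurableSet (A i))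
    (hfin : ∀ i, meanCount m K (A i) ≠ ∞) : corrMeasure m K k (univ.pi A) ≠ ∞ := by
  rw [corrMeasure_pi hA]
  exact ne_top_of_le_ne_top (ENNReal.prod_ne_top fun i _ => hfin i) (hK.lintegral_corr_le hm A)

/-- The intensity identity integrated against products of functions supported in disjoint open
sets. -/
theorem IsDeterminantalLaw.lintegral_prod_lintegral [SigmaFinite m] (hP : IsDeterminantalLaw m K P)
    (hK : IsPSDKernel K) (hm : Measurable (Function.uncurry K)) {k : ℕ} {V : Fin k → Set E}
    (hV : ∀ i, IsOpen (V i)) (hfin : ∀ i, meanCount m K (V i) ≠ ∞)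
    (hd : Pairwise fun i j => Disjoint (V i) (V j)) {f : Fin k → E → ℝ≥0∞}
    (hf : ∀ i, Measurable (f i)) (hfV : ∀ i, ∀ x ∉ V i, f i x = 0) :
    ∫⁻ X, ∏ i, ∫⁻ x, f i x ∂X.1 ∂(P : Measure (PointConfiguration E)) =
      ∫⁻ x, ∏ i, f i (x i) ∂(corrMeasure m K k) := by
  have hmd : Measurable fun x => K x x := hm.comp (measurable_id.prodMk measurable_id)
  have h1 : (momentMeasure P k).restrict (univ.pi V) = (corrMeasure m K k).restrict (univ.pi V) := by
    refine restrict_pi_eq_of_isOpen hV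
      (corrMeasure_pi_ne_top hK hmd (fun i => (hV i).measurableSet) hfin) fun U hU hUV => ?_
    rw [momentMeasure_pi _ fun i => (hU i).measurableSet,
      corrMeasure_pi fun i => (hU i).measurableSet]
    exact hP.lintegral_prod_fin U (fun i => (hU i).measurableSet)
      fun i j hij => (hd hij).mono (hUV i) (hUV j)
  have hbox : MeasurableSet (univ.pi V) := MeasurableSet.univ_pi fun i => (hV i).measurableSet
  have h2 : ∀ μ : Measure (Fin k → E), ∫⁻ x, ∏ i, f i (x i) ∂μ =
      ∫⁻ x, ∏ i, f i (x i) ∂(μ.restrict (univ.pi V)) := by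
    intro μ
    rw [← lintegral_indicator hbox]
    refine lintegral_congr fun x => ?_
    by_cases hx : x ∈ univ.pi V
    · rw [indicator_of_mem hx]
    · rw [indicator_of_notMem hx]
      simp only [mem_univ_pi, not_forall] at hx
      obtain ⟨i, hi⟩ := hx
      exact Finset.prod_eq_zero (Finset.mem_univ i) (hfV i _ hi)
  rw [← lintegral_prod_momentMeasure P hf, h2, h1, ← h2]

end MomentMeasure

/-! ### Limits of determinantal processes -/

/-- Expectations of an unbounded continuous function pass to the limit under a uniform bound on
second moments. -/
theorem lintegral_eq_of_tendsto_of_lintegral_sq_le {Ω ι : Type*} [TopologicalSpace Ω]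
    [MeasurableSpace Ω] [OpensMeasurableSpace Ω] {F : Filter ι} [F.NeBot]
    {P : ι → ProbabilityMeasure Ω} {P₀ : ProbabilityMeasure Ω} (hP : Tendsto P F (𝓝 P₀))
    {Y : Ω → ℝ≥0} (hY : Continuous Y) {b : ℝ≥0∞} {B : ℝ≥0}
    (ha : Tendsto (fun i => ∫⁻ ω, Y ω ∂(P i : Measure Ω)) F (𝓝 b))
    (hB : ∀ i, ∫⁻ ω, (Y ω : ℝ≥0∞) ^ 2 ∂(P i : Measure Ω) ≤ B) :
    ∫⁻ ω, Y ω ∂(P₀ : Measure Ω) = b := by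
  rw [ProbabilityMeasure.tendsto_iff_forall_lintegral_tendsto] at hP
  have hYm : Measurable fun ω => (Y ω : ℝ≥0∞) := hY.measurable.coe_nnreal_ennreal
  have hlim : ∀ n : ℕ, Tendsto (fun i => ∫⁻ ω, ((min (Y ω) n : ℝ≥0) : ℝ≥0∞) ∂(P i : Measure Ω)) F
      (𝓝 (∫⁻ ω, ((min (Y ω) n : ℝ≥0) : ℝ≥0∞) ∂(P₀ : Measure Ω))) := by
    intro n
    let g : BoundedContinuousFunction Ω ℝ≥0 :=
      BoundedContinuousFunction.mkOfBound ⟨fun ω => min (Y ω) n, by fun_prop⟩ n (by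
        intro x y
        rw [NNReal.dist_eq, abs_le]
        have h1 : ((min (Y x) n : ℝ≥0) : ℝ) ≤ n := by exact_mod_cast min_le_right _ _
        have h2 : ((min (Y y) n : ℝ≥0) : ℝ) ≤ n := by exact_mod_cast min_le_right _ _
        constructor <;> simp only [ContinuousMap.coe_mk] <;>
          linarith [(min (Y x) n).coe_nonneg, (min (Y y) n).coe_nonneg])
    exact hP g
  apply le_antisymm
  · have h1 : ∀ ω, (Y ω : ℝ≥0∞) ≤ liminf (fun n : ℕ => ((min (Y ω) n : ℝ≥0) : ℝ≥0∞)) atTop := by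
      intro ω
      refine le_liminf_of_le (by isBoundedDefault) ?_
      obtain ⟨n, hn⟩ := exists_nat_ge (Y ω)
      filter_upwards [eventually_ge_atTop n] with k hk
      rw [min_eq_left (hn.trans (by exact_mod_cast hk))]
    refine (lintegral_mono h1).trans ((lintegral_liminf_le fun n => by fun_prop).trans ?_)
    refine liminf_le_of_le (by isBoundedDefault) fun c hc => ?_
    obtain ⟨n, hn⟩ := hc.exists
    refine hn.trans (le_of_tendsto_of_tendsto' (hlim n) ha fun i => lintegral_mono fun ω => ?_)
    exact ENNReal.coe_le_coe.2 (min_le_left _ _)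
  · have h1 : ∀ n : ℕ, b ≤ ∫⁻ ω, Y ω ∂(P₀ : Measure Ω) + B * ((n : ℝ≥0∞) + 1)⁻¹ := by
      intro n
      have h2 : ∀ i, ∫⁻ ω, Y ω ∂(P i : Measure Ω) ≤
          ∫⁻ ω, ((min (Y ω) (n + 1 : ℕ) : ℝ≥0) : ℝ≥0∞) ∂(P i : Measure Ω) +
            B * ((n : ℝ≥0∞) + 1)⁻¹ := by
        intro i
        have h3 : ∀ ω, (Y ω : ℝ≥0∞) ≤ ((min (Y ω) (n + 1 : ℕ) : ℝ≥0) : ℝ≥0∞) +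
            (Y ω : ℝ≥0∞) ^ 2 * ((n : ℝ≥0∞) + 1)⁻¹ := by
          intro ω
          rcases le_total (Y ω) (n + 1 : ℕ) with h | h
          · rw [min_eq_left h]; exact le_self_add
          · refine le_add_left ?_
            rw [← div_eq_mul_inv, ENNReal.le_div_iff_mul_le (Or.inl (by simp))
              (Or.inl (by finiteness)), sq]
            gcongr
            exact_mod_cast h
        refine (lintegral_mono h3).trans ?_
        rw [lintegral_add_left (by fun_prop), lintegral_mul_const _ (by fun_prop)]
        gcongr
        exact hB i
      refine (le_of_tendsto_of_tendsto' ha ((hlim (n + 1)).add_const _) h2).trans ?_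
      gcongr with ω
      exact min_le_left _ _
    have h4 : Tendsto (fun n : ℕ => ∫⁻ ω, Y ω ∂(P₀ : Measure Ω) + B * ((n : ℝ≥0∞) + 1)⁻¹) atTop
        (𝓝 (∫⁻ ω, Y ω ∂(P₀ : Measure Ω) + B * 0)) := by
      refine tendsto_const_nhds.add (ENNReal.Tendsto.const_mul ?_ (Or.inr ENNReal.coe_ne_top))
      have := (tendsto_add_atTop_iff_nat 1).2 ENNReal.tendsto_inv_nat_nhds_zero
      simpa using this
    rw [mul_zero, add_zero] at h4
    exact ge_of_tendsto' h4 h1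

section Limit

variable {E : Type*} [TopologicalSpace E] [LocallyCompactSpace E] [T2Space E] [MeasurableSpace E]
  [BorelSpace E] [SecondCountableTopology E]

instance instMetrizableSpacePointConfiguration :
    TopologicalSpace.MetrizableSpace (PointConfiguration E) := by
  obtain ⟨u, -, hu⟩ := exists_countable_test_functions E
  exact (⟨hu, hu.injective⟩ : IsEmbedding _).metrizableSpace

variable {m : Measure E} {K : E → E → ℂ} {P : ProbabilityMeasure (PointConfiguration E)}

theorem pow_le_factorial_mul_three_pow {t : ℝ} (ht : 0 ≤ t) (k : ℕ) :
    t ^ k ≤ k.factorial * (3 : ℝ) ^ t := by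
  have h1 := Real.pow_div_factorial_le_exp t ht k
  rw [div_le_iff₀ (by positivity)] at h1
  have h2 : Real.exp t ≤ 3 ^ t := by
    rw [← Real.exp_one_rpow]
    exact Real.rpow_le_rpow (Real.exp_pos 1).le (Real.exp_one_lt_d9.le.trans (by norm_num)) ht
  rw [mul_comm]
  exact h1.trans (by gcongr)

theorem IsDeterminantalLaw.lintegral_pow_le [SigmaFinite m] (hP : IsDeterminantalLaw m K P)
    (hK : IsPSDKernel K) (hm : Measurable fun x => K x x) {A : Set E} (hA : MeasurableSet A)
    (h : meanCount m K A ≠ ∞) (k : ℕ) :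
    ∫⁻ X, (X.1 A) ^ k ∂(P : Measure (PointConfiguration E)) ≤
      k.factorial * ENNReal.ofReal (Real.exp (2 * (meanCount m K A).toReal)) := by
  refine le_trans ?_ (mul_le_mul_right (hP.lintegral_three_pow_le hK hm hA h) _)
  rw [← lintegral_const_mul' _ _ (by simp)]
  refine lintegral_mono_ae ?_
  filter_upwards [hP.ae_ne_top hA h] with X hX
  have h1 := pow_le_factorial_mul_three_pow (ENNReal.toReal_nonneg (a := X.1 A)) k
  rw [← ENNReal.ofReal_toReal (ENNReal.pow_ne_top hX (n := k)), ENNReal.toReal_pow]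
  refine (ENNReal.ofReal_le_ofReal h1).trans (le_of_eq ?_)
  rw [ENNReal.ofReal_mul (by positivity), ENNReal.ofReal_natCast]

/-- The probability of finding two points in a set is at most the square of the mean count. -/
theorem IsDeterminantalLaw.measure_two_le [SigmaFinite m] (hP : IsDeterminantalLaw m K P)
    (hK : IsPSDKernel K) (hm : Measurable fun x => K x x) {A : Set E} (hA : MeasurableSet A)
    (h : meanCount m K A ≠ ∞) :
    (P : Measure (PointConfiguration E)) {X | 1 < X.1 A} ≤ meanCount m K A ^ 2 := by
  classical
  let C : (n : ℕ) → (Fin n → Bool) → Set E := fun n b => A ∩ cell E n b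
  have hC : ∀ n b, MeasurableSet (C n b) := fun n b => hA.inter (measurableSet_cell n b)
  have hd : ∀ n, Pairwise fun b c => Disjoint (C n b) (C n c) := fun n b c hbc =>
    (disjoint_cell n hbc).mono inter_subset_right inter_subset_right
  have hS : MeasurableSet {X : PointConfiguration E | 1 < X.1 A} :=
    measurableSet_lt measurable_const (measurable_eval hA)
  have hXm : ∀ n b, Measurable fun X : PointConfiguration E => X.1 (C n b) := fun n b =>
    measurable_eval (hC n b)
  have hGm : ∀ n, Measurable fun X : PointConfiguration E =>
      ∑ p ∈ (Finset.univ : Finset (Fin n → Bool)).offDiag, X.1 (C n p.1) * X.1 (C n p.2) :=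
    fun n => Finset.measurable_fun_sum _ fun p _ => (hXm n p.1).mul (hXm n p.2)
  calc (P : Measure (PointConfiguration E)) {X | 1 < X.1 A}
      = ∫⁻ X, {X : PointConfiguration E | 1 < X.1 A}.indicator 1 X
          ∂(P : Measure (PointConfiguration E)) := (lintegral_indicator_one hS).symm
    _ ≤ ∫⁻ X, liminf (fun n => ∑ p ∈ (Finset.univ : Finset (Fin n → Bool)).offDiag,
          X.1 (C n p.1) * X.1 (C n p.2)) atTop ∂(P : Measure (PointConfiguration E)) := by
      refine lintegral_mono_ae ?_
      filter_upwards [hP.simple, hP.ae_ne_top hA h] with X hX hXf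
      by_cases hX1 : X ∈ {X : PointConfiguration E | 1 < X.1 A}
      swap
      · rw [indicator_of_notMem hX1]; exact zero_le
      rw [indicator_of_mem hX1]
      refine le_liminf_of_le (by isBoundedDefault) ?_
      filter_upwards [eventually_measure_inter_cell_le_one X hX hA hXf] with n hn
      have hsum := sum_measure_inter_cell X.1 hA n
      -- Some cell contains a point, and the remaining cells contain the others.
      have h1 : ∃ b, X.1 (C n b) ≠ 0 := by
        by_contra! h0
        have h00 : X.1 A = 0 := by rw [← hsum]; exact Finset.sum_eq_zero fun b _ => h0 b
        exact absurd (show 1 < X.1 A from hX1) (by simp [h00])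
      obtain ⟨b, hb⟩ := h1
      have h2 : ∃ c, c ≠ b ∧ X.1 (C n c) ≠ 0 := by
        by_contra! h0
        have h00 : X.1 A = X.1 (C n b) := by
          rw [← hsum]
          exact Finset.sum_eq_single b (fun c _ hc => h0 c hc) (by simp)
        exact absurd (show 1 < X.1 A from hX1) (by rw [h00]; exact (hn b).not_gt)
      obtain ⟨c, hcb, hc⟩ := h2
      have hone : ∀ b, X.1 (C n b) ≠ 0 → 1 ≤ X.1 (C n b) := by
        intro b hb
        obtain ⟨k, hk⟩ := X.exists_eq_natCast (hC n b)
          (measure_ne_top_of_subset inter_subset_left hXf)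
        rw [hk] at hb ⊢
        exact_mod_cast Nat.one_le_iff_ne_zero.2 (by exact_mod_cast hb)
      calc (1 : ℝ≥0∞) ≤ X.1 (C n c) * X.1 (C n b) := by
            simpa using mul_le_mul' (hone c hc) (hone b hb)
        _ ≤ _ := Finset.single_le_sum
            (f := fun p : (Fin n → Bool) × (Fin n → Bool) => X.1 (C n p.1) * X.1 (C n p.2))
            (fun _ _ => zero_le) (a := (c, b)) (by simp [hcb])
    _ ≤ liminf (fun n => ∫⁻ X, ∑ p ∈ (Finset.univ : Finset (Fin n → Bool)).offDiag,
          X.1 (C n p.1) * X.1 (C n p.2) ∂(P : Measure (PointConfiguration E))) atTop :=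
      lintegral_liminf_le hGm
    _ ≤ meanCount m K A ^ 2 := by
      refine liminf_le_of_le (by isBoundedDefault) fun c hc => ?_
      obtain ⟨n, hn⟩ := hc.exists
      refine hn.trans ?_
      rw [lintegral_finsetSum _ fun p _ => (hXm n p.1).mul (hXm n p.2)]
      have h1 : meanCount m K A = ∑ b, meanCount m K (C n b) := by
        rw [meanCount, ← withDensity_apply _ hA, ← sum_measure_inter_cell _ hA n]
        exact Finset.sum_congr rfl fun b _ => withDensity_apply _ (hC n b)
      rw [h1, sq, Finset.sum_mul_sum, ← Finset.sum_product']
      refine (Finset.sum_le_sum fun p hp => ?_).trans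
        (Finset.sum_le_sum_of_subset (by intro p _; simp : _ ⊆ Finset.univ ×ˢ Finset.univ))
      have hne : p.1 ≠ p.2 := by simpa using hp
      have := hP.lintegral_prod_finset_le hK hm (C n) (hC n) (hd n) {p.1, p.2}
      simpa [Finset.prod_pair hne] using this

end Limit

section Limit

variable {E : Type*} [TopologicalSpace E] [LocallyCompactSpace E] [T2Space E] [MeasurableSpace E]
  [BorelSpace E] [SecondCountableTopology E]

/-- Pointwise convergence of kernels, with local uniform bounds on the diagonal. -/
structure KernelsConverge (Kn : ℕ → E → E → ℂ) (K : E → E → ℂ) : Prop where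
  psd : ∀ n, IsPSDKernel (Kn n)
  psd_lim : IsPSDKernel K
  measurable : ∀ n, Measurable (Function.uncurry (Kn n))
  tendsto : ∀ x y, Tendsto (fun n => Kn n x y) atTop (𝓝 (K x y))
  bound : ∀ C, IsCompact C → ∃ M : ℝ, ∀ n, ∀ x ∈ C, (Kn n x x).re ≤ M

variable {Kn : ℕ → E → E → ℂ} {K : E → E → ℂ}

theorem KernelsConverge.measurable_lim (h : KernelsConverge Kn K) :
    Measurable (Function.uncurry K) :=
  measurable_of_tendsto_metrizable h.measurable (tendsto_pi_nhds.2 fun p => h.tendsto p.1 p.2)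

theorem measurable_diag (h : Measurable (Function.uncurry K)) : Measurable fun x => K x x :=
  h.comp (measurable_id.prodMk measurable_id)

theorem KernelsConverge.bound_lim (h : KernelsConverge Kn K) {C : Set E} (hC : IsCompact C) :
    ∃ M : ℝ≥0, (∀ n, ∀ x ∈ C, (Kn n x x).re ≤ M) ∧ ∀ x ∈ C, (K x x).re ≤ M := by
  obtain ⟨M, hM⟩ := h.bound C hC
  refine ⟨M.toNNReal, fun n x hx => (hM n x hx).trans (Real.le_coe_toNNReal M), fun x hx => ?_⟩
  exact le_of_tendsto' (((Complex.continuous_re.tendsto _).comp (h.tendsto x x)))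
    fun n => (hM n x hx).trans (Real.le_coe_toNNReal M)

theorem KernelsConverge.tendsto_corr (h : KernelsConverge Kn K) {k : ℕ} (x : Fin k → E) :
    Tendsto (fun n => corr (Kn n) x) atTop (𝓝 (corr K x)) := by
  unfold corr
  refine (Complex.continuous_re.tendsto _).comp ?_
  simp only [Matrix.det_apply]
  refine tendsto_finsetSum _ fun σ _ => Tendsto.const_smul ?_ _
  exact tendsto_finsetProd _ fun i _ => h.tendsto _ _

theorem meanCount_le [IsFiniteMeasureOnCompacts m] {M : ℝ≥0} {A : Set E} (hA : MeasurableSet A)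
    (hM : ∀ x ∈ A, (K x x).re ≤ M) : meanCount m K A ≤ M * m A := by
  rw [meanCount, ← setLIntegral_const]
  refine setLIntegral_mono' hA fun x hx => ?_
  rw [← ENNReal.ofReal_coe_nnreal]
  exact ENNReal.ofReal_le_ofReal (hM x hx)

variable {m : Measure E} [IsLocallyFiniteMeasure m]
  {P : ℕ → ProbabilityMeasure (PointConfiguration E)} {P₀ : ProbabilityMeasure (PointConfiguration E)}

/-- Determinantal processes whose mean counts are locally bounded form a tight family. -/
theorem KernelsConverge.exists_limit (h : KernelsConverge Kn K)
    (hP : ∀ n, IsDeterminantalLaw m (Kn n) (P n)) (U : Ultrafilter ℕ) :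
    ∃ P₀, Tendsto P U (𝓝 P₀) := by
  let D := CompactExhaustion.choice E
  have hD : ∀ j, MeasurableSet (interior (D j)) := fun j => isOpen_interior.measurableSet
  choose M hM _ using fun j => h.bound_lim (D.isCompact j)
  have hfin : ∀ j, m (D j) ≠ ∞ := fun j => (D.isCompact j).measure_ne_top
  let c : ℕ → ℝ≥0 := fun j => M j * (m (D j)).toNNReal
  have hc : ∀ n j, ∫⁻ X, X.1 (interior (D j)) ∂(P n : Measure (PointConfiguration E)) ≤ c j := by
    intro n j
    rw [(hP n).lintegral_eval (hD j)]
    refine (meanCount_le (hD j) fun x hx => hM j n x (interior_subset hx)).trans ?_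
    rw [ENNReal.coe_mul, ENNReal.coe_toNNReal (hfin j)]
    gcongr
    exact interior_subset
  let t : ℕ → ℕ → ℝ≥0 := fun k j => (c j + 1) * 2 ^ (k + j + 1)
  let S : ℕ → Set (PointConfiguration E) := fun k => {X | ∀ j, X.1 (interior (D j)) ≤ t k j}
  let u : ℕ → ℝ≥0 := fun k => (2⁻¹) ^ k
  have hu : Tendsto u atTop (𝓝 0) := NNReal.tendsto_pow_atTop_nhds_zero_of_lt_one (by
    rw [inv_lt_one₀ (by norm_num)]; norm_num)
  have hcpt := isCompact_setOfPred_probabilityMeasure_mass_eq_compl_isCompact_le hu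
    (fun k => isCompact_setOf_measure_interior_le D (t k) : ∀ k, IsCompact (S k))
    (Or.inl inferInstance)
  obtain ⟨P₀, -, h0⟩ := hcpt.ultrafilter_le_nhds (U.map P) (by
    rw [le_principal_iff]
    refine Eventually.of_forall (f := (U : Filter ℕ)) fun n k => ?_
    rw [← ENNReal.coe_le_coe, ProbabilityMeasure.ennreal_coeFn_eq_coeFn_toMeasure]
    have hsub : (S k)ᶜ ⊆ ⋃ j, {X : PointConfiguration E | (t k j : ℝ≥0∞) ≤ X.1 (interior (D j))} := by
      intro X hX
      have hX' : ¬ ∀ j, X.1 (interior (D j)) ≤ t k j := hX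
      push Not at hX'
      obtain ⟨j, hj⟩ := hX'
      exact mem_iUnion.2 ⟨j, hj.le⟩
    refine (measure_mono hsub).trans ((measure_iUnion_le _).trans ?_)
    have hb : ∀ j, (P n : Measure (PointConfiguration E))
        {X : PointConfiguration E | (t k j : ℝ≥0∞) ≤ X.1 (interior (D j))} ≤
        (u k : ℝ≥0∞) * (2⁻¹) ^ (j + 1) := by
      intro j
      have h1 := mul_meas_ge_le_lintegral (μ := (P n : Measure (PointConfiguration E)))
        (measurable_eval (hD j)) (t k j)
      have ht0 : (t k j : ℝ≥0∞) ≠ 0 := by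
        simp only [t, ne_eq, ENNReal.coe_eq_zero]; positivity
      have h2 := (ENNReal.mul_le_iff_le_inv ht0 ENNReal.coe_ne_top).1 (h1.trans (hc n j))
      refine h2.trans ?_
      rw [← ENNReal.coe_inv (by simpa using ht0), ← ENNReal.coe_mul]
      have h3 : (2⁻¹ : ℝ≥0∞) = ((2⁻¹ : ℝ≥0) : ℝ≥0∞) := by
        rw [ENNReal.coe_inv (by norm_num)]; simp
      rw [h3, ← ENNReal.coe_pow, ← ENNReal.coe_mul, ENNReal.coe_le_coe]
      simp only [t, u]
      rw [mul_inv, ← pow_add, inv_pow, ← add_assoc, mul_right_comm]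
      refine mul_le_of_le_one_left (zero_le) ?_
      rw [inv_mul_le_one₀ (by positivity)]
      exact le_self_add
    refine (ENNReal.tsum_le_tsum hb).trans ?_
    rw [ENNReal.tsum_mul_left, ENNReal.tsum_geometric_add_one, ENNReal.one_sub_inv_two,
      inv_inv, ENNReal.inv_mul_cancel (by simp) (by simp), mul_one])
  exact ⟨P₀, h0⟩

/-- Moments against products of functions with disjoint compact supports pass to the limit. -/
theorem KernelsConverge.lintegral_prod_lintegral (h : KernelsConverge Kn K)
    (hP : ∀ n, IsDeterminantalLaw m (Kn n) (P n)) {F : Filter ℕ} [F.NeBot] (hF : F ≤ atTop)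
    (hlim : Tendsto P F (𝓝 P₀)) {k : ℕ} {f : Fin k → E → ℝ} (hf : ∀ i, Continuous (f i))
    (hfc : ∀ i, HasCompactSupport (f i)) (hf01 : ∀ i x, 0 ≤ f i x ∧ f i x ≤ 1)
    {V : Fin k → Set E} (hV : ∀ i, IsOpen (V i)) (hVc : ∀ i, ∃ C, IsCompact C ∧ V i ⊆ C)
    (hd : Pairwise fun i j => Disjoint (V i) (V j)) (hfV : ∀ i, tsupport (f i) ⊆ V i) :
    ∫⁻ x, ∏ i, ENNReal.ofReal (f i (x i)) ∂(momentMeasure P₀ k) =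
      ∫⁻ x, ∏ i, ENNReal.ofReal (f i (x i)) ∂(corrMeasure m K k) := by
  have hfm : ∀ i, Measurable fun x => ENNReal.ofReal (f i x) := fun i =>
    (hf i).measurable.ennreal_ofReal
  choose C hC hVC using hVc
  have hU : IsCompact (⋃ i, C i) := isCompact_iUnion hC
  obtain ⟨M, hM, -⟩ := h.bound_lim hU
  have hmC : m (⋃ i, C i) ≠ ∞ := hU.measure_ne_top
  have hmean : ∀ n, meanCount m (Kn n) (⋃ i, C i) ≤ M * m (⋃ i, C i) := fun n =>
    meanCount_le hU.measurableSet (hM n)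
  have hmeanf : ∀ n, meanCount m (Kn n) (⋃ i, C i) ≠ ∞ := fun n =>
    ne_top_of_le_ne_top (ENNReal.mul_ne_top ENNReal.coe_ne_top hmC) (hmean n)
  have hVU : ∀ i, V i ⊆ ⋃ i, C i := fun i => (hVC i).trans (subset_iUnion C i)
  have hzero : ∀ i, ∀ x ∉ V i, f i x = 0 := fun i x hx =>
    image_eq_zero_of_notMem_tsupport fun hh => hx (hfV i hh)
  -- The product of the linear statistics, as a continuous function of the configuration.
  let Y : PointConfiguration E → ℝ≥0 := fun X => ∏ i, (∫ x, f i x ∂X.1).toNNReal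
  have hY : Continuous Y := continuous_finsetProd _ fun i _ =>
    continuous_real_toNNReal.comp (continuous_integral_pointConfiguration (hf i) (hfc i))
  have hYe : ∀ X, (Y X : ℝ≥0∞) = ∏ i, ∫⁻ x, ENNReal.ofReal (f i x) ∂X.1 := by
    intro X
    simp only [Y, ENNReal.ofNNReal_finsetProd]
    refine Finset.prod_congr rfl fun i _ => ?_
    exact ofReal_integral_eq_lintegral_ofReal ((hf i).integrable_of_hasCompactSupport (hfc i))
      (Eventually.of_forall fun x => (hf01 i x).1)
  have hYle : ∀ X, (Y X : ℝ≥0∞) ≤ X.1 (⋃ i, C i) ^ k := by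
    intro X
    rw [hYe]
    refine (Finset.prod_le_pow_card _ _ (X.1 (⋃ i, C i)) fun i _ => ?_).trans (by simp)
    rw [← lintegral_indicator_one hU.measurableSet]
    refine lintegral_mono fun x => ?_
    by_cases hx : x ∈ ⋃ i, C i
    · rw [indicator_of_mem hx]; simpa using (hf01 i x).2
    · rw [hzero i x fun hh => hx (hVU i hh)]; simp
  let B : ℝ≥0 := (k * 2).factorial * (Real.exp (2 * (M * m (⋃ i, C i)).toReal)).toNNReal
  have hB : ∀ n, ∫⁻ X, (Y X : ℝ≥0∞) ^ 2 ∂(P n : Measure (PointConfiguration E)) ≤ B := by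
    intro n
    refine (lintegral_mono fun X => pow_le_pow_left' (hYle X) 2).trans ?_
    simp only [← pow_mul]
    refine ((hP n).lintegral_pow_le (h.psd n) (measurable_diag (h.measurable n)) hU.measurableSet
      (hmeanf n) (k * 2)).trans ?_
    simp only [B, ENNReal.coe_mul, ENNReal.coe_natCast]
    gcongr
    refine ENNReal.ofReal_le_ofReal (Real.exp_le_exp.2 ?_)
    gcongr
    · exact ENNReal.mul_ne_top ENNReal.coe_ne_top hmC
    · exact hmean n
  have hlimY : Tendsto (fun n => ∫⁻ X, Y X ∂(P n : Measure (PointConfiguration E))) F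
      (𝓝 (∫⁻ x, ∏ i, ENNReal.ofReal (f i (x i)) ∂(corrMeasure m K k))) := by
    have h1 : ∀ n, ∫⁻ X, Y X ∂(P n : Measure (PointConfiguration E)) =
        ∫⁻ x, ENNReal.ofReal (corr (Kn n) x) * ∏ i, ENNReal.ofReal (f i (x i))
          ∂(Measure.pi fun _ => m) := by
      intro n
      simp_rw [hYe]
      rw [(hP n).lintegral_prod_lintegral (h.psd n) (h.measurable n) hV
        (fun i => ne_top_of_le_ne_top (hmeanf n) (meanCount_mono (hVU i))) hd hfm
        (fun i x hx => by rw [hzero i x hx, ENNReal.ofReal_zero]),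
        lintegral_corrMeasure (h.measurable n)]
      exact Finset.measurable_fun_prod _ fun i _ => (hfm i).comp (measurable_pi_apply i)
    have hpm : Measurable fun x : Fin k → E => ∏ i, ENNReal.ofReal (f i (x i)) :=
      Finset.measurable_fun_prod _ fun i _ => (hfm i).comp (measurable_pi_apply i)
    simp_rw [h1]
    rw [lintegral_corrMeasure h.measurable_lim hpm]
    refine Tendsto.mono_left ?_ hF
    refine tendsto_lintegral_of_dominated_convergence
      ((univ.pi fun _ : Fin k => ⋃ i, C i).indicator fun _ => (M : ℝ≥0∞) ^ k)
      (fun n => (measurable_corr (h.measurable n) k).ennreal_ofReal.mul hpm)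
      (fun n => Eventually.of_forall fun x => ?_) ?_ (Eventually.of_forall fun x => ?_)
    · by_cases hx : x ∈ univ.pi fun _ : Fin k => ⋃ i, C i
      · rw [indicator_of_mem hx]
        refine (mul_le_mul' (ENNReal.ofReal_le_ofReal ((h.psd n).corr_le_prod x))
          (Finset.prod_le_one' fun i _ => by simpa using (hf01 i (x i)).2)).trans ?_
        rw [mul_one, ENNReal.ofReal_prod_of_nonneg fun i _ =>
          (Complex.nonneg_iff.1 ((h.psd n).diag_nonneg _)).1]
        refine (Finset.prod_le_pow_card _ _ (M : ℝ≥0∞) fun i _ => ?_).trans (by simp)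
        rw [← ENNReal.ofReal_coe_nnreal]
        exact ENNReal.ofReal_le_ofReal (hM n _ (hx i (mem_univ i)))
      · rw [indicator_of_notMem hx]
        simp only [mem_univ_pi, not_forall] at hx
        obtain ⟨i, hi⟩ := hx
        beta_reduce
        rw [Finset.prod_eq_zero (Finset.mem_univ i), mul_zero]
        rw [hzero i _ fun hh => hi (hVU i hh), ENNReal.ofReal_zero]
    · rw [lintegral_indicator_const (MeasurableSet.univ_pi fun _ => hU.measurableSet),
        Measure.pi_pi]
      exact ENNReal.mul_ne_top (ENNReal.pow_ne_top ENNReal.coe_ne_top)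
        (ENNReal.prod_ne_top fun _ _ => hmC)
    · refine ENNReal.Tendsto.mul_const ?_ (Or.inr ?_)
      · exact (ENNReal.continuous_ofReal.tendsto _).comp (h.tendsto_corr x)
      · exact ENNReal.prod_ne_top fun _ _ => ENNReal.ofReal_ne_top
  have h2 := lintegral_eq_of_tendsto_of_lintegral_sq_le hlim hY hlimY hB
  rw [lintegral_prod_momentMeasure P₀ hfm, ← h2]
  exact lintegral_congr fun X => (hYe X).symm

theorem KernelsConverge.lintegral_prod_eq (h : KernelsConverge Kn K)
    (hP : ∀ n, IsDeterminantalLaw m (Kn n) (P n)) {F : Filter ℕ} [F.NeBot] (hF : F ≤ atTop)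
    (hlim : Tendsto P F (𝓝 P₀)) {k : ℕ} {A : Fin k → Set E} (hA : ∀ i, MeasurableSet (A i))
    (hd : Pairwise fun i j => Disjoint (A i) (A j)) :
    ∫⁻ X, ∏ i, X.1 (A i) ∂(P₀ : Measure (PointConfiguration E)) =
      ∫⁻ x in univ.pi A, ENNReal.ofReal (corr K x) ∂(Measure.pi fun _ => m) := by
  rw [← momentMeasure_pi P₀ hA, ← corrMeasure_pi hA]
  refine measure_pi_eq_of_restrict_eq (fun V hV hVc hVd => ?_) hA hd
  refine restrict_pi_eq_of_isOpen hV ?_ fun U hU hUV => ?_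
  · refine corrMeasure_pi_ne_top h.psd_lim (measurable_diag h.measurable_lim)
      (fun i => (hV i).measurableSet) fun i => ?_
    obtain ⟨C, hC, hVC⟩ := hVc i
    obtain ⟨M, -, hM⟩ := h.bound_lim hC
    exact ne_top_of_le_ne_top (meanCount_ne_top_of_isCompact hC hM) (meanCount_mono hVC)
  · have key := fun (f : Fin k → E → ℝ) (hf : ∀ i, Continuous (f i))
      (hfc : ∀ i, HasCompactSupport (f i)) (hfU : ∀ i, tsupport (f i) ⊆ U i)
      (hf01 : ∀ i x, 0 ≤ f i x ∧ f i x ≤ 1) =>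
      h.lintegral_prod_lintegral hP hF hlim hf hfc hf01 hV hVc hVd fun i => (hfU i).trans (hUV i)
    exact le_antisymm
      (measure_pi_le_of_cutoff hU fun f hf hfc hfU hf01 => (key f hf hfc hfU hf01).le)
      (measure_pi_le_of_cutoff hU fun f hf hfc hfU hf01 => (key f hf hfc hfU hf01).ge)

/-- A compact set can be covered by finitely many open sets of small measure whose measures have a
bounded sum. -/
theorem exists_finite_open_cover [NullSingletonClass m] {D L : Set E} (hD : IsCompact D)
    (hDL : D ⊆ interior L) {ε : ℝ≥0} (hε : 0 < ε) :
    ∃ (N : ℕ) (V : Fin N → Set E), (∀ i, IsOpen (V i)) ∧ (∀ i, V i ⊆ L) ∧ D ⊆ ⋃ i, V i ∧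
      (∀ i, m (V i) ≤ ε) ∧ ∑ i, m (V i) ≤ m L + 1 := by
  have h1 : ∀ x : E, ∃ W, x ∈ W ∧ IsOpen W ∧ m W < ε := by
    intro x
    obtain ⟨W, hW, hWo, hWm⟩ := Set.exists_isOpen_lt_of_lt (μ := m) {x} ε (by simpa using hε)
    exact ⟨W, hW rfl, hWo, hWm⟩
  choose W hxW hWo hWm using h1
  obtain ⟨s, hs⟩ := hD.elim_finite_subcover W hWo fun x _ => mem_iUnion.2 ⟨x, hxW x⟩
  let e := s.equivFin.symm
  let A : Fin s.card → Set E := fun i => W (e i) ∩ interior L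
  have hAo : ∀ i, IsOpen (A i) := fun i => (hWo _).inter isOpen_interior
  have hAm : ∀ i, MeasurableSet (disjointed A i) := fun i =>
    disjointedRec (fun _ _ ht => ht.diff (hAo _).measurableSet) (hAo i).measurableSet
  have h2 : ∀ i, ∃ V, disjointed A i ⊆ V ∧ IsOpen V ∧
      m V ≤ m (disjointed A i) + (s.card : ℝ≥0∞)⁻¹ := by
    intro i
    have hlt : m (disjointed A i) < m (disjointed A i) + (s.card : ℝ≥0∞)⁻¹ := by
      refine ENNReal.lt_add_right (ne_top_of_le_ne_top ENNReal.coe_ne_top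
        ((measure_mono ((disjointed_subset A i).trans inter_subset_left)).trans (hWm (e i)).le)) ?_
      simp
    obtain ⟨V, hV, hVo, hVm⟩ := Set.exists_isOpen_lt_of_lt _ _ hlt
    exact ⟨V, hV, hVo, hVm.le⟩
  choose V hAV hVo hVm using h2
  refine ⟨s.card, fun i => V i ∩ A i, fun i => (hVo i).inter (hAo i), fun i =>
    inter_subset_right.trans (inter_subset_right.trans interior_subset), ?_, fun i =>
    (measure_mono (inter_subset_right.trans inter_subset_left)).trans (hWm _).le, ?_⟩
  · have h3 : D ⊆ ⋃ i, A i := by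
      intro x hx
      obtain ⟨y, hy, hxy⟩ := mem_iUnion₂.1 (hs hx)
      exact mem_iUnion.2 ⟨e.symm ⟨y, hy⟩, by simpa [A] using ⟨hxy, hDL hx⟩⟩
    rw [← iUnion_disjointed] at h3
    exact h3.trans (iUnion_mono fun i => subset_inter (hAV i) (disjointed_subset A i))
  · calc ∑ i, m (V i ∩ A i) ≤ ∑ i, (m (disjointed A i) + (s.card : ℝ≥0∞)⁻¹) :=
          Finset.sum_le_sum fun i _ => (measure_mono inter_subset_left).trans (hVm i)
      _ = m (⋃ i, disjointed A i) + s.card * (s.card : ℝ≥0∞)⁻¹ := by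
          rw [Finset.sum_add_distrib, measure_iUnion (disjoint_disjointed A) hAm, tsum_fintype]
          simp
      _ ≤ m L + 1 := by
          gcongr
          · rw [iUnion_disjointed]
            exact iUnion_subset fun i => inter_subset_right.trans interior_subset
          · exact ENNReal.mul_inv_le_one _

/-- A limit of determinantal processes has no multiple points. -/
theorem KernelsConverge.ae_simple [NullSingletonClass m] (h : KernelsConverge Kn K)
    (hP : ∀ n, IsDeterminantalLaw m (Kn n) (P n)) {F : Filter ℕ} [F.NeBot]
    (hlim : Tendsto P F (𝓝 P₀)) :
    ∀ᵐ X ∂(P₀ : Measure (PointConfiguration E)), ∀ x, X.1 {x} ≤ 1 := by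
  let D := CompactExhaustion.choice E
  have hD : ∀ j, (P₀ : Measure (PointConfiguration E)) {X | ∃ x ∈ D j, 1 < X.1 {x}} = 0 := by
    intro j
    obtain ⟨M, hM, -⟩ := h.bound_lim (D.isCompact (j + 1))
    have hmL : m (D (j + 1)) ≠ ∞ := (D.isCompact (j + 1)).measure_ne_top
    have hb : ∀ ε : ℝ≥0, 0 < ε → (P₀ : Measure (PointConfiguration E))
        {X | ∃ x ∈ D j, 1 < X.1 {x}} ≤ ε * ((M : ℝ≥0∞) ^ 2 * (m (D (j + 1)) + 1)) := by
      intro ε hε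
      obtain ⟨N, V, hVo, hVL, hcov, hVε, hVs⟩ := exists_finite_open_cover (m := m)
        (D.isCompact j) (D.subset_interior_succ j) hε
      have hsub : {X : PointConfiguration E | ∃ x ∈ D j, 1 < X.1 {x}} ⊆
          ⋃ i, {X : PointConfiguration E | 1 < X.1 (V i)} := by
        rintro X ⟨x, hx, hXx⟩
        obtain ⟨i, hi⟩ := mem_iUnion.1 (hcov hx)
        exact mem_iUnion.2 ⟨i, hXx.trans_le (measure_mono (singleton_subset_iff.2 hi))⟩
      have hone : ∀ i, (P₀ : Measure (PointConfiguration E))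
          {X : PointConfiguration E | 1 < X.1 (V i)} ≤ ε * ((M : ℝ≥0∞) ^ 2 * m (V i)) := by
        intro i
        have hopen : IsOpen {X : PointConfiguration E | 1 < X.1 (V i)} :=
          (lowerSemicontinuous_measure_of_isOpen (hVo i)).isOpen_preimage 1
        refine (ProbabilityMeasure.le_liminf_measure_open_of_tendsto hlim hopen).trans ?_
        refine liminf_le_of_le (by isBoundedDefault) fun c hc => ?_
        obtain ⟨n, hn⟩ := hc.exists
        have hmc : meanCount m (Kn n) (V i) ≤ M * m (V i) :=
          meanCount_le (hVo i).measurableSet fun x hx => hM n x (hVL i hx)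
        refine hn.trans (((hP n).measure_two_le (h.psd n) (measurable_diag (h.measurable n))
          (hVo i).measurableSet (ne_top_of_le_ne_top (ENNReal.mul_ne_top ENNReal.coe_ne_top
            (measure_ne_top_of_subset (hVL i) hmL)) hmc)).trans ?_)
        calc meanCount m (Kn n) (V i) ^ 2 ≤ (M * m (V i)) ^ 2 := by gcongr
          _ = m (V i) * ((M : ℝ≥0∞) ^ 2 * m (V i)) := by ring
          _ ≤ _ := by gcongr; exact hVε i
      calc _ ≤ _ := measure_mono hsub
        _ ≤ ∑ i, (P₀ : Measure (PointConfiguration E))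
            {X : PointConfiguration E | 1 < X.1 (V i)} := measure_iUnion_fintype_le _ _
        _ ≤ ∑ i, ε * ((M : ℝ≥0∞) ^ 2 * m (V i)) := Finset.sum_le_sum fun i _ => hone i
        _ ≤ _ := by
          rw [← Finset.mul_sum, ← Finset.mul_sum]
          gcongr
    have hfin : (M : ℝ≥0∞) ^ 2 * (m (D (j + 1)) + 1) ≠ ∞ :=
      ENNReal.mul_ne_top (ENNReal.pow_ne_top ENNReal.coe_ne_top) (by finiteness)
    have ht : Tendsto (fun n : ℕ => (((n : ℝ≥0) + 1)⁻¹ : ℝ≥0) *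
        ((M : ℝ≥0∞) ^ 2 * (m (D (j + 1)) + 1))) atTop (𝓝 0) := by
      rw [← zero_mul ((M : ℝ≥0∞) ^ 2 * (m (D (j + 1)) + 1))]
      refine ENNReal.Tendsto.mul_const ?_ (Or.inr hfin)
      rw [← ENNReal.coe_zero, ENNReal.tendsto_coe]
      have := tendsto_one_div_add_atTop_nhds_zero_nat (𝕜 := ℝ≥0)
      simpa using this
    exact le_antisymm (ge_of_tendsto' ht fun n => hb _ (by positivity)) zero_le
  have h2 : ∀ᵐ X ∂(P₀ : Measure (PointConfiguration E)), ∀ j, ¬ ∃ x ∈ D j, 1 < X.1 {x} :=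
    ae_all_iff.2 fun j => by simpa [ae_iff] using hD j
  filter_upwards [h2] with X hX x
  by_contra hx
  exact hX (D.find x) ⟨x, D.mem_find x, not_le.1 hx⟩

/-- Determinantal processes whose kernels converge are relatively compact, and every limit law is
determinantal with the limit kernel. -/
theorem KernelsConverge.exists_isDeterminantalLaw [NullSingletonClass m] (h : KernelsConverge Kn K)
    (hP : ∀ n, IsDeterminantalLaw m (Kn n) (P n)) (U : Ultrafilter ℕ) (hU : (U : Filter ℕ) ≤ atTop) :
    ∃ P₀, IsDeterminantalLaw m K P₀ ∧ Tendsto P U (𝓝 P₀) := by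
  obtain ⟨P₀, h0⟩ := h.exists_limit hP U
  exact ⟨P₀, ⟨h.ae_simple hP h0, fun k x => h.psd_lim.det_nonneg x, fun k A hA hd =>
    h.lintegral_prod_eq hP hU h0 hA hd⟩, h0⟩

end Limit

/-! ### Determinantal processes of finite rank -/

section FiniteRank

variable {E : Type*} [TopologicalSpace E] [LocallyCompactSpace E] [T2Space E] [MeasurableSpace E]
  [BorelSpace E] [SecondCountableTopology E]

/-- The configuration consisting of the entries of a tuple. -/
noncomputable def tupleConfiguration {N : ℕ} (x : Fin N → E) : PointConfiguration E :=
  ⟨∑ i, Measure.dirac (x i), inferInstance, fun A hA => by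
    classical
    refine ⟨∑ i, if x i ∈ A then 1 else 0, ?_⟩
    simp only [Measure.coe_finsetSum, Finset.sum_apply, Measure.dirac_apply' _ hA,
      Finset.sum_boole]
    simp [indicator_apply]⟩

theorem tupleConfiguration_apply {N : ℕ} (x : Fin N → E) {A : Set E} (hA : MeasurableSet A) :
    (tupleConfiguration x).1 A = ∑ i, A.indicator 1 (x i) := by
  simp only [tupleConfiguration, Measure.coe_finsetSum, Finset.sum_apply,
    Measure.dirac_apply' _ hA]

theorem continuous_tupleConfiguration (N : ℕ) :
    Continuous fun x : Fin N → E => tupleConfiguration x := by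
  refine continuous_pointConfiguration_iff.2 fun f hf hfc => ?_
  have h : ∀ x : Fin N → E, ∫ t, f t ∂(tupleConfiguration x).1 = ∑ i, f (x i) := by
    intro x
    simp only [tupleConfiguration]
    rw [integral_finsetSum_measure fun i _ => hf.integrable_of_hasCompactSupport hfc]
    simp
  simp_rw [h]
  fun_prop

/-- Configurations without multiple points form a Borel set. -/
theorem measurableSet_simple : MeasurableSet {X : PointConfiguration E | ∀ x, X.1 {x} ≤ 1} := by
  let D := CompactExhaustion.choice E
  have h : {X : PointConfiguration E | ∀ x, X.1 {x} ≤ 1} =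
      ⋂ j, ⋃ n, ⋂ b, {X : PointConfiguration E | X.1 (D j ∩ cell E n b) ≤ 1} := by
    ext X
    simp only [mem_iInter, mem_iUnion, mem_ofPred_eq]
    constructor
    · intro hX j
      exact (eventually_measure_inter_cell_le_one X hX (D.isCompact j).measurableSet
        (D.isCompact j).measure_ne_top).exists
    · intro hX x
      obtain ⟨n, hn⟩ := hX (D.find x)
      refine (measure_mono (singleton_subset_iff.2 ?_)).trans
        (hn fun i => MeasurableSpace.mapNatBool E x i)
      exact ⟨D.mem_find x, fun i => rfl⟩
  rw [h]
  exact MeasurableSet.iInter fun j => MeasurableSet.iUnion fun n => MeasurableSet.iInter fun b =>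
    measurableSet_le (measurable_eval ((D.isCompact j).measurableSet.inter
      (measurableSet_cell n b))) measurable_const

/-- A kernel with the reproducing property `∫ K(b,y) K(y,a) dm(y) = K(b,a)` and trace `N`: the
kernel of an orthogonal projection of rank `N`. -/
structure IsProjectionKernel (m : Measure E) (K : E → E → ℂ) (N : ℕ) : Prop where
  psd : IsPSDKernel K
  measurable : Measurable (Function.uncurry K)
  integrable : ∀ a b, Integrable (fun y => K y a * K b y) m
  integral_eq : ∀ a b, ∫ y, K y a * K b y ∂m = K b a
  integrable_diag : Integrable (fun y => K y y) m
  trace_eq : ∫ y, K y y ∂m = N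

variable {m : Measure E} [SigmaFinite m] {K : E → E → ℂ} {N : ℕ}

theorem IsProjectionKernel.lintegral_corr_cons (h : IsProjectionKernel m K N) {n : ℕ}
    (x : Fin n → E) :
    ∫⁻ y, ENNReal.ofReal (corr K (Fin.cons y x : Fin (n + 1) → E)) ∂m =
      ENNReal.ofReal ((N : ℝ) - n) * ENNReal.ofReal (corr K x) := by
  by_cases h0 : (Matrix.of fun i j => K (x i) (x j)).det = 0
  · have h1 : ∀ y, corr K (Fin.cons y x : Fin (n + 1) → E) = 0 := fun y => by
      rw [corr, h.psd.det_cons_eq_zero x y h0]; rfl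
    have h2 : corr K x = 0 := by rw [corr, h0]; rfl
    simp [h1, h2]
  · set A := Matrix.of fun i j => K (x i) (x j) with hA
    have hu : IsUnit A.det := isUnit_iff_ne_zero.2 h0
    have hint : ∀ i j, Integrable (fun y => K y (x i) * A⁻¹ i j * K (x j) y) m := fun i j => by
      have := (h.integrable (x i) (x j)).const_mul (A⁻¹ i j)
      refine this.congr (Eventually.of_forall fun y => ?_)
      simp only; ring
    have hint2 : Integrable (fun y => A.det * (K y y - ∑ i, ∑ j,
        K y (x i) * A⁻¹ i j * K (x j) y)) m :=
      (h.integrable_diag.sub (integrable_finsetSum _ fun i _ =>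
        integrable_finsetSum _ fun j _ => hint i j)).const_mul _
    have hval : ∫ y, A.det * (K y y - ∑ i, ∑ j, K y (x i) * A⁻¹ i j * K (x j) y) ∂m =
        A.det * (N - n) := by
      rw [integral_const_mul, integral_sub h.integrable_diag (integrable_finsetSum _ fun i _ =>
        integrable_finsetSum _ fun j _ => hint i j), h.trace_eq,
        integral_finsetSum _ fun i _ => integrable_finsetSum _ fun j _ => hint i j]
      congr 2
      have h3 : ∀ i, ∫ y, ∑ j, K y (x i) * A⁻¹ i j * K (x j) y ∂m = (A⁻¹ * A) i i := by
        intro i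
        rw [integral_finsetSum _ fun j _ => hint i j, Matrix.mul_apply]
        refine Finset.sum_congr rfl fun j _ => ?_
        rw [hA, Matrix.of_apply, ← hA, ← h.integral_eq (x i) (x j), ← integral_const_mul]
        exact integral_congr_ae (Eventually.of_forall fun y => by simp only; ring)
      simp [h3, Matrix.nonsing_inv_mul A hu]
    have hdet := fun y => det_cons_eq x y hu
    have hc : ∀ y, corr K (Fin.cons y x : Fin (n + 1) → E) =
        (A.det * (K y y - ∑ i, ∑ j, K y (x i) * A⁻¹ i j * K (x j) y)).re := fun y => by
      rw [corr, hdet y]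
    simp_rw [hc]
    refine (ofReal_integral_eq_lintegral_ofReal hint2.re (Eventually.of_forall fun y => by
      have := h.psd.corr_nonneg (Fin.cons y x : Fin (n + 1) → E)
      rw [hc] at this; exact this)).symm.trans ?_
    have h5 : ∫ y, RCLike.re (A.det * (K y y - ∑ i, ∑ j, K y (x i) * A⁻¹ i j * K (x j) y)) ∂m =
        (N - n : ℝ) * corr K x := by
      rw [integral_re hint2, hval, hA, ← h.psd.ofReal_corr]
      simp [mul_comm]
    rw [h5, ENNReal.ofReal_mul' (h.psd.corr_nonneg x)]

/-- Integrating out all but `n` of the coordinates. -/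
theorem IsProjectionKernel.lintegral_addNat (h : IsProjectionKernel m K N) {n : ℕ}
    {g : (Fin n → E) → ℝ≥0∞} (hg : Measurable g) (j : ℕ) :
    ∫⁻ x : Fin (n + j) → E, g (fun i => x (i.addNat j)) * ENNReal.ofReal (corr K x)
        ∂(Measure.pi fun _ => m) =
      (∏ i ∈ Finset.range j, ENNReal.ofReal ((N : ℝ) - (n + i : ℕ))) *
        ∫⁻ x, g x * ENNReal.ofReal (corr K x) ∂(Measure.pi fun _ => m) := by
  induction j with
  | zero => simp
  | succ j ih =>
    have hm := (measurePreserving_piFinSuccAbove (fun _ : Fin (n + j + 1) => m) 0).symm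
    have hmc := (measurable_corr h.measurable (n + j + 1)).ennreal_ofReal
    have hga : Measurable fun x : Fin (n + j + 1) → E => g fun i => x (i.addNat (j + 1)) :=
      hg.comp (measurable_pi_lambda _ fun i => measurable_pi_apply _)
    change ∫⁻ x : Fin (n + j + 1) → E, g (fun i => x (i.addNat (j + 1))) *
      ENNReal.ofReal (corr K x) ∂(Measure.pi fun _ => m) = _
    rw [← hm.lintegral_comp_emb (MeasurableEquiv.measurableEmbedding _)]
    refine (lintegral_prod_symm _
      ((hga.mul hmc).comp (MeasurableEquiv.measurable _)).aemeasurable).trans ?_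
    let e := MeasurableEquiv.piFinSuccAbove (fun _ : Fin (n + j + 1) => E) 0
    have hcons : ∀ (x : Fin (n + j) → E) (y : E), e.symm (y, x) = Fin.cons y x := fun x y => by
      simp only [e, MeasurableEquiv.piFinSuccAbove_symm_apply, Fin.insertNthEquiv_zero]
      rfl
    change ∫⁻ x, ∫⁻ y, g (fun i => e.symm (y, x) (i.addNat (j + 1))) *
      ENNReal.ofReal (corr K (e.symm (y, x))) ∂m ∂(Measure.pi fun _ => m) = _
    simp only [hcons]
    have h1 : ∀ (x : Fin (n + j) → E) (y : E) (i : Fin n),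
        (Fin.cons y x : Fin (n + j + 1) → E) (i.addNat (j + 1)) = x (i.addNat j) := fun x y i => rfl
    simp only [h1]
    have h2 : ∀ x : Fin (n + j) → E, ∫⁻ y, g (fun i => x (i.addNat j)) *
        ENNReal.ofReal (corr K (Fin.cons y x : Fin (n + j + 1) → E)) ∂m =
        ENNReal.ofReal ((N : ℝ) - (n + j : ℕ)) *
          (g (fun i => x (i.addNat j)) * ENNReal.ofReal (corr K x)) := by
      intro x
      have h3 : Measurable fun y => ENNReal.ofReal (corr K (Fin.cons y x : Fin (n + j + 1) → E)) := by
        refine hmc.comp (measurable_pi_lambda _ fun i => ?_)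
        induction i using Fin.cases with
        | zero => exact measurable_id
        | succ i => exact measurable_const
      rw [lintegral_const_mul _ h3, h.lintegral_corr_cons]
      ring
    refine (lintegral_congr h2).trans ?_
    rw [lintegral_const_mul' _ _ ENNReal.ofReal_ne_top, ih, Finset.prod_range_succ]
    ring

theorem IsProjectionKernel.lintegral_corr (h : IsProjectionKernel m K N) (k : ℕ) :
    ∫⁻ x : Fin k → E, ENNReal.ofReal (corr K x) ∂(Measure.pi fun _ => m) = N.descFactorial k := by
  have h1 := h.lintegral_addNat (n := 0) (g := fun _ => 1) measurable_const k
  have h2 : ∀ n : ℕ, n = k → ∫⁻ x : Fin n → E, ENNReal.ofReal (corr K x) ∂(Measure.pi fun _ => m) =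
      ∫⁻ x : Fin k → E, ENNReal.ofReal (corr K x) ∂(Measure.pi fun _ => m) := by
    rintro n rfl; rfl
  simp only [one_mul] at h1
  rw [h2 _ (zero_add k)] at h1
  rw [h1, Nat.descFactorial_eq_prod_range]
  simp only [corr, Matrix.det_isEmpty, Complex.one_re, ENNReal.ofReal_one, lintegral_const,
    one_mul, zero_add, Nat.cast_prod]
  rw [Measure.pi_empty_univ, mul_one]
  refine Finset.prod_congr rfl fun i _ => ?_
  rw [ENNReal.ofReal_sub _ (Nat.cast_nonneg i), ENNReal.ofReal_natCast, ENNReal.ofReal_natCast,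
    ENNReal.natCast_sub]

theorem corr_comp_perm (K : E → E → ℂ) {n : ℕ} (x : Fin n → E) (τ : Equiv.Perm (Fin n)) :
    corr K (x ∘ τ) = corr K x := by
  unfold corr
  exact congrArg Complex.re
    (Matrix.det_submatrix_equiv_self τ (Matrix.of fun i j => K (x i) (x j)))

theorem IsProjectionKernel.lintegral_comp_injective (h : IsProjectionKernel m K N) {k : ℕ}
    {g : (Fin k → E) → ℝ≥0∞} (hg : Measurable g) {σ : Fin k → Fin N}
    (hσ : Function.Injective σ) :
    ∫⁻ x : Fin N → E, g (x ∘ σ) * ENNReal.ofReal (corr K x) ∂(Measure.pi fun _ => m) =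
      (N - k).factorial * ∫⁻ x, g x * ENNReal.ofReal (corr K x) ∂(Measure.pi fun _ => m) := by
  have hkN : k ≤ N := by simpa using Fintype.card_le_of_injective σ hσ
  obtain ⟨j, rfl⟩ := Nat.exists_eq_add_of_le hkN
  obtain ⟨τ, hτ⟩ := Equiv.Perm.exists_extending_pair (fun i : Fin k => i.addNat j) σ
    (fun a b hab => by simpa [Fin.ext_iff] using hab) hσ
  have hmp := measurePreserving_arrowCongr' (fun _ : Fin (k + j) => m) (fun _ : Fin (k + j) => m)
    τ.symm (MeasurableEquiv.refl E) fun _ => MeasurePreserving.id m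
  have h1 := hmp.lintegral_comp_emb (MeasurableEquiv.measurableEmbedding _)
    (fun y => g (fun i => y (i.addNat j)) * ENNReal.ofReal (corr K y))
  have h2 : ∀ x : Fin (k + j) → E,
      MeasurableEquiv.arrowCongr' τ.symm (MeasurableEquiv.refl E) x = x ∘ τ := fun x => rfl
  simp only [h2, corr_comp_perm, Function.comp_apply, hτ] at h1
  refine Eq.trans h1 ?_
  rw [h.lintegral_addNat hg]
  congr 1
  rw [Nat.add_sub_cancel_left, ← Finset.prod_range_add_one_eq_factorial, Nat.cast_prod,
    ← Finset.prod_range_reflect]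
  refine Finset.prod_congr rfl fun i hi => ?_
  have hi' : i < j := Finset.mem_range.1 hi
  rw [← ENNReal.ofReal_natCast]
  congr 1
  have : (j - 1 - i : ℕ) = (j : ℝ) - 1 - i := by
    rw [Nat.cast_sub (by omega), Nat.cast_sub (by omega), Nat.cast_one]
  push_cast
  rw [this]
  ring

theorem IsProjectionKernel.exists_isDeterminantalLaw (h : IsProjectionKernel m K N) :
    ∃ P : ProbabilityMeasure (PointConfiguration E), IsDeterminantalLaw m K P := by
  classical
  have hmc := fun k => (measurable_corr h.measurable k).ennreal_ofReal
  let c : ℝ≥0∞ := (N.factorial : ℝ≥0∞)⁻¹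
  have hf0 : (N.factorial : ℝ≥0∞) ≠ 0 := by exact_mod_cast N.factorial_ne_zero
  have hcf : c * N.factorial = 1 := ENNReal.inv_mul_cancel hf0 (by simp)
  let ρ : Measure (Fin N → E) :=
    (Measure.pi fun _ => m).withDensity fun x => c * ENNReal.ofReal (corr K x)
  have hρ : ∀ {f : (Fin N → E) → ℝ≥0∞}, Measurable f → ∫⁻ x, f x ∂ρ =
      c * ∫⁻ x, f x * ENNReal.ofReal (corr K x) ∂(Measure.pi fun _ => m) := by
    intro f hf
    rw [lintegral_withDensity_eq_lintegral_mul _ ((hmc N).const_mul c) hf]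
    refine Eq.trans (lintegral_congr fun x => ?_) (lintegral_const_mul _ (hf.mul (hmc N)))
    simp only [Pi.mul_apply]; ring
  have hprob : IsProbabilityMeasure ρ := ⟨by
    have := hρ (f := fun _ => 1) measurable_const
    simpa [h.lintegral_corr, Nat.descFactorial_self, hcf] using this⟩
  have hT : Measurable fun x : Fin N → E => tupleConfiguration x :=
    (continuous_tupleConfiguration N).measurable
  let P : ProbabilityMeasure (PointConfiguration E) :=
    ⟨ρ.map fun x => tupleConfiguration x, Measure.isProbabilityMeasure_map hT.aemeasurable⟩
  refine ⟨P, ?_, fun k x => h.psd.det_nonneg x, fun k A hA hd => ?_⟩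
  · refine (ae_map_iff hT.aemeasurable measurableSet_simple).2 ?_
    refine (ae_withDensity_iff ((hmc N).const_mul c)).2 (Eventually.of_forall fun x hx y => ?_)
    have hinj : Function.Injective x := by
      intro i j hij
      by_contra hne
      refine hx ?_
      rw [corr, Matrix.det_zero_of_row_eq hne (by ext l; simp [hij])]
      simp
    rw [tupleConfiguration_apply x (measurableSet_singleton y)]
    by_cases hy : ∃ i, x i = y
    · obtain ⟨i, rfl⟩ := hy
      rw [Finset.sum_eq_single i (fun j _ hj => by
        rw [indicator_of_notMem]; simpa using hinj.ne hj) (by simp)]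
      simp
    · push Not at hy
      rw [Finset.sum_eq_zero fun i _ => indicator_of_notMem (by simpa using hy i) _]
      exact zero_le
  · let g : (Fin k → E) → ℝ≥0∞ := fun x => ∏ i, (A i).indicator 1 (x i)
    have hg : Measurable g := Finset.measurable_fun_prod _ fun i _ =>
      (measurable_one.indicator (hA i)).comp (measurable_pi_apply i)
    have hgσ : ∀ σ : Fin k → Fin N, Measurable fun x : Fin N → E => g (x ∘ σ) := fun σ =>
      hg.comp (measurable_pi_lambda _ fun i => measurable_pi_apply _)
    have hgA : ∫⁻ x, g x * ENNReal.ofReal (corr K x) ∂(Measure.pi fun _ => m) =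
        ∫⁻ x in univ.pi A, ENNReal.ofReal (corr K x) ∂(Measure.pi fun _ => m) := by
      rw [← lintegral_indicator (MeasurableSet.univ_pi hA)]
      refine lintegral_congr fun x => ?_
      by_cases hx : x ∈ univ.pi A
      · rw [indicator_of_mem hx]
        have : g x = 1 := Finset.prod_eq_one fun i _ => indicator_of_mem (hx i (mem_univ i)) _
        rw [this, one_mul]
      · rw [indicator_of_notMem hx]
        simp only [mem_univ_pi, not_forall] at hx
        obtain ⟨i, hi⟩ := hx
        have : g x = 0 := Finset.prod_eq_zero (Finset.mem_univ i) (indicator_of_notMem hi _)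
        rw [this, zero_mul]
    -- Expand the product of sums; tuples of indices with a repetition do not contribute.
    have hexp : ∀ x : Fin N → E, ∏ i, (tupleConfiguration x).1 (A i) =
        ∑ σ : Fin k ↪ Fin N, g (x ∘ σ) := by
      intro x
      simp only [tupleConfiguration_apply x (hA _)]
      rw [Finset.prod_univ_sum, Fintype.piFinset_univ]
      have h1 : ∀ σ : Fin k → Fin N, ¬ Function.Injective σ →
          ∏ i, (A i).indicator (1 : E → ℝ≥0∞) (x (σ i)) = 0 := by
        intro σ hσ
        simp only [Function.Injective, not_forall] at hσ
        obtain ⟨i, j, hij, hne⟩ := hσ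
        by_cases hi : x (σ i) ∈ A i
        · refine Finset.prod_eq_zero (Finset.mem_univ j) (indicator_of_notMem ?_ _)
          rw [← hij]
          exact Set.disjoint_left.1 (hd hne) hi
        · exact Finset.prod_eq_zero (Finset.mem_univ i) (indicator_of_notMem hi _)
      rw [← Finset.sum_subset (s₁ := Finset.univ.filter Function.Injective) (Finset.subset_univ _)
        fun σ _ hσ => h1 σ (by simpa using hσ)]
      refine (Finset.sum_bij (fun (σ : Fin k ↪ Fin N) _ => (σ : Fin k → Fin N))
        (fun σ _ => by simpa using σ.injective) (fun σ _ σ' _ hh => DFunLike.coe_injective hh)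
        (fun σ hσ => ⟨⟨σ, by simpa using hσ⟩, Finset.mem_univ _, rfl⟩) fun σ _ => rfl).symm
    have hprodm : Measurable fun X : PointConfiguration E => ∏ i, X.1 (A i) :=
      Finset.measurable_fun_prod _ fun i _ => measurable_eval (hA i)
    refine (lintegral_map hprodm hT).trans ?_
    simp_rw [hexp]
    refine (lintegral_finsetSum _ fun (σ : Fin k ↪ Fin N) _ => hgσ σ).trans ?_
    have h2 : ∀ σ : Fin k ↪ Fin N, ∫⁻ x, g (x ∘ σ) ∂ρ = c * ((N - k).factorial *
        ∫⁻ x in univ.pi A, ENNReal.ofReal (corr K x) ∂(Measure.pi fun _ => m)) := by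
      intro σ
      rw [hρ (hgσ σ), h.lintegral_comp_injective hg σ.injective, hgA]
    simp only [h2, Finset.sum_const, Finset.card_univ, Fintype.card_embedding_eq,
      Fintype.card_fin, nsmul_eq_mul]
    change _ = ∫⁻ x in univ.pi A, ENNReal.ofReal (corr K x) ∂(Measure.pi fun _ => m)
    rcases le_or_gt k N with hk | hk
    · have h3 : ((N.descFactorial k : ℕ) : ℝ≥0∞) * ((N - k).factorial : ℕ) = N.factorial := by
        rw [← Nat.cast_mul, mul_comm, Nat.factorial_mul_descFactorial hk]
      rw [← mul_assoc, ← mul_assoc, mul_comm _ c, mul_assoc c, h3, hcf, one_mul]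
    · have h4 : ∫⁻ x in univ.pi A, ENNReal.ofReal (corr K x) ∂(Measure.pi fun _ => m) = 0 := by
        refine le_antisymm ((setLIntegral_le_lintegral _ _).trans ?_) zero_le
        rw [h.lintegral_corr, Nat.descFactorial_of_lt hk]
        simp
      rw [h4]
      simp

end FiniteRank

/-! ### Existence of determinantal processes -/

section Existence

variable {H : Type*} [NormedAddCommGroup H] [InnerProductSpace ℂ H]

theorem inner_starProjection_eq_sum (V : Submodule ℂ H) [FiniteDimensional ℂ V] (x y : H) :
    inner ℂ x (V.starProjection y) = ∑ i, inner ℂ x (stdOrthonormalBasis ℂ V i : H) *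
      inner ℂ (stdOrthonormalBasis ℂ V i : H) y := by
  have hmem : V.starProjection y ∈ V := by
    rw [Submodule.starProjection_apply]; exact Subtype.mem _
  have h := congrArg (Subtype.val) ((stdOrthonormalBasis ℂ V).sum_repr' ⟨_, hmem⟩)
  simp only [Submodule.coe_sum, Submodule.coe_smul, Submodule.coe_inner] at h
  conv_lhs => rw [← h]
  rw [inner_sum]
  refine Finset.sum_congr rfl fun i _ => ?_
  rw [inner_smul_right, ← Submodule.inner_starProjection_left_eq_right,
    Submodule.starProjection_eq_self_iff.2 (stdOrthonormalBasis ℂ V i).2, mul_comm]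

theorem inner_starProjection_starProjection (V : Submodule ℂ H) [V.HasOrthogonalProjection]
    (x y : H) : inner ℂ (V.starProjection x) (V.starProjection y) =
      inner ℂ x (V.starProjection y) := by
  have hmem : V.starProjection y ∈ V := by
    rw [Submodule.starProjection_apply]; exact Subtype.mem _
  rw [Submodule.inner_starProjection_left_eq_right, Submodule.starProjection_eq_self_iff.2 hmem]

variable {E : Type*} [TopologicalSpace E] [LocallyCompactSpace E] [T2Space E] [MeasurableSpace E]
  [BorelSpace E] [SecondCountableTopology E] {m : Measure E} {v : E → H}

/-- If `f ↦ (x ↦ ⟪v x, f⟫)` embeds `H` isometrically in `L²(m)`, then finite-dimensional subspaces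
of `H` have projection kernels. -/
theorem isProjectionKernel_starProjection
    (hL2 : ∀ f, MemLp (fun x => inner ℂ (v x) f) 2 m)
    (hmeas : ∀ f, Measurable fun x => inner ℂ (v x) f)
    (hiso : ∀ f g, ∫ x, inner ℂ f (v x) * inner ℂ (v x) g ∂m = inner ℂ f g)
    (V : Submodule ℂ H) [FiniteDimensional ℂ V] :
    IsProjectionKernel m (fun x y => inner ℂ (V.starProjection (v x)) (V.starProjection (v y)))
      (Module.finrank ℂ V) := by
  have hmeas' : ∀ f, Measurable fun x => inner ℂ f (v x) := fun f => by
    simp_rw [← inner_conj_symm f]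
    exact Complex.continuous_conj.measurable.comp (hmeas f)
  have hint : ∀ f g, Integrable (fun x => inner ℂ f (v x) * inner ℂ (v x) g) m := fun f g => by
    have h1 : MemLp (fun x => inner ℂ f (v x)) 2 m := by
      simp_rw [← inner_conj_symm f]
      exact (hL2 f).star
    exact h1.integrable_mul (hL2 g)
  have hre : ∀ a b y, inner ℂ (V.starProjection (v y)) (V.starProjection (v a)) *
      inner ℂ (V.starProjection (v b)) (V.starProjection (v y)) =
      inner ℂ (V.starProjection (v b)) (v y) * inner ℂ (v y) (V.starProjection (v a)) := by
    intro a b y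
    rw [inner_starProjection_starProjection, inner_starProjection_starProjection, mul_comm,
      V.inner_starProjection_left_eq_right (v b)]
  have hdiag : ∀ y, inner ℂ (V.starProjection (v y)) (V.starProjection (v y)) =
      ∑ i, inner ℂ (stdOrthonormalBasis ℂ V i : H) (v y) *
        inner ℂ (v y) (stdOrthonormalBasis ℂ V i : H) := by
    intro y
    rw [inner_starProjection_starProjection, inner_starProjection_eq_sum]
    exact Finset.sum_congr rfl fun i _ => mul_comm _ _
  refine ⟨isPSDKernel_inner _, ?_, fun a b => ?_, fun a b => ?_, ?_, ?_⟩
  · have h1 : (Function.uncurry fun x y => inner ℂ (V.starProjection (v x))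
        (V.starProjection (v y))) = fun p : E × E => ∑ i,
          inner ℂ (v p.1) (stdOrthonormalBasis ℂ V i : H) *
          inner ℂ (stdOrthonormalBasis ℂ V i : H) (v p.2) := by
      funext p
      rw [Function.uncurry, inner_starProjection_starProjection, inner_starProjection_eq_sum]
    rw [h1]
    exact Finset.measurable_fun_sum _ fun i _ =>
      ((hmeas _).comp measurable_fst).mul ((hmeas' _).comp measurable_snd)
  · simp_rw [hre a b]
    exact hint _ _
  · simp_rw [hre a b]
    exact hiso _ _
  · simp_rw [hdiag]
    exact integrable_finsetSum _ fun i _ => hint _ _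
  · simp_rw [hdiag]
    rw [integral_finsetSum _ fun i _ => hint _ _]
    simp only [hiso]
    have h1 : ∀ i, inner ℂ (stdOrthonormalBasis ℂ V i : H) (stdOrthonormalBasis ℂ V i : H) = 1 :=
      fun i => by
        rw [← Submodule.coe_inner, inner_self_eq_norm_sq_to_K,
          (stdOrthonormalBasis ℂ V).norm_eq_one]
        simp
    rw [Finset.sum_congr rfl fun i _ => h1 i]
    simp

/-- A reproducing kernel Hilbert space embedded in `L²(m)` has a determinantal process. -/
theorem exists_isDeterminantalLaw_inner [TopologicalSpace.SeparableSpace H]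
    [IsLocallyFiniteMeasure m] [NullSingletonClass m]
    (hL2 : ∀ f, MemLp (fun x => inner ℂ (v x) f) 2 m)
    (hmeas : ∀ f, Measurable fun x => inner ℂ (v x) f)
    (hiso : ∀ f g, ∫ x, inner ℂ f (v x) * inner ℂ (v x) g ∂m = inner ℂ f g)
    (hbdd : ∀ C, IsCompact C → ∃ M : ℝ, ∀ x ∈ C, ‖v x‖ ≤ M) :
    ∃ P, IsDeterminantalLaw m (fun x y => inner ℂ (v x) (v y)) P := by
  let u := TopologicalSpace.denseSeq H
  have hu : DenseRange u := TopologicalSpace.denseRange_denseSeq H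
  let V : ℕ → Submodule ℂ H := fun n => Submodule.span ℂ (u '' Iio n)
  have hfd : ∀ n, FiniteDimensional ℂ (V n) := fun n =>
    FiniteDimensional.span_of_finite ℂ ((finite_Iio n).image u)
  have hmono : Monotone V := fun a b hab =>
    Submodule.span_mono (image_mono (Iio_subset_Iio hab))
  have htop : ⊤ ≤ (⨆ n, V n).topologicalClosure := by
    intro x _
    refine closure_mono ?_ (hu x)
    rintro _ ⟨n, rfl⟩
    exact Submodule.mem_iSup_of_mem (n + 1)
      (Submodule.subset_span ⟨n, Nat.lt_succ_self n, rfl⟩)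
  have hproj := fun n => isProjectionKernel_starProjection hL2 hmeas hiso (V n)
  choose P hP using fun n => (hproj n).exists_isDeterminantalLaw
  have hconv : KernelsConverge
      (fun n x y => inner ℂ ((V n).starProjection (v x)) ((V n).starProjection (v y)))
      (fun x y => inner ℂ (v x) (v y)) := by
    refine ⟨fun n => (hproj n).psd, isPSDKernel_inner v, fun n => (hproj n).measurable,
      fun x y => ?_, fun C hC => ?_⟩
    · exact (Submodule.starProjection_tendsto_self V hmono _ htop).inner
        (Submodule.starProjection_tendsto_self V hmono _ htop)
    · obtain ⟨M, hM⟩ := hbdd C hC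
      refine ⟨M ^ 2, fun n x hx => ?_⟩
      rw [inner_self_eq_norm_sq_to_K]
      norm_cast
      exact pow_le_pow_left₀ (norm_nonneg _)
        ((Submodule.norm_starProjection_apply_le _ _).trans (hM x hx)) 2
  obtain ⟨P₀, h0, -⟩ := hconv.exists_isDeterminantalLaw hP (hyperfilter ℕ)
    Nat.hyperfilter_le_atTop
  exact ⟨P₀, h0⟩

end Existence

/-! ### Bergman kernels as Gram matrices -/

section BergmanKernel

variable {D : Set ℂ} {ρ : ℂ → ℝ}

/-- The square of the norm of `f` in `L²(D, ρ)`. -/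
noncomputable def energy (D : Set ℂ) (ρ : ℂ → ℝ) (f : ℂ → ℂ) : ℝ≥0∞ :=
  ∫⁻ z, ‖f z‖ₑ ^ 2 ∂(weightedMeasure D ρ)

theorem eLpNorm_sq_eq_energy (f : ℂ → ℂ) : eLpNorm f 2 (weightedMeasure D ρ) ^ 2 = energy D ρ f := by
  have h := eLpNorm_nnreal_pow_eq_lintegral (f := f) (μ := weightedMeasure D ρ) (p := 2) (by norm_num)
  simpa [energy] using h

theorem memLp_iff_energy_ne_top (hD : IsOpen D) {f : ℂ → ℂ} (hf : DifferentiableOn ℂ f D) :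
    MemLp f 2 (weightedMeasure D ρ) ↔ energy D ρ f ≠ ∞ := by
  rw [← eLpNorm_sq_eq_energy, MemLp, and_iff_right (aestronglyMeasurable_weightedMeasure hD ρ hf)]
  simp [lt_top_iff_ne_top]

theorem mem_bergmanSpace_iff (hD : IsOpen D) {f : ℂ → ℂ} :
    f ∈ bergmanSpace D ρ ↔ DifferentiableOn ℂ f D ∧ energy D ρ f ≠ ∞ :=
  and_congr_right fun hf => memLp_iff_energy_ne_top hD hf

theorem energy_eq_setLIntegral (hD : IsOpen D) (hc : ContinuousOn ρ D) {f : ℂ → ℂ}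
    (hf : DifferentiableOn ℂ f D) :
    energy D ρ f = ∫⁻ z in D, ENNReal.ofReal (‖f z‖ ^ 2 * ρ z) := by
  rw [energy, weightedMeasure, lintegral_withDensity_eq_lintegral_mul₀
    (hc.aemeasurable hD.measurableSet).ennreal_ofReal
    ((hf.continuousOn.aemeasurable hD.measurableSet).enorm.pow_const 2)]
  refine lintegral_congr fun z => ?_
  rw [Pi.mul_apply, ENNReal.ofReal_mul (by positivity), ENNReal.ofReal_pow (norm_nonneg _),
    ofReal_norm, mul_comm]

open Classical in
/-- The Bergman kernel `K(·,w)` as an element of `L²(D, ρ)`. -/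
noncomputable def bergmanVec (D : Set ℂ) (ρ : ℂ → ℝ) (w : ℂ) : Lp ℂ 2 (weightedMeasure D ρ) :=
  if h : MemLp (fun z => bergmanKernel D ρ z w) 2 (weightedMeasure D ρ) then h.toLp else 0

variable (hD : IsOpen D) (hc : ContinuousOn ρ D) (hpos : ∀ z ∈ D, 0 < ρ z)
include hD hc hpos

theorem bergmanVec_eq {w : ℂ} (hw : w ∈ D) : bergmanVec D ρ w =
    ((isReproducingKernel_bergmanKernel hD hc hpos).1 w hw).2.toLp :=
  dif_pos ((isReproducingKernel_bergmanKernel hD hc hpos).1 w hw).2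

theorem inner_bergmanVec {f : ℂ → ℂ} (hf : f ∈ bergmanSpace D ρ) {w : ℂ} (hw : w ∈ D) :
    inner ℂ (bergmanVec D ρ w) (hf.2.toLp f) = f w := by
  rw [bergmanVec_eq hD hc hpos hw, L2.inner_def,
    (isReproducingKernel_bergmanKernel hD hc hpos).2 f hf w hw]
  refine integral_congr_ae ?_
  filter_upwards [hf.2.coeFn_toLp,
    ((isReproducingKernel_bergmanKernel hD hc hpos).1 w hw).2.coeFn_toLp] with z h1 h2
  rw [h1, h2, RCLike.inner_apply]

theorem bergmanKernel_eq_inner {z w : ℂ} (hz : z ∈ D) (hw : w ∈ D) :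
    bergmanKernel D ρ z w = inner ℂ (bergmanVec D ρ z) (bergmanVec D ρ w) := by
  rw [bergmanVec_eq hD hc hpos hw]
  exact (inner_bergmanVec hD hc hpos ((isReproducingKernel_bergmanKernel hD hc hpos).1 w hw) hz).symm

theorem norm_bergmanVec_sq {w : ℂ} (hw : w ∈ D) :
    ‖bergmanVec D ρ w‖ ^ 2 = (bergmanKernel D ρ w w).re := by
  rw [bergmanKernel_eq_inner hD hc hpos hw hw, inner_self_eq_norm_sq_to_K]
  norm_cast

theorem bergmanKernel_self {w : ℂ} (hw : w ∈ D) :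
    bergmanKernel D ρ w w = ((bergmanKernel D ρ w w).re : ℂ) := by
  rw [← norm_bergmanVec_sq hD hc hpos hw, bergmanKernel_eq_inner hD hc hpos hw hw,
    inner_self_eq_norm_sq_to_K]
  norm_cast

theorem norm_toLp_sq {f : ℂ → ℂ} (hf : f ∈ bergmanSpace D ρ) :
    ENNReal.ofReal (‖hf.2.toLp f‖ ^ 2) = energy D ρ f := by
  rw [Lp.norm_toLp, ← ENNReal.toReal_pow, eLpNorm_sq_eq_energy,
    ENNReal.ofReal_toReal ((mem_bergmanSpace_iff hD).1 hf).2]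

theorem energy_bergmanKernel {w : ℂ} (hw : w ∈ D) :
    energy D ρ (fun z => bergmanKernel D ρ z w) = ENNReal.ofReal (bergmanKernel D ρ w w).re := by
  rw [← norm_bergmanVec_sq hD hc hpos hw, bergmanVec_eq hD hc hpos hw]
  exact (norm_toLp_sq hD hc hpos ((isReproducingKernel_bergmanKernel hD hc hpos).1 w hw)).symm

theorem bergmanKernel_self_nonneg {w : ℂ} (hw : w ∈ D) : 0 ≤ (bergmanKernel D ρ w w).re := by
  rw [← norm_bergmanVec_sq hD hc hpos hw]; positivity

theorem norm_sq_le_mul_energy {f : ℂ → ℂ} (hf : f ∈ bergmanSpace D ρ) {w : ℂ} (hw : w ∈ D) :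
    ENNReal.ofReal (‖f w‖ ^ 2) ≤ ENNReal.ofReal (bergmanKernel D ρ w w).re * energy D ρ f := by
  rw [← norm_toLp_sq hD hc hpos hf, ← norm_bergmanVec_sq hD hc hpos hw,
    ← ENNReal.ofReal_mul (by positivity), ← mul_pow]
  refine ENNReal.ofReal_le_ofReal (pow_le_pow_left₀ (norm_nonneg _) ?_ 2)
  rw [← inner_bergmanVec hD hc hpos hf hw]
  exact norm_inner_le_norm _ _

/-- The extremal characterization of `K(·,w)`, with uniqueness. -/
theorem eqOn_bergmanKernel {k : ℂ → ℂ} (hk : DifferentiableOn ℂ k D) {w : ℂ} (hw : w ∈ D)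
    (hkw : k w = ((bergmanKernel D ρ w w).re : ℂ))
    (hE : energy D ρ k ≤ ENNReal.ofReal (bergmanKernel D ρ w w).re) :
    EqOn k (fun z => bergmanKernel D ρ z w) D := by
  have hk2 : k ∈ bergmanSpace D ρ :=
    (mem_bergmanSpace_iff hD).2 ⟨hk, ne_top_of_le_ne_top ENNReal.ofReal_ne_top hE⟩
  have h1 := norm_toLp_sq hD hc hpos hk2
  rw [← h1, ENNReal.ofReal_le_ofReal_iff (bergmanKernel_self_nonneg hD hc hpos hw)] at hE
  have h2 := @norm_sub_sq ℂ _ _ _ _ (bergmanVec D ρ w) (hk2.2.toLp k)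
  rw [inner_bergmanVec hD hc hpos hk2 hw, hkw, norm_bergmanVec_sq hD hc hpos hw] at h2
  have h3 : ‖bergmanVec D ρ w - hk2.2.toLp k‖ ^ 2 ≤ 0 := by
    rw [h2]
    simp only [RCLike.re_to_complex, Complex.ofReal_re]
    linarith
  have h4 : bergmanVec D ρ w = hk2.2.toLp k := by
    rw [← sub_eq_zero, ← norm_eq_zero]
    exact pow_eq_zero_iff (two_ne_zero) |>.1 (le_antisymm h3 (by positivity))
  have hkk := (isReproducingKernel_bergmanKernel hD hc hpos).1 w hw
  rw [bergmanVec_eq hD hc hpos hw, MemLp.toLp_eq_toLp_iff] at h4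
  exact eqOn_of_ae_eq hD hc hpos hk hkk.1 h4.symm

end BergmanKernel

/-! ### Continuous dependence of the Bergman kernel on the weight -/

/-- Montel's theorem along an ultrafilter. -/
theorem exists_tendstoLocallyUniformlyOn_of_bounded {ι : Type*} {D : Set ℂ} (hD : IsOpen D)
    (U : Ultrafilter ι) {F : ι → ℂ → ℂ} (hF : ∀ᶠ i in (U : Filter ι), DifferentiableOn ℂ (F i) D)
    (hb : ∀ a ∈ D, ∃ R > 0, ∃ B : ℝ, ∀ᶠ i in (U : Filter ι), ∀ z ∈ Metric.ball a R, ‖F i z‖ ≤ B) :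
    ∃ k : ℂ → ℂ, TendstoLocallyUniformlyOn F k U D := by
  have hlim : ∀ a, ∃ l, a ∈ D → Tendsto (fun i => F i a) U (𝓝 l) := by
    intro a
    by_cases ha : a ∈ D
    · obtain ⟨R, hR, B, hB⟩ := hb a ha
      obtain ⟨l, -, hl⟩ := (isCompact_closedBall (0 : ℂ) B).ultrafilter_le_nhds
        (U.map fun i => F i a) (by
          rw [le_principal_iff, Ultrafilter.coe_map]
          refine mem_map.2 ?_
          filter_upwards [hB] with i hi
          simpa using hi a (Metric.mem_ball_self hR))
      exact ⟨l, fun _ => hl⟩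
    · exact ⟨0, fun h => absurd h ha⟩
  choose k hk using hlim
  refine ⟨k, Metric.tendstoLocallyUniformlyOn_iff.2 fun ε hε a ha => ?_⟩
  obtain ⟨R₀, hR₀, B₀, hB₀⟩ := hb a ha
  obtain ⟨R₁, hR₁, hRD⟩ := Metric.isOpen_iff.1 hD a ha
  let R := min R₀ R₁
  have hR : 0 < R := lt_min hR₀ hR₁
  let B := max B₀ 1
  have hB : 0 < B := lt_of_lt_of_le one_pos (le_max_right _ _)
  have hlip : ∀ᶠ i in (U : Filter ι), ∀ z ∈ Metric.ball a R,
      dist (F i z) (F i a) ≤ 2 * B / R * dist z a := by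
    filter_upwards [hF, hB₀] with i hi hBi z hz
    refine Complex.dist_le_div_mul_dist_of_mapsTo_ball
      (hi.mono ((Metric.ball_subset_ball (min_le_right _ _)).trans hRD)) (fun y hy => ?_) hz
    have h1 := hBi y (Metric.ball_subset_ball (min_le_left _ _) hy)
    have h2 := hBi a (Metric.mem_ball_self hR₀)
    rw [Metric.mem_closedBall, dist_eq_norm]
    refine (norm_sub_le _ _).trans ?_
    have := le_max_left B₀ 1
    linarith
  have hδ : 0 < ε / 3 * R / (2 * B) := by positivity
  refine ⟨Metric.ball a (min R (ε / 3 * R / (2 * B))) ∩ D,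
    inter_mem (mem_nhdsWithin_of_mem_nhds (Metric.ball_mem_nhds a (lt_min hR hδ)))
      self_mem_nhdsWithin, ?_⟩
  have hsmall : ∀ z ∈ Metric.ball a (min R (ε / 3 * R / (2 * B))), 2 * B / R * dist z a ≤ ε / 3 := by
    intro z hz
    have h1 : dist z a < ε / 3 * R / (2 * B) :=
      lt_of_lt_of_le (Metric.mem_ball.1 hz) (min_le_right _ _)
    rw [lt_div_iff₀ (by positivity)] at h1
    rw [div_mul_eq_mul_div, div_le_iff₀ hR]
    linarith
  have hka := Metric.tendsto_nhds.1 (hk a ha) (ε / 3) (by positivity)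
  filter_upwards [hlip, hka] with i hi hia z hz
  have h1 : dist (F i z) (F i a) ≤ ε / 3 :=
    (hi z (Metric.ball_subset_ball (min_le_left _ _) hz.1)).trans (hsmall z hz.1)
  have h2 : dist (k z) (k a) ≤ ε / 3 := by
    refine le_of_tendsto ((hk z hz.2).dist (hk a ha)) ?_
    filter_upwards [hlip] with j hj
    exact (hj z (Metric.ball_subset_ball (min_le_left _ _) hz.1)).trans (hsmall z hz.1)
  calc dist (k z) (F i z) ≤ dist (k z) (k a) + dist (k a) (F i a) + dist (F i a) (F i z) :=
        dist_triangle4 _ _ _ _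
    _ < ε / 3 + ε / 3 + ε / 3 := by
        rw [dist_comm (k a) (F i a), dist_comm (F i a) (F i z)]
        linarith
    _ = ε := by ring

section Convergence

variable {ι : Type*} {D : Set ℂ} {F : Filter ι} {ρn : ι → ℂ → ℝ} {ρ : ℂ → ℝ}

/-- A weight converging locally uniformly to a positive limit gives uniform local bounds. -/
theorem exists_uniform_local_bound (hD : IsOpen D) (hpos : ∀ z ∈ D, 0 < ρ z)
    (hρ : ∀ a ∈ D, Tendsto (fun p : ι × ℂ => ρn p.1 p.2) (F ×ˢ 𝓝 a) (𝓝 (ρ a))) {a : ℂ} (ha : a ∈ D) :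
    ∃ R > 0, ∃ M : ℝ≥0∞, M ≠ ∞ ∧ ∀ᶠ i in F, ∀ g : ℂ → ℂ, DifferentiableOn ℂ g D →
      ∀ w ∈ Metric.ball a R, ENNReal.ofReal (‖g w‖ ^ 2) ≤ M * energy D (ρn i) g := by
  have hlow : ∀ᶠ p : ι × ℂ in F ×ˢ 𝓝 a, ρ a / 2 < ρn p.1 p.2 :=
    (hρ a ha).eventually (lt_mem_nhds (half_lt_self (hpos a ha)))
  obtain ⟨pi, hpi, pz, hpz, hp⟩ := eventually_prod_iff.1 hlow
  obtain ⟨r, hr, hrD⟩ := Metric.mem_nhds_iff.1 (inter_mem hpz (hD.mem_nhds ha))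
  have hbD : Metric.ball a r ⊆ D := hrD.trans inter_subset_right
  obtain ⟨R, hR, C, hC, hb⟩ := exists_local_bound (ρ := fun _ => ρ a / 2) Metric.isOpen_ball
    continuousOn_const (fun _ _ => half_pos (hpos a ha)) (Metric.mem_ball_self hr)
  refine ⟨R, hR, C ^ 2, ENNReal.pow_ne_top hC, ?_⟩
  filter_upwards [hpi] with i hi g hg w hw
  have hle : weightedMeasure (Metric.ball a r) (fun _ => ρ a / 2) ≤ weightedMeasure D (ρn i) := by
    refine Measure.le_iff.2 fun s hs => ?_
    rw [weightedMeasure, weightedMeasure, withDensity_apply _ hs, withDensity_apply _ hs,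
      Measure.restrict_restrict hs, Measure.restrict_restrict hs]
    refine (setLIntegral_mono' (hs.inter measurableSet_ball) fun z hz => ?_).trans
      (lintegral_mono_set (inter_subset_inter_right s hbD))
    exact ENNReal.ofReal_le_ofReal (hp hi (hrD hz.2).1).le
  have h1 := (hb g (hg.mono hbD) w hw).trans (mul_le_mul_right (eLpNorm_mono_measure g hle) C)
  have h2 := pow_le_pow_left' h1 2
  rw [mul_pow, eLpNorm_sq_eq_energy] at h2
  rwa [ENNReal.ofReal_pow (norm_nonneg _), ofReal_norm]

variable (hD : IsOpen D) (hc : ContinuousOn ρ D) (hpos : ∀ z ∈ D, 0 < ρ z)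
  (hcn : ∀ i, ContinuousOn (ρn i) D) (hposn : ∀ i, ∀ z ∈ D, 0 < ρn i z)
  (hρ : ∀ a ∈ D, Tendsto (fun p : ι × ℂ => ρn p.1 p.2) (F ×ˢ 𝓝 a) (𝓝 (ρ a)))
include hD hc hpos hcn hposn hρ

theorem energy_le_of_tendstoLocallyUniformlyOn [F.NeBot] {kn : ι → ℂ → ℂ} {k : ℂ → ℂ}
    (hkn : ∀ᶠ i in F, DifferentiableOn ℂ (kn i) D) (hk : TendstoLocallyUniformlyOn kn k F D)
    {L : ℝ≥0∞} (hL : Tendsto (fun i => energy D (ρn i) (kn i)) F (𝓝 L)) : energy D ρ k ≤ L := by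
  have hkd : DifferentiableOn ℂ k D := hk.differentiableOn hkn hD
  have hjoint : ∀ a ∈ D, Tendsto (fun p : ι × ℂ => ‖k p.2‖ ^ 2 * ρ p.2 - ‖kn p.1 p.2‖ ^ 2 * ρn p.1 p.2)
      (F ×ˢ 𝓝 a) (𝓝 0) := by
    intro a ha
    have hka : ContinuousAt k a := hkd.continuousOn.continuousAt (hD.mem_nhds ha)
    have h1 : Tendsto (fun p : ι × ℂ => kn p.1 p.2) (F ×ˢ 𝓝 a) (𝓝 (k a)) := by
      refine Metric.tendsto_nhds.2 fun ε hε => ?_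
      obtain ⟨t, ht, hti⟩ := Metric.tendstoLocallyUniformlyOn_iff.1 hk (ε / 2) (half_pos hε) a ha
      rw [hD.nhdsWithin_eq ha] at ht
      have h2 := Metric.tendsto_nhds.1 hka (ε / 2) (half_pos hε)
      filter_upwards [hti.prod_mk (inter_mem ht h2)] with p hp
      have h3 := hp.1 p.2 hp.2.1
      have h4 : dist (k p.2) (k a) < ε / 2 := hp.2.2
      rw [dist_comm] at h3
      linarith [dist_triangle (kn p.1 p.2) (k p.2) (k a)]
    have h2 : Tendsto (fun p : ι × ℂ => k p.2) (F ×ˢ 𝓝 a) (𝓝 (k a)) := hka.tendsto.comp tendsto_snd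
    have h3 : Tendsto (fun p : ι × ℂ => ρ p.2) (F ×ˢ 𝓝 a) (𝓝 (ρ a)) :=
      (hc.continuousAt (hD.mem_nhds ha)).tendsto.comp tendsto_snd
    have h4 := ((h2.norm.pow 2).mul h3).sub ((h1.norm.pow 2).mul (hρ a ha))
    simpa using h4
  have hcpt : ∀ C, IsCompact C → C ⊆ D → ∫⁻ z in C, ENNReal.ofReal (‖k z‖ ^ 2 * ρ z) ≤ L := by
    intro C hC hCD
    have hb : ∀ ε : ℝ≥0, 0 < ε → ∫⁻ z in C, ENNReal.ofReal (‖k z‖ ^ 2 * ρ z) ≤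
        L + ε * volume C := by
      intro ε hε
      have hmem : {p : ι × ℂ | ‖k p.2‖ ^ 2 * ρ p.2 - ‖kn p.1 p.2‖ ^ 2 * ρn p.1 p.2 < ε} ∈
          F ×ˢ 𝓝ˢ C :=
        hC.mem_prod_nhdsSet_of_forall fun a ha =>
          (hjoint a (hCD ha)).eventually (gt_mem_nhds (by exact_mod_cast hε))
      obtain ⟨pi, hpi, pz, hpz, hp⟩ := eventually_prod_iff.1 hmem
      refine ge_of_tendsto (hL.add_const _) ?_
      filter_upwards [hpi, hkn] with i hi hki
      rw [energy_eq_setLIntegral hD (hcn i) hki]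
      calc ∫⁻ z in C, ENNReal.ofReal (‖k z‖ ^ 2 * ρ z)
          ≤ ∫⁻ z in C, (ENNReal.ofReal (‖kn i z‖ ^ 2 * ρn i z) + ε) := by
            refine setLIntegral_mono' hC.measurableSet fun z hz => ?_
            have h1 := hp hi (subset_of_mem_nhdsSet hpz hz)
            rw [← ENNReal.ofReal_coe_nnreal, ← ENNReal.ofReal_add
              (mul_nonneg (by positivity) (hposn i z (hCD hz)).le) ε.coe_nonneg]
            exact ENNReal.ofReal_le_ofReal (by simp only at h1; linarith)
        _ = (∫⁻ z in C, ENNReal.ofReal (‖kn i z‖ ^ 2 * ρn i z)) + ε * volume C := by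
            rw [lintegral_add_right _ measurable_const, setLIntegral_const]
        _ ≤ _ := by gcongr
    have h0 : Tendsto (fun n : ℕ => L + ((((n : ℝ≥0) + 1)⁻¹ : ℝ≥0) : ℝ≥0∞) * volume C) atTop
        (𝓝 (L + 0 * volume C)) := by
      refine tendsto_const_nhds.add (ENNReal.Tendsto.mul_const ?_ (Or.inr hC.measure_ne_top))
      rw [← ENNReal.coe_zero, ENNReal.tendsto_coe]
      have := tendsto_one_div_add_atTop_nhds_zero_nat (𝕜 := ℝ≥0)
      simpa using this
    rw [zero_mul, add_zero] at h0
    exact ge_of_tendsto' h0 fun n => hb _ (by positivity)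
  rw [energy_eq_setLIntegral hD hc hkd]
  obtain ⟨C, hC, hCD, hCe⟩ := exists_seq_isCompact_of_isOpen hD
  have hm : ∀ n, MeasurableSet (accumulate C n) := fun n =>
    MeasurableSet.iUnion fun j => MeasurableSet.iUnion fun _ => (hC j).measurableSet
  have hDC : D = ⋃ n, accumulate C n := by
    rw [iUnion_accumulate]
    refine subset_antisymm (fun z hz => ?_) (iUnion_subset hCD)
    obtain ⟨j, hj⟩ := (hCe z hz).exists
    exact mem_iUnion.2 ⟨j, hj⟩
  rw [hDC, setLIntegral_iUnion_of_directed _ (monotone_accumulate.directed_le)]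
  refine iSup_le fun n => hcpt _ ?_ ?_
  · exact (finite_Iic n).isCompact_biUnion fun j _ => hC j
  · exact iUnion₂_subset fun j _ => hCD j

/-- If the weights converge locally uniformly and the norms of all functions in the limit space
converge, then the Bergman kernels converge. By Montel's theorem `K_i(·,w_i)` has limit points,
and the extremal property identifies them. -/
theorem tendsto_bergmanKernel
    (hE : ∀ f ∈ bergmanSpace D ρ, Tendsto (fun i => energy D (ρn i) f) F (𝓝 (energy D ρ f)))
    {zn wn : ι → ℂ} {z w : ℂ} (hz : z ∈ D) (hw : w ∈ D) (hzn : Tendsto zn F (𝓝 z))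
    (hwn : Tendsto wn F (𝓝 w)) :
    Tendsto (fun i => bergmanKernel D (ρn i) (zn i) (wn i)) F (𝓝 (bergmanKernel D ρ z w)) := by
  rw [tendsto_iff_ultrafilter]
  intro U hU
  have hρU : ∀ a ∈ D, Tendsto (fun p : ι × ℂ => ρn p.1 p.2) ((U : Filter ι) ×ˢ 𝓝 a) (𝓝 (ρ a)) :=
    fun a ha => (hρ a ha).mono_left (Filter.prod_mono hU le_rfl)
  have hwnD : ∀ᶠ i in (U : Filter ι), wn i ∈ D := hU (hwn.eventually (hD.mem_nhds hw))
  have hwU := hwn.mono_left hU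
  let kn : ι → ℂ → ℂ := fun i z => bergmanKernel D (ρn i) z (wn i)
  have hrep := fun i => isReproducingKernel_bergmanKernel hD (hcn i) (hposn i)
  have hkn : ∀ᶠ i in (U : Filter ι), DifferentiableOn ℂ (kn i) D := by
    filter_upwards [hwnD] with i hi using ((hrep i).1 _ hi).1
  have hen : ∀ᶠ i in (U : Filter ι), energy D (ρn i) (kn i) =
      ENNReal.ofReal (bergmanKernel D (ρn i) (wn i) (wn i)).re := by
    filter_upwards [hwnD] with i hi using energy_bergmanKernel hD (hcn i) (hposn i) hi
  -- A uniform bound for the norms of the kernels.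
  obtain ⟨M, hM⟩ : ∃ M : ℝ, ∀ᶠ i in (U : Filter ι),
      (bergmanKernel D (ρn i) (wn i) (wn i)).re ≤ M := by
    obtain ⟨R, hR, M, hM, hb⟩ := exists_uniform_local_bound hD hpos hρU hw
    refine ⟨M.toReal, ?_⟩
    filter_upwards [hb, hwnD, hkn, hen, hwU.eventually (Metric.ball_mem_nhds w hR)] with i h1 h2 h3 h4 h5
    have h6 := h1 (kn i) h3 (wn i) h5
    have h7 := bergmanKernel_self_nonneg hD (hcn i) (hposn i) h2
    rw [h4, show kn i (wn i) = _ from bergmanKernel_self hD (hcn i) (hposn i) h2,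
      Complex.norm_real, Real.norm_of_nonneg h7, ← ENNReal.ofReal_toReal hM,
      ← ENNReal.ofReal_mul ENNReal.toReal_nonneg,
      ENNReal.ofReal_le_ofReal_iff (mul_nonneg ENNReal.toReal_nonneg h7), sq] at h6
    by_contra! h8
    exact absurd h6 (not_le.2 (mul_lt_mul_of_pos_right h8 (ENNReal.toReal_nonneg.trans_lt h8)))
  obtain ⟨k, hk⟩ := exists_tendstoLocallyUniformlyOn_of_bounded hD U hkn (by
    intro a ha
    obtain ⟨R, hR, M', hM', hb⟩ := exists_uniform_local_bound hD hpos hρU ha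
    refine ⟨R, hR, √(M'.toReal * M), ?_⟩
    filter_upwards [hb, hkn, hen, hM, hwnD] with i h1 h2 h3 h4 h4' y hy
    have h5 := h1 (kn i) h2 y hy
    have h7 := bergmanKernel_self_nonneg hD (hcn i) (hposn i) h4'
    rw [h3, ← ENNReal.ofReal_toReal hM', ← ENNReal.ofReal_mul ENNReal.toReal_nonneg,
      ENNReal.ofReal_le_ofReal_iff (mul_nonneg ENNReal.toReal_nonneg h7)] at h5
    exact Real.le_sqrt_of_sq_le (h5.trans (mul_le_mul_of_nonneg_left h4 ENNReal.toReal_nonneg)))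
  have hkd : DifferentiableOn ℂ k D := hk.differentiableOn hkn hD
  have hval : ∀ {yn : ι → ℂ} {y : ℂ}, y ∈ D → Tendsto yn U (𝓝 y) →
      Tendsto (fun i => kn i (yn i)) U (𝓝 (k y)) := by
    intro yn y hy hyn
    refine Metric.tendsto_nhds.2 fun ε hε => ?_
    obtain ⟨t, ht, hti⟩ := Metric.tendstoLocallyUniformlyOn_iff.1 hk (ε / 2) (half_pos hε) y hy
    rw [hD.nhdsWithin_eq hy] at ht
    have h2 := Metric.tendsto_nhds.1 (hkd.continuousOn.continuousAt (hD.mem_nhds hy)) (ε / 2)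
      (half_pos hε)
    filter_upwards [hti, hyn ht, hyn h2] with i h3 h4 h5
    have h6 := h3 _ h4
    have h7 : dist (k (yn i)) (k y) < ε / 2 := h5
    rw [dist_comm] at h6
    linarith [dist_triangle (kn i (yn i)) (k (yn i)) (k y)]
  -- The limit of the squared norms.
  have hLre : Tendsto (fun i => (bergmanKernel D (ρn i) (wn i) (wn i)).re) U (𝓝 (k w).re) :=
    (Complex.continuous_re.tendsto _).comp (hval hw hwU)
  have hkw : k w = ((k w).re : ℂ) := by
    have h1 : Tendsto (fun i => (kn i (wn i)).im) U (𝓝 (k w).im) :=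
      (Complex.continuous_im.tendsto _).comp (hval hw hwU)
    have h2 : (k w).im = 0 := by
      refine tendsto_nhds_unique (h1.congr' ?_) tendsto_const_nhds
      filter_upwards [hwnD] with i hi
      simp only [kn]
      rw [bergmanKernel_self hD (hcn i) (hposn i) hi, Complex.ofReal_im]
    exact Complex.ext rfl (by simp [h2])
  have hL0 : 0 ≤ (k w).re := ge_of_tendsto hLre (by
    filter_upwards [hwnD] with i hi using bergmanKernel_self_nonneg hD (hcn i) (hposn i) hi)
  have hLen : Tendsto (fun i => energy D (ρn i) (kn i)) U (𝓝 (ENNReal.ofReal (k w).re)) :=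
    ((ENNReal.continuous_ofReal.tendsto _).comp hLre).congr' (by
      filter_upwards [hen] with i hi using hi.symm)
  have hek := energy_le_of_tendstoLocallyUniformlyOn hD hc hpos hcn hposn hρU hkn hk hLen
  have hK0 := bergmanKernel_self_nonneg hD hc hpos hw
  have hkmem : k ∈ bergmanSpace D ρ :=
    (mem_bergmanSpace_iff hD).2 ⟨hkd, ne_top_of_le_ne_top ENNReal.ofReal_ne_top hek⟩
  have hupper : (k w).re ≤ (bergmanKernel D ρ w w).re := by
    have h1 := (norm_sq_le_mul_energy hD hc hpos hkmem hw).trans (mul_le_mul_right hek _)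
    rw [hkw, Complex.norm_real, Real.norm_of_nonneg hL0, ← ENNReal.ofReal_mul hK0,
      Complex.ofReal_re, ENNReal.ofReal_le_ofReal_iff (mul_nonneg hK0 hL0), sq] at h1
    by_contra! h2
    exact absurd h1 (not_le.2 (mul_lt_mul_of_pos_right h2 (hK0.trans_lt h2)))
  have hlower : (bergmanKernel D ρ w w).re ≤ (k w).re := by
    have hkk := (isReproducingKernel_bergmanKernel hD hc hpos).1 w hw
    have hEn := (hE _ hkk).mono_left hU
    have hfin : ∀ᶠ i in (U : Filter ι), energy D (ρn i) (fun z => bergmanKernel D ρ z w) ≠ ∞ := by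
      filter_upwards [hEn.eventually (gt_mem_nhds
        (((mem_bergmanSpace_iff hD).1 hkk).2.lt_top))] with i hi using hi.ne
    have h1 : Tendsto (fun i => ENNReal.ofReal (‖bergmanKernel D ρ (wn i) w‖ ^ 2)) U
        (𝓝 (ENNReal.ofReal (‖bergmanKernel D ρ w w‖ ^ 2))) := by
      refine (ENNReal.continuous_ofReal.tendsto _).comp ?_
      exact (((hkk.1.continuousOn.continuousAt (hD.mem_nhds hw)).tendsto.comp hwU).norm).pow 2
    have h2 : Tendsto (fun i => ENNReal.ofReal (bergmanKernel D (ρn i) (wn i) (wn i)).re *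
        energy D (ρn i) (fun z => bergmanKernel D ρ z w)) U
        (𝓝 (ENNReal.ofReal (k w).re * ENNReal.ofReal (bergmanKernel D ρ w w).re)) := by
      rw [← energy_bergmanKernel hD hc hpos hw]
      exact ENNReal.Tendsto.mul ((ENNReal.continuous_ofReal.tendsto _).comp hLre)
        (Or.inr ((mem_bergmanSpace_iff hD).1 hkk).2) hEn (Or.inr ENNReal.ofReal_ne_top)
    have h3 := le_of_tendsto_of_tendsto h1 h2 (by
      filter_upwards [hwnD, hfin] with i h4 h5
      exact norm_sq_le_mul_energy hD (hcn i) (hposn i) ((mem_bergmanSpace_iff hD).2 ⟨hkk.1, h5⟩) h4)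
    rw [bergmanKernel_self hD hc hpos hw, Complex.norm_real, Real.norm_of_nonneg hK0,
      ← ENNReal.ofReal_mul hL0, Complex.ofReal_re,
      ENNReal.ofReal_le_ofReal_iff (mul_nonneg hL0 hK0), sq] at h3
    by_contra! h4
    exact absurd h3 (not_le.2 (mul_lt_mul_of_pos_right h4 (hL0.trans_lt h4)))
  have heq := le_antisymm hupper hlower
  have h := eqOn_bergmanKernel hD hc hpos hkd hw (by rw [hkw, heq]) (by rwa [heq] at hek)
  have h2 : bergmanKernel D ρ z w = k z := (h hz).symm
  rw [h2]
  exact hval hz (hzn.mono_left hU)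

end Convergence

/-! ### The Bergman point process -/

theorem isLocallyFiniteMeasure_comap_subtype {D : Set ℂ} (hD : IsOpen D) :
    IsLocallyFiniteMeasure (Measure.comap ((↑) : D → ℂ) volume) := by
  refine ⟨fun x => ⟨((↑) : D → ℂ) ⁻¹' Metric.ball (x : ℂ) 1,
    (continuous_subtype_val.continuousAt (x := x)) (Metric.ball_mem_nhds _ one_pos), ?_⟩⟩
  rw [comap_subtype_coe_apply hD.measurableSet]
  exact (measure_mono (image_preimage_subset _ _)).trans_lt measure_ball_lt_top

theorem nullSingletonClass_comap_subtype {D : Set ℂ} (hD : IsOpen D) :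
    NullSingletonClass (Measure.comap ((↑) : D → ℂ) volume) := by
  refine ⟨fun x => ?_⟩
  rw [comap_subtype_coe_apply hD.measurableSet, image_singleton]
  exact measure_singleton _

theorem integral_weightedMeasure {D : Set ℂ} {ρ : ℂ → ℝ} (hD : IsOpen D) (hc : ContinuousOn ρ D)
    (hpos : ∀ z ∈ D, 0 < ρ z) (g : ℂ → ℂ) :
    ∫ z, g z ∂(weightedMeasure D ρ) = ∫ z in D, (ρ z : ℂ) * g z := by
  rw [weightedMeasure, integral_withDensity_eq_integral_toReal_smul₀
    (hc.aemeasurable hD.measurableSet).ennreal_ofReal (Eventually.of_forall fun _ =>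
      ENNReal.ofReal_lt_top)]
  refine setIntegral_congr_fun hD.measurableSet fun z hz => ?_
  rw [ENNReal.toReal_ofReal (hpos z hz).le, Complex.real_smul]

section Weight

variable {D : Set ℂ} {ρ : ℂ → ℝ} (hD : IsOpen D) (hc : ContinuousOn ρ D)
  (hpos : ∀ z ∈ D, 0 < ρ z)

include hD in
theorem bergmanVec_mem (hc : ContinuousOn ρ D) (hpos : ∀ z ∈ D, 0 < ρ z) {w : ℂ} (hw : w ∈ D) :
    bergmanVec D ρ w ∈ bergmanSubmodule D ρ := by
  rw [bergmanVec_eq hD hc hpos hw]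
  exact ⟨_, ((isReproducingKernel_bergmanKernel hD hc hpos).1 w hw).1, MemLp.coeFn_toLp _⟩

include hD hc hpos

theorem correlationKernel_eq_inner {z w : ℂ} (hz : z ∈ D) (hw : w ∈ D) :
    correlationKernel D ρ z w =
      inner ℂ ((√(ρ z) : ℂ) • bergmanVec D ρ z) ((√(ρ w) : ℂ) • bergmanVec D ρ w) := by
  rw [correlationKernel, bergmanKernel_eq_inner hD hc hpos hz hw, inner_smul_left,
    inner_smul_right, Complex.conj_ofReal]
  ring

theorem isPSDKernel_correlationKernel :
    IsPSDKernel fun z w : D => correlationKernel D ρ z w := by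
  have h : (fun z w : D => correlationKernel D ρ z w) = fun z w : D =>
      inner ℂ ((√(ρ z) : ℂ) • bergmanVec D ρ z) ((√(ρ w) : ℂ) • bergmanVec D ρ w) := by
    funext z w
    exact correlationKernel_eq_inner hD hc hpos z.2 w.2
  rw [h]
  exact isPSDKernel_inner fun z : D => (√(ρ z) : ℂ) • bergmanVec D ρ z

theorem continuous_correlationKernel :
    Continuous fun p : D × D => correlationKernel D ρ p.1 p.2 := by
  have hK : Continuous fun p : D × D => bergmanKernel D ρ p.1 p.2 := by
    refine continuous_iff_continuousAt.2 fun p => ?_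
    refine tendsto_bergmanKernel (ρn := fun _ : D × D => ρ) (F := 𝓝 p) (zn := fun p => (p.1 : ℂ))
      (wn := fun p => (p.2 : ℂ)) hD hc hpos (fun _ => hc) (fun _ => hpos) (fun a ha => ?_)
      (fun f _ => tendsto_const_nhds) p.1.2 p.2.2 ?_ ?_
    · exact (hc.continuousAt (hD.mem_nhds ha)).tendsto.comp tendsto_snd
    · exact (continuous_subtype_val.comp continuous_fst).continuousAt
    · exact (continuous_subtype_val.comp continuous_snd).continuousAt
  have hs : Continuous fun z : D => ((√(ρ z) : ℝ) : ℂ) :=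
    Complex.continuous_ofReal.comp (Real.continuous_sqrt.comp hc.domRestrict)
  exact (hK.mul (hs.comp continuous_fst)).mul (hs.comp continuous_snd)

/-- The Bergman space has a determinantal point process: multiplication by `√ρ` embeds it
isometrically into `L²(D)`. -/
theorem exists_isDeterminantalLaw_correlationKernel :
    ∃ P, IsDeterminantalLaw (Measure.comap ((↑) : D → ℂ) volume)
      (fun z w => correlationKernel D ρ z w) P := by
  have := hD.locallyCompactSpace
  have := isLocallyFiniteMeasure_comap_subtype hD
  have := nullSingletonClass_comap_subtype hD
  have : Fact ((2 : ℝ≥0∞) ≠ ∞) := ⟨by simp⟩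
  have : SFinite (weightedMeasure D ρ) := by unfold weightedMeasure; infer_instance
  have hcl := isClosed_bergmanSubmodule hD hc hpos
  obtain ⟨v, hvz⟩ : ∃ v : D → bergmanSubmodule D ρ, ∀ z : D,
      (v z : Lp ℂ 2 (weightedMeasure D ρ)) = (√(ρ z) : ℂ) • bergmanVec D ρ z :=
    ⟨fun z => ⟨_, Submodule.smul_mem _ (√(ρ z) : ℂ) (bergmanVec_mem hD hc hpos z.2)⟩, fun _ => rfl⟩
  have hv : (fun z w : D => correlationKernel D ρ z w) = fun z w => inner ℂ (v z) (v w) := by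
    funext z w
    rw [correlationKernel_eq_inner hD hc hpos z.2 w.2, ← hvz, ← hvz, Submodule.coe_inner]
  have hrep : ∀ f : bergmanSubmodule D ρ, ∃ g : ℂ → ℂ, ∃ hg : g ∈ bergmanSpace D ρ,
      (f : Lp ℂ 2 (weightedMeasure D ρ)) = hg.2.toLp g := by
    rintro ⟨f, g, hg, hfg⟩
    have h2 : MemLp g 2 (weightedMeasure D ρ) := (memLp_congr_ae hfg).1 (Lp.memLp f)
    refine ⟨g, ⟨hg, h2⟩, ?_⟩
    exact (Lp.toLp_coeFn f (Lp.memLp f)).symm.trans ((MemLp.toLp_eq_toLp_iff _ _).2 hfg)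
  choose r hr hfr using hrep
  have hinner : ∀ (z : D) f, inner ℂ (v z) f = (√(ρ z) : ℂ) * r f z := by
    intro z f
    rw [Submodule.coe_inner, hvz, inner_smul_left, hfr f,
      inner_bergmanVec hD hc hpos (hr f) z.2, Complex.conj_ofReal]
  have hcont : ∀ f, Continuous fun z : D => inner ℂ (v z) f := by
    intro f
    simp_rw [hinner]
    exact (Complex.continuous_ofReal.comp (Real.continuous_sqrt.comp hc.domRestrict)).mul
      (hr f).1.continuousOn.domRestrict
  have hemb : MeasurableEmbedding ((↑) : D → ℂ) := MeasurableEmbedding.subtype_coe hD.measurableSet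
  rw [hv]
  refine exists_isDeterminantalLaw_inner (fun f => ?_) (fun f => (hcont f).measurable) (fun f g => ?_)
    fun C hC => ?_
  · refine ⟨(hcont f).aestronglyMeasurable, ?_⟩
    have h1 : eLpNorm (fun z : D => inner ℂ (v z) f) 2 (Measure.comap ((↑) : D → ℂ) volume) ^ 2 =
        energy D ρ (r f) := by
      have h := eLpNorm_nnreal_pow_eq_lintegral (f := fun z : D => inner ℂ (v z) f)
        (μ := Measure.comap ((↑) : D → ℂ) volume) (p := 2) (by norm_num)
      refine Eq.trans (by simpa using h) ?_
      rw [energy_eq_setLIntegral hD hc (hr f).1, ← lintegral_subtype_comap hD.measurableSet]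
      refine lintegral_congr fun z => ?_
      rw [← Submodule.coe_inner, hinner, ← ofReal_norm, norm_mul, Complex.norm_real,
          Real.norm_of_nonneg (Real.sqrt_nonneg _),
        ← ENNReal.ofReal_pow (by positivity), mul_pow, Real.sq_sqrt (hpos z z.2).le, mul_comm]
    have h2 := ((mem_bergmanSpace_iff hD).1 (hr f)).2
    rw [← h1] at h2
    simpa [lt_top_iff_ne_top] using h2
  · have h1 : inner ℂ f g = inner ℂ ((hr f).2.toLp (r f)) ((hr g).2.toLp (r g)) := by
      rw [← hfr f, ← hfr g, Submodule.coe_inner]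
    have h2 : ∀ z : D, inner ℂ f (v z) * inner ℂ (v z) g =
        (fun z : ℂ => (ρ z : ℂ) * (starRingEnd ℂ (r f z) * r g z)) z := by
      intro z
      have h5 : inner ℂ f (v z) = starRingEnd ℂ ((√(ρ z) : ℂ) * r f z) := by
        rw [← hinner z f]
        exact (inner_conj_symm f (v z)).symm
      refine (congrArg₂ (· * ·) h5 (hinner z g)).trans ?_
      rw [map_mul, Complex.conj_ofReal]
      have : (ρ z : ℂ) = √(ρ z) * √(ρ z) := by
        rw [← Complex.ofReal_mul, Real.mul_self_sqrt (hpos z z.2).le]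
      simp only
      rw [this]
      ring
    simp_rw [h2]
    rw [integral_subtype_comap hD.measurableSet
      (fun z : ℂ => (ρ z : ℂ) * (starRingEnd ℂ (r f z) * r g z)),
      ← integral_weightedMeasure hD hc hpos, h1, L2.inner_def]
    refine integral_congr_ae ?_
    filter_upwards [(hr f).2.coeFn_toLp, (hr g).2.coeFn_toLp] with z h3 h4
    rw [h3, h4, RCLike.inner_apply, mul_comm]
  · have hcv : Continuous fun z : D => ‖v z‖ := by
      have h3 : (fun z : D => ‖v z‖) = fun z : D => √((correlationKernel D ρ z z).re) := by
        funext z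
        rw [congrFun (congrFun hv z) z]
        exact norm_eq_sqrt_re_inner (𝕜 := ℂ) (v z)
      rw [h3]
      exact Real.continuous_sqrt.comp (Complex.continuous_re.comp
        ((continuous_correlationKernel hD hc hpos).comp (continuous_id.prodMk continuous_id)))
    obtain ⟨M, hM⟩ := (hC.image hcv).bddAbove
    exact ⟨M, fun z hz => hM ⟨z, hz, rfl⟩⟩

end Weight

/-! ### Change of weight by a holomorphic factor -/

/-- Multiplication by a holomorphic function without zeros maps weighted Bergman spaces
isometrically onto each other. -/
theorem bergmanKernel_mul_norm_sq {D : Set ℂ} {ρ ρ' : ℂ → ℝ} (hD : IsOpen D) (hc : ContinuousOn ρ D)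
    (hpos : ∀ z ∈ D, 0 < ρ z) {e : ℂ → ℂ} (he : DifferentiableOn ℂ e D) (he0 : ∀ z ∈ D, e z ≠ 0)
    (hρ' : ∀ z ∈ D, ρ' z = ρ z * ‖e z‖ ^ 2) {z w : ℂ} (hz : z ∈ D) (hw : w ∈ D) :
    bergmanKernel D ρ' z w = bergmanKernel D ρ z w / (e z * starRingEnd ℂ (e w)) := by
  have hc' : ContinuousOn ρ' D :=
    (hc.mul (he.continuousOn.norm.pow 2)).congr hρ'
  have hpos' : ∀ z ∈ D, 0 < ρ' z := fun z hz => by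
    rw [hρ' z hz]
    exact mul_pos (hpos z hz) (pow_pos (norm_pos_iff.2 (he0 z hz)) 2)
  have hrep := isReproducingKernel_bergmanKernel hD hc hpos
  have hen : ∀ f : ℂ → ℂ, DifferentiableOn ℂ f D →
      energy D ρ' f = energy D ρ (fun z => f z * e z) := by
    intro f hf
    have hfe : DifferentiableOn ℂ (fun z => f z * e z) D := hf.mul he
    rw [energy_eq_setLIntegral hD hc' hf, energy_eq_setLIntegral hD hc hfe]
    refine setLIntegral_congr_fun hD.measurableSet fun z hz => ?_
    rw [hρ' z hz, norm_mul]
    congr 1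
    ring
  refine (isReproducingKernel_bergmanKernel hD hc' hpos').unique
    (K' := fun z w => bergmanKernel D ρ z w / (e z * starRingEnd ℂ (e w))) ⟨fun w hw => ?_,
    fun f hf w hw => ?_⟩ hz hw
  · have hk := hrep.1 w hw
    have hd : DifferentiableOn ℂ
        (fun z => bergmanKernel D ρ z w / (e z * starRingEnd ℂ (e w))) D :=
      hk.1.div (he.mul_const _) fun z hz => mul_ne_zero (he0 z hz)
        ((map_ne_zero (starRingEnd ℂ)).2 (he0 w hw))
    refine ⟨hd, ?_⟩
    have hde : DifferentiableOn ℂ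
        (fun z => bergmanKernel D ρ z w / (e z * starRingEnd ℂ (e w)) * e z) D := hd.mul he
    rw [memLp_iff_energy_ne_top hD hd, hen _ hd, ← memLp_iff_energy_ne_top hD hde]
    refine (memLp_congr_ae ?_).1 (hk.2.const_mul (starRingEnd ℂ (e w))⁻¹)
    filter_upwards [ae_mem_weightedMeasure hD ρ] with z hz
    have h1 := he0 z hz
    have h2 := (map_ne_zero (starRingEnd ℂ)).2 (he0 w hw)
    field_simp
  · have hfe : (fun z => f z * e z) ∈ bergmanSpace D ρ := by
      rw [mem_bergmanSpace_iff hD, ← hen f hf.1]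
      exact ⟨hf.1.mul he, ((mem_bergmanSpace_iff hD).1 hf).2⟩
    have h1 := hrep.2 _ hfe w hw
    rw [integral_weightedMeasure hD hc hpos] at h1
    rw [integral_weightedMeasure hD hc' hpos']
    have h2 : f w = (e w)⁻¹ * (f w * e w) := by
      have := he0 w hw
      field_simp
    rw [h2, h1, ← integral_const_mul]
    refine setIntegral_congr_fun hD.measurableSet fun z hz => ?_
    have h3 := he0 z hz
    have h4 := (map_ne_zero (starRingEnd ℂ)).2 (he0 z hz)
    have h5 := he0 w hw
    simp only
    rw [hρ' z hz, Complex.ofReal_mul, Complex.ofReal_pow, map_div₀, map_mul, Complex.conj_conj,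
      ← Complex.mul_conj']
    field_simp

/-- Gauge-equivalent kernels: they differ by conjugation with a unimodular function. -/
def GaugeEquiv {E : Type*} (K K' : E → E → ℂ) : Prop :=
  ∃ u : E → ℂ, (∀ x, u x * starRingEnd ℂ (u x) = 1) ∧
    ∀ x y, K' x y = K x y * u x * starRingEnd ℂ (u y)

theorem GaugeEquiv.diag {E : Type*} {K K' : E → E → ℂ} (h : GaugeEquiv K K') (x : E) :
    K' x x = K x x := by
  obtain ⟨u, hu, h⟩ := h
  rw [h, mul_assoc, hu, mul_one]

theorem GaugeEquiv.det {E : Type*} {K K' : E → E → ℂ} (h : GaugeEquiv K K') {k : ℕ}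
    (x : Fin k → E) : (Matrix.of fun i j => K' (x i) (x j)).det =
      (Matrix.of fun i j => K (x i) (x j)).det := by
  obtain ⟨u, hu, h⟩ := h
  have h1 : (Matrix.of fun i j => K' (x i) (x j)) = Matrix.diagonal (fun i => u (x i)) *
      (Matrix.of fun i j => K (x i) (x j)) * Matrix.diagonal fun i => starRingEnd ℂ (u (x i)) := by
    ext i j
    rw [Matrix.mul_diagonal, Matrix.diagonal_mul, Matrix.of_apply, Matrix.of_apply, h]
    ring
  rw [h1, Matrix.det_mul, Matrix.det_mul, Matrix.det_diagonal, Matrix.det_diagonal,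
    mul_right_comm, ← Finset.prod_mul_distrib]
  simp [hu]

theorem GaugeEquiv.isDeterminantalLaw_iff {E : Type*} [TopologicalSpace E] [MeasurableSpace E]
    {m : Measure E} {K K' : E → E → ℂ} (h : GaugeEquiv K K')
    {P : ProbabilityMeasure (PointConfiguration E)} :
    IsDeterminantalLaw m K' P ↔ IsDeterminantalLaw m K P := by
  constructor
  · rintro ⟨h1, h2, h3⟩
    simp only [h.det] at h2 h3
    exact ⟨h1, h2, h3⟩
  · rintro ⟨h1, h2, h3⟩
    refine ⟨h1, ?_, ?_⟩ <;> simp only [h.det]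
    · exact h2
    · exact h3

theorem gaugeEquiv_correlationKernel {D : Set ℂ} {ρ ρ' : ℂ → ℝ} (hD : IsOpen D)
    (hc : ContinuousOn ρ D) (hpos : ∀ z ∈ D, 0 < ρ z) {e : ℂ → ℂ} (he : DifferentiableOn ℂ e D)
    (he0 : ∀ z ∈ D, e z ≠ 0) (hρ' : ∀ z ∈ D, ρ' z = ρ z * ‖e z‖ ^ 2) :
    GaugeEquiv (fun z w : D => correlationKernel D ρ z w)
      (fun z w : D => correlationKernel D ρ' z w) := by
  have hn : ∀ z : D, (‖e z‖ : ℂ) ≠ 0 := fun z => by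
    exact_mod_cast norm_ne_zero_iff.2 (he0 z z.2)
  have hconj : ∀ z : D, starRingEnd ℂ (e z) ≠ 0 := fun z =>
    (map_ne_zero (starRingEnd ℂ)).2 (he0 z z.2)
  refine ⟨fun z => ‖e z‖ / e z, fun z => ?_, fun z w => ?_⟩
  · have h1 := he0 z z.2
    have h2 := hconj z
    rw [map_div₀, Complex.conj_ofReal, div_mul_div_comm, Complex.mul_conj', ← sq,
      div_self (pow_ne_zero 2 (hn z))]
  · have h1 := he0 z z.2
    have h2 := hconj w
    simp only [correlationKernel]
    rw [bergmanKernel_mul_norm_sq hD hc hpos he he0 hρ' z.2 w.2, hρ' z z.2, hρ' w w.2,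
      Real.sqrt_mul (hpos z z.2).le, Real.sqrt_mul (hpos w w.2).le, Real.sqrt_sq (norm_nonneg _),
      Real.sqrt_sq (norm_nonneg _), map_div₀, Complex.conj_ofReal]
    push_cast
    field_simp

/-! ### Continuous families of weights -/

/-- A family of weights, depending continuously on the parameter, for which the norm of every
function in a member of the corresponding family of Bergman spaces is continuous in the parameter. -/
structure IsContinuousWeightFamily {T : Type*} [TopologicalSpace T] (D : Set ℂ) (ρ : T → ℂ → ℝ) :
    Prop where
  isOpen : IsOpen D
  continuousAt : ∀ t, ∀ a ∈ D, Tendsto (fun p : T × ℂ => ρ p.1 p.2) (𝓝 t ×ˢ 𝓝 a) (𝓝 (ρ t a))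
  pos : ∀ t, ∀ z ∈ D, 0 < ρ t z
  energy : ∀ t, ∀ f ∈ bergmanSpace D (ρ t),
    Tendsto (fun s => energy D (ρ s) f) (𝓝 t) (𝓝 (energy D (ρ t) f))

section Family

variable {T : Type*} [TopologicalSpace T] {D : Set ℂ} {ρ : T → ℂ → ℝ}

theorem IsContinuousWeightFamily.continuousOn (h : IsContinuousWeightFamily D ρ) (t : T) :
    ContinuousOn (ρ t) D := by
  intro a ha
  have h1 : Tendsto (fun z : ℂ => ((t, z) : T × ℂ)) (𝓝 a) (𝓝 t ×ˢ 𝓝 a) :=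
    tendsto_const_nhds.prodMk tendsto_id
  exact ((h.continuousAt t a ha).comp h1).mono_left nhdsWithin_le_nhds

theorem IsContinuousWeightFamily.continuous_correlationKernel (h : IsContinuousWeightFamily D ρ) :
    Continuous fun p : T × D × D => correlationKernel D (ρ p.1) p.2.1 p.2.2 := by
  have hD := h.isOpen
  refine continuous_iff_continuousAt.2 fun p => ?_
  have hK : Tendsto (fun q : T × D × D => bergmanKernel D (ρ q.1) q.2.1 q.2.2) (𝓝 p)
      (𝓝 (bergmanKernel D (ρ p.1) p.2.1 p.2.2)) := by
    refine tendsto_bergmanKernel (ρn := fun q : T × D × D => ρ q.1) (F := 𝓝 p)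
      (zn := fun q => (q.2.1 : ℂ)) (wn := fun q => (q.2.2 : ℂ)) hD (h.continuousOn _) (h.pos _)
      (fun _ => h.continuousOn _) (fun _ => h.pos _) (fun a ha => ?_) (fun f hf => ?_) p.2.1.2
      p.2.2.2 ?_ ?_
    · have h1 : Tendsto (fun q : (T × D × D) × ℂ => (q.1.1, q.2)) (𝓝 p ×ˢ 𝓝 a) (𝓝 p.1 ×ˢ 𝓝 a) :=
        (continuous_fst.continuousAt.tendsto.comp tendsto_fst).prodMk tendsto_snd
      exact (h.continuousAt p.1 a ha).comp h1
    · exact (h.energy p.1 f hf).comp continuous_fst.continuousAt.tendsto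
    · exact (continuous_subtype_val.comp (continuous_fst.comp continuous_snd)).continuousAt
    · exact (continuous_subtype_val.comp (continuous_snd.comp continuous_snd)).continuousAt
  have hs : ∀ g : T × D × D → D, Continuous g →
      Tendsto (fun q : T × D × D => ((√(ρ q.1 (g q)) : ℝ) : ℂ)) (𝓝 p)
        (𝓝 ((√(ρ p.1 (g p)) : ℝ) : ℂ)) := by
    intro g hg
    have h1 : Tendsto (fun q : T × D × D => (q.1, (g q : ℂ))) (𝓝 p) (𝓝 p.1 ×ˢ 𝓝 (g p : ℂ)) :=
      continuous_fst.continuousAt.tendsto.prodMk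
        (continuous_subtype_val.comp hg).continuousAt.tendsto
    exact (Complex.continuous_ofReal.tendsto _).comp ((Real.continuous_sqrt.tendsto _).comp
      ((h.continuousAt p.1 _ (g p).2).comp h1))
  exact (hK.mul (hs (fun q => q.2.1) (continuous_fst.comp continuous_snd))).mul
    (hs (fun q => q.2.2) (continuous_snd.comp continuous_snd))

theorem IsDeterminantalLaw.unique_correlationKernel {ρ : ℂ → ℝ} (hD : IsOpen D)
    (hc : ContinuousOn ρ D) (hpos : ∀ z ∈ D, 0 < ρ z) {P P' : ProbabilityMeasure (PointConfiguration D)}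
    (hP : IsDeterminantalLaw (Measure.comap ((↑) : D → ℂ) volume)
      (fun z w => correlationKernel D ρ z w) P)
    (hP' : IsDeterminantalLaw (Measure.comap ((↑) : D → ℂ) volume)
      (fun z w => correlationKernel D ρ z w) P') : P = P' := by
  have := hD.locallyCompactSpace
  have := isLocallyFiniteMeasure_comap_subtype hD
  have hcont := (continuous_correlationKernel hD hc hpos).comp
    (continuous_id.prodMk continuous_id : Continuous fun z : D => (z, z))
  refine hP.unique hP' (isPSDKernel_correlationKernel hD hc hpos) hcont.measurable fun C hC => ?_
  obtain ⟨M, hM⟩ := (hC.image (Complex.continuous_re.comp hcont)).bddAbove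
  exact meanCount_ne_top_of_isCompact hC fun x hx => hM ⟨x, hx, rfl⟩

/-- The laws of the Bergman processes depend continuously on the weight. -/
theorem IsContinuousWeightFamily.continuous_law [SequentialSpace T]
    (h : IsContinuousWeightFamily D ρ) {L : T → ProbabilityMeasure (PointConfiguration D)}
    (hL : ∀ t, IsDeterminantalLaw (Measure.comap ((↑) : D → ℂ) volume)
      (fun z w => correlationKernel D (ρ t) z w) (L t)) : Continuous L := by
  have hD := h.isOpen
  have := hD.locallyCompactSpace
  have := isLocallyFiniteMeasure_comap_subtype hD
  have := nullSingletonClass_comap_subtype hD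
  have hcont := h.continuous_correlationKernel
  refine continuous_iff_seqContinuous.2 fun t t₀ ht => ?_
  have hconv : KernelsConverge (fun n (z w : D) => correlationKernel D (ρ (t n)) z w)
      (fun z w => correlationKernel D (ρ t₀) z w) := by
    refine ⟨fun n => isPSDKernel_correlationKernel hD (h.continuousOn (t n)) (h.pos (t n)),
      isPSDKernel_correlationKernel hD (h.continuousOn t₀) (h.pos t₀), fun n => ?_, fun z w => ?_,
      fun C hC => ?_⟩
    · have hm := BergmanProcess.continuous_correlationKernel hD (h.continuousOn (t n)) (h.pos (t n))
      exact hm.measurable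
    · have h1 : Tendsto (fun n => ((t n, z, w) : T × D × D)) atTop (𝓝 (t₀, z, w)) :=
        ht.prodMk_nhds tendsto_const_nhds
      have h2 := (hcont.tendsto (t₀, z, w)).comp h1
      exact h2
    · have hcpt := ht.isCompact_insert_range.prod hC
      have hd : Continuous fun p : T × D => ((p.1, p.2, p.2) : T × D × D) := by fun_prop
      have hc2 := Complex.continuous_re.comp (hcont.comp hd)
      obtain ⟨M, hM⟩ := (hcpt.image hc2).bddAbove
      exact ⟨M, fun n x hx => hM ⟨(t n, x), ⟨Or.inr ⟨n, rfl⟩, hx⟩, rfl⟩⟩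
  rw [tendsto_iff_ultrafilter]
  intro U hU
  obtain ⟨P₀, h0, hlim⟩ := hconv.exists_isDeterminantalLaw (fun n => hL (t n)) U hU
  rw [IsDeterminantalLaw.unique_correlationKernel hD (h.continuousOn _) (h.pos _) (hL t₀) h0]
  exact hlim

end Family

/-! ### Holomorphic logarithms -/

/-- `f` has a holomorphic logarithm on `U`. -/
def HasHolomorphicLog (U : Set ℂ) (f : ℂ → ℂ) : Prop :=
  ∃ L : ℂ → ℂ, DifferentiableOn ℂ L U ∧ ∀ z ∈ U, Complex.exp (L z) = f z

theorem HasHolomorphicLog.of_norm_sub_lt {U : Set ℂ} {f g : ℂ → ℂ} (hf : HasHolomorphicLog U f)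
    (hfd : DifferentiableOn ℂ f U) (hg : DifferentiableOn ℂ g U)
    (h : ∀ z ∈ U, ‖g z - f z‖ < ‖f z‖) : HasHolomorphicLog U g := by
  obtain ⟨L, hL, hexp⟩ := hf
  have h0 : ∀ z ∈ U, f z ≠ 0 := fun z hz => by
    rw [← hexp z hz]
    exact Complex.exp_ne_zero _
  have hs : ∀ z ∈ U, g z / f z ∈ Complex.slitPlane := by
    intro z hz
    refine Complex.ball_one_subset_slitPlane ?_
    rw [Metric.mem_ball, dist_eq_norm]
    have h1 : g z / f z - 1 = (g z - f z) / f z := by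
      have := h0 z hz
      field_simp
    rw [h1, norm_div, div_lt_one (norm_pos_iff.2 (h0 z hz))]
    exact h z hz
  refine ⟨fun z => L z + Complex.log (g z / f z), hL.add ((hg.div hfd h0).clog hs), fun z hz => ?_⟩
  rw [Complex.exp_add, hexp z hz, Complex.exp_log (Complex.slitPlane_ne_zero (hs z hz)),
    mul_div_cancel₀ _ (h0 z hz)]

/-- Two logarithms of the same function on a preconnected open set that agree at one point are
equal. -/
theorem eqOn_of_exp_eq {U : Set ℂ} (hU : IsOpen U) (hUc : IsPreconnected U) {L L' : ℂ → ℂ}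
    (hL : DifferentiableOn ℂ L U) (hL' : DifferentiableOn ℂ L' U)
    (h : ∀ z ∈ U, Complex.exp (L z) = Complex.exp (L' z)) {z₀ : ℂ} (hz₀ : z₀ ∈ U)
    (h0 : L z₀ = L' z₀) : EqOn L L' U := by
  have hd : ∀ z ∈ U, deriv L z = deriv L' z := by
    intro z hz
    have h1 := (hL.hasDerivAt (hU.mem_nhds hz)).cexp
    have h2 := (hL'.hasDerivAt (hU.mem_nhds hz)).cexp
    have h3 : (fun z => Complex.exp (L z)) =ᶠ[𝓝 z] fun z => Complex.exp (L' z) := by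
      filter_upwards [hU.mem_nhds hz] with y hy using h y hy
    have h4 := h1.unique (h2.congr_of_eventuallyEq h3)
    rw [h z hz] at h4
    exact mul_left_cancel₀ (Complex.exp_ne_zero _) h4
  exact hU.eqOn_of_deriv_eq hUc hL hL' hd hz₀ h0

/-- Relatively compact subdomains of `Ω` that contain the base point `z₀`. -/
def IsSubdomain (Ω : Set ℂ) (z₀ : ℂ) (U : Set ℂ) : Prop :=
  IsOpen U ∧ IsPreconnected U ∧ z₀ ∈ U ∧ ∃ K, IsCompact K ∧ U ⊆ K ∧ K ⊆ Ω

theorem IsSubdomain.union {Ω : Set ℂ} {z₀ : ℂ} {U V : Set ℂ} (hU : IsSubdomain Ω z₀ U)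
    (hV : IsSubdomain Ω z₀ V) : IsSubdomain Ω z₀ (U ∪ V) := by
  obtain ⟨hU, hUc, h0, K, hK, hUK, hKΩ⟩ := hU
  obtain ⟨hV, hVc, h0', K', hK', hVK, hKΩ'⟩ := hV
  exact ⟨hU.union hV, hUc.union z₀ h0 h0' hVc, Or.inl h0, K ∪ K', hK.union hK',
    union_subset_union hUK hVK, union_subset hKΩ hKΩ'⟩

theorem exists_isSubdomain {Ω : Set ℂ} (hΩ : IsOpen Ω) (hΩc : IsConnected Ω) {z₀ z : ℂ}
    (hz₀ : z₀ ∈ Ω) (hz : z ∈ Ω) : ∃ U, IsSubdomain Ω z₀ U ∧ z ∈ U := by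
  obtain ⟨γ, hγ⟩ := (hΩ.isConnected_iff_isPathConnected.1 hΩc).joinedIn z₀ hz₀ z hz
  have hcpt : IsCompact (range γ) := isCompact_range γ.continuous
  obtain ⟨δ, hδ, hsub⟩ := hcpt.exists_cthickening_subset_open hΩ (range_subset_iff.2 hγ)
  refine ⟨Metric.thickening δ (range γ), ⟨Metric.isOpen_thickening, ?_,
    Metric.self_subset_thickening hδ _ ⟨0, γ.source⟩, Metric.cthickening δ (range γ),
    hcpt.cthickening, Metric.thickening_subset_cthickening δ _, hsub⟩,
    Metric.self_subset_thickening hδ _ ⟨1, γ.target⟩⟩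
  have h1 : Metric.thickening δ (range γ) =
      (fun p : ℂ × ℂ => p.1 + p.2) '' (range γ ×ˢ Metric.ball 0 δ) := by
    rw [← add_ball_zero]
    exact (image_prod _).symm
  rw [h1]
  exact ((isPreconnected_range γ.continuous).prod (convex_ball (0 : ℂ) δ).isPreconnected).image _
    continuous_add.continuousOn

/-- A function that has a logarithm on every relatively compact subdomain has one: logarithms
normalized at the base point are compatible. -/
theorem hasHolomorphicLog_of_isSubdomain {Ω : Set ℂ} (hΩ : IsOpen Ω) (hΩc : IsConnected Ω) {z₀ : ℂ}
    (hz₀ : z₀ ∈ Ω) {f : ℂ → ℂ} (h : ∀ U, IsSubdomain Ω z₀ U → HasHolomorphicLog U f) :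
    HasHolomorphicLog Ω f := by
  have h1 : ∀ U, IsSubdomain Ω z₀ U → ∃ L : ℂ → ℂ, L z₀ = Complex.log (f z₀) ∧
      DifferentiableOn ℂ L U ∧ ∀ z ∈ U, Complex.exp (L z) = f z := by
    intro U hU
    obtain ⟨L, hL, hexp⟩ := h U hU
    have h0 : f z₀ ≠ 0 := by
      rw [← hexp z₀ hU.2.2.1]
      exact Complex.exp_ne_zero _
    refine ⟨fun z => L z - L z₀ + Complex.log (f z₀), by ring, (hL.sub_const _).add_const _,
      fun z hz => ?_⟩
    rw [Complex.exp_add, Complex.exp_sub, hexp z hz, hexp z₀ hU.2.2.1, Complex.exp_log h0,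
      div_mul_cancel₀ _ h0]
  choose! Λ hΛ0 hΛd hΛe using h1
  have hle : ∀ U V, IsSubdomain Ω z₀ U → IsSubdomain Ω z₀ V → U ⊆ V → EqOn (Λ U) (Λ V) U := by
    intro U V hU hV hUV
    refine eqOn_of_exp_eq hU.1 hU.2.1 (hΛd U hU) ((hΛd V hV).mono hUV) (fun z hz => ?_)
      hU.2.2.1 ?_
    · rw [hΛe U hU z hz, hΛe V hV z (hUV hz)]
    · rw [hΛ0 U hU, hΛ0 V hV]
  have hagree : ∀ U V, IsSubdomain Ω z₀ U → IsSubdomain Ω z₀ V → ∀ z ∈ U ∩ V, Λ U z = Λ V z := by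
    intro U V hU hV z hz
    rw [hle U _ hU (hU.union hV) subset_union_left hz.1,
      hle V _ hV (hU.union hV) subset_union_right hz.2]
  have hex := fun z (hz : z ∈ Ω) => exists_isSubdomain hΩ hΩc hz₀ hz
  choose! W hW hWz using hex
  refine ⟨fun z => Λ (W z) z, fun z hz => ?_, fun z hz => hΛe _ (hW z hz) z (hWz z hz)⟩
  have hnhds := (hW z hz).1.mem_nhds (hWz z hz)
  have h2 : (fun z => Λ (W z) z) =ᶠ[𝓝 z] Λ (W z) := by
    filter_upwards [hnhds, hΩ.mem_nhds hz] with y hy hyΩ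
    exact hagree _ _ (hW y hyΩ) (hW z hz) y ⟨hWz y hyΩ, hy⟩
  exact (((hΛd _ (hW z hz)).differentiableAt hnhds).congr_of_eventuallyEq h2).differentiableWithinAt

/-- Invariance of the existence of a logarithm along a connected family of zero-free functions. -/
theorem hasHolomorphicLog_of_preconnected {Ω : Set ℂ} (hΩ : IsOpen Ω) (hΩc : IsConnected Ω)
    {T : Type*} [TopologicalSpace T] [PreconnectedSpace T] {F : ℂ → T → ℂ}
    (hd : ∀ t, DifferentiableOn ℂ (fun z => F z t) Ω)
    (hcont : ∀ z ∈ Ω, ∀ t, ContinuousAt (fun p : T × ℂ => F p.2 p.1) (t, z))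
    (h0 : ∀ z ∈ Ω, ∀ t, F z t ≠ 0)
    (hlog : ∀ K ⊆ Ω, IsCompact K → ∃ t, HasHolomorphicLog K fun z => F z t) (t : T) :
    HasHolomorphicLog Ω fun z => F z t := by
  obtain ⟨z₀, hz₀⟩ := hΩc.nonempty
  refine hasHolomorphicLog_of_isSubdomain hΩ hΩc hz₀ fun U hU => ?_
  obtain ⟨-, -, -, K, hK, hUK, hKΩ⟩ := hU
  have hUΩ := hUK.trans hKΩ
  have hloc : ∀ t₀, ∀ᶠ t in 𝓝 t₀,
      HasHolomorphicLog U (fun z => F z t) ↔ HasHolomorphicLog U fun z => F z t₀ := by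
    intro t₀
    have h1 : ∀ z ∈ K, ∀ᶠ p : T × ℂ in 𝓝 t₀ ×ˢ 𝓝 z,
        ‖F p.2 p.1 - F p.2 t₀‖ < ‖F p.2 t₀‖ ∧ ‖F p.2 t₀ - F p.2 p.1‖ < ‖F p.2 p.1‖ := by
      intro z hz
      have hz := hKΩ hz
      have h2 : Tendsto (fun p : T × ℂ => F p.2 p.1) (𝓝 t₀ ×ˢ 𝓝 z) (𝓝 (F z t₀)) := by
        rw [← nhds_prod_eq]
        exact hcont z hz t₀
      have h3 : Tendsto (fun p : T × ℂ => F p.2 t₀) (𝓝 t₀ ×ˢ 𝓝 z) (𝓝 (F z t₀)) :=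
        ((hd t₀).continuousOn.continuousAt (hΩ.mem_nhds hz)).tendsto.comp tendsto_snd
      have hpos : 0 < ‖F z t₀‖ := norm_pos_iff.2 (h0 z hz t₀)
      have h4 : Tendsto (fun p : T × ℂ => ‖F p.2 p.1 - F p.2 t₀‖) (𝓝 t₀ ×ˢ 𝓝 z) (𝓝 0) := by
        simpa using (h2.sub h3).norm
      have h5 : Tendsto (fun p : T × ℂ => ‖F p.2 t₀ - F p.2 p.1‖) (𝓝 t₀ ×ˢ 𝓝 z) (𝓝 0) := by
        simpa using (h3.sub h2).norm
      exact (h4.eventually_lt h3.norm hpos).and (h5.eventually_lt h2.norm hpos)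
    simp only [← nhds_prod_eq] at h1
    filter_upwards [hK.eventually_forall_of_forall_eventually
      (P := fun t z => ‖F z t - F z t₀‖ < ‖F z t₀‖ ∧ ‖F z t₀ - F z t‖ < ‖F z t‖) h1] with t ht
    exact ⟨fun h => h.of_norm_sub_lt ((hd t).mono hUΩ) ((hd t₀).mono hUΩ)
        fun z hz => (ht z (hUK hz)).2,
      fun h => h.of_norm_sub_lt ((hd t₀).mono hUΩ) ((hd t).mono hUΩ)
        fun z hz => (ht z (hUK hz)).1⟩
  have hclopen : IsClopen {t | HasHolomorphicLog U fun z => F z t} := by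
    constructor
    · rw [← isOpen_compl_iff, isOpen_iff_mem_nhds]
      intro t₀ ht₀
      filter_upwards [hloc t₀] with t ht h using ht₀ (ht.1 h)
    · rw [isOpen_iff_mem_nhds]
      intro t₀ ht₀
      filter_upwards [hloc t₀] with t ht using ht.2 ht₀
  obtain ⟨t₁, L, hL, hexp⟩ := hlog K hKΩ hK
  have huniv := hclopen.eq_univ ⟨t₁, L, hL.mono hUK, fun z hz => hexp z (hUK hz)⟩
  exact huniv.ge (mem_univ t)

/-- The logarithm of `(z - a) / (z - b)`, for `a` and `b` in the same component of the
complement. -/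
theorem hasHolomorphicLog_div {Ω : Set ℂ} (hΩ : IsOpen Ω) (hΩc : IsConnected Ω) {S : Set ℂ}
    (hS : IsPreconnected S) (hSΩ : S ⊆ Ωᶜ) {a b : ℂ} (ha : a ∈ S) (hb : b ∈ S) :
    HasHolomorphicLog Ω fun z => (z - a) / (z - b) := by
  have : PreconnectedSpace S := isPreconnected_iff_preconnectedSpace.1 hS
  have hne : ∀ z ∈ Ω, ∀ t ∈ S, z - t ≠ 0 := fun z hz t ht =>
    sub_ne_zero.2 fun h => hSΩ ht (h ▸ hz)
  refine hasHolomorphicLog_of_preconnected hΩ hΩc (F := fun z (t : S) => (z - t) / (z - b))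
    (fun t => ?_) (fun z hz t => ?_) (fun z hz t => div_ne_zero (hne z hz t t.2) (hne z hz b hb))
    (fun K hK _ => ⟨⟨b, hb⟩, 0, differentiableOn_const 0, fun z hz => ?_⟩) ⟨a, ha⟩
  · exact DifferentiableOn.div (by fun_prop) (by fun_prop) fun z hz => hne z hz b hb
  · refine ContinuousAt.div ?_ ?_ (hne z hz b hb)
    · exact (continuous_snd.sub (continuous_subtype_val.comp continuous_fst)).continuousAt
    · exact (continuous_snd.sub continuous_const).continuousAt
  · simp [div_self (hne z (hK hz) b hb)]

/-- The logarithm of `z - a`, for `a` in an unbounded component of the complement. -/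
theorem hasHolomorphicLog_sub {Ω : Set ℂ} (hΩ : IsOpen Ω) (hΩc : IsConnected Ω) {S : Set ℂ}
    (hS : IsPreconnected S) (hSΩ : S ⊆ Ωᶜ) (hSb : ¬Bornology.IsBounded S) {a : ℂ} (ha : a ∈ S) :
    HasHolomorphicLog Ω fun z => z - a := by
  have : PreconnectedSpace S := isPreconnected_iff_preconnectedSpace.1 hS
  refine hasHolomorphicLog_of_preconnected hΩ hΩc (F := fun z (t : S) => z - t)
    (fun t => by fun_prop) (fun z hz t => ?_)
    (fun z hz t => sub_ne_zero.2 fun h => hSΩ t.2 (h ▸ hz)) (fun K hK hKc => ?_) ⟨a, ha⟩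
  · exact (continuous_snd.sub (continuous_subtype_val.comp continuous_fst)).continuousAt
  · obtain ⟨R, hR⟩ := hKc.isBounded.exists_norm_le
    obtain ⟨t, ht, htR⟩ : ∃ t ∈ S, max R 0 < ‖t‖ := by
      by_contra! h
      exact hSb (isBounded_iff_forall_norm_le.2 ⟨_, h⟩)
    have ht0 : -t ≠ 0 := neg_ne_zero.2 (norm_pos_iff.1 ((le_max_right R 0).trans_lt htR))
    refine ⟨⟨t, ht⟩, HasHolomorphicLog.of_norm_sub_lt (f := fun _ => -t)
      ⟨fun _ => Complex.log (-t), differentiableOn_const _, fun _ _ => Complex.exp_log ht0⟩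
      (differentiableOn_const _) (by fun_prop) fun z hz => ?_⟩
    have h1 : z - t - -t = z := by ring
    rw [h1, norm_neg]
    exact (hR z hz).trans_lt ((le_max_left R 0).trans_lt htR)

/-- For a holomorphic square root `φ` of `z - a`, the sum `φ(z) + φ(ζ)` has a logarithm on `Ω`:
`-φ(Ω)` is connected, unbounded, and disjoint from `φ(Ω)`. -/
theorem hasHolomorphicLog_add {Ω : Set ℂ} (hΩ : IsOpen Ω) (hΩc : IsConnected Ω)
    (hΩb : ¬Bornology.IsBounded Ω) {φ : ℂ → ℂ} {a : ℂ} (hφ : DifferentiableOn ℂ φ Ω)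
    (hsq : ∀ z ∈ Ω, φ z ^ 2 = z - a) (hadd : ∀ z ∈ Ω, ∀ w ∈ Ω, φ z + φ w ≠ 0) {ζ : ℂ}
    (hζ : ζ ∈ Ω) : HasHolomorphicLog Ω fun z => φ z + φ ζ := by
  have : PreconnectedSpace Ω := isPreconnected_iff_preconnectedSpace.1 hΩc.isPreconnected
  refine hasHolomorphicLog_of_preconnected hΩ hΩc (F := fun z (t : Ω) => φ z + φ t)
    (fun t => hφ.add_const _) (fun z hz t => ?_)
    (fun z hz t => hadd z hz t t.2) (fun K hK hKc => ?_) ⟨ζ, hζ⟩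
  · have h1 : ContinuousAt (fun p : Ω × ℂ => φ p.2) (t, z) :=
      (hφ.continuousOn.continuousAt (hΩ.mem_nhds hz)).comp continuousAt_snd
    have h2 : ContinuousAt (fun p : Ω × ℂ => φ p.1) (t, z) :=
      (hφ.continuousOn.domRestrict.comp continuous_fst).continuousAt
    exact h1.add h2
  · obtain ⟨R, hR⟩ := (hKc.image_of_continuousOn (hφ.continuousOn.mono hK)).isBounded.exists_norm_le
    obtain ⟨t, ht, htR⟩ : ∃ t ∈ Ω, ‖a‖ + (max R 0) ^ 2 < ‖t‖ := by
      by_contra! h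
      exact hΩb (isBounded_iff_forall_norm_le.2 ⟨_, h⟩)
    have h1 : max R 0 < ‖φ t‖ := by
      refine lt_of_pow_lt_pow_left₀ 2 (norm_nonneg _) ?_
      rw [← norm_pow, hsq t ht]
      linarith [norm_sub_norm_le t a]
    have ht0 : φ t ≠ 0 := norm_pos_iff.1 ((le_max_right R 0).trans_lt h1)
    refine ⟨⟨t, ht⟩, HasHolomorphicLog.of_norm_sub_lt (f := fun _ => φ t)
      ⟨fun _ => Complex.log (φ t), differentiableOn_const _, fun _ _ => Complex.exp_log ht0⟩
      (differentiableOn_const _) ((hφ.mono hK).add_const _) fun z hz => ?_⟩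
    rw [add_sub_cancel_right]
    exact (hR _ ⟨z, hz, rfl⟩).trans_lt ((le_max_left R 0).trans_lt h1)

/-! ### Normalization of the potentials -/

theorem abs_log_sub_log_le {x y A B : ℝ} (hx : 0 < x) (hy : 0 < y) (hA : x ≤ A * y)
    (hB : y ≤ B * x) : |Real.log x - Real.log y| ≤ |Real.log A| + |Real.log B| := by
  have hA0 : 0 < A := pos_of_mul_pos_left (hx.trans_le hA) hy.le
  have hB0 : 0 < B := pos_of_mul_pos_left (hy.trans_le hB) hx.le
  have h1 := Real.log_le_log hx hA
  have h2 := Real.log_le_log hy hB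
  rw [Real.log_mul hA0.ne' hy.ne'] at h1
  rw [Real.log_mul hB0.ne' hx.ne'] at h2
  rw [abs_le]
  constructor <;> linarith [le_abs_self (Real.log A), le_abs_self (Real.log B),
    abs_nonneg (Real.log A), abs_nonneg (Real.log B)]

theorem exists_abs_log_norm_sub_le {Ω : Set ℂ} {b : ℂ} {r : ℝ} (hr : 0 < r)
    (h : ∀ z ∈ Ω, r ≤ ‖z - b‖) :
    ∃ C, ∀ z ∈ Ω, |Real.log ‖z - b‖ - Real.log (1 + ‖z‖)| ≤ C := by
  refine ⟨_, fun z hz => abs_log_sub_log_le (A := 1 + ‖b‖) (B := (1 + ‖b‖) / r + 1)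
    (hr.trans_le (h z hz)) (by positivity) ?_ ?_⟩
  · nlinarith [norm_sub_le z b, norm_nonneg z, norm_nonneg b, mul_nonneg (norm_nonneg z)
      (norm_nonneg b)]
  · have h1 : ‖z‖ ≤ ‖z - b‖ + ‖b‖ := by simpa using norm_add_le (z - b) b
    have h2 : 1 + ‖b‖ ≤ (1 + ‖b‖) / r * ‖z - b‖ := by
      rw [div_mul_eq_mul_div, le_div_iff₀ hr]
      exact mul_le_mul_of_nonneg_left (h z hz) (by positivity)
    nlinarith

/-- On an unbounded domain whose complement has an unbounded component, `log (1 + |z|)` is at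
bounded distance from the real part of a holomorphic function. -/
theorem exists_re_sub_log_le {Ω : Set ℂ} (hΩ : IsOpen Ω) (hΩc : IsConnected Ω)
    (hΩb : ¬Bornology.IsBounded Ω) {S : Set ℂ} (hS : IsPreconnected S) (hSΩ : S ⊆ Ωᶜ)
    (hSb : ¬Bornology.IsBounded S) : ∃ g : ℂ → ℂ, DifferentiableOn ℂ g Ω ∧
      ∃ C, ∀ z ∈ Ω, |(g z).re - Real.log (1 + ‖z‖)| ≤ C := by
  obtain ⟨a, ha⟩ : S.Nonempty := by
    by_contra h
    rw [not_nonempty_iff_eq_empty] at h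
    exact hSb (h ▸ Bornology.isBounded_empty)
  obtain ⟨L, hL, hexp⟩ := hasHolomorphicLog_sub hΩ hΩc hS hSΩ hSb ha
  beta_reduce at hexp
  set φ : ℂ → ℂ := fun z => Complex.exp (L z / 2) with hφdef
  have hφ : DifferentiableOn ℂ φ Ω := (hL.div_const 2).cexp
  have hsq : ∀ z ∈ Ω, φ z ^ 2 = z - a := by
    intro z hz
    rw [← hexp z hz, ← Complex.exp_nat_mul]
    congr 1
    push_cast
    ring
  have hadd : ∀ z ∈ Ω, ∀ w ∈ Ω, φ z + φ w ≠ 0 := by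
    intro z hz w hw h
    have h1 : φ z = -φ w := eq_neg_of_add_eq_zero_left h
    have h2 : z = w := by
      have := hsq z hz
      rw [h1, neg_sq, hsq w hw] at this
      exact (sub_left_inj.1 this).symm
    rw [h2, ← two_mul] at h
    exact (mul_ne_zero two_ne_zero (Complex.exp_ne_zero _)) h
  obtain ⟨ζ, hζ⟩ := hΩc.nonempty
  obtain ⟨Λ, hΛ, hΛe⟩ := hasHolomorphicLog_add hΩ hΩc hΩb hφ hsq hadd hζ
  beta_reduce at hΛe
  -- The image of `φ` contains a disc around `φ ζ`, which the image of `-φ` avoids.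
  obtain ⟨r, hr, hrb⟩ : ∃ r > 0, ∀ z ∈ Ω, r ≤ ‖φ z + φ ζ‖ := by
    have hinj : InjOn φ Ω := fun z hz w hw h => by
      have := hsq z hz
      rw [h, hsq w hw] at this
      exact (sub_left_inj.1 this).symm
    have han : AnalyticAt ℂ φ ζ := hφ.analyticAt (hΩ.mem_nhds hζ)
    have hnhds : φ '' Ω ∈ 𝓝 (φ ζ) := by
      rcases han.eventually_constant_or_nhds_le_map_nhds with h | h
      · exfalso
        have h1 : ∀ᶠ z in 𝓝 ζ, z = ζ := by
          filter_upwards [h, hΩ.mem_nhds hζ] with z h1 h2 using hinj h2 hζ h1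
        have h2 : (𝓝[≠] ζ).NeBot := inferInstance
        exact h2.ne (by
          rw [← Filter.eventually_false_iff_eq_bot]
          filter_upwards [mem_nhdsWithin_of_mem_nhds h1, self_mem_nhdsWithin] with z h3 h4
            using h4 h3)
      · exact h (image_mem_map (hΩ.mem_nhds hζ))
    obtain ⟨r, hr, hrs⟩ := Metric.mem_nhds_iff.1 hnhds
    refine ⟨r, hr, fun z hz => ?_⟩
    by_contra! hlt
    obtain ⟨w, hw, hw2⟩ : -φ z ∈ φ '' Ω := hrs (by
      rw [Metric.mem_ball, dist_eq_norm, ← norm_neg]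
      simpa [add_comm] using hlt)
    exact hadd z hz w hw (by rw [hw2, add_neg_cancel])
  refine ⟨fun z => 2 * Λ z, hΛ.const_mul 2, |Real.log (2 + 2 * ‖a‖ + 2 * ‖φ ζ‖ ^ 2)| +
    |Real.log ((1 + ‖a‖ + 2 * ‖φ ζ‖ ^ 2) / r ^ 2 + 2)|, fun z hz => ?_⟩
  have hre : (2 * Λ z).re = Real.log (‖φ z + φ ζ‖ ^ 2) := by
    rw [← hΛe z hz, Complex.norm_exp, Real.log_pow, Real.log_exp]
    simp
  have hn : ‖φ z‖ ^ 2 = ‖z - a‖ := by rw [← norm_pow, hsq z hz]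
  have hlow := hrb z hz
  beta_reduce
  rw [hre]
  have h1 : 1 ≤ ‖φ z + φ ζ‖ ^ 2 / r ^ 2 := by
    rw [one_le_div (by positivity)]
    exact pow_le_pow_left₀ hr.le hlow 2
  refine abs_log_sub_log_le (A := 2 + 2 * ‖a‖ + 2 * ‖φ ζ‖ ^ 2)
    (B := (1 + ‖a‖ + 2 * ‖φ ζ‖ ^ 2) / r ^ 2 + 2) (pow_pos (hr.trans_le hlow) 2)
    (by positivity) ?_ ?_
  · have h2 := norm_add_le (φ z) (φ ζ)
    have h3 := norm_sub_le z a
    have h4 : ‖φ z + φ ζ‖ ^ 2 ≤ 2 * ‖φ z‖ ^ 2 + 2 * ‖φ ζ‖ ^ 2 := by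
      nlinarith [sq_nonneg (‖φ z‖ - ‖φ ζ‖), norm_nonneg (φ z + φ ζ)]
    have h5 : 0 ≤ (2 * ‖a‖ + 2 * ‖φ ζ‖ ^ 2) * ‖z‖ := by positivity
    nlinarith
  · have h2 : ‖φ z‖ ≤ ‖φ z + φ ζ‖ + ‖φ ζ‖ := by simpa using norm_sub_le (φ z + φ ζ) (φ ζ)
    have h3 : ‖z‖ ≤ ‖z - a‖ + ‖a‖ := by simpa using norm_add_le (z - a) a
    have h4 : ‖φ z‖ ^ 2 ≤ 2 * ‖φ z + φ ζ‖ ^ 2 + 2 * ‖φ ζ‖ ^ 2 := by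
      nlinarith [sq_nonneg (‖φ z + φ ζ‖ - ‖φ ζ‖), norm_nonneg (φ z)]
    have h5 := mul_le_mul_of_nonneg_left h1
      (by positivity : 0 ≤ 1 + ‖a‖ + 2 * ‖φ ζ‖ ^ 2)
    have h6 : ((1 + ‖a‖ + 2 * ‖φ ζ‖ ^ 2) / r ^ 2 + 2) * ‖φ z + φ ζ‖ ^ 2 =
      (1 + ‖a‖ + 2 * ‖φ ζ‖ ^ 2) * (‖φ z + φ ζ‖ ^ 2 / r ^ 2) + 2 * ‖φ z + φ ζ‖ ^ 2 := by ring
    rw [h6]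
    linarith

/-- After adding the real part of a holomorphic function, the potential `log |z - z i|` is bounded
on `Ω`, or else the complement of `Ω` is bounded and the potential is `log (1 + |z|)` up to a
bounded error. -/
theorem exists_normalization {l : ℕ} {Ω : Set ℂ} (hΩ : IsOpen Ω) (hΩc : IsConnected Ω)
    {H : Fin l → Set ℂ} (hHr : Set.range H = holes Ω) (hHi : ∀ i, (interior (H i)).Nonempty)
    {z : Fin l → ℂ} (hz : ∀ i, z i ∈ H i) :
    ∃ g : Fin l → ℂ → ℂ, (∀ i, DifferentiableOn ℂ (g i) Ω) ∧
      ((∃ C, ∀ i, ∀ ζ ∈ Ω, |Real.log ‖ζ - z i‖ - (g i ζ).re| ≤ C) ∨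
        (Bornology.IsBounded Ωᶜ ∧
          ∃ C, ∀ i, ∀ ζ ∈ Ω, |Real.log ‖ζ - z i‖ - (g i ζ).re - Real.log (1 + ‖ζ‖)| ≤ C)) := by
  have hhole : ∀ i, IsPreconnected (H i) ∧ H i ⊆ Ωᶜ := by
    intro i
    have h1 : H i ∈ holes Ω := hHr ▸ mem_range_self i
    obtain ⟨⟨x, hx, hxe⟩, -⟩ := h1
    rw [hxe]
    exact ⟨isPreconnected_connectedComponentIn, connectedComponentIn_subset _ _⟩
  have h1 : ∀ i, ∃ g : ℂ → ℂ, DifferentiableOn ℂ g Ω ∧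
      ∃ C, ∀ ζ ∈ Ω, |Real.log ‖ζ - z i‖ - (g ζ).re - Real.log (1 + ‖ζ‖)| ≤ C := by
    intro i
    obtain ⟨b, hb⟩ := hHi i
    obtain ⟨r, hr, hrb⟩ := Metric.isOpen_iff.1 isOpen_interior b hb
    have hbH : b ∈ H i := interior_subset hb
    obtain ⟨L, hL, hexp⟩ := hasHolomorphicLog_div hΩ hΩc (hhole i).1 (hhole i).2 (hz i) hbH
    beta_reduce at hexp
    have hrΩ : ∀ ζ ∈ Ω, r ≤ ‖ζ - b‖ := by
      intro ζ hζ
      by_contra! h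
      exact (hhole i).2 (interior_subset (hrb (by rwa [Metric.mem_ball, dist_eq_norm]))) hζ
    obtain ⟨C, hC⟩ := exists_abs_log_norm_sub_le hr hrΩ
    refine ⟨L, hL, C, fun ζ hζ => ?_⟩
    have h2 : ζ - z i ≠ 0 := sub_ne_zero.2 fun h => (hhole i).2 (hz i) (h ▸ hζ)
    have h3 : (L ζ).re = Real.log ‖ζ - z i‖ - Real.log ‖ζ - b‖ := by
      rw [← Real.log_div (norm_ne_zero_iff.2 h2) (hr.trans_le (hrΩ ζ hζ)).ne', ← norm_div,
        ← hexp ζ hζ, Complex.norm_exp, Real.log_exp]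
    rw [h3, sub_sub_cancel]
    exact hC ζ hζ
  choose g hg C hC using h1
  have hC' : ∀ i, C i ≤ ∑ j, |C j| := fun i => (le_abs_self _).trans
    (Finset.single_le_sum (f := fun j => |C j|) (fun j _ => abs_nonneg _) (Finset.mem_univ i))
  by_cases hcb : Bornology.IsBounded Ωᶜ
  · exact ⟨g, hg, Or.inr ⟨hcb, _, fun i ζ hζ => (hC i ζ hζ).trans (hC' i)⟩⟩
  suffices h : ∃ G : ℂ → ℂ, DifferentiableOn ℂ G Ω ∧
      ∃ B, ∀ ζ ∈ Ω, |(G ζ).re - Real.log (1 + ‖ζ‖)| ≤ B by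
    obtain ⟨G, hG, B, hB⟩ := h
    refine ⟨fun i ζ => g i ζ + G ζ, fun i => (hg i).add hG, Or.inl ⟨∑ j, |C j| + B, fun i ζ hζ => ?_⟩⟩
    have h1 : Real.log ‖ζ - z i‖ - (g i ζ + G ζ).re =
        (Real.log ‖ζ - z i‖ - (g i ζ).re - Real.log (1 + ‖ζ‖)) -
          ((G ζ).re - Real.log (1 + ‖ζ‖)) := by
      rw [Complex.add_re]
      ring
    rw [h1]
    exact (abs_sub _ _).trans (add_le_add ((hC i ζ hζ).trans (hC' i)) (hB ζ hζ))
  by_cases hΩb : Bornology.IsBounded Ω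
  · obtain ⟨R, hR⟩ := hΩb.exists_norm_le
    refine ⟨0, differentiableOn_const 0, Real.log (1 + R), fun ζ hζ => ?_⟩
    have h2 := hR ζ hζ
    have h3 : 0 ≤ Real.log (1 + ‖ζ‖) := Real.log_nonneg (by linarith [norm_nonneg ζ])
    simp only [Pi.zero_apply, Complex.zero_re, zero_sub, abs_neg, abs_of_nonneg h3]
    exact Real.log_le_log (by positivity) (by linarith)
  · -- All but finitely many components of the complement are unbounded.
    obtain ⟨a, ha, haH⟩ : ∃ a ∈ Ωᶜ, ∀ i, a ∉ H i := by
      by_contra! h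
      refine hcb (Bornology.IsBounded.subset (Bornology.isBounded_iUnion.2 fun i => ?_)
        fun a ha => mem_iUnion.2 (h a ha))
      have h1 : H i ∈ holes Ω := hHr ▸ mem_range_self i
      exact h1.2
    refine exists_re_sub_log_le hΩ hΩc hΩb (S := connectedComponentIn Ωᶜ a)
      isPreconnected_connectedComponentIn (connectedComponentIn_subset _ _) fun hb => ?_
    have h1 : connectedComponentIn Ωᶜ a ∈ range H := hHr ▸ ⟨⟨a, ha, rfl⟩, hb⟩
    obtain ⟨i, hi⟩ := h1
    exact haH i (hi ▸ mem_connectedComponentIn ha)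

/-! ### Growth at infinity -/

theorem setLIntegral_norm_rpow_ne_top_iff {R s : ℝ} (hR : 0 < R) :
    ∫⁻ z : ℂ in {z | R < ‖z‖}, ENNReal.ofReal (‖z‖ ^ s) ≠ ∞ ↔ s < -2 := by
  have hE : MeasurableSet {z : ℂ | R < ‖z‖} := measurableSet_lt measurable_const measurable_norm
  have h1 : ∫⁻ z : ℂ in {z | R < ‖z‖}, ENNReal.ofReal (‖z‖ ^ s) =
      ∫⁻ z : ℂ, ENNReal.ofReal ((Ioi R).indicator (fun y => y ^ s) ‖z‖) := by
    rw [← lintegral_indicator hE]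
    refine lintegral_congr fun z => ?_
    by_cases hz : R < ‖z‖
    · rw [indicator_of_mem (show z ∈ {z : ℂ | R < ‖z‖} from hz),
        indicator_of_mem (show ‖z‖ ∈ Ioi R from hz)]
    · rw [indicator_of_notMem (show z ∉ {z : ℂ | R < ‖z‖} from hz),
        indicator_of_notMem (show ‖z‖ ∉ Ioi R from hz), ENNReal.ofReal_zero]
  have hm : Measurable ((Ioi R).indicator fun y : ℝ => y ^ s) :=
    (measurable_id.pow_const s).indicator measurableSet_Ioi
  have hm' : Measurable fun z : ℂ => (Ioi R).indicator (fun y : ℝ => y ^ s) ‖z‖ :=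
    hm.comp measurable_norm
  rw [h1, lintegral_ofReal_ne_top_iff_integrable hm'.aestronglyMeasurable
    (Eventually.of_forall fun z =>
      indicator_nonneg (fun y hy => Real.rpow_nonneg (hR.le.trans (le_of_lt hy)) s) _),
    integrable_fun_norm_addHaar volume, Complex.finrank_real_complex]
  have h2 : (fun y : ℝ => y ^ (2 - 1) • (Ioi R).indicator (fun y => y ^ s) y) =
      (Ioi R).indicator fun y => y ^ (s + 1) := by
    funext y
    by_cases hy : y ∈ Ioi R
    · rw [indicator_of_mem hy, indicator_of_mem hy, Real.rpow_add (hR.trans hy), Real.rpow_one,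
        smul_eq_mul]
      ring
    · rw [indicator_of_notMem hy, indicator_of_notMem hy, smul_zero]
  have h3 : Ioi R ∩ Ioi 0 = Ioi R := inter_eq_left.2 (Ioi_subset_Ioi hR.le)
  rw [h2, IntegrableOn, integrable_indicator_iff measurableSet_Ioi, IntegrableOn,
    Measure.restrict_restrict measurableSet_Ioi, h3]
  refine (integrableOn_Ioi_rpow_iff hR).trans ⟨fun h => by linarith, fun h => by linarith⟩

/-- A holomorphic function of polynomial growth near infinity vanishes there or is comparable to a
power of `|z|`. -/
theorem exists_comparable_rpow {f : ℂ → ℂ} {R A : ℝ} {N : ℕ} (hR : 0 < R)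
    (hf : DifferentiableOn ℂ f {z | R < ‖z‖})
    (hb : ∀ z, R < ‖z‖ → ‖f z‖ ≤ A * (2 + ‖z‖) ^ N) :
    ∃ R', R ≤ R' ∧ 1 ≤ R' ∧ ((∀ z, R' < ‖z‖ → f z = 0) ∨ ∃ k a b : ℝ, 0 < a ∧ 0 < b ∧
      ∀ z, R' < ‖z‖ → a * ‖z‖ ^ k ≤ ‖f z‖ ∧ ‖f z‖ ≤ b * ‖z‖ ^ k) := by
  have hopen : IsOpen {z : ℂ | R < ‖z‖} := isOpen_lt continuous_const continuous_norm
  have hnear : ∀ᶠ u : ℂ in 𝓝 0, ‖u‖ < R⁻¹ := by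
    have := Metric.ball_mem_nhds (0 : ℂ) (inv_pos.2 hR)
    filter_upwards [this] with u hu using by simpa using hu
  have hinv : ∀ u : ℂ, u ≠ 0 → ‖u‖ < R⁻¹ → R < ‖u⁻¹‖ := fun u hu h => by
    rw [norm_inv]
    exact (lt_inv_comm₀ (norm_pos_iff.2 hu) hR).1 h
  have hG : AnalyticAt ℂ (fun u : ℂ => u ^ (N + 1) * f u⁻¹) 0 := by
    refine Complex.analyticAt_of_differentiable_on_punctured_nhds_of_continuousAt ?_ ?_
    · filter_upwards [self_mem_nhdsWithin, mem_nhdsWithin_of_mem_nhds hnear] with u hu hu2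
      have h1 : DifferentiableAt ℂ f u⁻¹ := hf.differentiableAt (hopen.mem_nhds (hinv u hu hu2))
      exact (differentiableAt_id.pow (N + 1)).mul (h1.comp u (differentiableAt_inv hu))
    · rw [ContinuousAt, zero_pow (by omega), zero_mul]
      refine squeeze_zero_norm' (a := fun u : ℂ => A * (‖u‖ * (2 * ‖u‖ + 1) ^ N)) ?_ ?_
      · filter_upwards [hnear] with u hu2
        by_cases hu : u = 0
        · simp [hu]
        · have hn : 0 < ‖u‖ := norm_pos_iff.2 hu
          have h1 := mul_le_mul_of_nonneg_left (hb _ (hinv u hu hu2))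
            (pow_nonneg (norm_nonneg u) (N + 1))
          rw [norm_mul, norm_pow]
          refine h1.trans (le_of_eq ?_)
          have h2 : 2 * ‖u‖ + 1 = ‖u‖ * (2 + ‖u⁻¹‖) := by
            rw [norm_inv]
            field_simp
          rw [h2, mul_pow, pow_succ]
          ring
      · have : Continuous fun u : ℂ => A * (‖u‖ * (2 * ‖u‖ + 1) ^ N) := by fun_prop
        simpa using this.tendsto 0
  have hmer : MeromorphicAt (fun u : ℂ => f u⁻¹) 0 := ⟨N + 1, by simpa using hG⟩
  have hcob : Tendsto (fun z : ℂ => z⁻¹) (Bornology.cobounded ℂ) (𝓝[≠] 0) := by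
    rw [← inv_cobounded₀]
    exact fun s hs => by simpa using hs
  have hbasis : ∀ P : ℂ → Prop, (∀ᶠ u in 𝓝[≠] (0 : ℂ), P u) →
      ∃ R', R ≤ R' ∧ 1 ≤ R' ∧ ∀ z, R' < ‖z‖ → P z⁻¹ := by
    intro P hP
    obtain ⟨r, -, hr⟩ := hasBasis_cobounded_norm.eventually_iff.1 (hcob.eventually hP)
    refine ⟨max R (max 1 r), le_max_left _ _, (le_max_left _ _).trans (le_max_right _ _),
      fun z hz => hr ?_⟩
    exact ((le_max_right _ _).trans (le_max_right _ _)).trans hz.le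
  by_cases htop : meromorphicOrderAt (fun u : ℂ => f u⁻¹) 0 = ⊤
  · obtain ⟨R', h1, h2, h3⟩ := hbasis _ (meromorphicOrderAt_eq_top_iff.1 htop)
    exact ⟨R', h1, h2, Or.inl fun z hz => by simpa using h3 z hz⟩
  · obtain ⟨h, hh, hh0, heq⟩ := (meromorphicOrderAt_ne_top_iff hmer).1 htop
    have hpos : 0 < ‖h 0‖ := norm_pos_iff.2 hh0
    have e1 : ∀ᶠ u in 𝓝 (0 : ℂ), ‖h 0‖ / 2 < ‖h u‖ :=
      hh.continuousAt.norm.eventually (lt_mem_nhds (by linarith))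
    have e2 : ∀ᶠ u in 𝓝 (0 : ℂ), ‖h u‖ < 2 * ‖h 0‖ :=
      hh.continuousAt.norm.eventually (gt_mem_nhds (by linarith))
    obtain ⟨R', h1, h2, h3⟩ := hbasis _ (heq.and
      (((e1.and e2).filter_mono nhdsWithin_le_nhds)))
    refine ⟨R', h1, h2, Or.inr ⟨-(meromorphicOrderAt (fun u : ℂ => f u⁻¹) 0).untop₀,
      ‖h 0‖ / 2, 2 * ‖h 0‖, by positivity, by positivity, fun z hz => ?_⟩⟩
    obtain ⟨h4, h5, h6⟩ := h3 z hz
    have hz0 : 0 < ‖z‖ := one_pos.trans_le h2 |>.trans hz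
    have h7 : ‖f z‖ = ‖h z⁻¹‖ * ‖z‖ ^ (-((meromorphicOrderAt (fun u : ℂ => f u⁻¹) 0).untop₀ : ℝ)) := by
      beta_reduce at h4
      rw [inv_inv, sub_zero] at h4
      rw [h4, norm_smul, norm_zpow, norm_inv, Real.rpow_neg hz0.le, Real.rpow_intCast, inv_zpow,
        mul_comm]
    rw [h7]
    exact ⟨mul_le_mul_of_nonneg_right h5.le (Real.rpow_nonneg hz0.le _),
      mul_le_mul_of_nonneg_right h6.le (Real.rpow_nonneg hz0.le _)⟩

theorem le_exp_mul_rpow {x y s B : ℝ} (hx : 0 < x) (hy : 0 < y)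
    (h : |Real.log x - s * Real.log y| ≤ B) :
    Real.exp (-B) * y ^ s ≤ x ∧ x ≤ Real.exp B * y ^ s := by
  obtain ⟨h1, h2⟩ := abs_le.1 h
  rw [Real.rpow_def_of_pos hy, ← Real.exp_add, ← Real.exp_add]
  constructor
  · rw [← Real.le_log_iff_exp_le hx]
    linarith
  · rw [← Real.log_le_iff_le_exp hx]
    linarith

section Margin

variable {D : Set ℂ} {ρ : ℂ → ℝ} {s B : ℝ} {f : ℂ → ℂ}

/-- Functions in the Bergman space of a weight comparable to a power grow at most polynomially. -/
theorem exists_polynomial_bound (hD : IsOpen D) (hc : ContinuousOn ρ D)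
    (hpos : ∀ z ∈ D, 0 < ρ z) (hρ : ∀ ζ ∈ D, |Real.log (ρ ζ) - s * Real.log (1 + ‖ζ‖)| ≤ B)
    (hf : f ∈ bergmanSpace D ρ) :
    ∃ (A : ℝ) (N : ℕ), ∀ ζ, Metric.ball ζ 1 ⊆ D → ‖f ζ‖ ≤ A * (2 + ‖ζ‖) ^ N := by
  obtain ⟨hfd, hE⟩ := (mem_bergmanSpace_iff hD).1 hf
  rw [energy_eq_setLIntegral hD hc hfd] at hE
  set E := ∫⁻ z in D, ENNReal.ofReal (‖f z‖ ^ 2 * ρ z) with hEdef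
  obtain ⟨c, hc0, hct, hcb⟩ := lintegral_ball_lower_bound 1 one_pos
  obtain ⟨N, hN⟩ := exists_nat_ge |s|
  set V := volume (Metric.ball (0 : ℂ) 1) with hV
  have hVt : V ≠ ∞ := measure_ball_lt_top.ne
  have hB : V + ENNReal.ofReal (Real.exp B) * E ≠ ∞ :=
    ENNReal.add_ne_top.2 ⟨hVt, ENNReal.mul_ne_top ENNReal.ofReal_ne_top hE⟩
  refine ⟨(c⁻¹ * (V + ENNReal.ofReal (Real.exp B) * E)).toReal, N, fun ζ hζ => ?_⟩
  have hpow : 1 ≤ (2 + ‖ζ‖) ^ N := one_le_pow₀ (by linarith [norm_nonneg ζ])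
  have h1 : ∀ w ∈ Metric.ball ζ 1, ‖f w‖ₑ ≤ 1 + ENNReal.ofReal (Real.exp B * (2 + ‖ζ‖) ^ N) *
      ENNReal.ofReal (‖f w‖ ^ 2 * ρ w) := by
    intro w hw
    have hwD := hζ hw
    have h2 := (le_exp_mul_rpow (hpos w hwD) (by positivity) (hρ w hwD)).1
    have hw1 : ‖w‖ ≤ 1 + ‖ζ‖ := by
      have h3 : ‖w - ζ‖ < 1 := by simpa [dist_eq_norm] using hw
      have h4 : ‖w‖ ≤ ‖w - ζ‖ + ‖ζ‖ := by simpa using norm_add_le (w - ζ) ζ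
      linarith
    have h5 : (1 + ‖w‖) ^ (-s) ≤ (2 + ‖ζ‖) ^ N := by
      calc (1 + ‖w‖) ^ (-s) ≤ (1 + ‖w‖) ^ (N : ℝ) :=
            Real.rpow_le_rpow_of_exponent_le (by linarith [norm_nonneg w])
              ((neg_le_abs s).trans hN)
        _ = (1 + ‖w‖) ^ N := Real.rpow_natCast _ _
        _ ≤ (2 + ‖ζ‖) ^ N := pow_le_pow_left₀ (by positivity) (by linarith) N
    have h6 : 1 ≤ Real.exp B * (2 + ‖ζ‖) ^ N * ρ w := by
      calc (1 : ℝ) = (1 + ‖w‖) ^ (-s) * (Real.exp B * (Real.exp (-B) * (1 + ‖w‖) ^ s)) := by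
            rw [← mul_assoc (Real.exp B), ← Real.exp_add, add_neg_cancel, Real.exp_zero, one_mul,
              ← Real.rpow_add (by positivity), neg_add_cancel, Real.rpow_zero]
        _ ≤ (2 + ‖ζ‖) ^ N * (Real.exp B * ρ w) := by
            gcongr
        _ = _ := by ring
    rw [← ENNReal.ofReal_mul (by positivity), ← ENNReal.ofReal_one, ← ofReal_norm,
      ← ENNReal.ofReal_add zero_le_one (mul_nonneg (by positivity)
        (mul_nonneg (by positivity) (hpos w hwD).le))]
    refine ENNReal.ofReal_le_ofReal ?_
    have h7 : ‖f w‖ ^ 2 ≤ Real.exp B * (2 + ‖ζ‖) ^ N * (‖f w‖ ^ 2 * ρ w) := by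
      nlinarith [sq_nonneg ‖f w‖]
    nlinarith [sq_nonneg (‖f w‖ - 1), sq_nonneg ‖f w‖]
  have h2 : c * ‖f ζ‖ₑ ≤ (V + ENNReal.ofReal (Real.exp B) * E) *
      ENNReal.ofReal ((2 + ‖ζ‖) ^ N) := by
    refine (hcb f ζ (hfd.mono hζ)).trans ((setLIntegral_mono' measurableSet_ball h1).trans ?_)
    rw [lintegral_add_left measurable_const, setLIntegral_const, one_mul,
      lintegral_const_mul' _ _ ENNReal.ofReal_ne_top, Measure.addHaar_ball_center,
      ENNReal.ofReal_mul (Real.exp_nonneg _), add_mul]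
    refine add_le_add ?_ ?_
    · refine le_mul_of_one_le_right' ?_
      rwa [ENNReal.one_le_ofReal]
    · rw [mul_right_comm]
      gcongr
      exact lintegral_mono_set hζ
  have h3 : ‖f ζ‖ₑ ≤ c⁻¹ * (V + ENNReal.ofReal (Real.exp B) * E) *
      ENNReal.ofReal ((2 + ‖ζ‖) ^ N) := by
    rw [mul_assoc, ← ENNReal.mul_le_iff_le_inv hc0 hct]
    exact h2
  have h4 := ENNReal.toReal_mono (ENNReal.mul_ne_top (ENNReal.mul_ne_top
    (ENNReal.inv_ne_top.2 hc0) hB) ENNReal.ofReal_ne_top) h3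
  rw [ENNReal.toReal_mul, ENNReal.toReal_ofReal (by positivity)] at h4
  simpa using h4

/-- Near infinity square integrability is an open condition on the exponent of the weight, because
a holomorphic function behaves like a power. -/
theorem exists_integrability_margin (hD : IsOpen D) (hc : ContinuousOn ρ D)
    (hpos : ∀ z ∈ D, 0 < ρ z) (hcb : Bornology.IsBounded Dᶜ)
    (hρ : ∀ ζ ∈ D, |Real.log (ρ ζ) - s * Real.log (1 + ‖ζ‖)| ≤ B)
    (hf : f ∈ bergmanSpace D ρ) :
    ∃ ε > (0 : ℝ), ∫⁻ ζ in D, ENNReal.ofReal (‖f ζ‖ ^ 2 * ρ ζ * (1 + ‖ζ‖) ^ ε) ≠ ∞ := by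
  obtain ⟨hfd, hE⟩ := (mem_bergmanSpace_iff hD).1 hf
  rw [energy_eq_setLIntegral hD hc hfd] at hE
  obtain ⟨R₀, hR₀⟩ := hcb.exists_norm_le
  obtain ⟨A, N, hA⟩ := exists_polynomial_bound hD hc hpos hρ hf
  have hD₀ : ∀ ζ : ℂ, |R₀| < ‖ζ‖ → ζ ∈ D := fun ζ hζ => by
    by_contra h
    exact absurd (hR₀ ζ h) (not_le.2 ((le_abs_self _).trans_lt hζ))
  have hmem : ∀ ζ : ℂ, |R₀| + 1 < ‖ζ‖ → ζ ∈ D := fun ζ hζ => hD₀ ζ (by linarith)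
  obtain ⟨R, hR1, hR2, hR⟩ := exists_comparable_rpow (f := f) (R := |R₀| + 1) (A := A) (N := N)
    (by positivity) (hfd.mono hmem) fun ζ hζ => hA ζ fun w hw => hD₀ w (by
      have h3 : ‖w - ζ‖ < 1 := by simpa [dist_eq_norm] using hw
      have h4 : ‖ζ‖ ≤ ‖w‖ + ‖w - ζ‖ := by simpa using norm_sub_le w (w - ζ)
      linarith)
  have hED : {ζ : ℂ | R < ‖ζ‖} ⊆ D := fun ζ hζ => hmem ζ (hR1.trans_lt hζ)
  have hEm : MeasurableSet {ζ : ℂ | R < ‖ζ‖} := measurableSet_lt measurable_const measurable_norm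
  have hR0 : 0 < R := one_pos.trans_le hR2
  -- Only the part of the integral near infinity matters.
  have hsplit : ∀ ε > (0 : ℝ), ∫⁻ ζ in {ζ : ℂ | R < ‖ζ‖},
      ENNReal.ofReal (‖f ζ‖ ^ 2 * ρ ζ * (1 + ‖ζ‖) ^ ε) ≠ ∞ →
      ∫⁻ ζ in D, ENNReal.ofReal (‖f ζ‖ ^ 2 * ρ ζ * (1 + ‖ζ‖) ^ ε) ≠ ∞ := by
    intro ε hε h
    have h1 : D ⊆ D ∩ Metric.closedBall 0 R ∪ {ζ : ℂ | R < ‖ζ‖} := fun ζ hζ => by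
      rcases le_or_gt ‖ζ‖ R with h | h
      · exact Or.inl ⟨hζ, by simpa using h⟩
      · exact Or.inr h
    have h2 : ∫⁻ ζ in D ∩ Metric.closedBall 0 R,
        ENNReal.ofReal (‖f ζ‖ ^ 2 * ρ ζ * (1 + ‖ζ‖) ^ ε) ≤
        (∫⁻ z in D, ENNReal.ofReal (‖f z‖ ^ 2 * ρ z)) * ENNReal.ofReal ((1 + R) ^ ε) := by
      rw [← lintegral_mul_const' _ _ ENNReal.ofReal_ne_top]
      refine (setLIntegral_mono' (hD.measurableSet.inter Metric.isClosed_closedBall.measurableSet)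
        fun ζ hζ => ?_).trans (lintegral_mono_set inter_subset_left)
      have h3 : 0 ≤ ‖f ζ‖ ^ 2 * ρ ζ := mul_nonneg (by positivity) (hpos ζ hζ.1).le
      have h4 : ‖ζ‖ ≤ R := by simpa using hζ.2
      rw [← ENNReal.ofReal_mul h3]
      refine ENNReal.ofReal_le_ofReal (mul_le_mul_of_nonneg_left ?_ h3)
      exact Real.rpow_le_rpow (by positivity) (by linarith) hε.le
    refine ne_top_of_le_ne_top ?_ ((lintegral_mono_set h1).trans (lintegral_union_le _ _ _))
    exact ENNReal.add_ne_top.2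
      ⟨ne_top_of_le_ne_top (ENNReal.mul_ne_top hE ENNReal.ofReal_ne_top) h2, h⟩
  rcases hR with hR | ⟨k, a, b, ha, hb, hab⟩
  · refine ⟨1, one_pos, hsplit 1 one_pos ?_⟩
    rw [setLIntegral_congr_fun (g := fun _ => 0) hEm fun ζ hζ => by simp [hR ζ hζ]]
    simp
  · have hρ' : ∀ ζ : ℂ, R < ‖ζ‖ →
        |Real.log (ρ ζ) - s * Real.log ‖ζ‖| ≤ B + |s| * Real.log 2 := by
      intro ζ hζ
      have hζ1 : 1 < ‖ζ‖ := hR2.trans_lt hζ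
      have h1 : |Real.log (1 + ‖ζ‖) - Real.log ‖ζ‖| ≤ Real.log 2 := by
        have h2 := Real.log_le_log (by linarith : 0 < ‖ζ‖) (by linarith : ‖ζ‖ ≤ 1 + ‖ζ‖)
        have h3 := Real.log_le_log (by linarith : 0 < 1 + ‖ζ‖) (by linarith : 1 + ‖ζ‖ ≤ 2 * ‖ζ‖)
        rw [Real.log_mul two_ne_zero (by linarith)] at h3
        rw [abs_of_nonneg (by linarith)]
        linarith
      have h2 : Real.log (ρ ζ) - s * Real.log ‖ζ‖ = (Real.log (ρ ζ) - s * Real.log (1 + ‖ζ‖)) +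
          s * (Real.log (1 + ‖ζ‖) - Real.log ‖ζ‖) := by ring
      rw [h2]
      refine (abs_add_le _ _).trans (add_le_add (hρ ζ (hED hζ)) ?_)
      rw [abs_mul]
      exact mul_le_mul_of_nonneg_left h1 (abs_nonneg s)
    set B' := B + |s| * Real.log 2
    have hsq : ∀ ζ : ℂ, R < ‖ζ‖ → (‖ζ‖ ^ k) ^ 2 * ‖ζ‖ ^ s = ‖ζ‖ ^ (2 * k + s) := by
      intro ζ hζ
      have h0 := hR0.trans hζ
      rw [Real.rpow_add h0, mul_comm 2 k, Real.rpow_mul h0.le, Real.rpow_ofNat]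
    have hks : 2 * k + s < -2 := by
      rw [← setLIntegral_norm_rpow_ne_top_iff hR0]
      have h1 : ENNReal.ofReal (a ^ 2 * Real.exp (-B')) *
          ∫⁻ ζ : ℂ in {ζ | R < ‖ζ‖}, ENNReal.ofReal (‖ζ‖ ^ (2 * k + s)) ≤
          ∫⁻ z in D, ENNReal.ofReal (‖f z‖ ^ 2 * ρ z) := by
        rw [← lintegral_const_mul' _ _ ENNReal.ofReal_ne_top]
        refine (setLIntegral_mono' hEm fun ζ hζ => ?_).trans (lintegral_mono_set hED)
        rw [← ENNReal.ofReal_mul (by positivity)]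
        refine ENNReal.ofReal_le_ofReal ?_
        rw [← hsq ζ hζ]
        have h2 := (le_exp_mul_rpow (hpos ζ (hED hζ)) (hR0.trans hζ) (hρ' ζ hζ)).1
        have h3 := (hab ζ hζ).1
        calc a ^ 2 * Real.exp (-B') * ((‖ζ‖ ^ k) ^ 2 * ‖ζ‖ ^ s)
            = (a * ‖ζ‖ ^ k) ^ 2 * (Real.exp (-B') * ‖ζ‖ ^ s) := by ring
          _ ≤ ‖f ζ‖ ^ 2 * ρ ζ := by gcongr
      have h4 := ne_top_of_le_ne_top hE h1
      refine fun htop => h4 ?_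
      rw [htop, ENNReal.mul_top]
      simpa using by positivity
    set ε := (-2 - (2 * k + s)) / 2 with hε
    have hε0 : 0 < ε := by rw [hε]; linarith
    refine ⟨ε, hε0, hsplit ε hε0 ?_⟩
    have h1 : ∫⁻ ζ in {ζ : ℂ | R < ‖ζ‖}, ENNReal.ofReal (‖f ζ‖ ^ 2 * ρ ζ * (1 + ‖ζ‖) ^ ε) ≤
        ENNReal.ofReal (b ^ 2 * Real.exp B' * 2 ^ ε) *
          ∫⁻ ζ : ℂ in {ζ | R < ‖ζ‖}, ENNReal.ofReal (‖ζ‖ ^ (2 * k + s + ε)) := by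
      rw [← lintegral_const_mul' _ _ ENNReal.ofReal_ne_top]
      refine setLIntegral_mono' hEm fun ζ hζ => ?_
      rw [← ENNReal.ofReal_mul (by positivity)]
      refine ENNReal.ofReal_le_ofReal ?_
      have h0 := hR0.trans hζ
      have h2 := (le_exp_mul_rpow (hpos ζ (hED hζ)) (hR0.trans hζ) (hρ' ζ hζ)).2
      have h3 := (hab ζ hζ).2
      have h5 : (1 + ‖ζ‖) ^ ε ≤ 2 ^ ε * ‖ζ‖ ^ ε := by
        rw [← Real.mul_rpow (by norm_num) h0.le]
        refine Real.rpow_le_rpow (by positivity) ?_ hε0.le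
        have : R < ‖ζ‖ := hζ
        linarith
      have h6 := (hpos ζ (hED hζ)).le
      rw [Real.rpow_add h0, ← hsq ζ hζ]
      calc ‖f ζ‖ ^ 2 * ρ ζ * (1 + ‖ζ‖) ^ ε
          ≤ (b * ‖ζ‖ ^ k) ^ 2 * (Real.exp B' * ‖ζ‖ ^ s) * (2 ^ ε * ‖ζ‖ ^ ε) := by gcongr
        _ = _ := by ring
    refine ne_top_of_le_ne_top (ENNReal.mul_ne_top ENNReal.ofReal_ne_top ?_) h1
    rw [setLIntegral_norm_rpow_ne_top_iff hR0, hε]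
    linarith

end Margin

/-! ### The normalized weights -/

/-- The weight `exp (-2 ∑ Q i (log |ζ - z i| - Re g i))`, which differs from `logWeight z Q` by the
squared modulus of a holomorphic function when the `g i` are holomorphic. -/
noncomputable def normalizedWeight {l : ℕ} (z : Fin l → ℂ) (g : Fin l → ℂ → ℂ) (Q : Fin l → ℝ)
    (ζ : ℂ) : ℝ :=
  Real.exp (-2 * ∑ i, Q i * (Real.log ‖ζ - z i‖ - (g i ζ).re))

theorem normalizedWeight_eq {l : ℕ} {z : Fin l → ℂ} (g : Fin l → ℂ → ℂ) (Q : Fin l → ℝ) {ζ : ℂ}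
    (hζ : ∀ i, ζ ≠ z i) :
    normalizedWeight z g Q ζ = logWeight z Q ζ * ‖Complex.exp (∑ i, Q i * g i ζ)‖ ^ 2 := by
  have h1 : logWeight z Q ζ = Real.exp (-2 * ∑ i, Q i * Real.log ‖ζ - z i‖) := by
    rw [logWeight, Finset.mul_sum, Real.exp_sum]
    refine Finset.prod_congr rfl fun i _ => ?_
    rw [Real.rpow_def_of_pos (norm_pos_iff.2 (sub_ne_zero.2 (hζ i)))]
    congr 1
    ring
  rw [h1, Complex.norm_exp, ← Real.exp_nat_mul, ← Real.exp_add, normalizedWeight]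
  congr 1
  simp only [Complex.re_sum, Complex.re_ofReal_mul, mul_sub, Finset.sum_sub_distrib]
  push_cast
  ring

/-- If the potentials are at bounded distance from a common function, and the Bergman spaces have an
integrability margin with respect to that function, then the weights form a continuous family. -/
theorem isContinuousWeightFamily_of_margin {l : ℕ} {Ω : Set ℂ} (hΩ : IsOpen Ω) {z : Fin l → ℂ}
    (hz : ∀ i, z i ∉ Ω) {g : Fin l → ℂ → ℂ} (hg : ∀ i, DifferentiableOn ℂ (g i) Ω) {ψ : ℂ → ℝ}
    {C : ℝ} (hψ : ∀ ζ ∈ Ω, 0 ≤ ψ ζ)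
    (hC : ∀ i, ∀ ζ ∈ Ω, |Real.log ‖ζ - z i‖ - (g i ζ).re - ψ ζ| ≤ C)
    (hmargin : ∀ Q, ∀ f ∈ bergmanSpace Ω (normalizedWeight z g Q), ∃ ε > 0,
      ∫⁻ ζ in Ω, ENNReal.ofReal (‖f ζ‖ ^ 2 * normalizedWeight z g Q ζ * Real.exp (ε * ψ ζ)) ≠ ∞) :
    IsContinuousWeightFamily Ω (normalizedWeight z g) := by
  have hcont : ∀ Q, ∀ a ∈ Ω, Tendsto (fun p : (Fin l → ℝ) × ℂ => normalizedWeight z g p.1 p.2)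
      (𝓝 Q ×ˢ 𝓝 a) (𝓝 (normalizedWeight z g Q a)) := by
    intro Q a ha
    refine (Real.continuous_exp.tendsto _).comp (Tendsto.const_mul _ (tendsto_finsetSum _
      fun i _ => ?_))
    have h1 : Tendsto (fun p : (Fin l → ℝ) × ℂ => p.1 i) (𝓝 Q ×ˢ 𝓝 a) (𝓝 (Q i)) :=
      ((continuous_apply i).tendsto Q).comp tendsto_fst
    have h2 : ContinuousAt (fun ζ => Real.log ‖ζ - z i‖ - (g i ζ).re) a := by
      refine ContinuousAt.sub (ContinuousAt.log (by fun_prop) ?_) ?_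
      · exact norm_ne_zero_iff.2 (sub_ne_zero.2 fun h => hz i (h ▸ ha))
      · exact Complex.continuous_re.continuousAt.comp
          ((hg i).continuousOn.continuousAt (hΩ.mem_nhds ha))
    exact h1.mul (h2.tendsto.comp tendsto_snd)
  have hpos : ∀ Q, ∀ ζ ∈ Ω, 0 < normalizedWeight z g Q ζ := fun Q ζ _ => Real.exp_pos _
  have hcon : ∀ Q, ContinuousOn (normalizedWeight z g Q) Ω := by
    intro Q a ha
    have h1 : Tendsto (fun ζ : ℂ => ((Q, ζ) : (Fin l → ℝ) × ℂ)) (𝓝 a) (𝓝 Q ×ˢ 𝓝 a) :=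
      tendsto_const_nhds.prodMk tendsto_id
    exact ((hcont Q a ha).comp h1).mono_left nhdsWithin_le_nhds
  refine ⟨hΩ, hcont, hpos, fun Q f hf => ?_⟩
  obtain ⟨ε, hε, hint⟩ := hmargin Q f hf
  simp_rw [energy_eq_setLIntegral hΩ (hcon _) hf.1]
  have hnear : ∀ᶠ Q' in 𝓝 Q, 2 * ∑ i, |Q' i - Q i| < min ε 1 := by
    have h1 : Continuous fun Q' : Fin l → ℝ => 2 * ∑ i, |Q' i - Q i| := by fun_prop
    refine (h1.tendsto Q).eventually (gt_mem_nhds ?_)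
    simpa using hε
  refine tendsto_of_seq_tendsto fun Qn hQn => ?_
  obtain ⟨n₀, hn₀⟩ := eventually_atTop.1 (hQn.eventually hnear)
  refine (tendsto_add_atTop_iff_nat n₀).1 ?_
  refine tendsto_lintegral_of_dominated_convergence' (fun ζ => ENNReal.ofReal (Real.exp |C|) *
    ENNReal.ofReal (‖f ζ‖ ^ 2 * normalizedWeight z g Q ζ * Real.exp (ε * ψ ζ))) (fun n => ?_)
    (fun n => ?_) ?_ ?_
  · exact (((hf.1.continuousOn.norm.pow 2).mul (hcon _)).aemeasurable
      hΩ.measurableSet).ennreal_ofReal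
  · filter_upwards [ae_restrict_mem hΩ.measurableSet] with ζ hζ
    have hn := hn₀ (n + n₀) (by omega)
    set Q' := Qn (n + n₀)
    rw [← ENNReal.ofReal_mul (by positivity)]
    refine ENNReal.ofReal_le_ofReal ?_
    have h1 : normalizedWeight z g Q' ζ ≤
        normalizedWeight z g Q ζ * (Real.exp |C| * Real.exp (ε * ψ ζ)) := by
      rw [normalizedWeight, normalizedWeight, ← Real.exp_add, ← Real.exp_add, Real.exp_le_exp]
      have h2 : -2 * ∑ i, Q' i * (Real.log ‖ζ - z i‖ - (g i ζ).re) =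
          -2 * ∑ i, Q i * (Real.log ‖ζ - z i‖ - (g i ζ).re) +
            -2 * ∑ i, (Q' i - Q i) * (Real.log ‖ζ - z i‖ - (g i ζ).re) := by
        rw [← mul_add, ← Finset.sum_add_distrib]
        congr 1
        refine Finset.sum_congr rfl fun i _ => ?_
        ring
      have h3 : |∑ i, (Q' i - Q i) * (Real.log ‖ζ - z i‖ - (g i ζ).re)| ≤
          (∑ i, |Q' i - Q i|) * (|C| + ψ ζ) := by
        rw [Finset.sum_mul]
        refine (Finset.abs_sum_le_sum_abs _ _).trans (Finset.sum_le_sum fun i _ => ?_)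
        rw [abs_mul]
        refine mul_le_mul_of_nonneg_left ?_ (abs_nonneg _)
        have h4 := abs_le.1 (hC i ζ hζ)
        rw [abs_le]
        constructor <;> linarith [le_abs_self C, hψ ζ hζ]
      have h5 := (abs_le.1 h3).1
      have h6 : 2 * ((∑ i, |Q' i - Q i|) * (|C| + ψ ζ)) ≤ |C| + ε * ψ ζ := by
        have h7 := mul_le_mul_of_nonneg_right (hn.le.trans (min_le_right _ _)) (abs_nonneg C)
        have h8 := mul_le_mul_of_nonneg_right (hn.le.trans (min_le_left _ _)) (hψ ζ hζ)
        nlinarith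
      rw [h2]
      linarith
    calc ‖f ζ‖ ^ 2 * normalizedWeight z g Q' ζ
        ≤ ‖f ζ‖ ^ 2 * (normalizedWeight z g Q ζ * (Real.exp |C| * Real.exp (ε * ψ ζ))) := by
          gcongr
      _ = _ := by ring
  · rw [lintegral_const_mul' _ _ ENNReal.ofReal_ne_top]
    exact ENNReal.mul_ne_top ENNReal.ofReal_ne_top hint
  · filter_upwards [ae_restrict_mem hΩ.measurableSet] with ζ hζ
    refine ENNReal.tendsto_ofReal (Tendsto.const_mul _ ?_)
    have h1 : Tendsto (fun n => ((Qn (n + n₀), ζ) : (Fin l → ℝ) × ℂ)) atTop (𝓝 Q ×ˢ 𝓝 ζ) :=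
      (hQn.comp (tendsto_add_atTop_nat n₀)).prodMk tendsto_const_nhds
    have h2 := (hcont Q ζ hζ).comp h1
    exact h2

theorem continuousOn_normalizedWeight {l : ℕ} {Ω : Set ℂ} {z : Fin l → ℂ} {g : Fin l → ℂ → ℂ}
    (hg : ∀ i, DifferentiableOn ℂ (g i) Ω) (hzΩ : ∀ i, z i ∉ Ω) (Q : Fin l → ℝ) :
    ContinuousOn (normalizedWeight z g Q) Ω := by
  refine (ContinuousOn.const_mul ?_ _).rexp
  refine continuousOn_finsetSum _ fun i _ => ContinuousOn.const_mul ?_ _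
  refine ContinuousOn.sub (ContinuousOn.log (by fun_prop) fun ζ hζ => ?_)
    (Complex.continuous_re.comp_continuousOn (hg i).continuousOn)
  exact norm_ne_zero_iff.2 (sub_ne_zero.2 fun h => hzΩ i (h ▸ hζ))

theorem exists_isContinuousWeightFamily {l : ℕ} {Ω : Set ℂ} (hΩ : IsOpen Ω) (hΩc : IsConnected Ω)
    {H : Fin l → Set ℂ} (hHr : Set.range H = holes Ω) (hHi : ∀ i, (interior (H i)).Nonempty)
    {z : Fin l → ℂ} (hz : ∀ i, z i ∈ H i) (hzΩ : ∀ i, z i ∉ Ω) :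
    ∃ g : Fin l → ℂ → ℂ, (∀ i, DifferentiableOn ℂ (g i) Ω) ∧
      IsContinuousWeightFamily Ω (normalizedWeight z g) := by
  obtain ⟨g, hg, ⟨C, hC⟩ | ⟨hcb, C, hC⟩⟩ := exists_normalization hΩ hΩc hHr hHi hz
  · refine ⟨g, hg, isContinuousWeightFamily_of_margin hΩ hzΩ hg (ψ := 0) (fun _ _ => le_rfl)
      (by simpa using hC) fun Q f hf => ⟨1, one_pos, ?_⟩⟩
    have hc : ContinuousOn (normalizedWeight z g Q) Ω := continuousOn_normalizedWeight hg hzΩ Q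
    have h1 := ((mem_bergmanSpace_iff hΩ).1 hf).2
    rw [energy_eq_setLIntegral hΩ hc hf.1] at h1
    simpa using h1
  · refine ⟨g, hg, isContinuousWeightFamily_of_margin hΩ hzΩ hg
      (ψ := fun ζ => Real.log (1 + ‖ζ‖))
      (fun ζ _ => Real.log_nonneg (by linarith [norm_nonneg ζ])) hC fun Q f hf => ?_⟩
    have hc : ContinuousOn (normalizedWeight z g Q) Ω := continuousOn_normalizedWeight hg hzΩ Q
    have hlog : ∀ ζ ∈ Ω, |Real.log (normalizedWeight z g Q ζ) - -2 * (∑ i, Q i) *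
        Real.log (1 + ‖ζ‖)| ≤ 2 * ∑ i, |Q i| * C := by
      intro ζ hζ
      have h1 : Real.log (normalizedWeight z g Q ζ) - -2 * (∑ i, Q i) * Real.log (1 + ‖ζ‖) =
          -2 * ∑ i, Q i * (Real.log ‖ζ - z i‖ - (g i ζ).re - Real.log (1 + ‖ζ‖)) := by
        rw [normalizedWeight, Real.log_exp, mul_assoc, ← mul_sub, Finset.sum_mul,
          ← Finset.sum_sub_distrib]
        congr 1
        refine Finset.sum_congr rfl fun i _ => ?_
        ring
      rw [h1, abs_mul, abs_neg, abs_two]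
      refine mul_le_mul_of_nonneg_left ((Finset.abs_sum_le_sum_abs _ _).trans
        (Finset.sum_le_sum fun i _ => ?_)) two_pos.le
      rw [abs_mul]
      exact mul_le_mul_of_nonneg_left (hC i ζ hζ) (abs_nonneg _)
    obtain ⟨ε, hε, h⟩ := exists_integrability_margin hΩ hc (fun ζ _ => Real.exp_pos _) hcb hlog hf
    refine ⟨ε, hε, ?_⟩
    convert h using 6 with ζ
    rw [Real.rpow_def_of_pos (by positivity), mul_comm]

/-! ### Monodromy around a compact set -/

section Transport

variable {γ : ℝ → ℂ} {u : ℂ} {α β : ℝ}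

/-- The solution of `M' = R M` along a segment. -/
theorem exp_integral_mul_eq {M R : ℂ → ℂ} (hαβ : α ≤ β) (hγ : ∀ x, HasDerivAt γ u x)
    (hM : ∀ x ∈ Icc α β, HasDerivAt M (R (γ x) * M (γ x)) (γ x))
    (hR : ContinuousOn (fun x => R (γ x)) (Icc α β)) :
    Complex.exp (u * ∫ x in α..β, R (γ x)) * M (γ α) = M (γ β) := by
  set r : ℝ → ℂ := IccExtend hαβ ((Icc α β).domRestrict fun x => R (γ x)) with hr
  have hrc : Continuous r := hR.domRestrict.Icc_extend'
  have hre : ∀ x ∈ Icc α β, r x = R (γ x) := fun x hx => IccExtend_of_mem hαβ _ hx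
  have hint : ∫ x in α..β, R (γ x) = ∫ x in α..β, r x :=
    intervalIntegral.integral_congr fun x hx => (hre x (uIcc_of_le hαβ ▸ hx)).symm
  have hderiv : ∀ x ∈ Icc α β,
      HasDerivAt (fun t => Complex.exp (-(u * ∫ s in α..t, r s)) * M (γ t)) 0 x := by
    intro x hx
    have h1 : HasDerivAt (fun t => ∫ s in α..t, r s) (r x) x :=
      (hrc.integral_hasStrictDerivAt α x).hasDerivAt
    have h2 : HasDerivAt (fun t => M (γ t)) (R (γ x) * M (γ x) * u) x :=
      (hM x hx).comp x (hγ x)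
    refine ((h1.const_mul u).neg.cexp.mul h2).congr_deriv ?_
    rw [hre x hx]
    ring
  have hconst := constant_of_has_deriv_right_zero
    (fun x hx => (hderiv x hx).continuousAt.continuousWithinAt)
    (fun x hx => (hderiv x (Ico_subset_Icc_self hx)).hasDerivWithinAt) β (right_mem_Icc.2 hαβ)
  rw [intervalIntegral.integral_same, mul_zero, neg_zero, Complex.exp_zero, one_mul] at hconst
  rw [← hconst, hint, ← mul_assoc, ← Complex.exp_add, add_neg_cancel, Complex.exp_zero, one_mul]

theorem integral_inv_eq_log_sub (hγ : ∀ x, HasDerivAt γ u x)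
    (hs : ∀ x ∈ uIcc α β, γ x ∈ Complex.slitPlane) :
    u * ∫ x in α..β, (γ x)⁻¹ = Complex.log (γ β) - Complex.log (γ α) := by
  rw [← intervalIntegral.integral_const_mul]
  refine intervalIntegral.integral_eq_sub_of_hasDerivAt (f := fun x => Complex.log (γ x))
    (fun x hx => ?_) ?_
  · exact HasDerivAt.congr_deriv (HasDerivAt.clog_real (hγ x) (hs x hx)) (div_eq_mul_inv _ _)
  · refine ContinuousOn.intervalIntegrable (continuousOn_const.mul (ContinuousOn.inv₀ ?_ ?_))
    · exact fun x _ => (hγ x).continuousAt.continuousWithinAt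
    · exact fun x hx => Complex.slitPlane_ne_zero (hs x hx)

end Transport

theorem hasDerivAt_horizontal (a : ℂ) (x : ℝ) : HasDerivAt (fun x : ℝ => (x : ℂ) + a) 1 x :=
  Complex.ofRealCLM.hasDerivAt.add_const a

theorem hasDerivAt_vertical (a : ℂ) (y : ℝ) :
    HasDerivAt (fun y : ℝ => a + y * Complex.I) Complex.I y := by
  have h := (Complex.ofRealCLM.hasDerivAt (x := y)).mul_const Complex.I
  simpa using h.const_add a

/-- The integral of `f` along the boundary of the rectangle `[x₀, x₁] × [y₀, y₁]`. -/
noncomputable def rectIntegral (f : ℂ → ℂ) (x₀ x₁ y₀ y₁ : ℝ) : ℂ :=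
  (∫ x : ℝ in x₀..x₁, f (x + y₀ * Complex.I)) - (∫ x : ℝ in x₀..x₁, f (x + y₁ * Complex.I)) +
    Complex.I * (∫ y : ℝ in y₀..y₁, f (x₁ + y * Complex.I)) -
    Complex.I * ∫ y : ℝ in y₀..y₁, f (x₀ + y * Complex.I)

theorem rectIntegral_eq_zero {f : ℂ → ℂ} {x₀ x₁ y₀ y₁ : ℝ} (hx : x₀ ≤ x₁) (hy : y₀ ≤ y₁)
    (hf : DifferentiableOn ℂ f (Icc x₀ x₁ ×ℂ Icc y₀ y₁)) : rectIntegral f x₀ x₁ y₀ y₁ = 0 := by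
  have h := Complex.integral_boundary_rect_eq_zero_of_differentiableOn f ⟨x₀, y₀⟩ ⟨x₁, y₁⟩
    (by simpa only [uIcc_of_le hx, uIcc_of_le hy] using hf)
  simp only [smul_eq_mul] at h
  exact h

theorem log_I_mul {w : ℂ} (hw : w ≠ 0) (harg : w.arg ≤ Real.pi / 2) :
    Complex.log (Complex.I * w) - Complex.log w = Real.pi / 2 * Complex.I := by
  rw [(Complex.log_mul_eq_add_log_iff Complex.I_ne_zero hw).2, Complex.log_I, add_sub_cancel_right]
  rw [Complex.arg_I]
  constructor <;> linarith [Complex.neg_pi_lt_arg w, Real.pi_pos]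

theorem rectIntegral_inv_sub (c : ℂ) {h : ℝ} (hh : 0 < h) :
    rectIntegral (fun z => (z - c)⁻¹) (c.re - h) (c.re + h) (c.im - h) (c.im + h) =
      2 * Real.pi * Complex.I := by
  have e1 : ∫ x : ℝ in (c.re - h)..(c.re + h),
      ((x : ℂ) + ((c.im - h : ℝ) : ℂ) * Complex.I - c)⁻¹ = Real.pi / 2 * Complex.I := by
    have h1 := integral_inv_eq_log_sub (α := c.re - h) (β := c.re + h)
      (hasDerivAt_horizontal (((c.im - h : ℝ) : ℂ) * Complex.I - c)) fun x _ => by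
        refine Complex.mem_slitPlane_iff.2 (Or.inr (ne_of_lt ?_))
        simpa using hh
    rw [one_mul] at h1
    simp only [← add_sub_assoc] at h1
    rw [h1]
    have h2 : ((c.re - h : ℝ) : ℂ) + ((c.im - h : ℝ) : ℂ) * Complex.I - c = ⟨-h, -h⟩ := by
      apply Complex.ext <;> simp
    have h3 : ((c.re + h : ℝ) : ℂ) + ((c.im - h : ℝ) : ℂ) * Complex.I - c =
        Complex.I * ⟨-h, -h⟩ := by
      apply Complex.ext <;> simp
    rw [h2, h3, log_I_mul]
    · exact fun h0 => hh.ne' (by simpa using congrArg Complex.re h0)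
    · exact (Complex.arg_neg_iff.2 (by simpa using hh)).le.trans (by positivity)
  have e2 : ∫ x : ℝ in (c.re - h)..(c.re + h),
      ((x : ℂ) + ((c.im + h : ℝ) : ℂ) * Complex.I - c)⁻¹ = -(Real.pi / 2 * Complex.I) := by
    have h1 := integral_inv_eq_log_sub (α := c.re - h) (β := c.re + h)
      (hasDerivAt_horizontal (((c.im + h : ℝ) : ℂ) * Complex.I - c)) fun x _ => by
        refine Complex.mem_slitPlane_iff.2 (Or.inr (ne_of_gt ?_))
        simpa using hh
    rw [one_mul] at h1
    simp only [← add_sub_assoc] at h1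
    rw [h1]
    have h2 : ((c.re - h : ℝ) : ℂ) + ((c.im + h : ℝ) : ℂ) * Complex.I - c =
        Complex.I * ⟨h, h⟩ := by
      apply Complex.ext <;> simp
    have h3 : ((c.re + h : ℝ) : ℂ) + ((c.im + h : ℝ) : ℂ) * Complex.I - c = ⟨h, h⟩ := by
      apply Complex.ext <;> simp
    rw [h2, h3, ← neg_sub, log_I_mul]
    · exact fun h0 => hh.ne' (by simpa using congrArg Complex.re h0)
    · exact (abs_le.1 (Complex.abs_arg_le_pi_div_two_iff.2 hh.le)).2
  have e3 : Complex.I * ∫ y : ℝ in (c.im - h)..(c.im + h),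
      (((c.re + h : ℝ) : ℂ) + (y : ℂ) * Complex.I - c)⁻¹ = Real.pi / 2 * Complex.I := by
    have h1 := integral_inv_eq_log_sub (α := c.im - h) (β := c.im + h)
      (hasDerivAt_vertical (((c.re + h : ℝ) : ℂ) - c)) fun x _ => by
        refine Complex.mem_slitPlane_iff.2 (Or.inl ?_)
        simpa using hh
    simp only [sub_add_eq_add_sub] at h1
    rw [h1]
    have h2 : ((c.re + h : ℝ) : ℂ) + ((c.im - h : ℝ) : ℂ) * Complex.I - c = ⟨h, -h⟩ := by
      apply Complex.ext <;> simp
    have h3 : ((c.re + h : ℝ) : ℂ) + ((c.im + h : ℝ) : ℂ) * Complex.I - c =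
        Complex.I * ⟨h, -h⟩ := by
      apply Complex.ext <;> simp
    rw [h2, h3, log_I_mul]
    · exact fun h0 => hh.ne' (by simpa using congrArg Complex.re h0)
    · exact (abs_le.1 (Complex.abs_arg_le_pi_div_two_iff.2 hh.le)).2
  -- The left side crosses the branch cut of `log`, so `log (c - z)` is the primitive there.
  have e4 : Complex.I * ∫ y : ℝ in (c.im - h)..(c.im + h),
      (((c.re - h : ℝ) : ℂ) + (y : ℂ) * Complex.I - c)⁻¹ = -(Real.pi / 2 * Complex.I) := by
    have h1 := integral_inv_eq_log_sub (α := c.im - h) (β := c.im + h)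
      (γ := fun y : ℝ => -(((c.re - h : ℝ) : ℂ) + (y : ℂ) * Complex.I - c))
      (fun y => ((hasDerivAt_vertical ((c.re - h : ℝ) : ℂ) y).sub_const c).neg) fun x _ => by
        refine Complex.mem_slitPlane_iff.2 (Or.inl ?_)
        simpa using hh
    simp only [inv_neg, intervalIntegral.integral_neg, neg_mul_neg] at h1
    rw [h1]
    have h2 : -(((c.re - h : ℝ) : ℂ) + ((c.im - h : ℝ) : ℂ) * Complex.I - c) =
        Complex.I * ⟨h, -h⟩ := by
      apply Complex.ext <;> simp
    have h3 : -(((c.re - h : ℝ) : ℂ) + ((c.im + h : ℝ) : ℂ) * Complex.I - c) = ⟨h, -h⟩ := by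
      apply Complex.ext <;> simp
    rw [h2, h3, ← neg_sub, log_I_mul]
    · exact fun h0 => hh.ne' (by simpa using congrArg Complex.re h0)
    · exact (abs_le.1 (Complex.abs_arg_le_pi_div_two_iff.2 hh.le)).2
  rw [rectIntegral, e1, e2, e3, e4]
  ring

theorem rectIntegral_add {f g : ℂ → ℂ} {x₀ x₁ y₀ y₁ : ℝ} (hx : x₀ ≤ x₁) (hy : y₀ ≤ y₁)
    (hf : ∀ z ∈ Icc x₀ x₁ ×ℂ Icc y₀ y₁,
      z.re = x₀ ∨ z.re = x₁ ∨ z.im = y₀ ∨ z.im = y₁ → ContinuousAt f z)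
    (hg : ∀ z ∈ Icc x₀ x₁ ×ℂ Icc y₀ y₁,
      z.re = x₀ ∨ z.re = x₁ ∨ z.im = y₀ ∨ z.im = y₁ → ContinuousAt g z) :
    rectIntegral (fun z => f z + g z) x₀ x₁ y₀ y₁ =
      rectIntegral f x₀ x₁ y₀ y₁ + rectIntegral g x₀ x₁ y₀ y₁ := by
  have hH : ∀ φ : ℂ → ℂ, (∀ z ∈ Icc x₀ x₁ ×ℂ Icc y₀ y₁,
      z.re = x₀ ∨ z.re = x₁ ∨ z.im = y₀ ∨ z.im = y₁ → ContinuousAt φ z) → ∀ y, y = y₀ ∨ y = y₁ →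
      IntervalIntegrable (fun x : ℝ => φ (x + y * Complex.I)) volume x₀ x₁ := by
    intro φ hφ y hyy
    refine ContinuousOn.intervalIntegrable fun x hx' => ?_
    rw [uIcc_of_le hx] at hx'
    have h1 : ContinuousAt φ ((x : ℂ) + y * Complex.I) := by
      refine hφ _ ?_ ?_
      · rw [Complex.mem_reProdIm]
        rcases hyy with rfl | rfl <;> simpa [hy] using hx'
      · rcases hyy with rfl | rfl <;> simp
    refine ContinuousAt.continuousWithinAt ?_
    exact ContinuousAt.comp (f := fun x : ℝ => (x : ℂ) + y * Complex.I) h1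
      (Continuous.continuousAt (by fun_prop))
  have hV : ∀ φ : ℂ → ℂ, (∀ z ∈ Icc x₀ x₁ ×ℂ Icc y₀ y₁,
      z.re = x₀ ∨ z.re = x₁ ∨ z.im = y₀ ∨ z.im = y₁ → ContinuousAt φ z) → ∀ x, x = x₀ ∨ x = x₁ →
      IntervalIntegrable (fun y : ℝ => φ (x + y * Complex.I)) volume y₀ y₁ := by
    intro φ hφ x hxx
    refine ContinuousOn.intervalIntegrable fun y hy' => ?_
    rw [uIcc_of_le hy] at hy'
    have h1 : ContinuousAt φ ((x : ℂ) + y * Complex.I) := by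
      refine hφ _ ?_ ?_
      · rw [Complex.mem_reProdIm]
        rcases hxx with rfl | rfl <;> simpa [hx] using hy'
      · rcases hxx with rfl | rfl <;> simp
    refine ContinuousAt.continuousWithinAt ?_
    exact ContinuousAt.comp (f := fun y : ℝ => (x : ℂ) + y * Complex.I) h1
      (Continuous.continuousAt (by fun_prop))
  simp only [rectIntegral]
  rw [intervalIntegral.integral_add (hH f hf _ (Or.inl rfl)) (hH g hg _ (Or.inl rfl)),
    intervalIntegral.integral_add (hH f hf _ (Or.inr rfl)) (hH g hg _ (Or.inr rfl)),
    intervalIntegral.integral_add (hV f hf _ (Or.inl rfl)) (hV g hg _ (Or.inl rfl)),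
    intervalIntegral.integral_add (hV f hf _ (Or.inr rfl)) (hV g hg _ (Or.inr rfl))]
  ring

/-- A product over a finite set of cells is unchanged under a shift if the factor is trivial on the
faces between a cell of the set and one outside it. -/
theorem prod_comp_equiv_eq {ι : Type*} [DecidableEq ι] (S : Finset ι) (σ : ι ≃ ι) (f : ι → ℂ)
    (h1 : ∀ p ∈ S, σ.symm p ∉ S → f p = 1) (h2 : ∀ p ∈ S, σ p ∉ S → f (σ p) = 1) :
    ∏ p ∈ S, f (σ p) = ∏ p ∈ S, f p := by
  have h3 : ∏ p ∈ S, f (σ p) = ∏ p ∈ S.map σ.toEmbedding, f p := by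
    rw [Finset.prod_map]
    rfl
  rw [h3]
  refine Finset.prod_congr_of_eq_on_inter (fun p hp hpS => ?_) (fun p hp hpS => ?_)
    fun _ _ _ => rfl
  · obtain ⟨q, hq, rfl⟩ := Finset.mem_map.1 hp
    exact h2 q hq hpS
  · refine h1 p hp fun h => hpS (Finset.mem_map.2 ⟨_, h, ?_⟩)
    exact σ.apply_symm_apply p

/-- If `M` has the logarithmic derivative `δ / (z - c) + r`, with `r` holomorphic, on a punctured
neighbourhood of a compact set `K ∋ c`, then `δ` is an integer: the product, over the squares of a
grid that meet `K`, of the monodromies of `M' = (δ / (z - c) + r) M` around the square is the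
monodromy around `c`, and it is trivial because the boundary of the union of these squares lies in
the domain of `M`. -/
theorem exp_two_pi_I_mul_eq_one {K : Set ℂ} (hK : IsCompact K) {c δ : ℂ} (hc : c ∈ K) {η : ℝ}
    (hη : 0 < η) {M r : ℂ → ℂ} (hr : DifferentiableOn ℂ r (Metric.thickening η K))
    (hM0 : ∀ z ∈ Metric.thickening η K \ K, M z ≠ 0)
    (hM : ∀ z ∈ Metric.thickening η K \ K, HasDerivAt M ((δ * (z - c)⁻¹ + r z) * M z) z) :
    Complex.exp (2 * Real.pi * Complex.I * δ) = 1 := by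
  classical
  obtain ⟨h, hh, hhη⟩ : ∃ h > 0, 4 * h < η := ⟨η / 5, by positivity, by linarith⟩
  set R : ℂ → ℂ := fun z => δ * (z - c)⁻¹ + r z with hRdef
  -- The grid, with `c` at the centre of the square `(0, 0)`.
  set X : ℤ → ℝ := fun a => c.re + (2 * a - 1) * h with hX
  set Y : ℤ → ℝ := fun b => c.im + (2 * b - 1) * h with hY
  have hX1 : ∀ a, X (a + 1) = X a + 2 * h := fun a => by simp only [hX]; push_cast; ring
  have hY1 : ∀ b, Y (b + 1) = Y b + 2 * h := fun b => by simp only [hY]; push_cast; ring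
  have hXle : ∀ a, X a ≤ X (a + 1) := fun a => by rw [hX1]; linarith
  have hYle : ∀ b, Y b ≤ Y (b + 1) := fun b => by rw [hY1]; linarith
  have hodd : ∀ a : ℤ, (2 * (a : ℝ) - 1) * h ≠ 0 := fun a => by
    refine mul_ne_zero (fun h0 => ?_) hh.ne'
    have : (2 * a - 1 : ℤ) = 0 := by exact_mod_cast h0
    omega
  set Sq : ℤ × ℤ → Set ℂ := fun p =>
    Icc (X p.1) (X (p.1 + 1)) ×ℂ Icc (Y p.2) (Y (p.2 + 1)) with hSq
  have hmem : ∀ p (x y : ℝ), (x : ℂ) + y * Complex.I ∈ Sq p ↔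
      x ∈ Icc (X p.1) (X (p.1 + 1)) ∧ y ∈ Icc (Y p.2) (Y (p.2 + 1)) := fun p x y => by
    simp only [hSq]
    rw [Complex.mem_reProdIm]
    simp
  have hfin : {p | (Sq p ∩ K).Nonempty}.Finite := by
    obtain ⟨B, hB⟩ := hK.isBounded.exists_norm_le
    obtain ⟨n, hn⟩ := exists_nat_ge ((B + ‖c‖) / h + 1)
    have hn' : B + ‖c‖ ≤ (n - 1) * h := by
      rw [← div_le_iff₀ hh]
      linarith
    have key : ∀ (a : ℤ) (x x₀ : ℝ), |x| ≤ B → |x₀| ≤ ‖c‖ → x₀ + (2 * a - 1) * h ≤ x →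
        x ≤ x₀ + (2 * a - 1) * h + 2 * h → a ∈ Icc (-(n : ℤ)) n := by
      intro a x x₀ h1 h2 h3 h4
      rw [abs_le] at h1 h2
      have h5 : (2 * (a : ℝ) - 1) * h ≤ (n - 1) * h := by linarith
      have h6 : -((n - 1) * h) ≤ (2 * (a : ℝ) + 1) * h := by linarith
      have h7 := le_of_mul_le_mul_right h5 hh
      have h8 : -((n : ℝ) - 1) ≤ 2 * (a : ℝ) + 1 :=
        le_of_mul_le_mul_right (by linarith) hh
      have h7' : 2 * a - 1 ≤ (n : ℤ) - 1 := by exact_mod_cast h7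
      have h8' : -((n : ℤ) - 1) ≤ 2 * a + 1 := by exact_mod_cast h8
      constructor <;> omega
    refine ((finite_Icc (-(n : ℤ)) n).prod (finite_Icc (-(n : ℤ)) n)).subset ?_
    rintro ⟨a, b⟩ ⟨z, hz, hzK⟩
    simp only [hSq] at hz
    rw [Complex.mem_reProdIm] at hz
    obtain ⟨⟨h1, h2⟩, h3, h4⟩ := hz
    rw [hX1] at h2
    rw [hY1] at h4
    exact ⟨key a z.re c.re ((Complex.abs_re_le_norm z).trans (hB z hzK))
      (Complex.abs_re_le_norm c) h1 h2, key b z.im c.im ((Complex.abs_im_le_norm z).trans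
      (hB z hzK)) (Complex.abs_im_le_norm c) h3 h4⟩
  set S : Finset (ℤ × ℤ) := hfin.toFinset with hS
  have hSmem : ∀ p, p ∈ S ↔ (Sq p ∩ K).Nonempty := fun p => by rw [hS]; simp
  have hsub : ∀ p ∈ S, Sq p ⊆ Metric.thickening η K := by
    intro p hp z hz
    obtain ⟨w, hw, hwK⟩ := (hSmem p).1 hp
    refine Metric.mem_thickening_iff.2 ⟨w, hwK, ?_⟩
    simp only [hSq] at hz hw
    rw [Complex.mem_reProdIm] at hz hw
    obtain ⟨⟨h1, h2⟩, h3, h4⟩ := hz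
    obtain ⟨⟨h5, h6⟩, h7, h8⟩ := hw
    rw [hX1] at h2 h6
    rw [hY1] at h4 h8
    rw [dist_eq_norm]
    refine (Complex.norm_le_abs_re_add_abs_im _).trans_lt ?_
    rw [Complex.sub_re, Complex.sub_im]
    have h9 : |z.re - w.re| ≤ 2 * h := abs_le.2 ⟨by linarith, by linarith⟩
    have h10 : |z.im - w.im| ≤ 2 * h := abs_le.2 ⟨by linarith, by linarith⟩
    linarith
  have hthick : IsOpen (Metric.thickening η K) := Metric.isOpen_thickening
  have hRc : ∀ z ∈ Metric.thickening η K, z ≠ c → ContinuousAt R z := by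
    intro z hz hzc
    refine ContinuousAt.add (continuousAt_const.mul (ContinuousAt.inv₀ (by fun_prop)
      (sub_ne_zero.2 hzc))) (hr.continuousOn.continuousAt (hthick.mem_nhds hz))
  -- The factors attached to the edges of the grid.
  set G : ℂ → ℂ := fun z => if z ∈ K then 1 else M z with hG
  set pt : ℤ → ℤ → ℂ := fun a b => (X a : ℂ) + Y b * Complex.I with hpt
  set u : ℤ × ℤ → ℂ := fun p =>
    Complex.exp (∫ x : ℝ in X p.1..X (p.1 + 1), R (x + Y p.2 * Complex.I)) *
      (G (pt p.1 p.2) / G (pt (p.1 + 1) p.2)) with hu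
  set v : ℤ × ℤ → ℂ := fun p =>
    Complex.exp (Complex.I * ∫ y : ℝ in Y p.2..Y (p.2 + 1), R (X p.1 + y * Complex.I)) *
      (G (pt p.1 p.2) / G (pt p.1 (p.2 + 1))) with hv
  have hG0 : ∀ p ∈ S, ∀ z ∈ Sq p, G z ≠ 0 := by
    intro p hp z hz
    simp only [hG]
    split_ifs with hzK
    · exact one_ne_zero
    · exact hM0 z ⟨hsub p hp hz, hzK⟩
  have hcorner : ∀ p : ℤ × ℤ, pt p.1 p.2 ∈ Sq p ∧ pt (p.1 + 1) p.2 ∈ Sq p ∧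
      pt p.1 (p.2 + 1) ∈ Sq p ∧ pt (p.1 + 1) (p.2 + 1) ∈ Sq p := by
    intro p
    have a1 : X p.1 ∈ Icc (X p.1) (X (p.1 + 1)) := left_mem_Icc.2 (hXle _)
    have a2 : X (p.1 + 1) ∈ Icc (X p.1) (X (p.1 + 1)) := right_mem_Icc.2 (hXle _)
    have b1 : Y p.2 ∈ Icc (Y p.2) (Y (p.2 + 1)) := left_mem_Icc.2 (hYle _)
    have b2 : Y (p.2 + 1) ∈ Icc (Y p.2) (Y (p.2 + 1)) := right_mem_Icc.2 (hYle _)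
    exact ⟨(hmem p _ _).2 ⟨a1, b1⟩, (hmem p _ _).2 ⟨a2, b1⟩, (hmem p _ _).2 ⟨a1, b2⟩,
      (hmem p _ _).2 ⟨a2, b2⟩⟩
  -- An edge between a square that meets `K` and one that does not has a trivial factor.
  have hu1 : ∀ (p : ℤ × ℤ) (q : ℤ × ℤ), q ∈ S →
      (∀ x ∈ Icc (X p.1) (X (p.1 + 1)), (x : ℂ) + Y p.2 * Complex.I ∈ Sq q ∧
        (x : ℂ) + Y p.2 * Complex.I ∉ K) → u p = 1 := by
    intro p q hq hp
    have hne : ∀ x : ℝ, (x : ℂ) + Y p.2 * Complex.I ≠ c := fun x h0 => by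
      have := congrArg Complex.im h0
      simp only [hY] at this
      simp [hh.ne'] at this
      exact hodd p.2 (by simp [this])
    have h1 := exp_integral_mul_eq (M := M) (R := R) (hXle p.1)
      (hasDerivAt_horizontal ((Y p.2 : ℂ) * Complex.I))
      (fun x hx => hM _ ⟨hsub q hq (hp x hx).1, (hp x hx).2⟩)
      (fun x hx => ContinuousAt.continuousWithinAt <| ContinuousAt.comp
        (f := fun x : ℝ => (x : ℂ) + Y p.2 * Complex.I)
        (hRc _ (hsub q hq (hp x hx).1) (hne x)) (Continuous.continuousAt (by fun_prop)))
    have hl := hp _ (left_mem_Icc.2 (hXle p.1))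
    have hr' := hp _ (right_mem_Icc.2 (hXle p.1))
    have e1 : G (pt p.1 p.2) = M (pt p.1 p.2) := if_neg hl.2
    have e2 : G (pt (p.1 + 1) p.2) = M (pt (p.1 + 1) p.2) := if_neg hr'.2
    have h0 : M (pt (p.1 + 1) p.2) ≠ 0 := hM0 _ ⟨hsub q hq hr'.1, hr'.2⟩
    rw [one_mul] at h1
    simp only [hu]
    rw [e1, e2, ← mul_div_assoc, div_eq_one_iff_eq h0]
    exact h1
  have hv1 : ∀ (p : ℤ × ℤ) (q : ℤ × ℤ), q ∈ S →
      (∀ y ∈ Icc (Y p.2) (Y (p.2 + 1)), (X p.1 : ℂ) + (y : ℂ) * Complex.I ∈ Sq q ∧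
        (X p.1 : ℂ) + (y : ℂ) * Complex.I ∉ K) → v p = 1 := by
    intro p q hq hp
    have hne : ∀ y : ℝ, (X p.1 : ℂ) + (y : ℂ) * Complex.I ≠ c := fun y h0 => by
      have := congrArg Complex.re h0
      simp only [hX] at this
      simp [hh.ne'] at this
      exact hodd p.1 (by simp [this])
    have h1 := exp_integral_mul_eq (M := M) (R := R) (hYle p.2)
      (hasDerivAt_vertical (X p.1 : ℂ))
      (fun y hy => hM _ ⟨hsub q hq (hp y hy).1, (hp y hy).2⟩)
      (fun y hy => ContinuousAt.continuousWithinAt <| ContinuousAt.comp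
        (f := fun y : ℝ => (X p.1 : ℂ) + (y : ℂ) * Complex.I)
        (hRc _ (hsub q hq (hp y hy).1) (hne y)) (Continuous.continuousAt (by fun_prop)))
    have hl := hp _ (left_mem_Icc.2 (hYle p.2))
    have hr' := hp _ (right_mem_Icc.2 (hYle p.2))
    have e1 : G (pt p.1 p.2) = M (pt p.1 p.2) := if_neg hl.2
    have e2 : G (pt p.1 (p.2 + 1)) = M (pt p.1 (p.2 + 1)) := if_neg hr'.2
    have h0 : M (pt p.1 (p.2 + 1)) ≠ 0 := hM0 _ ⟨hsub q hq hr'.1, hr'.2⟩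
    simp only [hv]
    rw [e1, e2, ← mul_div_assoc, div_eq_one_iff_eq h0]
    exact h1
  have hnotK : ∀ p ∉ S, ∀ z ∈ Sq p, z ∉ K := fun p hp z hz hzK => hp ((hSmem p).2 ⟨z, hz, hzK⟩)
  let σ : ℤ × ℤ ≃ ℤ × ℤ := (Equiv.refl ℤ).prodCongr (Equiv.addRight (1 : ℤ))
  let τ : ℤ × ℤ ≃ ℤ × ℤ := (Equiv.addRight (1 : ℤ)).prodCongr (Equiv.refl ℤ)
  have hprodu : ∏ p ∈ S, u (p.1, p.2 + 1) = ∏ p ∈ S, u p := by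
    refine prod_comp_equiv_eq S σ u (fun p hp hp' => ?_) (fun p hp hp' => ?_)
    · have hs : σ.symm p = (p.1, p.2 - 1) := rfl
      rw [hs] at hp'
      refine hu1 p p hp fun x hx => ⟨(hmem p _ _).2 ⟨hx, left_mem_Icc.2 (hYle _)⟩,
        hnotK _ hp' _ ((hmem _ _ _).2 ⟨hx, ?_⟩)⟩
      have h1 := hY1 (p.2 - 1)
      rw [sub_add_cancel] at h1
      simp only [sub_add_cancel]
      constructor <;> linarith
    · have hs : σ p = (p.1, p.2 + 1) := rfl
      rw [hs] at hp' ⊢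
      exact hu1 _ p hp fun x hx => ⟨(hmem p _ _).2 ⟨hx, right_mem_Icc.2 (hYle _)⟩,
        hnotK _ hp' _ ((hmem _ _ _).2 ⟨hx, left_mem_Icc.2 (hYle _)⟩)⟩
  have hprodv : ∏ p ∈ S, v (p.1 + 1, p.2) = ∏ p ∈ S, v p := by
    refine prod_comp_equiv_eq S τ v (fun p hp hp' => ?_) (fun p hp hp' => ?_)
    · have hs : τ.symm p = (p.1 - 1, p.2) := rfl
      rw [hs] at hp'
      refine hv1 p p hp fun y hy => ⟨(hmem p _ _).2 ⟨left_mem_Icc.2 (hXle _), hy⟩,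
        hnotK _ hp' _ ((hmem _ _ _).2 ⟨?_, hy⟩)⟩
      have h1 := hX1 (p.1 - 1)
      rw [sub_add_cancel] at h1
      simp only [sub_add_cancel]
      constructor <;> linarith
    · have hs : τ p = (p.1 + 1, p.2) := rfl
      rw [hs] at hp' ⊢
      exact hv1 _ p hp fun y hy => ⟨(hmem p _ _).2 ⟨right_mem_Icc.2 (hXle _), hy⟩,
        hnotK _ hp' _ ((hmem _ _ _).2 ⟨left_mem_Icc.2 (hXle _), hy⟩)⟩
  -- The factors around one square.
  have hcell : ∀ p ∈ S, Complex.exp (rectIntegral R (X p.1) (X (p.1 + 1)) (Y p.2) (Y (p.2 + 1))) *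
      (u (p.1, p.2 + 1) * v p) = u p * v (p.1 + 1, p.2) := by
    intro p hp
    obtain ⟨c1, c2, c3, c4⟩ := hcorner p
    have g1 := hG0 p hp _ c1
    have g2 := hG0 p hp _ c2
    have g3 := hG0 p hp _ c3
    have g4 := hG0 p hp _ c4
    simp only [hu, hv, rectIntegral, Complex.exp_sub, Complex.exp_add]
    have n1 := Complex.exp_ne_zero (∫ x : ℝ in X p.1..X (p.1 + 1),
      R (x + Y (p.2 + 1) * Complex.I))
    have n2 := Complex.exp_ne_zero (Complex.I * ∫ y : ℝ in Y p.2..Y (p.2 + 1),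
      R (X p.1 + y * Complex.I))
    field_simp
  have hne : ∀ p ∈ S, u (p.1, p.2 + 1) * v p ≠ 0 := by
    intro p hp
    obtain ⟨c1, c2, c3, c4⟩ := hcorner p
    exact mul_ne_zero (mul_ne_zero (Complex.exp_ne_zero _) (div_ne_zero (hG0 p hp _ c3)
      (hG0 p hp _ c4))) (mul_ne_zero (Complex.exp_ne_zero _) (div_ne_zero (hG0 p hp _ c1)
      (hG0 p hp _ c3)))
  have hprod : ∏ p ∈ S,
      Complex.exp (rectIntegral R (X p.1) (X (p.1 + 1)) (Y p.2) (Y (p.2 + 1))) = 1 := by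
    have h1 := Finset.prod_congr rfl hcell
    rw [Finset.prod_mul_distrib, Finset.prod_mul_distrib (f := u)
      (g := fun p : ℤ × ℤ => v (p.1 + 1, p.2)), hprodv, ← hprodu,
      ← Finset.prod_mul_distrib (f := fun p : ℤ × ℤ => u (p.1, p.2 + 1))] at h1
    exact (mul_eq_right₀ (Finset.prod_ne_zero_iff.2 hne)).1 h1
  have hcSq : ∀ p, c ∈ Sq p → p = (0, 0) := by
    intro p hp
    simp only [hSq] at hp
    rw [Complex.mem_reProdIm] at hp
    obtain ⟨⟨h1, h2⟩, h3, h4⟩ := hp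
    rw [hX1] at h2
    rw [hY1] at h4
    have key : ∀ (a : ℤ) (x : ℝ), x + (2 * a - 1) * h ≤ x → x ≤ x + (2 * a - 1) * h + 2 * h →
        a = 0 := by
      intro a x h1 h2
      have h3 : (2 * (a : ℝ) - 1) ≤ 0 := le_of_mul_le_mul_right (by linarith) hh
      have h4 : 0 ≤ 2 * (a : ℝ) + 1 := le_of_mul_le_mul_right (by linarith) hh
      have h3' : 2 * a - 1 ≤ 0 := by exact_mod_cast h3
      have h4' : 0 ≤ 2 * a + 1 := by exact_mod_cast h4
      omega
    exact Prod.ext (key _ _ h1 h2) (key _ _ h3 h4)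
  have hX0 : X 0 = c.re - h ∧ X (0 + 1) = c.re + h := by
    constructor <;> simp only [hX] <;> push_cast <;> ring
  have hY0 : Y 0 = c.im - h ∧ Y (0 + 1) = c.im + h := by
    constructor <;> simp only [hY] <;> push_cast <;> ring
  have h00 : ((0, 0) : ℤ × ℤ) ∈ S := by
    refine (hSmem _).2 ⟨c, ?_, hc⟩
    simp only [hSq]
    rw [Complex.mem_reProdIm, hX0.1, hX0.2, hY0.1, hY0.2]
    exact ⟨⟨by linarith, by linarith⟩, by linarith, by linarith⟩
  rw [Finset.prod_eq_single_of_mem _ h00] at hprod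
  · have hsub0 := hsub _ h00
    simp only [hSq] at hsub0
    have h1 : rectIntegral R (X 0) (X (0 + 1)) (Y 0) (Y (0 + 1)) =
        2 * Real.pi * Complex.I * δ := by
      rw [hRdef, rectIntegral_add (hXle 0) (hYle 0), rectIntegral_eq_zero (f := r) (hXle 0)
        (hYle 0) (hr.mono hsub0), add_zero]
      · have h2 := rectIntegral_inv_sub c hh
        rw [hX0.1, hX0.2, hY0.1, hY0.2, ← h2]
        simp only [rectIntegral, intervalIntegral.integral_const_mul]
        ring
      · intro z _ hz
        refine continuousAt_const.mul (ContinuousAt.inv₀ (by fun_prop) (sub_ne_zero.2 ?_))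
        rintro rfl
        rw [hX0.1, hX0.2, hY0.1, hY0.2] at hz
        rcases hz with hz | hz | hz | hz <;> linarith
      · intro z hz _
        exact hr.continuousOn.continuousAt (hthick.mem_nhds (hsub0 hz))
    rwa [h1] at hprod
  · intro p hp hp0
    rw [rectIntegral_eq_zero (hXle _) (hYle _), Complex.exp_zero]
    intro z hz
    have hzc : z ≠ c := fun h0 => hp0 (hcSq p (h0 ▸ hz))
    have hzt := hsub p hp hz
    refine DifferentiableAt.differentiableWithinAt (DifferentiableAt.add ?_
      (hr.differentiableAt (hthick.mem_nhds hzt)))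
    have hd : DifferentiableAt ℂ (fun z : ℂ => z - c) z := by fun_prop
    exact (hd.inv (sub_ne_zero.2 hzc)).const_mul δ

/-! ### Holes are isolated -/

/-- In a compact Hausdorff space a neighbourhood of a component contains a clopen one. -/
theorem exists_isClopen_subset {Y : Type*} [TopologicalSpace Y] [T2Space Y] [CompactSpace Y]
    {y : Y} {U : Set Y} (hU : IsOpen U) (h : connectedComponent y ⊆ U) :
    ∃ W, IsClopen W ∧ y ∈ W ∧ W ⊆ U := by
  rw [connectedComponent_eq_iInter_isClopen] at h
  have : Nonempty {s : Set Y // IsClopen s ∧ y ∈ s} := ⟨⟨univ, isClopen_univ, mem_univ y⟩⟩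
  obtain ⟨W, hW⟩ := exists_subset_nhds_of_isCompact'
    (V := fun s : {s : Set Y // IsClopen s ∧ y ∈ s} => (s : Set Y)) (fun s t =>
      ⟨⟨s ∩ t, s.2.1.inter t.2.1, s.2.2, t.2.2⟩, inter_subset_left, inter_subset_right⟩)
    (fun s => s.2.1.isClosed.isCompact) (fun s => s.2.1.isClosed)
    fun x hx => hU.mem_nhds (h hx)
  exact ⟨W, W.2.1, W.2.2, hW⟩

/-- A bounded component of a closed set has relatively clopen bounded neighbourhoods: here `V` is
open and `V ∩ C` is closed. -/
theorem exists_isOpen_inter_isClosed {C : Set ℂ} (hC : IsClosed C) {x : ℂ} (hx : x ∈ C)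
    (hb : Bornology.IsBounded (connectedComponentIn C x)) :
    ∃ V, IsOpen V ∧ connectedComponentIn C x ⊆ V ∧ IsClosed (V ∩ C) ∧
      Bornology.IsBounded V := by
  obtain ⟨r, hr⟩ := hb.subset_ball 0
  set D := C ∩ Metric.closedBall 0 r with hD
  have hDc : IsCompact D := (isCompact_closedBall 0 r).inter_left hC
  have : CompactSpace D := isCompact_iff_compactSpace.1 hDc
  have hxc : x ∈ connectedComponentIn C x := mem_connectedComponentIn hx
  have hxD : x ∈ D := ⟨hx, Metric.ball_subset_closedBall (hr hxc)⟩
  have hle : connectedComponentIn D x ⊆ connectedComponentIn C x :=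
    isPreconnected_connectedComponentIn.subset_connectedComponentIn (mem_connectedComponentIn hxD)
      ((connectedComponentIn_subset _ _).trans inter_subset_left)
  have hge : connectedComponentIn C x ⊆ connectedComponentIn D x :=
    isPreconnected_connectedComponentIn.subset_connectedComponentIn hxc
      (subset_inter (connectedComponentIn_subset _ _) (hr.trans Metric.ball_subset_closedBall))
  rw [connectedComponentIn_eq_image hxD] at hle hge
  obtain ⟨W, hW, hxW, hWs⟩ := exists_isClopen_subset (y := (⟨x, hxD⟩ : D))
    (Metric.isOpen_ball.preimage continuous_subtype_val : IsOpen ((↑) ⁻¹' Metric.ball (0 : ℂ) r))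
    fun y hy => hr (hle ⟨y, hy, rfl⟩)
  obtain ⟨V, hV, hVW⟩ := isOpen_induced_iff.1 hW.isOpen
  have hVC : V ∩ Metric.ball 0 r ∩ C = (↑) '' W := by
    ext p
    constructor
    · rintro ⟨⟨h1, h2⟩, h3⟩
      exact ⟨⟨p, h3, Metric.ball_subset_closedBall h2⟩, hVW ▸ h1, rfl⟩
    · rintro ⟨q, hq, rfl⟩
      refine ⟨⟨?_, hWs hq⟩, q.2.1⟩
      rw [← hVW] at hq
      exact hq
  refine ⟨V ∩ Metric.ball 0 r, hV.inter Metric.isOpen_ball, fun p hp => ?_, ?_,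
    Metric.isBounded_ball.subset inter_subset_right⟩
  · obtain ⟨q, hq, rfl⟩ := hge hp
    have h1 : ((q : D) : ℂ) ∈ V ∩ Metric.ball 0 r ∩ C :=
      hVC ▸ ⟨q, hW.connectedComponent_subset hxW hq, rfl⟩
    exact h1.1
  · rw [hVC]
    exact (hW.isClosed.isCompact.image continuous_subtype_val).isClosed

theorem isCompact_of_mem_holes {Ω : Set ℂ} (hΩ : IsOpen Ω) {S : Set ℂ} (hS : S ∈ holes Ω) :
    IsCompact S := by
  obtain ⟨⟨x, hx, rfl⟩, hb⟩ := hS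
  refine Metric.isCompact_of_isClosed_isBounded (isClosed_of_closure_subset ?_) hb
  exact isPreconnected_connectedComponentIn.closure.subset_connectedComponentIn
    (subset_closure (mem_connectedComponentIn hx))
    (closure_minimal (connectedComponentIn_subset _ _) hΩ.isClosed_compl)

theorem subset_compl_of_mem_holes {Ω S : Set ℂ} (hS : S ∈ holes Ω) : S ⊆ Ωᶜ := by
  obtain ⟨⟨x, hx, rfl⟩, -⟩ := hS
  exact connectedComponentIn_subset _ _

theorem eq_of_mem_holes {Ω : Set ℂ} {S S' : Set ℂ} (hS : S ∈ holes Ω) (hS' : S' ∈ holes Ω) {p : ℂ}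
    (hp : p ∈ S) (hp' : p ∈ S') : S = S' := by
  obtain ⟨⟨x, hx, rfl⟩, -⟩ := hS
  obtain ⟨⟨y, hy, rfl⟩, -⟩ := hS'
  rw [connectedComponentIn_eq hp, connectedComponentIn_eq hp']

/-- If there are finitely many holes, each has a neighbourhood in which it is the whole complement
of the domain. -/
theorem exists_thickening_diff_subset {l : ℕ} {Ω : Set ℂ} (hΩ : IsOpen Ω) {H : Fin l → Set ℂ}
    (hHr : Set.range H = holes Ω) (j : Fin l) :
    ∃ η > 0, Metric.thickening η (H j) \ H j ⊆ Ω := by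
  have hmem : ∀ i, H i ∈ holes Ω := fun i => hHr ▸ mem_range_self i
  obtain ⟨⟨x, hx, hxe⟩, hb⟩ := hmem j
  rw [hxe] at hb
  obtain ⟨V, hV, hxV, hVC, hVb⟩ := exists_isOpen_inter_isClosed hΩ.isClosed_compl hx hb
  rw [← hxe] at hxV
  -- The component of a point of `V ∩ Ωᶜ` stays in `V`, so it is a hole.
  have hhole : ∀ y ∈ V ∩ Ωᶜ, ∃ i, y ∈ H i := by
    intro y hy
    have hsub : connectedComponentIn Ωᶜ y ⊆ V := by
      intro q hq
      by_contra hqV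
      have hcover : connectedComponentIn Ωᶜ y ⊆ V ∪ (V ∩ Ωᶜ)ᶜ := by
        intro p _
        by_cases h : p ∈ V
        · exact Or.inl h
        · exact Or.inr fun h' => h h'.1
      obtain ⟨p, hp, hpV, hpn⟩ := isPreconnected_connectedComponentIn V (V ∩ Ωᶜ)ᶜ hV
        hVC.isOpen_compl hcover ⟨y, mem_connectedComponentIn hy.2, hy.1⟩ ⟨q, hq, fun h => hqV h.1⟩
      exact hpn ⟨hpV, connectedComponentIn_subset _ _ hp⟩
    have h1 : connectedComponentIn Ωᶜ y ∈ range H :=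
      hHr ▸ ⟨⟨y, hy.2, rfl⟩, hVb.subset hsub⟩
    obtain ⟨i, hi⟩ := h1
    exact ⟨i, hi ▸ mem_connectedComponentIn hy.2⟩
  obtain ⟨η, hη, hηs⟩ := (isCompact_of_mem_holes hΩ (hmem j)).exists_thickening_subset_open
    (t := V ∩ ⋂ i, ⋂ _ : H i ≠ H j, (H i)ᶜ) (hV.inter (isOpen_iInter_of_finite fun i =>
      isOpen_iInter_of_finite fun _ => (isCompact_of_mem_holes hΩ (hmem i)).isClosed.isOpen_compl))
    (fun p hp => ⟨hxV hp, mem_iInter₂.2 fun i hi hpi =>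
      hi (eq_of_mem_holes (hmem i) (hmem j) hpi hp)⟩)
  refine ⟨η, hη, fun p hp => ?_⟩
  by_contra hpΩ
  obtain ⟨hpV, hpn⟩ := hηs hp.1
  obtain ⟨i, hi⟩ := hhole p ⟨hpV, hpΩ⟩
  by_cases hij : H i = H j
  · exact hp.2 (hij ▸ hi)
  · exact mem_iInter₂.1 hpn i hij hi

/-! ### The law determines the kernel up to gauge -/

section Law

variable {E : Type*} [TopologicalSpace E] [T2Space E] [MeasurableSpace E] [BorelSpace E]
  {m : Measure E} [IsLocallyFiniteMeasure m] [m.IsOpenPosMeasure] [SigmaFinite m]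
  {K K' : E → E → ℂ} {P : ProbabilityMeasure (PointConfiguration E)}

theorem IsDeterminantalLaw.not_det_re_lt (h : IsDeterminantalLaw m K P)
    (h' : IsDeterminantalLaw m K' P) (hK : Continuous fun p : E × E => K p.1 p.2)
    (hK' : Continuous fun p : E × E => K' p.1 p.2) {k : ℕ} {x : Fin k → E}
    (hx : Function.Injective x) :
    ¬(Matrix.of fun i j => K (x i) (x j)).det.re < (Matrix.of fun i j => K' (x i) (x j)).det.re := by
  intro hlt
  have hcont : ∀ L : E → E → ℂ, (Continuous fun p : E × E => L p.1 p.2) →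
      Continuous fun y : Fin k → E => (Matrix.of fun i j => L (y i) (y j)).det.re := by
    intro L hL
    refine Complex.continuous_re.comp (Continuous.matrix_det (continuous_matrix fun i j => ?_))
    have h1 : Continuous fun y : Fin k → E => (y i, y j) :=
      (continuous_apply i).prodMk (continuous_apply j)
    exact hL.comp h1
  obtain ⟨c₁, hc₁, hc₁'⟩ := exists_between hlt
  obtain ⟨c₂, hc₂, hc₂'⟩ := exists_between hc₁'
  have h0 : 0 < c₁ := ((Complex.le_def.1 (h.det_nonneg k x)).1).trans_lt hc₁
  have hopen : IsOpen {y : Fin k → E | (Matrix.of fun i j => K (y i) (y j)).det.re < c₁ ∧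
      c₂ < (Matrix.of fun i j => K' (y i) (y j)).det.re} :=
    (isOpen_lt (hcont K hK) continuous_const).inter (isOpen_lt continuous_const (hcont K' hK'))
  obtain ⟨u, hu, hus⟩ := isOpen_pi_iff'.1 hopen x ⟨hc₁, hc₂'⟩
  obtain ⟨V, hV, hVd⟩ := (finite_range x).t2_separation
  have hfin := fun i => m.exists_isOpen_measure_lt_top (x i)
  choose W hxW hW hWt using hfin
  set A : Fin k → Set E := fun i => u i ∩ V (x i) ∩ W i with hA
  have hAo : ∀ i, IsOpen (A i) := fun i => ((hu i).1.inter (hV (x i)).2).inter (hW i)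
  have hAm : ∀ i, MeasurableSet (A i) := fun i => (hAo i).measurableSet
  have hxA : ∀ i, x i ∈ A i := fun i => ⟨⟨(hu i).2, (hV (x i)).1⟩, hxW i⟩
  have hAd : Pairwise fun i j => Disjoint (A i) (A j) := fun i j hij =>
    (hVd (mem_range_self i) (mem_range_self j) (hx.ne hij)).mono
      (inter_subset_left.trans inter_subset_right) (inter_subset_left.trans inter_subset_right)
  have hAs : ∀ y ∈ univ.pi A, (Matrix.of fun i j => K (y i) (y j)).det.re < c₁ ∧
      c₂ < (Matrix.of fun i j => K' (y i) (y j)).det.re := fun y hy =>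
    hus fun i hi => (hy i hi).1.1
  have heq := (h.intensity k A hAm hAd).symm.trans (h'.intensity k A hAm hAd)
  have hmp : MeasurableSet (univ.pi A) := MeasurableSet.univ_pi hAm
  set μ : Measure (Fin k → E) := Measure.pi fun _ => m
  have hμ : μ (univ.pi A) = ∏ i, m (A i) := Measure.pi_pi _ _
  have hμ0 : μ (univ.pi A) ≠ 0 := by
    rw [hμ, Finset.prod_ne_zero_iff]
    exact fun i _ => (hAo i).measure_ne_zero m ⟨_, hxA i⟩
  have hμt : μ (univ.pi A) ≠ ∞ := by
    rw [hμ]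
    exact ENNReal.prod_ne_top fun i _ => ((measure_mono inter_subset_right).trans_lt (hWt i)).ne
  have h1 : ENNReal.ofReal c₂ * μ (univ.pi A) ≤ ENNReal.ofReal c₁ * μ (univ.pi A) := by
    rw [← setLIntegral_const, ← setLIntegral_const]
    refine (setLIntegral_mono' hmp fun y hy => ENNReal.ofReal_le_ofReal (hAs y hy).2.le).trans ?_
    rw [← heq]
    exact setLIntegral_mono' hmp fun y hy => ENNReal.ofReal_le_ofReal (hAs y hy).1.le
  have h2 := (ENNReal.mul_le_mul_iff_left hμ0 hμt).1 h1
  exact absurd ((ENNReal.ofReal_le_ofReal_iff h0.le).1 h2) (not_le.2 hc₂)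

/-- The law determines the determinants of continuous kernels. -/
theorem IsDeterminantalLaw.det_eq (h : IsDeterminantalLaw m K P)
    (h' : IsDeterminantalLaw m K' P) (hK : Continuous fun p : E × E => K p.1 p.2)
    (hK' : Continuous fun p : E × E => K' p.1 p.2) {k : ℕ} {x : Fin k → E}
    (hx : Function.Injective x) :
    (Matrix.of fun i j => K (x i) (x j)).det = (Matrix.of fun i j => K' (x i) (x j)).det := by
  have h1 := h.not_det_re_lt h' hK hK' hx
  have h2 := h'.not_det_re_lt h hK' hK hx
  refine Complex.ext (le_antisymm (not_lt.1 h2) (not_lt.1 h1)) ?_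
  rw [← (Complex.le_def.1 (h.det_nonneg k x)).2, ← (Complex.le_def.1 (h'.det_nonneg k x)).2]

/-- The one- and two-point functions determine the modulus of a Hermitian kernel. -/
theorem IsDeterminantalLaw.norm_eq (h : IsDeterminantalLaw m K P)
    (h' : IsDeterminantalLaw m K' P) (hK : Continuous fun p : E × E => K p.1 p.2)
    (hK' : Continuous fun p : E × E => K' p.1 p.2) (hH : ∀ x y, K y x = starRingEnd ℂ (K x y))
    (hH' : ∀ x y, K' y x = starRingEnd ℂ (K' x y)) (x y : E) : ‖K x y‖ = ‖K' x y‖ := by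
  have h1 : ∀ x, K x x = K' x x := by
    intro x
    have h2 := h.det_eq h' hK hK' (k := 1) (x := fun _ => x) (Function.injective_of_subsingleton _)
    simpa [Matrix.det_fin_one] using h2
  by_cases hxy : x = y
  · rw [hxy, h1]
  have h2 := h.det_eq h' hK hK' (k := 2) (x := ![x, y]) (by
    intro i j hij
    fin_cases i <;> fin_cases j
    · rfl
    · exact absurd hij hxy
    · exact absurd hij.symm hxy
    · rfl)
  simp only [Matrix.det_fin_two, Matrix.of_apply, Matrix.cons_val_zero, Matrix.cons_val_one,
    hH x y, hH' x y, Complex.mul_conj', h1] at h2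
  have h3 : ‖K x y‖ ^ 2 = ‖K' x y‖ ^ 2 := by exact_mod_cast sub_right_injective h2
  exact (pow_left_inj₀ (norm_nonneg _) (norm_nonneg _) two_ne_zero).1 h3

end Law

theorem isOpenPosMeasure_comap_subtype {D : Set ℂ} (hD : IsOpen D) :
    (Measure.comap ((↑) : D → ℂ) volume).IsOpenPosMeasure := by
  refine ⟨fun U hU hne => ?_⟩
  rw [comap_subtype_coe_apply hD.measurableSet]
  exact (hD.isOpenMap_subtype_val U hU).measure_ne_zero volume (hne.image _)

/-! ### Holomorphic functions with prescribed modulus -/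

/-- Holomorphic functions of equal modulus on a domain are proportional. -/
theorem exists_eqOn_const_mul {B : Set ℂ} (hB : IsOpen B) (hBc : IsPreconnected B) {f g : ℂ → ℂ}
    (hf : DifferentiableOn ℂ f B) (hg : DifferentiableOn ℂ g B) (h : ∀ z ∈ B, ‖f z‖ = ‖g z‖) :
    ∃ κ : ℂ, ‖κ‖ = 1 ∧ ∀ z ∈ B, f z = κ * g z := by
  by_cases h0 : ∃ p ∈ B, g p ≠ 0
  · obtain ⟨p, hp, hgp⟩ := h0
    have hne : ∀ᶠ z in 𝓝 p, z ∈ B ∧ g z ≠ 0 := (hB.eventually_mem hp).and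
      ((hg.continuousOn.continuousAt (hB.mem_nhds hp)).eventually_ne hgp)
    have hnorm : ∀ z, z ∈ B ∧ g z ≠ 0 → ‖f z / g z‖ = 1 := fun z hz => by
      rw [norm_div, h z hz.1, div_self (norm_ne_zero_iff.2 hz.2)]
    have h1 := Complex.eventually_eq_of_isLocalMax_norm (f := fun z => f z / g z) (c := p) (by
      filter_upwards [hne] with z hz
      exact (hf.differentiableAt (hB.mem_nhds hz.1)).div (hg.differentiableAt (hB.mem_nhds hz.1))
        hz.2) (by
      filter_upwards [hne] with z hz
      exact ((hnorm z hz).trans (hnorm p ⟨hp, hgp⟩).symm).le)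
    refine ⟨f p / g p, hnorm p ⟨hp, hgp⟩, ?_⟩
    refine AnalyticOnNhd.eqOn_of_preconnected_of_eventuallyEq (hf.analyticOnNhd hB)
      ((hg.const_mul _).analyticOnNhd hB) hBc hp ?_
    filter_upwards [h1, hne] with z h2 h3
    rw [← h2, div_mul_cancel₀ _ h3.2]
  · push Not at h0
    refine ⟨1, norm_one, fun z hz => ?_⟩
    have := h z hz
    rw [h0 z hz, norm_zero, norm_eq_zero] at this
    rw [this, h0 z hz, mul_zero]

/-- On a disc that avoids the points `z i`, the function `∏ |ζ - z i| ^ δ i` is the modulus of a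
holomorphic function. -/
theorem exists_norm_eq_prod_rpow {l : ℕ} (z : Fin l → ℂ) (δ : Fin l → ℝ) {a : ℂ} {r : ℝ}
    (hr : 0 < r) (hz : ∀ i, z i ∉ Metric.ball a r) :
    ∃ e : ℂ → ℂ, ∀ ζ ∈ Metric.ball a r, e ζ ≠ 0 ∧ ‖e ζ‖ = ∏ i, ‖ζ - z i‖ ^ δ i ∧
      HasDerivAt e ((∑ i, (δ i : ℂ) * (ζ - z i)⁻¹) * e ζ) ζ := by
  have ha : ∀ i, a - z i ≠ 0 := fun i h0 =>
    hz i (by rw [← sub_eq_zero.1 h0]; exact Metric.mem_ball_self hr)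
  have hζ0 : ∀ ζ ∈ Metric.ball a r, ∀ i, ζ - z i ≠ 0 := fun ζ hζ i h0 =>
    hz i (by rw [← sub_eq_zero.1 h0]; exact hζ)
  have hs : ∀ ζ ∈ Metric.ball a r, ∀ i, (ζ - z i) / (a - z i) ∈ Complex.slitPlane := by
    intro ζ hζ i
    refine Complex.ball_one_subset_slitPlane ?_
    rw [Metric.mem_ball, dist_eq_norm, div_sub_one (ha i), norm_div,
      div_lt_one (norm_pos_iff.2 (ha i)), sub_sub_sub_cancel_right, ← dist_eq_norm]
    refine (Metric.mem_ball.1 hζ).trans_le ?_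
    rw [← dist_eq_norm, dist_comm]
    exact not_lt.1 (hz i)
  refine ⟨fun ζ => Complex.exp (∑ i, (δ i : ℂ) * (Complex.log ((ζ - z i) / (a - z i)) +
    (Real.log ‖a - z i‖ : ℝ))), fun ζ hζ => ⟨Complex.exp_ne_zero _, ?_, ?_⟩⟩
  · rw [Complex.norm_exp, Complex.re_sum, Real.exp_sum]
    refine Finset.prod_congr rfl fun i _ => ?_
    rw [Complex.re_ofReal_mul, Complex.add_re, Complex.ofReal_re, Complex.log_re, norm_div,
      Real.log_div (norm_ne_zero_iff.2 (hζ0 ζ hζ i)) (norm_ne_zero_iff.2 (ha i)), sub_add_cancel,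
      Real.rpow_def_of_pos (norm_pos_iff.2 (hζ0 ζ hζ i)), mul_comm]
  · have h1 : ∀ i ∈ Finset.univ, HasDerivAt (fun ζ => (δ i : ℂ) *
        (Complex.log ((ζ - z i) / (a - z i)) + (Real.log ‖a - z i‖ : ℝ)))
        ((δ i : ℂ) * (ζ - z i)⁻¹) ζ := by
      intro i _
      have h2 : HasDerivAt (fun ζ => (ζ - z i) / (a - z i)) (1 / (a - z i)) ζ :=
        ((hasDerivAt_id ζ).sub_const (z i)).div_const _
      have h3 := ((h2.clog (hs ζ hζ i)).add_const ((Real.log ‖a - z i‖ : ℝ) : ℂ)).const_mul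
        (δ i : ℂ)
      refine h3.congr_deriv ?_
      have := ha i
      have := hζ0 ζ hζ i
      field_simp
    exact (HasDerivAt.fun_sum h1).cexp.congr_deriv (mul_comm _ _)

/-- If `|F| = |G| ∏ |ζ - z i| ^ δ i` on a domain, then `F / G` extends to a holomorphic function
without zeros, whose logarithmic derivative is `∑ δ i / (ζ - z i)`. -/
theorem exists_quotient {l : ℕ} {Ω : Set ℂ} (hΩ : IsOpen Ω) (hΩc : IsConnected Ω)
    {z : Fin l → ℂ} (hz : ∀ i, z i ∉ Ω) (δ : Fin l → ℝ) {F G : ℂ → ℂ}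
    (hF : DifferentiableOn ℂ F Ω) (hG : DifferentiableOn ℂ G Ω) {w₀ : ℂ} (hw₀ : w₀ ∈ Ω)
    (hG0 : G w₀ ≠ 0) (h : ∀ ζ ∈ Ω, ‖F ζ‖ = ‖G ζ‖ * ∏ i, ‖ζ - z i‖ ^ δ i) :
    ∃ M : ℂ → ℂ, ∀ ζ ∈ Ω, M ζ ≠ 0 ∧
      HasDerivAt M ((∑ i, (δ i : ℂ) * (ζ - z i)⁻¹) * M ζ) ζ := by
  have hGz : ∀ ζ ∈ Ω, ∀ᶠ w in 𝓝[≠] ζ, G w ≠ 0 := by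
    intro ζ hζ
    by_contra hcon
    rw [not_eventually] at hcon
    have hfreq : ∃ᶠ w in 𝓝[≠] ζ, G w = (fun _ => 0) w := hcon.mono fun w hw => not_not.1 hw
    exact hG0 ((hG.analyticOnNhd hΩ).eqOn_of_preconnected_of_frequently_eq
      analyticOnNhd_const hΩc.isPreconnected hζ hfreq hw₀)
  refine ⟨fun ζ => limUnder (𝓝[≠] ζ) fun w => F w / G w, fun a ha => ?_⟩
  obtain ⟨r, hr, hrΩ⟩ := Metric.isOpen_iff.1 hΩ a ha
  obtain ⟨e, he⟩ := exists_norm_eq_prod_rpow z δ hr fun i hi => hz i (hrΩ hi)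
  have hed : DifferentiableOn ℂ e (Metric.ball a r) := fun ζ hζ =>
    (he ζ hζ).2.2.differentiableAt.differentiableWithinAt
  obtain ⟨κ, hκ, hFG⟩ := exists_eqOn_const_mul Metric.isOpen_ball (convex_ball a r).isPreconnected
    (hF.mono hrΩ) ((hG.mono hrΩ).mul hed) fun ζ hζ => by
      rw [h ζ (hrΩ hζ), Pi.mul_apply, norm_mul, (he ζ hζ).2.1]
  have hκ0 : κ ≠ 0 := norm_ne_zero_iff.1 (hκ ▸ one_ne_zero)
  have hlim : ∀ ζ ∈ Metric.ball a r, (limUnder (𝓝[≠] ζ) fun w => F w / G w) = κ * e ζ := by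
    intro ζ hζ
    refine Tendsto.limUnder_eq ?_
    have h1 : Tendsto (fun w => κ * e w) (𝓝[≠] ζ) (𝓝 (κ * e ζ)) :=
      ((he ζ hζ).2.2.continuousAt.tendsto.const_mul κ).mono_left nhdsWithin_le_nhds
    refine h1.congr' ?_
    filter_upwards [hGz ζ (hrΩ hζ), mem_nhdsWithin_of_mem_nhds (Metric.isOpen_ball.mem_nhds hζ)]
      with w hw hwb
    rw [hFG w hwb, Pi.mul_apply, eq_div_iff hw]
    ring
  have haa := Metric.mem_ball_self (x := a) hr
  beta_reduce
  rw [hlim a haa]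
  refine ⟨mul_ne_zero hκ0 (he a haa).1, ?_⟩
  refine (((he a haa).2.2.const_mul κ).congr_deriv (mul_left_comm _ _ _)).congr_of_eventuallyEq ?_
  filter_upwards [Metric.isOpen_ball.mem_nhds haa] with ζ hζ using hlim ζ hζ

/-! ### Non-degeneracy of the kernel -/

/-- The functions `∏ (ζ - z i) ^ m i / (ζ - b) ^ n`, with `b` in the interior of a hole, show that
the Bergman kernel has no zeros on the diagonal. -/
theorem bergmanKernel_logWeight_self_ne_zero {l : ℕ} {Ω : Set ℂ} (hΩ : IsOpen Ω)
    {z : Fin l → ℂ} (hz : ∀ i, z i ∉ Ω) (Q : Fin l → ℝ) {b : ℂ} {r : ℝ} (hr : 0 < r)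
    (hb : ∀ ζ ∈ Ω, r ≤ ‖ζ - b‖) {w : ℂ} (hw : w ∈ Ω) :
    bergmanKernel Ω (logWeight z Q) w w ≠ 0 := by
  have hc := continuousOn_logWeight hz Q
  have hpos : ∀ ζ ∈ Ω, 0 < logWeight z Q ζ := fun ζ hζ => logWeight_pos hz Q hζ
  have hζ0 : ∀ ζ ∈ Ω, ∀ i, ζ - z i ≠ 0 := fun ζ hζ i =>
    sub_ne_zero.2 fun h => hz i (h ▸ hζ)
  have hb0 : ∀ ζ ∈ Ω, ζ - b ≠ 0 := fun ζ hζ => norm_pos_iff.1 (hr.trans_le (hb ζ hζ))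
  have hm := fun i => exists_nat_ge (Q i)
  choose m hm using hm
  set s : ℝ := ∑ i, (2 * (m i : ℝ) - 2 * Q i) with hs
  obtain ⟨n, hn⟩ := exists_nat_gt (s / 2 + 1)
  obtain ⟨C, hC⟩ := exists_abs_log_norm_sub_le hr hb
  set A : ℝ := 1 + ∑ i, ‖z i‖ with hA
  have hA1 : 1 ≤ A := le_add_of_nonneg_right (Finset.sum_nonneg fun i _ => norm_nonneg _)
  set f : ℂ → ℂ := fun ζ => (∏ i, (ζ - z i) ^ m i) / (ζ - b) ^ n with hf
  have hfd : DifferentiableOn ℂ f Ω :=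
    DifferentiableOn.div (DifferentiableOn.fun_finsetProd fun i _ => by fun_prop) (by fun_prop)
      fun ζ hζ => pow_ne_zero n (hb0 ζ hζ)
  have hbound : ∀ ζ ∈ Ω, ‖f ζ‖ ^ 2 * logWeight z Q ζ ≤
      A ^ s * Real.exp C ^ (2 * n) * (1 + ‖ζ‖) ^ (-(2 * n - s)) := by
    intro ζ hζ
    have h1 : ‖f ζ‖ ^ 2 * logWeight z Q ζ =
        (∏ i, ‖ζ - z i‖ ^ (2 * (m i : ℝ) - 2 * Q i)) / ‖ζ - b‖ ^ (2 * n) := by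
      rw [hf, norm_div, norm_prod, norm_pow, div_pow, ← pow_mul, mul_comm n, div_mul_eq_mul_div,
        logWeight, ← Finset.prod_pow, ← Finset.prod_mul_distrib]
      congr 1
      refine Finset.prod_congr rfl fun i _ => ?_
      have h2 := norm_pos_iff.2 (hζ0 ζ hζ i)
      rw [norm_pow, sub_eq_add_neg (2 * (m i : ℝ)), Real.rpow_add h2, ← pow_mul, mul_comm (m i) 2]
      congr 1
      · rw [← Real.rpow_natCast]
        push_cast
        rfl
      · congr 1
        ring
    have h2 : ∏ i, ‖ζ - z i‖ ^ (2 * (m i : ℝ) - 2 * Q i) ≤ (A * (1 + ‖ζ‖)) ^ s := by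
      rw [hs, Real.rpow_sum_of_pos (by positivity)]
      refine Finset.prod_le_prod (fun i _ => by positivity) fun i _ => ?_
      refine Real.rpow_le_rpow (norm_nonneg _) ?_ (by linarith [hm i])
      have h3 : ‖z i‖ ≤ ∑ i, ‖z i‖ :=
        Finset.single_le_sum (f := fun i => ‖z i‖) (fun _ _ => norm_nonneg _) (Finset.mem_univ i)
      have h4 := norm_sub_le ζ (z i)
      nlinarith [norm_nonneg ζ]
    have h3 : (1 + ‖ζ‖) ≤ Real.exp C * ‖ζ - b‖ := by
      have h4 := (abs_le.1 (hC ζ hζ)).1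
      have h5 := hr.trans_le (hb ζ hζ)
      rw [← Real.log_le_log_iff (by positivity) (by positivity),
        Real.log_mul (Real.exp_ne_zero _) h5.ne', Real.log_exp]
      linarith
    have h5 := hr.trans_le (hb ζ hζ)
    rw [h1, div_le_iff₀ (by positivity)]
    refine h2.trans ?_
    have h6 : (1 + ‖ζ‖) ^ (-(2 * n - s)) * (1 + ‖ζ‖) ^ (2 * n) = (1 + ‖ζ‖) ^ s := by
      rw [← Real.rpow_natCast, ← Real.rpow_add (by positivity)]
      congr 1
      push_cast
      ring
    calc (A * (1 + ‖ζ‖)) ^ s = A ^ s * ((1 + ‖ζ‖) ^ (-(2 * n - s)) * (1 + ‖ζ‖) ^ (2 * n)) := by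
          rw [h6, Real.mul_rpow (by positivity) (by positivity)]
      _ ≤ A ^ s * ((1 + ‖ζ‖) ^ (-(2 * n - s)) * (Real.exp C * ‖ζ - b‖) ^ (2 * n)) := by gcongr
      _ = _ := by rw [mul_pow]; ring
  have hfin : energy Ω (logWeight z Q) f ≠ ∞ := by
    rw [energy_eq_setLIntegral hΩ hc hfd]
    have hint : Integrable (fun ζ : ℂ => A ^ s * Real.exp C ^ (2 * n) *
        (1 + ‖ζ‖) ^ (-(2 * n - s))) volume := by
      refine (integrable_one_add_norm ?_).const_mul _
      rw [Complex.finrank_real_complex]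
      push_cast
      linarith
    refine ne_top_of_le_ne_top ?_ ((setLIntegral_mono' hΩ.measurableSet fun ζ hζ =>
      ENNReal.ofReal_le_ofReal (hbound ζ hζ)).trans (setLIntegral_le_lintegral _ _))
    rw [lintegral_ofReal_ne_top_iff_integrable hint.aestronglyMeasurable
      (Eventually.of_forall fun ζ => by positivity)]
    exact hint
  intro h0
  have h1 := norm_sq_le_mul_energy hΩ hc hpos ((mem_bergmanSpace_iff hΩ).2 ⟨hfd, hfin⟩) hw
  rw [h0, Complex.zero_re, ENNReal.ofReal_zero, zero_mul, nonpos_iff_eq_zero,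
    ENNReal.ofReal_eq_zero] at h1
  have h2 : f w ≠ 0 := div_ne_zero (Finset.prod_ne_zero_iff.2 fun i _ => pow_ne_zero _ (hζ0 w hw i))
    (pow_ne_zero _ (hb0 w hw))
  have h3 := norm_pos_iff.2 h2
  nlinarith [pow_pos h3 2]

/-! ### Dependence on the exponents -/

theorem sqrt_logWeight {l : ℕ} (z : Fin l → ℂ) (Q : Fin l → ℝ) (ζ : ℂ) :
    √(logWeight z Q ζ) = ∏ i, ‖ζ - z i‖ ^ (-Q i) := by
  have h1 : logWeight z Q ζ = (∏ i, ‖ζ - z i‖ ^ (-Q i)) ^ 2 := by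
    rw [logWeight, ← Finset.prod_pow]
    refine Finset.prod_congr rfl fun i _ => ?_
    rw [← Real.rpow_mul_natCast (norm_nonneg _)]
    congr 1
    push_cast
    ring
  rw [h1, Real.sqrt_sq (Finset.prod_nonneg fun i _ => by positivity)]

/-- A change of the exponents by integers is a change of gauge, by `∏ (ζ - z i) ^ n i`. -/
theorem gaugeEquiv_bergmanB_of_int {l : ℕ} {Ω : Set ℂ} (hΩ : IsOpen Ω) {z : Fin l → ℂ}
    (hz : ∀ i, z i ∉ Ω) {Q Q' : Fin l → ℝ} (h : ∀ i, ∃ n : ℤ, Q i - Q' i = n) :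
    GaugeEquiv (fun ζ ξ : Ω => bergmanB Ω z Q ζ ξ) fun ζ ξ : Ω => bergmanB Ω z Q' ζ ξ := by
  choose n hn using h
  have hζ0 : ∀ ζ ∈ Ω, ∀ i, ζ - z i ≠ 0 := fun ζ hζ i => sub_ne_zero.2 fun h => hz i (h ▸ hζ)
  refine gaugeEquiv_correlationKernel (e := fun ζ => ∏ i, (ζ - z i) ^ n i) hΩ
    (continuousOn_logWeight hz Q) (fun ζ hζ => logWeight_pos hz Q hζ) ?_
    (fun ζ hζ => Finset.prod_ne_zero_iff.2 fun i _ => zpow_ne_zero _ (hζ0 ζ hζ i)) fun ζ hζ => ?_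
  · refine DifferentiableOn.fun_finsetProd fun i _ => ?_
    exact DifferentiableOn.zpow (by fun_prop) (Or.inl fun ζ hζ => hζ0 ζ hζ i)
  · rw [norm_prod, ← Finset.prod_pow, logWeight, logWeight, ← Finset.prod_mul_distrib]
    refine Finset.prod_congr rfl fun i _ => ?_
    have h1 := norm_pos_iff.2 (hζ0 ζ hζ i)
    rw [norm_zpow, ← Real.rpow_intCast, ← Real.rpow_mul_natCast h1.le, ← Real.rpow_add h1, ← hn]
    congr 1
    push_cast
    ring

theorem gaugeEquiv_bergmanB_normalizedWeight {l : ℕ} {Ω : Set ℂ} (hΩ : IsOpen Ω) {z : Fin l → ℂ}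
    (hz : ∀ i, z i ∉ Ω) {g : Fin l → ℂ → ℂ} (hg : ∀ i, DifferentiableOn ℂ (g i) Ω)
    (Q : Fin l → ℝ) :
    GaugeEquiv (fun ζ ξ : Ω => bergmanB Ω z Q ζ ξ)
      fun ζ ξ : Ω => correlationKernel Ω (normalizedWeight z g Q) ζ ξ := by
  refine gaugeEquiv_correlationKernel (e := fun ζ => Complex.exp (∑ i, Q i * g i ζ)) hΩ
    (continuousOn_logWeight hz Q) (fun ζ hζ => logWeight_pos hz Q hζ) ?_
    (fun ζ hζ => Complex.exp_ne_zero _)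
    fun ζ hζ => normalizedWeight_eq g Q fun i h => hz i (h ▸ hζ)
  exact (DifferentiableOn.fun_sum fun i _ => (hg i).const_mul _).cexp

theorem correlationKernel_conj {D : Set ℂ} {ρ : ℂ → ℝ} (hD : IsOpen D) (hc : ContinuousOn ρ D)
    (hpos : ∀ z ∈ D, 0 < ρ z) (z w : D) :
    correlationKernel D ρ w z = starRingEnd ℂ (correlationKernel D ρ z w) := by
  have h := isReproducingKernel_bergmanKernel hD hc hpos
  rw [correlationKernel, correlationKernel, h.eq_conj h w.2 z.2, map_mul, map_mul,
    Complex.conj_ofReal, Complex.conj_ofReal, mul_right_comm]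

/-- The law determines the exponents modulo the integers. -/
theorem exists_int_of_isBergmanLaw {l : ℕ} {Ω : Set ℂ} (hΩ : IsOpen Ω) (hΩc : IsConnected Ω)
    {H : Fin l → Set ℂ} (hH : Function.Injective H) (hHr : Set.range H = holes Ω)
    (hHi : ∀ i, (interior (H i)).Nonempty) {z : Fin l → ℂ} (hz : ∀ i, z i ∈ H i)
    {Q Q' : Fin l → ℝ} {P : ProbabilityMeasure (PointConfiguration Ω)}
    (h : IsBergmanLaw Ω z Q P) (h' : IsBergmanLaw Ω z Q' P) (j : Fin l) :
    ∃ n : ℤ, Q j - Q' j = n := by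
  have hmem : ∀ i, H i ∈ holes Ω := fun i => hHr ▸ mem_range_self i
  have hzΩ : ∀ i, z i ∉ Ω := fun i => subset_compl_of_mem_holes (hmem i) (hz i)
  have := isLocallyFiniteMeasure_comap_subtype hΩ
  have := isOpenPosMeasure_comap_subtype hΩ
  have hc := continuousOn_logWeight hzΩ
  have hpos : ∀ Q, ∀ ζ ∈ Ω, 0 < logWeight z Q ζ := fun Q ζ hζ => logWeight_pos hzΩ Q hζ
  have hζ0 : ∀ ζ ∈ Ω, ∀ i, 0 < ‖ζ - z i‖ := fun ζ hζ i =>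
    norm_pos_iff.2 (sub_ne_zero.2 fun h => hzΩ i (h ▸ hζ))
  have hnorm := h.norm_eq h' (continuous_correlationKernel hΩ (hc Q) (hpos Q))
    (continuous_correlationKernel hΩ (hc Q') (hpos Q'))
    (fun x y => correlationKernel_conj hΩ (hc Q) (hpos Q) x y)
    (fun x y => correlationKernel_conj hΩ (hc Q') (hpos Q') x y)
  obtain ⟨w₀, hw₀⟩ := hΩc.nonempty
  set k : (Fin l → ℝ) → ℂ → ℂ := fun Q ζ =>
    bergmanKernel Ω (logWeight z Q) ζ w₀ * (√(logWeight z Q w₀) : ℝ) with hk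
  have hkd : ∀ Q, DifferentiableOn ℂ (k Q) Ω := fun Q =>
    ((isReproducingKernel_bergmanKernel hΩ (hc Q) (hpos Q)).1 w₀ hw₀).1.mul_const _
  have hkn : ∀ Q, ∀ ζ ∈ Ω, ‖bergmanB Ω z Q ζ w₀‖ = ‖k Q ζ‖ * ∏ i, ‖ζ - z i‖ ^ (-Q i) := by
    intro Q ζ hζ
    rw [← sqrt_logWeight, bergmanB, correlationKernel, hk, mul_right_comm, norm_mul,
      Complex.norm_real, Real.norm_of_nonneg (Real.sqrt_nonneg _)]
  obtain ⟨b, hb⟩ := hHi j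
  obtain ⟨r, hr, hrb⟩ := Metric.isOpen_iff.1 isOpen_interior b hb
  have hrΩ : ∀ ζ ∈ Ω, r ≤ ‖ζ - b‖ := by
    intro ζ hζ
    by_contra! hlt
    exact subset_compl_of_mem_holes (hmem j)
      (interior_subset (hrb (by rwa [Metric.mem_ball, dist_eq_norm]))) hζ
  have hk0 : k Q' w₀ ≠ 0 := mul_ne_zero
    (bergmanKernel_logWeight_self_ne_zero hΩ hzΩ Q' hr hrΩ hw₀)
    (Complex.ofReal_ne_zero.2 (Real.sqrt_pos.2 (hpos Q' w₀ hw₀)).ne')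
  obtain ⟨M, hM⟩ := exists_quotient hΩ hΩc hzΩ (fun i => Q i - Q' i) (hkd Q) (hkd Q') hw₀ hk0 (by
    intro ζ hζ
    have h1 : ‖bergmanB Ω z Q ζ w₀‖ = ‖bergmanB Ω z Q' ζ w₀‖ := hnorm ⟨ζ, hζ⟩ ⟨w₀, hw₀⟩
    rw [hkn Q ζ hζ, hkn Q' ζ hζ] at h1
    have h2 : 0 < ∏ i, ‖ζ - z i‖ ^ (-Q i) :=
      Finset.prod_pos fun i _ => Real.rpow_pos_of_pos (hζ0 ζ hζ i) _
    have h3 : ∏ i, ‖ζ - z i‖ ^ (-Q' i) =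
        (∏ i, ‖ζ - z i‖ ^ (Q i - Q' i)) * ∏ i, ‖ζ - z i‖ ^ (-Q i) := by
      rw [← Finset.prod_mul_distrib]
      refine Finset.prod_congr rfl fun i _ => ?_
      rw [← Real.rpow_add (hζ0 ζ hζ i)]
      congr 1
      ring
    rw [h3, ← mul_assoc] at h1
    exact mul_right_cancel₀ h2.ne' h1)
  obtain ⟨η, hη, hηΩ⟩ := exists_thickening_diff_subset hΩ hHr j
  have hzη : ∀ i, i ≠ j → z i ∉ Metric.thickening η (H j) := fun i hij hi =>
    hzΩ i (hηΩ ⟨hi, fun hzj => hij (hH (eq_of_mem_holes (hmem i) (hmem j) (hz i) hzj))⟩)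
  have h1 := exp_two_pi_I_mul_eq_one (isCompact_of_mem_holes hΩ (hmem j)) (hz j) hη (M := M)
    (δ := ((Q j - Q' j : ℝ) : ℂ))
    (r := fun ζ => ∑ i ∈ Finset.univ.erase j, ((Q i - Q' i : ℝ) : ℂ) * (ζ - z i)⁻¹)
    (DifferentiableOn.fun_sum fun i hi => DifferentiableOn.const_mul (DifferentiableOn.inv
      (by fun_prop) fun ζ hζ => sub_ne_zero.2 fun h =>
        hzη i (Finset.ne_of_mem_erase hi) (by rwa [← h])) _)
    (fun ζ hζ => (hM ζ (hηΩ hζ)).1) fun ζ hζ => by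
      have h2 := (hM ζ (hηΩ hζ)).2
      rwa [← Finset.add_sum_erase _ _ (Finset.mem_univ j)] at h2
  obtain ⟨n, hn⟩ := Complex.exp_eq_one_iff.1 h1
  refine ⟨n, ?_⟩
  have h2 : ((Q j - Q' j : ℝ) : ℂ) = n := by
    refine mul_left_cancel₀ Complex.two_pi_I_ne_zero ?_
    rw [hn, mul_comm]
  exact_mod_cast h2

theorem coe_eq_coe_iff_exists_int {l : ℕ} {Q Q' : Fin l → ℝ} :
    ((fun i => (Q i : UnitAddCircle)) = fun i => (Q' i : UnitAddCircle)) ↔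
      ∀ i, ∃ n : ℤ, Q i - Q' i = n := by
  rw [funext_iff]
  refine forall_congr' fun i => ?_
  rw [← sub_eq_zero, ← AddCircle.coe_sub, AddCircle.coe_eq_zero_iff]
  simp only [zsmul_eq_mul, mul_one, eq_comm]

end BergmanProcess

theorem mainTheorem7 (l : ℕ) (Ω : Set ℂ) (hΩ : IsOpen Ω) (hΩc : IsConnected Ω)
    (H : Fin l → Set ℂ) (hH : Function.Injective H) (hHr : Set.range H = holes Ω)
    (hHi : ∀ i, (interior (H i)).Nonempty) (z : Fin l → ℂ) (hz : ∀ i, z i ∈ H i) :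
    (∃ β : Ω × (Fin l → UnitAddCircle) → ℂ,
      (∀ (ζ : Ω) (Q : Fin l → ℝ), β (ζ, fun i => (Q i : UnitAddCircle)) = bergmanB Ω z Q ζ ζ) ∧
      Continuous β) ∧
    (∃ L : (Fin l → UnitAddCircle) → ProbabilityMeasure (PointConfiguration Ω),
      (∀ (Q : Fin l → ℝ) (P : ProbabilityMeasure (PointConfiguration Ω)),
        IsBergmanLaw Ω z Q P ↔ P = L fun i => (Q i : UnitAddCircle)) ∧
      Function.Injective L ∧ Continuous L) := by
  have hmem : ∀ i, H i ∈ holes Ω := fun i => hHr ▸ Set.mem_range_self i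
  have hzΩ : ∀ i, z i ∉ Ω := fun i => subset_compl_of_mem_holes (hmem i) (hz i)
  obtain ⟨g, hg, hfam⟩ := exists_isContinuousWeightFamily hΩ hΩc hHr hHi hz hzΩ
  have hc := continuousOn_logWeight hzΩ
  have hpos : ∀ Q, ∀ ζ ∈ Ω, 0 < logWeight z Q ζ := fun Q ζ hζ => logWeight_pos hzΩ Q hζ
  have hnorm := fun Q => gaugeEquiv_bergmanB_normalizedWeight hΩ hzΩ hg Q
  have hint : ∀ Q Q' : Fin l → ℝ,
      ((fun i => (Q i : UnitAddCircle)) = fun i => (Q' i : UnitAddCircle)) →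
      GaugeEquiv (fun ζ ξ : Ω => bergmanB Ω z Q ζ ξ) fun ζ ξ : Ω => bergmanB Ω z Q' ζ ξ :=
    fun Q Q' h => gaugeEquiv_bergmanB_of_int hΩ hzΩ (coe_eq_coe_iff_exists_int.1 h)
  -- Representatives of the classes of exponents.
  have hsurj : Function.Surjective fun (Q : Fin l → ℝ) i => (Q i : UnitAddCircle) := fun θ => by
    have h : ∀ i, ∃ x : ℝ, (x : UnitAddCircle) = θ i := fun i => QuotientAddGroup.mk_surjective _
    choose Q hQ using h
    exact ⟨Q, funext hQ⟩
  choose s hs using hsurj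
  have hquot : IsOpenQuotientMap fun (Q : Fin l → ℝ) i => (Q i : UnitAddCircle) :=
    IsOpenQuotientMap.piMap fun _ => QuotientAddGroup.isOpenQuotientMap_mk
  constructor
  · have hβ : ∀ (ζ : Ω) (Q : Fin l → ℝ),
        bergmanB Ω z (s fun i => (Q i : UnitAddCircle)) ζ ζ = bergmanB Ω z Q ζ ζ := fun ζ Q =>
      ((hint _ _ (hs fun i => (Q i : UnitAddCircle))).diag ζ).symm
    refine ⟨fun p => bergmanB Ω z (s p.2) p.1 p.1, hβ, ?_⟩
    refine (IsOpenQuotientMap.id.prodMap hquot).isQuotientMap.continuous_iff.2 ?_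
    have hd : Continuous fun p : Ω × (Fin l → ℝ) => (p.2, p.1, p.1) := by fun_prop
    refine (hfam.continuous_correlationKernel.comp hd).congr fun p => ?_
    exact ((hnorm p.2).diag p.1).trans (hβ p.1 p.2).symm
  · have hex : ∀ Q, ∃ P, IsBergmanLaw Ω z Q P := fun Q =>
      exists_isDeterminantalLaw_correlationKernel hΩ (hc Q) (hpos Q)
    choose law hlaw using hex
    have hiff : ∀ (Q : Fin l → ℝ) (P : ProbabilityMeasure (PointConfiguration Ω)),
        IsBergmanLaw Ω z Q P ↔ P = law (s fun i => (Q i : UnitAddCircle)) := by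
      intro Q P
      have h1 : IsBergmanLaw Ω z Q (law (s fun i => (Q i : UnitAddCircle))) :=
        (hint _ _ (hs fun i => (Q i : UnitAddCircle))).isDeterminantalLaw_iff.2 (hlaw _)
      refine ⟨fun h => IsDeterminantalLaw.unique_correlationKernel hΩ (hc Q) (hpos Q) h h1, ?_⟩
      rintro rfl
      exact h1
    refine ⟨fun θ => law (s θ), hiff, fun θ θ' h => ?_, ?_⟩
    · have h1 := hlaw (s θ)
      have h2 := hlaw (s θ')
      rw [show law (s θ) = law (s θ') from h] at h1
      have h3 := coe_eq_coe_iff_exists_int.2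
        (exists_int_of_isBergmanLaw hΩ hΩc hH hHr hHi hz h1 h2)
      exact (hs θ).symm.trans (h3.trans (hs θ'))
    · refine hquot.isQuotientMap.continuous_iff.2 (hfam.continuous_law fun Q => ?_)
      exact (hnorm Q).isDeterminantalLaw_iff.2 ((hiff Q _).2 rfl)
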